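/- Notation. For $d\ge 1$ let $B_d(0,r)$ be the open ball of radius $r$ in $\mathbb{R}^d$, and for a set $A\subseteq\mathbb{R}^d$ let $\mathcal{M}(A)$ be the set of finite Borel measures compactly supported in $A$. Put $\widehat{g}(\xi)=\int e^{-i\langle x,\xi\rangle}g(x)\,dx$ and $\widehat{\mu}(\xi)=\int e^{-i\langle x,\xi\rangle}\,d\mu(x)$. For $\alpha>0$ and a finite Borel measure $\mu$ on $\mathbb{R}^d$ let $I_\alpha(\mu)=\int_{\mathbb{R}^d}|\widehat{\mu}(\xi)|^2|\xi|^{\alpha-d}\,d\xi\in[0,\infty]$. For Schwartz $g$ on $\mathbb{R}^n$ let \[ e^{it\sqrt{-\Delta}}g(x)=\frac{1}{(2\pi)^n}\int_{\mathbb{R}^n} e^{i(\langle x,\xi\rangle+t|\xi|)}\,\widehat{g}(\xi)\,d\xi,\qquad \|g\|_{H^s}=\Big(\int_{\mathbb{R}^n}(1+|\xi|^2)^s|\widehat{g}(\xi)|^2\,d\xi\Big)^{1/2}. \] Let $s_n^{\max}(\alpha)$ be the infimum of all $s\ge 0$ for which there is a constant $C_{\alpha,s}$ such that for all $R\ge 1$,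 \[ \int\sup_{0<t<1}\big|e^{it\sqrt{-\Delta}}g(x)\big|\,d\mu(x)\le C_{\alpha,s}\,I_\alpha(\mu)^{1/2}R^s\|g\|_2 \] for all Schwartz $g$ with $\operatorname{supp}\widehat{g}\subseteq B_n(0,R)\setminus B_n(0,R/2)$ and all $\mu\in\mathcal{M}(B_n(0,1))$. Let $s_n(\alpha)$ be the infimum of all $s\ge 0$ for which there is a constant $C_{\alpha,s}$ such that for all $R\ge 1$, \[ \int\big|e^{it\sqrt{-\Delta}}g(x)\big|\,d\nu(x,t)\le C_{\alpha,s}\,I_\alpha(\nu)^{1/2}R^s\|g\|_2 \] for all such $g$ and all $\nu\in\mathcal{M}(B_{n+1}(0,1))$. Let $\beta(\alpha,\Gamma^n)$ be the supremum of all $\beta>0$ (with the supremum equal to $0$ if there is no such $\beta$) for which there is a constant $C_\beta$ such that for all $R\ge1$ and all $\nu\in\mathcal{M}(B_{n+1}(0,1))$, \[ \int_{B_n(0,1)\setminus B_n(0,1/2)}\big|\widehat{\nu}(R(\xi,|\xi|))\big|^2\,d\xi\le C_\beta\,I_\alpha(\nu)R^{-\beta}. \] Theorem. Let $n\ge1$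 and $s\ge0$. There is a constant $K$, depending only on $s$ and $n$, such that the following holds for every $\alpha>0$ and every constant $C\geq 0$. (i) If \[ \int\sup_{0<t<1}\big|e^{it\sqrt{-\Delta}}g(x)\big|\,d\mu(x)\le C\,I_\alpha(\mu)^{1/2}\|g\|_{H^s}\quad\text{for all }\mu\in\mathcal{M}(B_n(0,1)),\ g\in\mathcal{S}(\mathbb{R}^n), \] then \[ \int\big|e^{it\sqrt{-\Delta}}f(x)\big|\,d\nu(x,t)\le KC\,I_\alpha(\nu)^{1/2}\|f\|_{H^s}\quad\text{for all }\nu\in\mathcal{M}(B_{n+1}(0,1)),\ f\in\mathcal{S}(\mathbb{R}^n). \] (ii) If $\lambda\ge1$ and \[ \int\sup_{0<t<1}\big|e^{it\sqrt{-\Delta}}g(x)\big|\,d\mu(x)\le C\,I_\alpha(\mu)^{1/2}\lambda^s\|g\|_2 \] for all $\mu\in\mathcal{M}(B_n(0,1))$ and all $g\in\mathcal{S}(\mathbb{R}^n)$ with $\operatorname{supp}\widehat{g}\subseteq B_n(0,\lambda)$, then \[ \int\big|e^{it\sqrt{-\Delta}}f(x)\big|\,d\nu(x,t)\le KC\,I_\alpha(\nu)^{1/2}\lambda^s\|f\|_2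 \] for all $\nu\in\mathcal{M}(B_{n+1}(0,1))$ and all $f\in\mathcal{S}(\mathbb{R}^n)$ with $\operatorname{supp}\widehat{f}\subseteq B_n(0,\lambda)$. (iii) For all $\alpha\in(0,n]$, $s_n(\alpha)=s_n^{\max}(\alpha)$. If $n<\alpha\le n+1$, then $s_n^{\max}(\alpha)\ge s_n(\alpha)$. Moreover $\beta(\alpha,\Gamma^n)=n-2s_n(\alpha)$ for all $\alpha\in(0,n+1]$, so that for $\alpha\in(0,n]$ the maximal exponent is determined by the $L^2$ decay over the cone of Fourier transforms of measures. -/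

import Mathlib

open MeasureTheory Set
open scoped ENNReal NNReal

noncomputable section

namespace WaveMax

/-- The Euclidean space `ℝ^d`. -/
abbrev E (d : ℕ) : Type := EuclideanSpace ℝ (Fin d)

/-- The space variable `x ∈ ℝⁿ` of a point `z = (x, t) ∈ ℝⁿ⁺¹`. -/
def spacePart {n : ℕ} (z : E (n + 1)) : E n := WithLp.toLp 2 (fun i => z i.castSucc)

/-- The time variable `t ∈ ℝ` of a point `z = (x, t) ∈ ℝⁿ⁺¹`. -/
def timePart {n : ℕ} (z : E (n + 1)) : ℝ := z (Fin.last n)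

/-- The point `(ξ, |ξ|)` of the light cone in `ℝⁿ⁺¹` above `ξ ∈ ℝⁿ`. -/
def coneLift {n : ℕ} (ξ : E n) : E (n + 1) :=
  WithLp.toLp 2 (Fin.snoc (α := fun _ => ℝ) (fun i => ξ i) ‖ξ‖)

/-- The class `𝓜(A)`: finite Borel measures that are compactly supported in `A`. -/
def IsCompactlySupportedIn {d : ℕ} (μ : Measure (E d)) (A : Set (E d)) : Prop :=
  IsFiniteMeasure μ ∧ ∃ S : Set (E d), IsCompact S ∧ S ⊆ A ∧ μ Sᶜ = 0

/-- The Fourier transform `ĝ(ξ) = ∫ exp(-i⟨x, ξ⟩) g(x) dx` of a function on `ℝ^d`. -/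
def fourierHat {d : ℕ} (g : E d → ℂ) (ξ : E d) : ℂ :=
  ∫ x, Complex.exp (-(Complex.I * ((inner ℝ x ξ : ℝ) : ℂ))) * g x

/-- The Fourier transform `μ̂(ξ) = ∫ exp(-i⟨x, ξ⟩) dμ(x)` of a measure on `ℝ^d`. -/
def measureHat {d : ℕ} (μ : Measure (E d)) (ξ : E d) : ℂ :=
  ∫ x, Complex.exp (-(Complex.I * ((inner ℝ x ξ : ℝ) : ℂ))) ∂μ

/-- The Fourier energy `I_α(μ) = ∫ |μ̂(ξ)|² |ξ|^(α - d) dξ ∈ [0, ∞]` of a measure on `ℝ^d`. -/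
def energy {d : ℕ} (α : ℝ) (μ : Measure (E d)) : ℝ≥0∞ :=
  ∫⁻ ξ, ENNReal.ofReal (‖measureHat μ ξ‖ ^ 2 * ‖ξ‖ ^ (α - (d : ℝ)))

/-- The half-wave propagator
`exp(it√-Δ) g (x) = (2π)^(-n) ∫ exp(i(⟨x, ξ⟩ + t|ξ|)) ĝ(ξ) dξ`. -/
def wave {n : ℕ} (g : SchwartzMap (E n) ℂ) (x : E n) (t : ℝ) : ℂ :=
  (((2 * Real.pi) ^ n)⁻¹ : ℝ) *
    ∫ ξ, Complex.exp (Complex.I * ((inner ℝ x ξ + t * ‖ξ‖ : ℝ) : ℂ)) * fourierHat g ξ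

/-- The norm `‖g‖_{H^s} = (∫ (1 + |ξ|²)^s |ĝ(ξ)|² dξ)^(1/2)`. -/
def sobolevNorm {n : ℕ} (s : ℝ) (g : SchwartzMap (E n) ℂ) : ℝ≥0∞ :=
  (∫⁻ ξ, ENNReal.ofReal ((1 + ‖ξ‖ ^ 2) ^ s * ‖fourierHat g ξ‖ ^ 2)) ^ (1 / 2 : ℝ)

/-- The left-hand side of the maximal estimates: `∫ sup_{0<t<1} |exp(it√-Δ) g (x)| dμ(x)`. -/
def maxLHS {n : ℕ} (g : SchwartzMap (E n) ℂ) (μ : Measure (E n)) : ℝ≥0∞ :=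
  ∫⁻ x, ⨆ t ∈ Ioo (0 : ℝ) 1, ‖wave g x t‖ₑ ∂μ

/-- The left-hand side of the space-time estimates: `∫ |exp(it√-Δ) f (x)| dν(x, t)`. -/
def spaceTimeLHS {n : ℕ} (f : SchwartzMap (E n) ℂ) (ν : Measure (E (n + 1))) : ℝ≥0∞ :=
  ∫⁻ z, ‖wave f (spacePart z) (timePart z)‖ₑ ∂ν

/-- The global maximal estimate with constant `C`. -/
def GlobalMaxEstimate (n : ℕ) (α s : ℝ) (C : ℝ≥0) : Prop :=
  ∀ μ : Measure (E n), IsCompactlySupportedIn μ (Metric.ball 0 1) →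
    ∀ g : SchwartzMap (E n) ℂ,
      maxLHS g μ ≤ C * energy α μ ^ (1 / 2 : ℝ) * sobolevNorm s g

/-- The global space-time estimate with constant `C`. -/
def GlobalSpaceTimeEstimate (n : ℕ) (α s : ℝ) (C : ℝ≥0) : Prop :=
  ∀ ν : Measure (E (n + 1)), IsCompactlySupportedIn ν (Metric.ball 0 1) →
    ∀ f : SchwartzMap (E n) ℂ,
      spaceTimeLHS f ν ≤ C * energy α ν ^ (1 / 2 : ℝ) * sobolevNorm s f

/-- The maximal estimate with constant `C` and factor `lam ^ s` for all Schwartz functions whose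
Fourier transform is supported in `A`. -/
def MaxEstimateOn (n : ℕ) (α s lam : ℝ) (C : ℝ≥0) (A : Set (E n)) : Prop :=
  ∀ μ : Measure (E n), IsCompactlySupportedIn μ (Metric.ball 0 1) →
    ∀ g : SchwartzMap (E n) ℂ, tsupport (fourierHat g) ⊆ A →
      maxLHS g μ ≤
        C * energy α μ ^ (1 / 2 : ℝ) * ENNReal.ofReal (lam ^ s) * eLpNorm g 2 volume

/-- The space-time estimate with constant `C` and factor `lam ^ s` for all Schwartz functions whose
Fourier transform is supported in `A`. -/
def SpaceTimeEstimateOn (n : ℕ) (α s lam : ℝ) (C : ℝ≥0) (A : Set (E n)) : Prop :=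
  ∀ ν : Measure (E (n + 1)), IsCompactlySupportedIn ν (Metric.ball 0 1) →
    ∀ f : SchwartzMap (E n) ℂ, tsupport (fourierHat f) ⊆ A →
      spaceTimeLHS f ν ≤
        C * energy α ν ^ (1 / 2 : ℝ) * ENNReal.ofReal (lam ^ s) * eLpNorm f 2 volume

/-- The annulus `B(0, R) \ B(0, R/2)` in `ℝⁿ`. -/
def annulus (n : ℕ) (R : ℝ) : Set (E n) := Metric.ball 0 R \ Metric.ball 0 (R / 2)

/-- The exponent `s_n^max(α)`: the infimum of all `s ≥ 0` such that, with a constant independent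
of `R ≥ 1`, the maximal estimate with factor `R ^ s` holds for frequencies in the annulus. -/
def sMaxWave (n : ℕ) (α : ℝ) : ℝ≥0∞ :=
  ⨅ (s : ℝ≥0) (_ : ∃ C : ℝ≥0, ∀ R : ℝ, 1 ≤ R → MaxEstimateOn n α s R C (annulus n R)),
    (s : ℝ≥0∞)

/-- The exponent `s_n(α)`: the infimum of all `s ≥ 0` such that, with a constant independent
of `R ≥ 1`, the space-time estimate with factor `R ^ s` holds for frequencies in the annulus. -/
def sWave (n : ℕ) (α : ℝ) : ℝ≥0∞ :=
  ⨅ (s : ℝ≥0) (_ : ∃ C : ℝ≥0, ∀ R : ℝ, 1 ≤ R → SpaceTimeEstimateOn n α s R C (annulus n R)),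
    (s : ℝ≥0∞)

/-- The decay exponent `β(α, Γⁿ)` of the `L²` averages over the cone: the supremum of all `β > 0`
such that `∫_{1/2 ≤ |ξ| < 1} |ν̂(R(ξ, |ξ|))|² dξ ≤ C I_α(ν) R^(-β)` with a constant independent of
`R ≥ 1` and `ν` (it is `0` if there is no such `β`). -/
def betaCone (n : ℕ) (α : ℝ) : ℝ≥0∞ :=
  ⨆ (β : ℝ≥0) (_ : 0 < β ∧ ∃ C : ℝ≥0, ∀ R : ℝ, 1 ≤ R →
      ∀ ν : Measure (E (n + 1)), IsCompactlySupportedIn ν (Metric.ball 0 1) →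
        ∫⁻ ξ in annulus n 1, ENNReal.ofReal (‖measureHat ν (R • coneLift ξ)‖ ^ 2) ≤
          C * energy α ν * ENNReal.ofReal (R ^ (-(β : ℝ)))),
    (β : ℝ≥0∞)

end WaveMax

end

noncomputable section

namespace WaveMax

/-! ### Fourier energies -/

/-! By duality, a space-time estimate for `ν` is a weighted `L²` bound over the light cone for the
transforms of all complex measures `w ν` with `|w| ≤ 1` (`DualBound.testBound`,
`TestBound.dualBound`). If `ν` lives at times in `(0,1)`, the wave is dominated on its support by
the maximal function, so a maximal estimate gives the space-time estimate with the energy of the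
spatial projection of `ν` in place of the energy of `ν` (`SlabBound`). That projection may have
infinite energy although `I_α(ν)` is finite. The direction of projection therefore has to be
changed, and the changes that respect the wave equation are Lorentz maps.

Bounded orders. The energy of a projection taken after a Lorentz reflection is, up to a shear, a
weighted integral of `|ν̂|²` over a hyperplane `τ = ⟨v, ξ⟩`. Averaged over `|v| < 1/4`, these
hyperplanes fill the region `|τ| ≤ |ξ|/4` with density about `1/|ξ|`, which is exactly what turns
the weight `|ξ|^(α-n)` into `|(ξ,τ)|^(α-n-1)`. Hence some reflection has projected energy `≲ I_α(ν)`
(`exists_energy_lorentz_proj_le`). Small pieces of `ν` can be translated, dilated and reflected into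
a slab (`exists_dualBound_local`), and smooth cutoffs reassemble the pieces
(`exists_dualBound_of_slab`). The constants obtained in this way depend on an upper bound for `α`.

Large orders. After a mollification that increases no energy, `ν` is a function `h` supported in the
unit ball. Repeated integration by parts on chords through `z`, averaged over the directions of the
chords, gives `|h(z)|² ≲ G (1-|z|²)^(N+1) I_α(ν)` with `N` close to `α/2` and an explicit `G`
(`exists_enorm_sq_le_energy`). The slab bound is now used only for one radial measure on a time
slice, with density `(1-|y|²)₊^e`, and for its space-time translates. In `G` times the energy of
this measure all factorials cancel and a factor `N` remains; covering the Gaussian majorant of `|h|`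
by the translates gains `N^(-1/2)` before squaring. The product is bounded uniformly in `α`
(`SlabBound.testBound_of_const`), so the two regimes together give (i) and (ii) with a constant
depending on `n` alone.

Critical exponents. For orders up to the dimension the energy is an average of positive Gaussian
kernels, hence monotone in the measure. Complex densities then split into positive submeasures, so
`s_n(α)` is the exponent of the decay `ConeDecay`, and scaling gives `β = n - 2 s_n`. The Lorentz
argument applied to dyadic annuli gives `s_n ≤ s_n^max`. Conversely, linearizing the supremum by a
measurable time `t(x)` turns the maximal estimate into a space-time estimate on a graph. For orders
strictly below `n` the energy of a graph is controlled by that of its projection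
(`exists_energy_le_proj`). The small loss of order needed for this is converted by mollification at
scale `1/R` into a factor `R^ε` (`ConeDecay.smoothed`). -/

lemma measureHat_eq_charFun {d : ℕ} (μ : Measure (E d)) (ξ : E d) :
    measureHat μ ξ = charFun μ (-ξ) := by
  simp only [measureHat, charFun_apply, inner_neg_right]
  congr 1; ext x; congr 1; push_cast; ring

lemma norm_measureHat {d : ℕ} (μ : Measure (E d)) (ξ : E d) :
    ‖measureHat μ ξ‖ = ‖charFun μ ξ‖ := by
  rw [measureHat_eq_charFun, charFun_neg, RCLike.norm_conj]

lemma energy_eq {d : ℕ} (α : ℝ) (μ : Measure (E d)) :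
    energy α μ = ∫⁻ ξ, ‖charFun μ ξ‖ₑ ^ 2 * ENNReal.ofReal (‖ξ‖ ^ (α - (d : ℝ))) := by
  unfold energy
  congr 1; ext ξ
  rw [ENNReal.ofReal_mul (by positivity), norm_measureHat, ENNReal.ofReal_pow (norm_nonneg _),
    ofReal_norm]

lemma lintegral_comp_smul_pos {d : ℕ} (f : E d → ℝ≥0∞) {r : ℝ} (hr : 0 < r) :
    ∫⁻ x, f (r • x) = ENNReal.ofReal (r ^ (-(d : ℝ))) * ∫⁻ x, f x := by
  have h := Measure.map_addHaar_smul (volume : Measure (E d)) hr.ne'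
  have e : MeasurableEmbedding (fun x : E d => r • x) :=
    (Homeomorph.smulOfNeZero r hr.ne').measurableEmbedding
  have h2 : ∫⁻ x, f (r • x) = ∫⁻ x, f x ∂(Measure.map (fun x : E d => r • x) volume) :=
    (e.lintegral_map f).symm
  have h3 : Measure.map (fun x : E d => r • x) volume =
      ENNReal.ofReal |(r ^ Module.finrank ℝ (E d))⁻¹| • volume := h
  rw [h2, h3, lintegral_smul_measure]
  simp only [finrank_euclideanSpace, Fintype.card_fin, smul_eq_mul]
  rw [abs_of_pos (by positivity), Real.rpow_neg hr.le, Real.rpow_natCast]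

lemma energy_map_smul {d : ℕ} (α : ℝ) (μ : Measure (E d)) {r : ℝ} (hr : 0 < r) :
    energy α (μ.map (fun x => r • x)) = ENNReal.ofReal (r ^ (-α)) * energy α μ := by
  rw [energy_eq, energy_eq]
  have : ∀ ξ : E d, ‖charFun (μ.map (fun x => r • x)) ξ‖ₑ ^ 2 *
      ENNReal.ofReal (‖ξ‖ ^ (α - (d : ℝ))) =
      ENNReal.ofReal (r ^ ((d : ℝ) - α)) * (fun ξ : E d => ‖charFun μ ξ‖ₑ ^ 2 *
        ENNReal.ofReal (‖ξ‖ ^ (α - (d : ℝ)))) (r • ξ) := by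
    intro ξ
    have h1 : ‖ξ‖ ^ (α - (d : ℝ)) = r ^ ((d : ℝ) - α) * ‖r • ξ‖ ^ (α - (d : ℝ)) := by
      rw [norm_smul, Real.norm_of_nonneg hr.le, Real.mul_rpow hr.le (norm_nonneg _), ← mul_assoc,
        ← Real.rpow_add hr]
      simp
    rw [h1, charFun_map_smul, ENNReal.ofReal_mul (by positivity)]
    ring
  simp_rw [this]
  rw [lintegral_const_mul' _ _ ENNReal.ofReal_ne_top, lintegral_comp_smul_pos (fun ξ : E d =>
      ‖charFun μ ξ‖ₑ ^ 2 * ENNReal.ofReal (‖ξ‖ ^ (α - (d : ℝ)))) hr, ← mul_assoc,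
    ← ENNReal.ofReal_mul (by positivity), ← Real.rpow_add hr]
  congr 3; ring

lemma energy_map_add {d : ℕ} (α : ℝ) (μ : Measure (E d)) (a : E d) :
    energy α (μ.map (fun x => x + a)) = energy α μ := by
  rw [energy_eq, energy_eq]
  congr 1; ext ξ
  rw [charFun_map_add_const, enorm_mul]
  have : ‖Complex.exp ((inner ℝ a ξ : ℝ) * Complex.I)‖ₑ = 1 := by
    rw [← ofReal_norm, Complex.norm_exp_ofReal_mul_I]; simp
  rw [this, mul_one]

/-- Near the origin the Fourier transform of a positive measure is as large as its mass. -/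
lemma half_mass_le_norm_charFun {d : ℕ} (μ : Measure (E d)) [IsFiniteMeasure μ] {r : ℝ}
    (hμ : ∀ᵐ x ∂μ, ‖x‖ ≤ r) {ξ : E d} (hξ : r * ‖ξ‖ ≤ 1) :
    μ.real univ / 2 ≤ ‖charFun μ ξ‖ := by
  have hint : Integrable (fun x : E d => Complex.exp ((inner ℝ x ξ : ℝ) * Complex.I)) μ := by
    refine Integrable.of_bound (C := 1) ?_ (Filter.Eventually.of_forall fun x => ?_)
    · exact (by fun_prop : Continuous fun x : E d =>
        Complex.exp ((inner ℝ x ξ : ℝ) * Complex.I)).aestronglyMeasurable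
    · rw [Complex.norm_exp_ofReal_mul_I]
  have h1 : (charFun μ ξ).re = ∫ x, Real.cos (inner ℝ x ξ) ∂μ := by
    rw [charFun_apply, ← RCLike.re_eq_complex_re, ← integral_re hint]
    congr 1; ext x
    simp [Complex.exp_ofReal_mul_I_re]
  have hcos : Integrable (fun x : E d => Real.cos (inner ℝ x ξ)) μ := by
    refine Integrable.of_bound (C := 1) ?_ (Filter.Eventually.of_forall fun x => ?_)
    · exact (by fun_prop : Continuous fun x : E d => Real.cos (inner ℝ x ξ)).aestronglyMeasurable
    · exact Real.abs_cos_le_one _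
  have h2 : ∫ _, (1 / 2 : ℝ) ∂μ ≤ ∫ x, Real.cos (inner ℝ x ξ) ∂μ := by
    refine integral_mono_ae (integrable_const _) hcos ?_
    filter_upwards [hμ] with x hx
    have h3 : |inner ℝ x ξ| ≤ 1 := (abs_real_inner_le_norm x ξ).trans
      ((mul_le_mul_of_nonneg_right hx (norm_nonneg _)).trans hξ)
    have h4 := Real.one_sub_sq_div_two_le_cos (x := inner ℝ x ξ)
    have h5 : (inner ℝ x ξ) ^ 2 ≤ (1 : ℝ) := by
      rw [← sq_abs]; exact pow_le_one₀ (abs_nonneg _) h3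
    show (1 / 2 : ℝ) ≤ _
    linarith
  rw [integral_const, smul_eq_mul] at h2
  calc μ.real univ / 2 = μ.real univ * (1 / 2) := by ring
    _ ≤ (charFun μ ξ).re := by rw [h1]; exact h2
    _ ≤ _ := Complex.re_le_norm _

lemma half_mass_le_enorm_charFun {d : ℕ} (μ : Measure (E d)) [IsFiniteMeasure μ] {r : ℝ}
    (hμ : ∀ᵐ x ∂μ, ‖x‖ ≤ r) {ξ : E d} (hξ : r * ‖ξ‖ ≤ 1) :
    μ univ ≤ 2 * ‖charFun μ ξ‖ₑ := by
  have h := half_mass_le_norm_charFun μ hμ hξ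
  have h2 : (2 : ℝ≥0∞) = ENNReal.ofReal 2 := by simp
  calc μ univ = ENNReal.ofReal (μ.real univ) := (ofReal_measureReal (measure_ne_top μ univ)).symm
    _ ≤ ENNReal.ofReal (2 * ‖charFun μ ξ‖) := ENNReal.ofReal_le_ofReal (by linarith)
    _ = 2 * ‖charFun μ ξ‖ₑ := by rw [ENNReal.ofReal_mul zero_le_two, ofReal_norm, ← h2]

/-- The mass is controlled by the energy, uniformly for bounded orders. -/
lemma exists_mass_sq_le_energy (d : ℕ) (hd : 1 ≤ d) (α₀ : ℝ) : ∃ K : ℝ≥0, ∀ α : ℝ, 0 < α → α ≤ α₀ →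
    ∀ μ : Measure (E d), IsFiniteMeasure μ → (∀ᵐ x ∂μ, ‖x‖ ≤ 1) → μ univ ^ 2 ≤ K * energy α μ := by
  set A : Set (E d) := Metric.ball 0 1 \ Metric.closedBall 0 (1 / 2) with hA
  have hAo : IsOpen A := Metric.isOpen_ball.sdiff Metric.isClosed_closedBall
  have hApos : volume A ≠ 0 := by
    refine (hAo.measure_pos volume ?_).ne'
    refine ⟨EuclideanSpace.single ⟨0, hd⟩ (3 / 4), ?_, ?_⟩
    · simp; norm_num
    · simp; norm_num
  have hAtop : volume A ≠ ⊤ :=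
    ((measure_mono sdiff_subset).trans_lt measure_ball_lt_top).ne
  -- A lower bound for `|ξ|^(α-d)` on `1/2 < |ξ| < 1`, uniform in `0 < α ≤ α₀`. The annulus stays
  -- away from the origin, where the weight may degenerate, and inside the unit ball, where the
  -- transform is at least half the mass.
  set c : ℝ := (2 : ℝ) ^ (-|α₀|) with hc
  have hcpos : 0 < c := by positivity
  set κ : ℝ≥0∞ := ENNReal.ofReal c * volume A with hκ
  have hκ0 : κ ≠ 0 := mul_ne_zero (by simpa using hcpos) hApos
  have hκt : κ ≠ ⊤ := ENNReal.mul_ne_top ENNReal.ofReal_ne_top hAtop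
  refine ⟨(4 * κ⁻¹).toNNReal, fun α hα hα0 μ hμ hsupp => ?_⟩
  rw [ENNReal.coe_toNNReal (ENNReal.mul_ne_top (by simp) (ENNReal.inv_ne_top.2 hκ0))]
  have key : (μ univ) ^ 2 * κ ≤ 4 * energy α μ := by
    rw [energy_eq]
    calc (μ univ) ^ 2 * κ = ∫⁻ ξ in A, (μ univ) ^ 2 * ENNReal.ofReal c := by
          rw [setLIntegral_const, hκ]; ring
      _ ≤ ∫⁻ ξ in A, 4 * (‖charFun μ ξ‖ₑ ^ 2 * ENNReal.ofReal (‖ξ‖ ^ (α - (d : ℝ)))) := by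
          refine setLIntegral_mono' hAo.measurableSet fun ξ hξ => ?_
          have h1 : ‖ξ‖ < 1 := by simpa using hξ.1
          have h2 : 1 / 2 < ‖ξ‖ := by simpa using hξ.2
          have h3 := half_mass_le_enorm_charFun μ hsupp (ξ := ξ) (by linarith)
          have h4 : c ≤ ‖ξ‖ ^ (α - (d : ℝ)) := by
            rcases le_total (α - d) 0 with h | h
            · refine le_trans ?_ (Real.one_le_rpow_of_pos_of_le_one_of_nonpos (by linarith) h1.le h)
              exact Real.rpow_le_one_of_one_le_of_nonpos (by norm_num) (by simp)
            · calc c = (1 / 2 : ℝ) ^ |α₀| := by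
                    rw [hc, Real.rpow_neg (by norm_num), one_div, Real.inv_rpow (by norm_num)]
                _ ≤ (1 / 2 : ℝ) ^ (α - (d : ℝ)) := by
                    refine Real.rpow_le_rpow_of_exponent_ge (by norm_num) (by norm_num) ?_
                    have := le_abs_self α₀
                    have : (0 : ℝ) ≤ d := by positivity
                    linarith
                _ ≤ _ := Real.rpow_le_rpow (by norm_num) h2.le h
          calc μ univ ^ 2 * ENNReal.ofReal c ≤ (2 * ‖charFun μ ξ‖ₑ) ^ 2 *
                ENNReal.ofReal (‖ξ‖ ^ (α - (d : ℝ))) := by gcongr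
            _ = _ := by rw [mul_pow]; norm_num; ring
      _ ≤ ∫⁻ ξ, 4 * (‖charFun μ ξ‖ₑ ^ 2 * ENNReal.ofReal (‖ξ‖ ^ (α - (d : ℝ)))) :=
          setLIntegral_le_lintegral _ _
      _ = _ := by rw [lintegral_const_mul' _ _ (by simp)]
  calc μ univ ^ 2 = κ⁻¹ * (μ univ ^ 2 * κ) := by
        rw [mul_comm, mul_assoc, ENNReal.mul_inv_cancel hκ0 hκt, mul_one]
    _ ≤ κ⁻¹ * (4 * energy α μ) := by gcongr
    _ = _ := by ring

/-! ### Space-time coordinates -/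

lemma inner_eq_space_time {n : ℕ} (z y : E (n + 1)) :
    inner ℝ z y = inner ℝ (spacePart z) (spacePart y) + timePart z * timePart y := by
  simp only [PiLp.inner_apply, Fin.sum_univ_castSucc, spacePart, timePart]
  simp [mul_comm]

lemma norm_sq_eq_space_time {n : ℕ} (z : E (n + 1)) :
    ‖z‖ ^ 2 = ‖spacePart z‖ ^ 2 + timePart z ^ 2 := by
  rw [← real_inner_self_eq_norm_sq, inner_eq_space_time, real_inner_self_eq_norm_sq]; ring

@[simp] lemma spacePart_coneLift {n : ℕ} (ξ : E n) : spacePart (coneLift ξ) = ξ := by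
  ext i; simp [spacePart, coneLift]

@[simp] lemma timePart_coneLift {n : ℕ} (ξ : E n) : timePart (coneLift ξ) = ‖ξ‖ := by
  simp [timePart, coneLift]

lemma inner_coneLift {n : ℕ} (z : E (n + 1)) (ξ : E n) :
    inner ℝ z (coneLift ξ) = inner ℝ (spacePart z) ξ + timePart z * ‖ξ‖ := by
  rw [inner_eq_space_time]; simp

/-- The point `(x, t)` of space-time. -/
def mkPt {n : ℕ} (x : E n) (t : ℝ) : E (n + 1) :=
  WithLp.toLp 2 (Fin.snoc (α := fun _ => ℝ) (fun i => x i) t)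

@[simp] lemma spacePart_mkPt {n : ℕ} (x : E n) (t : ℝ) : spacePart (mkPt x t) = x := by
  ext i; simp [spacePart, mkPt]

@[simp] lemma timePart_mkPt {n : ℕ} (x : E n) (t : ℝ) : timePart (mkPt x t) = t := by
  simp [timePart, mkPt]

lemma ext_space_time {n : ℕ} {z y : E (n + 1)} (h1 : spacePart z = spacePart y)
    (h2 : timePart z = timePart y) : z = y := by
  ext i
  refine Fin.lastCases h2 (fun j => ?_) i
  have := congrArg (fun x : E n => x j) h1
  simpa [spacePart] using this

lemma spacePart_add {n : ℕ} (z y : E (n + 1)) : spacePart (z + y) = spacePart z + spacePart y := by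
  ext i; simp [spacePart]

lemma spacePart_smul {n : ℕ} (r : ℝ) (z : E (n + 1)) : spacePart (r • z) = r • spacePart z := by
  ext i; simp [spacePart]

lemma timePart_add {n : ℕ} (z y : E (n + 1)) : timePart (z + y) = timePart z + timePart y := by
  simp [timePart]

lemma timePart_smul {n : ℕ} (r : ℝ) (z : E (n + 1)) : timePart (r • z) = r * timePart z := by
  simp [timePart]

@[fun_prop] lemma continuous_spacePart {n : ℕ} : Continuous (spacePart : E (n + 1) → E n) := by
  unfold spacePart; fun_prop

@[fun_prop] lemma continuous_timePart {n : ℕ} : Continuous (timePart : E (n + 1) → ℝ) := by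
  unfold timePart; fun_prop

lemma continuous_mkPt {n : ℕ} : Continuous (fun p : E n × ℝ => mkPt p.1 p.2) := by
  unfold mkPt
  refine (PiLp.continuous_toLp 2 _).comp (continuous_pi fun i => ?_)
  refine Fin.lastCases ?_ (fun j => ?_) i
  · simp only [Fin.snoc_last]; fun_prop
  · simp only [Fin.snoc_castSucc]; fun_prop

lemma continuous_coneLift {n : ℕ} : Continuous (coneLift : E n → E (n + 1)) :=
  continuous_mkPt.comp (f := fun ξ : E n => (ξ, ‖ξ‖)) (by fun_prop)

lemma norm_spacePart_le {n : ℕ} (z : E (n + 1)) : ‖spacePart z‖ ≤ ‖z‖ := by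
  have := norm_sq_eq_space_time z
  exact le_of_sq_le_sq (by nlinarith [sq_nonneg (timePart z)]) (norm_nonneg _)
where
  le_of_sq_le_sq {a b : ℝ} (h : a ^ 2 ≤ b ^ 2) (hb : 0 ≤ b) : a ≤ b :=
    (abs_le_of_sq_le_sq' h hb).2

lemma abs_timePart_le {n : ℕ} (z : E (n + 1)) : |timePart z| ≤ ‖z‖ := by
  have := norm_sq_eq_space_time z
  exact abs_le_of_sq_le_sq (by nlinarith [sq_nonneg ‖spacePart z‖]) (norm_nonneg _)

lemma measurePreserving_mkPt (n : ℕ) :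
    MeasurePreserving (fun p : E n × ℝ => mkPt p.1 p.2) volume volume := by
  have h1 := (EuclideanSpace.volume_preserving_symm_measurableEquiv_toLp (Fin (n + 1))).symm
  have h2 := (volume_preserving_piFinSuccAbove (fun _ : Fin (n + 1) => ℝ) (Fin.last n)).symm
  have h3 := (EuclideanSpace.volume_preserving_symm_measurableEquiv_toLp (Fin n))
  have h4 : MeasurePreserving (Prod.swap : E n × ℝ → ℝ × E n) volume volume :=
    Measure.measurePreserving_swap
  have h5 := (MeasurePreserving.id (volume : Measure ℝ)).prod h3
  have h6 := h1.comp (h2.comp (h5.comp h4))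
  have h7 : (fun p : E n × ℝ => mkPt p.1 p.2) =
      (MeasurableEquiv.toLp 2 (Fin (n + 1) → ℝ)).symm.symm ∘
        (MeasurableEquiv.piFinSuccAbove (fun _ => ℝ) (Fin.last n)).symm ∘
          Prod.map id (MeasurableEquiv.toLp 2 (Fin n → ℝ)).symm ∘ Prod.swap := by
    funext p
    show WithLp.toLp 2 (Fin.snoc (α := fun _ => ℝ) (fun i => p.1 i) p.2) =
      (MeasurableEquiv.toLp 2 (Fin (n + 1) → ℝ)) (Fin.insertNth (α := fun _ => ℝ) (Fin.last n) p.2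
        ((MeasurableEquiv.toLp 2 (Fin n → ℝ)).symm p.1))
    rw [Fin.insertNth_last']
    rfl
  rw [h7]
  exact h6

lemma lintegral_space_time {n : ℕ} (f : E (n + 1) → ℝ≥0∞) (hf : Measurable f) :
    ∫⁻ z, f z = ∫⁻ x : E n, ∫⁻ t : ℝ, f (mkPt x t) := by
  rw [← (measurePreserving_mkPt n).lintegral_comp hf]
  rw [Measure.volume_eq_prod, lintegral_prod (fun p : E n × ℝ => f (mkPt p.1 p.2))
    (hf.comp continuous_mkPt.measurable).aemeasurable]

/-! ### Fourier transforms of Schwartz functions -/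

lemma fourierHat_eq_fourier {d : ℕ} (g : E d → ℂ) (ξ : E d) :
    fourierHat g ξ = FourierTransform.fourier g ((2 * Real.pi)⁻¹ • ξ) := by
  rw [Real.fourier_eq', fourierHat]
  congr 1; ext x
  rw [smul_eq_mul, inner_smul_right]
  congr 2
  have : (Real.pi : ℂ) ≠ 0 := by exact_mod_cast Real.pi_ne_zero
  push_cast
  field_simp

/-- The scaling `ξ ↦ r ξ` as a continuous linear equivalence. -/
def scaleEquiv (d : ℕ) (r : ℝ) (hr : r ≠ 0) : E d ≃L[ℝ] E d :=
  ContinuousLinearEquiv.smulLeft (Units.mk0 r hr)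

@[simp] lemma scaleEquiv_apply {d : ℕ} {r : ℝ} (hr : r ≠ 0) (x : E d) :
    scaleEquiv d r hr x = r • x := rfl

/-- The Fourier transform of a Schwartz function, as a Schwartz function. -/
def hatS {d : ℕ} (g : SchwartzMap (E d) ℂ) : SchwartzMap (E d) ℂ :=
  SchwartzMap.compCLMOfContinuousLinearEquiv ℂ
    (scaleEquiv d (2 * Real.pi)⁻¹ (by positivity)) (FourierTransform.fourier g)

lemma hatS_apply {d : ℕ} (g : SchwartzMap (E d) ℂ) (ξ : E d) : hatS g ξ = fourierHat g ξ := by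
  rw [fourierHat_eq_fourier, hatS, SchwartzMap.compCLMOfContinuousLinearEquiv_apply]
  simp [SchwartzMap.fourier_coe]

lemma coe_hatS {d : ℕ} (g : SchwartzMap (E d) ℂ) : (hatS g : E d → ℂ) = fourierHat g :=
  funext (hatS_apply g)

/-- Supplies the test functions of the duality argument, which are prescribed on the Fourier side,
and lets a smooth cutoff be written as a Fourier transform. -/
lemma exists_fourierHat_eq {d : ℕ} (φ : SchwartzMap (E d) ℂ) :
    ∃ g : SchwartzMap (E d) ℂ, fourierHat g = φ := by
  refine ⟨FourierTransformInv.fourierInv (SchwartzMap.compCLMOfContinuousLinearEquiv ℂ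
    (scaleEquiv d (2 * Real.pi) (by positivity)) φ), ?_⟩
  rw [← coe_hatS]
  ext ξ
  rw [hatS, FourierTransform.fourier_fourierInv_eq,
    SchwartzMap.compCLMOfContinuousLinearEquiv_apply]
  simp only [Function.comp, SchwartzMap.compCLMOfContinuousLinearEquiv_apply, scaleEquiv_apply,
    smul_smul]
  rw [mul_inv_cancel₀ (by positivity), one_smul]

lemma lintegral_enorm_sq_fourierHat {d : ℕ} (g : SchwartzMap (E d) ℂ) :
    ∫⁻ ξ, ‖fourierHat g ξ‖ₑ ^ 2 = ENNReal.ofReal ((2 * Real.pi) ^ d) * ∫⁻ x, ‖g x‖ₑ ^ 2 := by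
  have hsq : ∀ f : SchwartzMap (E d) ℂ, ∫⁻ x, ‖f x‖ₑ ^ 2 = ENNReal.ofReal (∫ x, ‖f x‖ ^ 2) := by
    intro f
    have hi : Integrable (fun x => ‖f x‖ ^ 2) := (f.memLp 2).integrable_norm_pow (by norm_num)
    rw [ofReal_integral_eq_lintegral_ofReal hi
      (Filter.Eventually.of_forall fun x => by positivity)]
    congr 1; ext x
    rw [ENNReal.ofReal_pow (norm_nonneg _), ofReal_norm]
  have h1 : ∀ ξ : E d, ‖fourierHat g ξ‖ₑ ^ 2 =
      (fun ξ : E d => ‖(FourierTransform.fourier g : SchwartzMap (E d) ℂ) ξ‖ₑ ^ 2)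
        ((2 * Real.pi)⁻¹ • ξ) := by
    intro ξ
    rw [fourierHat_eq_fourier]
    rfl
  simp_rw [h1]
  rw [lintegral_comp_smul_pos (fun ξ : E d =>
    ‖(FourierTransform.fourier g : SchwartzMap (E d) ℂ) ξ‖ₑ ^ 2) (by positivity), hsq, hsq,
    SchwartzMap.integral_norm_sq_fourier]
  congr 2
  rw [Real.inv_rpow (by positivity), Real.rpow_neg (by positivity), inv_inv, Real.rpow_natCast]

lemma eLpNorm_two_eq {d : ℕ} (g : E d → ℂ) :
    eLpNorm g 2 volume = (∫⁻ x, ‖g x‖ₑ ^ 2) ^ (1 / 2 : ℝ) := by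
  rw [eLpNorm_eq_lintegral_rpow_enorm_toReal (by norm_num) (by norm_num)]
  simp

/-! ### Fourier transforms of complex densities -/

/-- The Fourier transform `ξ ↦ ∫ exp(i⟨x, ξ⟩) w(x) dμ(x)` of the complex measure `w μ`. -/
def ft {d : ℕ} (μ : Measure (E d)) (w : E d → ℂ) (ξ : E d) : ℂ :=
  ∫ x, Complex.exp ((inner ℝ x ξ : ℝ) * Complex.I) * w x ∂μ

lemma ft_one {d : ℕ} (μ : Measure (E d)) (ξ : E d) : ft μ (fun _ => 1) ξ = charFun μ ξ := by
  simp [ft, charFun_apply]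

lemma measurable_ft {d : ℕ} (μ : Measure (E d)) [SFinite μ] {w : E d → ℂ} (hw : Measurable w) :
    Measurable (ft μ w) := by
  refine (StronglyMeasurable.integral_prod_right (f := fun ξ x : E d =>
    Complex.exp ((inner ℝ x ξ : ℝ) * Complex.I) * w x) (Measurable.stronglyMeasurable ?_)).measurable
  refine Measurable.mul (Continuous.measurable (by fun_prop)) (hw.comp measurable_snd)

/-- The heat kernel of the quadratic form `∫ |ft μ w|² exp(-τ|ξ|²)`. -/
def heat (d : ℕ) (τ : ℝ) (x : E d) : ℝ :=
  (Real.pi / τ) ^ ((d : ℝ) / 2) * Real.exp (-(‖x‖ ^ 2 / (4 * τ)))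

lemma heat_pos {d : ℕ} {τ : ℝ} (hτ : 0 < τ) (x : E d) : 0 < heat d τ x := by
  unfold heat; positivity

lemma integral_gauss_char {d : ℕ} {τ : ℝ} (hτ : 0 < τ) (x : E d) :
    ∫ ξ : E d, Complex.exp ((inner ℝ x ξ : ℝ) * Complex.I) * (Real.exp (-(τ * ‖ξ‖ ^ 2)) : ℝ) =
      (heat d τ x : ℂ) := by
  have h := GaussianFourier.integral_cexp_neg_mul_sq_norm_add (b := (τ : ℂ)) (V := E d)
    (by simpa using hτ) Complex.I x
  have e : ∀ ξ : E d, Complex.exp ((inner ℝ x ξ : ℝ) * Complex.I) *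
      (Real.exp (-(τ * ‖ξ‖ ^ 2)) : ℝ) =
      Complex.exp (-τ * ‖ξ‖ ^ 2 + Complex.I * (inner ℝ x ξ : ℝ)) := by
    intro ξ
    rw [Complex.ofReal_exp, ← Complex.exp_add]
    congr 1; push_cast; ring
  simp_rw [e]
  rw [h, heat, Complex.ofReal_mul, Complex.ofReal_exp, Complex.ofReal_cpow (by positivity)]
  congr 1
  · push_cast; simp
  · congr 1; push_cast; rw [Complex.I_sq]; ring

lemma integrable_gauss {d : ℕ} {τ : ℝ} (hτ : 0 < τ) :
    Integrable (fun ξ : E d => Real.exp (-(τ * ‖ξ‖ ^ 2))) := by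
  have h := GaussianFourier.integrable_cexp_neg_mul_sq_norm_add (b := (τ : ℂ)) (V := E d)
    (by simpa using hτ) 0 0
  refine h.re.congr (Filter.Eventually.of_forall fun ξ => ?_)
  simp only [zero_mul, add_zero]
  have : (-(τ : ℂ) * ‖ξ‖ ^ 2) = ((-(τ * ‖ξ‖ ^ 2) : ℝ) : ℂ) := by push_cast; ring
  rw [this, ← Complex.ofReal_exp]; rfl

/-- Expand the square into a double integral and integrate first in `ξ`; the Gaussian makes Fubini
legitimate. What matters is that the resulting kernel `heat` is positive: every monotonicity
statement for energies rests on this. -/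
lemma integral_ft_sq_gauss {d : ℕ} (μ : Measure (E d)) [IsFiniteMeasure μ] {w : E d → ℂ}
    (hw : Measurable w) {C : ℝ} (hC : ∀ x, ‖w x‖ ≤ C) {τ : ℝ} (hτ : 0 < τ) :
    ((∫ ξ, ‖ft μ w ξ‖ ^ 2 * Real.exp (-(τ * ‖ξ‖ ^ 2)) : ℝ) : ℂ) =
      ∫ p : E d × E d, w p.1 * (starRingEnd ℂ) (w p.2) * (heat d τ (p.1 - p.2) : ℂ)
        ∂(μ.prod μ) := by
  have h1 : ∀ ξ : E d, ((‖ft μ w ξ‖ ^ 2 * Real.exp (-(τ * ‖ξ‖ ^ 2)) : ℝ) : ℂ) =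
      ∫ p : E d × E d, w p.1 * (starRingEnd ℂ) (w p.2) *
        (Complex.exp ((inner ℝ (p.1 - p.2) ξ : ℝ) * Complex.I) *
          (Real.exp (-(τ * ‖ξ‖ ^ 2)) : ℝ)) ∂(μ.prod μ) := by
    intro ξ
    rw [Complex.ofReal_mul]
    have h2 : ((‖ft μ w ξ‖ ^ 2 : ℝ) : ℂ) = ft μ w ξ * (starRingEnd ℂ) (ft μ w ξ) := by
      rw [Complex.mul_conj, Complex.normSq_eq_norm_sq]
    rw [h2, ft, ← integral_conj, ← integral_prod_mul, ← integral_mul_const]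
    congr 1; ext p
    rw [map_mul, ← Complex.exp_conj, inner_sub_left, Complex.ofReal_sub, sub_mul, Complex.exp_sub,
      map_mul, Complex.conj_ofReal, Complex.conj_I, mul_neg, Complex.exp_neg]
    ring
  rw [← integral_complex_ofReal]
  simp_rw [h1]
  rw [integral_integral_swap]
  · congr 1; ext p
    rw [integral_const_mul, integral_gauss_char hτ]
  · have hb : Integrable (fun q : E d × (E d × E d) =>
        Real.exp (-(τ * ‖q.1‖ ^ 2)) * (C * C)) (volume.prod (μ.prod μ)) :=
      Integrable.mul_prod (integrable_gauss hτ) (integrable_const _)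
    refine hb.mono' ?_ (Filter.Eventually.of_forall fun q => ?_)
    · refine Measurable.aestronglyMeasurable ?_
      refine Measurable.mul (Measurable.mul ?_ ?_) (Continuous.measurable (by fun_prop))
      · exact hw.comp (measurable_fst.comp measurable_snd)
      · exact (Complex.continuous_conj.measurable).comp (hw.comp (measurable_snd.comp measurable_snd))
    · simp only [Function.uncurry]
      rw [norm_mul, norm_mul, norm_mul, Complex.norm_exp_ofReal_mul_I, one_mul, RCLike.norm_conj,
        Complex.norm_real, Real.norm_of_nonneg (Real.exp_pos _).le, mul_comm]
      gcongr
      · exact (norm_nonneg _).trans (hC 0)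
      · exact hC _
      · exact hC _

lemma ofReal_integral_ft_sq_gauss {d : ℕ} (μ : Measure (E d)) [IsFiniteMeasure μ] {w : E d → ℂ}
    (hw : Measurable w) {C : ℝ} (hC : ∀ x, ‖w x‖ ≤ C) {τ : ℝ} (hτ : 0 < τ) :
    ∫⁻ ξ, ‖ft μ w ξ‖ₑ ^ 2 * ENNReal.ofReal (Real.exp (-(τ * ‖ξ‖ ^ 2))) =
      ENNReal.ofReal (∫ ξ, ‖ft μ w ξ‖ ^ 2 * Real.exp (-(τ * ‖ξ‖ ^ 2))) := by
  rw [ofReal_integral_eq_lintegral_ofReal]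
  · congr 1; ext ξ
    rw [ENNReal.ofReal_mul (by positivity), ENNReal.ofReal_pow (norm_nonneg _), ofReal_norm]
  · have hC0 : 0 ≤ C := (norm_nonneg _).trans (hC 0)
    refine ((integrable_gauss hτ).const_mul ((C * μ.real univ) ^ 2)).mono' ?_
      (Filter.Eventually.of_forall fun ξ => ?_)
    · exact (((measurable_ft μ hw).norm.pow_const 2).mul
        (Continuous.measurable (by fun_prop))).aestronglyMeasurable
    · have : ‖ft μ w ξ‖ ≤ C * μ.real univ :=
        norm_integral_le_of_norm_le_const (Filter.Eventually.of_forall fun x => by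
          rw [norm_mul, Complex.norm_exp_ofReal_mul_I, one_mul]; exact hC x)
      rw [norm_mul, Real.norm_of_nonneg (Real.exp_pos _).le, norm_pow, norm_norm]
      gcongr
  · exact Filter.Eventually.of_forall fun ξ => by positivity

lemma lintegral_ft_sq_gauss_le {d : ℕ} (μ : Measure (E d)) [IsFiniteMeasure μ] {w : E d → ℂ}
    (hw : Measurable w) {C : ℝ} (hC : ∀ x, ‖w x‖ ≤ C) {τ : ℝ} (hτ : 0 < τ) :
    ∫⁻ ξ, ‖ft μ w ξ‖ₑ ^ 2 * ENNReal.ofReal (Real.exp (-(τ * ‖ξ‖ ^ 2))) ≤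
      ∫⁻ x, ∫⁻ y, ‖w x‖ₑ * ‖w y‖ₑ * ENNReal.ofReal (heat d τ (x - y)) ∂μ ∂μ := by
  rw [ofReal_integral_ft_sq_gauss μ hw hC hτ]
  have h0 : 0 ≤ ∫ ξ, ‖ft μ w ξ‖ ^ 2 * Real.exp (-(τ * ‖ξ‖ ^ 2)) :=
    integral_nonneg fun ξ => by positivity
  have hm : Measurable (fun p : E d × E d => ‖w p.1‖ₑ * ‖w p.2‖ₑ *
      ENNReal.ofReal (heat d τ (p.1 - p.2))) := by
    refine Measurable.mul (Measurable.mul (hw.comp measurable_fst).enorm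
      (hw.comp measurable_snd).enorm) (ENNReal.measurable_ofReal.comp ?_)
    unfold heat
    exact Continuous.measurable (by fun_prop)
  rw [← lintegral_prod (fun p : E d × E d => ‖w p.1‖ₑ * ‖w p.2‖ₑ *
      ENNReal.ofReal (heat d τ (p.1 - p.2))) hm.aemeasurable]
  calc _ = ‖((∫ ξ, ‖ft μ w ξ‖ ^ 2 * Real.exp (-(τ * ‖ξ‖ ^ 2)) : ℝ) : ℂ)‖ₑ := by
        rw [← ofReal_norm, Complex.norm_real, Real.norm_of_nonneg h0]
    _ ≤ _ := by
        rw [integral_ft_sq_gauss μ hw hC hτ]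
        refine (enorm_integral_le_lintegral_enorm _).trans (lintegral_mono fun p => le_of_eq ?_)
        rw [enorm_mul, enorm_mul, ← ofReal_norm ((starRingEnd ℂ) (w p.2)), RCLike.norm_conj,
          ofReal_norm, ← ofReal_norm ((heat d τ (p.1 - p.2) : ℝ) : ℂ), Complex.norm_real,
          Real.norm_of_nonneg (heat_pos hτ _).le]

lemma lintegral_charFun_sq_gauss {d : ℕ} (μ : Measure (E d)) [IsFiniteMeasure μ]
    {τ : ℝ} (hτ : 0 < τ) :
    ∫⁻ ξ, ‖charFun μ ξ‖ₑ ^ 2 * ENNReal.ofReal (Real.exp (-(τ * ‖ξ‖ ^ 2))) =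
      ∫⁻ x, ∫⁻ y, ENNReal.ofReal (heat d τ (x - y)) ∂μ ∂μ := by
  have hm : Measurable (fun p : E d × E d => heat d τ (p.1 - p.2)) := by
    unfold heat
    exact Continuous.measurable (by fun_prop)
  have hb : ∀ x : E d, heat d τ x ≤ (Real.pi / τ) ^ ((d : ℝ) / 2) := by
    intro x
    unfold heat
    refine mul_le_of_le_one_right (by positivity) (Real.exp_le_one_iff.2 ?_)
    have : 0 ≤ ‖x‖ ^ 2 / (4 * τ) := by positivity
    linarith
  have h1 := ofReal_integral_ft_sq_gauss μ (w := fun _ => 1) measurable_const (C := 1) (by simp) hτ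
  have h2 := integral_ft_sq_gauss μ (w := fun _ => 1) measurable_const (C := 1) (by simp) hτ
  simp only [ft_one, map_one, one_mul] at h1 h2
  rw [integral_complex_ofReal, Complex.ofReal_inj] at h2
  rw [h1, h2, ← lintegral_prod (fun p : E d × E d => ENNReal.ofReal (heat d τ (p.1 - p.2)))
    hm.ennreal_ofReal.aemeasurable, ofReal_integral_eq_lintegral_ofReal]
  · refine Integrable.of_bound (C := (Real.pi / τ) ^ ((d : ℝ) / 2)) hm.aestronglyMeasurable
      (Filter.Eventually.of_forall fun p => ?_)
    rw [Real.norm_of_nonneg (heat_pos hτ _).le]; exact hb _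
  · exact Filter.Eventually.of_forall fun p => (heat_pos hτ _).le

/-- The mass is independent of `τ`: it is `(2π)^d` times the value at the origin of the Gaussian of
which `heat` is the transform. This yields Plancherel-type bounds uniform in the regularization. -/
lemma lintegral_heat {d : ℕ} {τ : ℝ} (hτ : 0 < τ) (y : E d) :
    ∫⁻ x, ENNReal.ofReal (heat d τ (x - y)) = ENNReal.ofReal ((2 * Real.pi) ^ d) := by
  have hi : Integrable (fun x : E d => heat d τ x) := by
    refine ((integrable_gauss (d := d) (τ := 1 / (4 * τ)) (by positivity)).const_mul
      ((Real.pi / τ) ^ ((d : ℝ) / 2))).congr (Filter.Eventually.of_forall fun x => ?_)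
    simp only [heat]; congr 2; ring
  rw [lintegral_sub_right_eq_self (fun x : E d => ENNReal.ofReal (heat d τ x)),
    ← ofReal_integral_eq_lintegral_ofReal hi
    (Filter.Eventually.of_forall fun p => (heat_pos hτ _).le)]
  congr 1
  have h := integral_gauss_char (d := d) (τ := 1 / (4 * τ)) (by positivity) 0
  simp only [inner_zero_left, Complex.ofReal_zero, zero_mul, Complex.exp_zero, one_mul] at h
  rw [integral_complex_ofReal, Complex.ofReal_inj] at h
  have e : ∀ x : E d, heat d τ x = (Real.pi / τ) ^ ((d : ℝ) / 2) *
      Real.exp (-(1 / (4 * τ) * ‖x‖ ^ 2)) := by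
    intro x; simp only [heat]; congr 2; ring
  simp_rw [e]
  rw [integral_const_mul, h, heat]
  simp only [norm_zero]
  have e1 : (Real.pi / τ) ^ ((d : ℝ) / 2) * ((Real.pi / (1 / (4 * τ))) ^ ((d : ℝ) / 2)) =
      (2 * Real.pi) ^ d := by
    rw [← Real.mul_rpow (by positivity) (by positivity)]
    have : Real.pi / τ * (Real.pi / (1 / (4 * τ))) = (2 * Real.pi) ^ (2 : ℝ) := by
      rw [Real.rpow_two]; field_simp; norm_num
    rw [this, ← Real.rpow_mul (by positivity), ← Real.rpow_natCast]
    congr 1; ring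
  rw [← e1]
  simp

/-! ### Radial integrals -/

lemma nontrivial_E {d : ℕ} (hd : 1 ≤ d) : Nontrivial (E d) := by
  obtain ⟨k, rfl⟩ : ∃ k, d = k + 1 := ⟨d - 1, by omega⟩
  infer_instance

lemma lintegral_radial {d : ℕ} (hd : 1 ≤ d) (f : ℝ → ℝ≥0∞) (hf : Measurable f) :
    ∫⁻ x : E d, f ‖x‖ = (d * volume (Metric.ball (0 : E d) 1)) *
      ∫⁻ r in Ioi (0 : ℝ), ENNReal.ofReal (r ^ (d - 1)) * f r := by
  have := nontrivial_E hd
  have hp := (volume : Measure (E d)).measurePreserving_homeomorphUnitSphereProd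
  have h1 : ∫⁻ x : E d, f ‖x‖ = ∫⁻ x : ({(0)}ᶜ : Set (E d)), f ‖x.1‖ ∂(volume.comap (Subtype.val)) := by
    rw [lintegral_subtype_comap (measurableSet_singleton _).compl (fun x => f ‖x‖),
      restrict_compl_singleton]
  have h2 : ∫⁻ x : ({(0)}ᶜ : Set (E d)), f ‖x.1‖ ∂(volume.comap (Subtype.val)) =
      ∫⁻ x, (f ∘ Subtype.val ∘ Prod.snd) x ∂((volume : Measure (E d)).toSphere.prod
        (.volumeIoiPow (Module.finrank ℝ (E d) - 1))) := by
    rw [← hp.lintegral_comp (hf.comp (measurable_subtype_coe.comp measurable_snd))]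
    simp
  rw [h1, h2, lintegral_prod _
    (hf.comp (measurable_subtype_coe.comp measurable_snd)).aemeasurable]
  simp only [Function.comp, lintegral_const]
  rw [Measure.toSphere_apply_univ, mul_comm, finrank_euclideanSpace, Fintype.card_fin]
  congr 1
  rw [Measure.volumeIoiPow, lintegral_withDensity_eq_lintegral_mul]
  · simp only [Pi.mul_apply]
    rw [lintegral_subtype_comap measurableSet_Ioi (fun r : ℝ => ENNReal.ofReal (r ^ (d - 1)) * f r)]
  · exact ENNReal.measurable_ofReal.comp (measurable_subtype_coe.pow_const _)
  · exact hf.comp measurable_subtype_coe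

lemma lintegral_ball_norm_rpow_lt_top {d : ℕ} (hd : 1 ≤ d) {α : ℝ} (hα : 0 < α) :
    ∫⁻ ξ in Metric.ball (0 : E d) 1, ENNReal.ofReal (‖ξ‖ ^ (α - (d : ℝ))) < ⊤ := by
  have := nontrivial_E hd
  have h : IntegrableOn (fun x : E d => ‖x‖ ^ (α - (d : ℝ))) (Metric.ball (0 : E d) 1) := by
    rw [integrableOn_fun_norm_addHaar volume (f := fun r => r ^ (α - (d : ℝ)))]
    have h1 : IntegrableOn (fun y : ℝ => y ^ (α - 1)) (Ioo 0 1) := by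
      have := (intervalIntegral.intervalIntegrable_rpow' (a := 0) (b := 1)
        (by linarith : -1 < α - 1)).1
      exact this.mono_set Ioo_subset_Ioc_self
    refine h1.congr_fun (fun y hy => ?_) measurableSet_Ioo
    simp only [finrank_euclideanSpace, Fintype.card_fin, smul_eq_mul]
    rw [← Real.rpow_natCast, ← Real.rpow_add hy.1]
    congr 1
    push_cast [hd]; ring
  have := h.2
  rw [hasFiniteIntegral_iff_ofReal (Filter.Eventually.of_forall fun x => by positivity)] at this
  exact this

/-! ### Positivity of energies -/

/-- The Gaussian regularisation of the energy. -/
def gaussEnergy {d : ℕ} (τ : ℝ) (μ : Measure (E d)) : ℝ≥0∞ :=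
  ∫⁻ ξ, ‖charFun μ ξ‖ₑ ^ 2 * ENNReal.ofReal (Real.exp (-(τ * ‖ξ‖ ^ 2)))

/-- The regularized energy is a double integral against the positive kernel `heat`, so it can only
grow with the measure. On the Fourier side this is invisible. -/
lemma gaussEnergy_mono {d : ℕ} {μ' μ : Measure (E d)} [IsFiniteMeasure μ] (h : μ' ≤ μ) {τ : ℝ}
    (hτ : 0 < τ) : gaussEnergy τ μ' ≤ gaussEnergy τ μ := by
  have : IsFiniteMeasure μ' := isFiniteMeasure_of_le μ h
  rw [gaussEnergy, gaussEnergy, lintegral_charFun_sq_gauss _ hτ, lintegral_charFun_sq_gauss _ hτ]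
  exact lintegral_mono' h fun x => lintegral_mono' h le_rfl

/-- The heat kernel in dimension `n + 1` is the one in dimension `n` at the spatial difference,
times `(π/τ)^(1/2)`, times a Gaussian in the time difference, which is at most `1`. -/
lemma gaussEnergy_le_proj {n : ℕ} (ν : Measure (E (n + 1))) [IsFiniteMeasure ν] {τ : ℝ}
    (hτ : 0 < τ) : gaussEnergy τ ν ≤
      ENNReal.ofReal ((Real.pi / τ) ^ (1 / 2 : ℝ)) * gaussEnergy τ (ν.map spacePart) := by
  rw [gaussEnergy, gaussEnergy, lintegral_charFun_sq_gauss _ hτ, lintegral_charFun_sq_gauss _ hτ]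
  have hc : Continuous fun p : E n × E n => heat n τ (p.1 - p.2) := by unfold heat; fun_prop
  have hc1 : ∀ x : E n, Measurable fun y : E n => ENNReal.ofReal (heat n τ (x - y)) := fun x =>
    (hc.measurable.comp measurable_prodMk_left).ennreal_ofReal
  have hc2 : Measurable fun x : E n => ∫⁻ y, ENNReal.ofReal (heat n τ (x - y)) ∂(ν.map spacePart) :=
    hc.measurable.ennreal_ofReal.lintegral_prod_right'
  rw [lintegral_map hc2 continuous_spacePart.measurable]
  simp_rw [fun x : E n => lintegral_map (μ := ν) (hc1 x) continuous_spacePart.measurable]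
  rw [← lintegral_const_mul' _ _ ENNReal.ofReal_ne_top]
  refine lintegral_mono fun z => ?_
  rw [← lintegral_const_mul' _ _ ENNReal.ofReal_ne_top]
  refine lintegral_mono fun y => ?_
  rw [← ENNReal.ofReal_mul (by positivity)]
  refine ENNReal.ofReal_le_ofReal ?_
  unfold heat
  rw [← mul_assoc, ← Real.rpow_add (by positivity)]
  have e : (1 / 2 : ℝ) + n / 2 = ((n + 1 : ℕ) : ℝ) / 2 := by push_cast; ring
  rw [e]
  gcongr
  have : spacePart z - spacePart y = spacePart (z - y) := by
    ext i; simp [spacePart]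
  rw [this]
  exact norm_spacePart_le _

/-- The weight `|ξ|^(α-d)` is a Gamma integral of Gaussians `exp(-τ|ξ|²)` with exponent `(d-α)/2`,
positive exactly when `α < d`. Inequalities for `gaussEnergy` thus pass to `energy`. -/
lemma energy_eq_subordination {d : ℕ} (hd : 1 ≤ d) {α : ℝ} (hα : α < d) (μ : Measure (E d))
    [IsFiniteMeasure μ] :
    ENNReal.ofReal (Real.Gamma ((d - α) / 2)) * energy α μ =
      ∫⁻ τ in Ioi (0 : ℝ), ENNReal.ofReal (τ ^ ((d - α) / 2 - 1)) * gaussEnergy τ μ := by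
  have := nontrivial_E hd
  set b : ℝ := (d - α) / 2 with hb
  have hb0 : 0 < b := by rw [hb]; linarith
  have hsub : ∀ ξ : E d, ξ ≠ 0 → ENNReal.ofReal (Real.Gamma b) *
      ENNReal.ofReal (‖ξ‖ ^ (α - (d : ℝ))) =
      ∫⁻ τ in Ioi (0 : ℝ), ENNReal.ofReal (τ ^ (b - 1)) *
        ENNReal.ofReal (Real.exp (-(τ * ‖ξ‖ ^ 2))) := by
    intro ξ hξ
    have hpos : 0 < ‖ξ‖ ^ 2 := by positivity
    have h := Real.integral_rpow_mul_exp_neg_mul_Ioi hb0 hpos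
    -- The Bochner integral of a non-integrable function is `0` by convention, whereas the Gamma
    -- integral is positive; its known value therefore proves integrability.
    have hint : IntegrableOn (fun t : ℝ => t ^ (b - 1) * Real.exp (-(‖ξ‖ ^ 2 * t))) (Ioi 0) := by
      by_contra hcon
      rw [integral_undef hcon] at h
      have : 0 < (1 / ‖ξ‖ ^ 2) ^ b * Real.Gamma b :=
        mul_pos (by positivity) (Real.Gamma_pos_of_pos hb0)
      linarith
    have h2 : ∫⁻ τ in Ioi (0 : ℝ), ENNReal.ofReal (τ ^ (b - 1)) *
        ENNReal.ofReal (Real.exp (-(τ * ‖ξ‖ ^ 2))) =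
        ENNReal.ofReal (∫ t in Ioi (0 : ℝ), t ^ (b - 1) * Real.exp (-(‖ξ‖ ^ 2 * t))) := by
      rw [ofReal_integral_eq_lintegral_ofReal hint]
      · refine setLIntegral_congr_fun measurableSet_Ioi fun t ht => ?_
        simp only [mem_Ioi] at ht
        rw [← ENNReal.ofReal_mul (by positivity), mul_comm (‖ξ‖ ^ 2) t]
      · filter_upwards [ae_restrict_mem measurableSet_Ioi] with t ht
        simp only [mem_Ioi] at ht
        positivity
    rw [h2, h, ← ENNReal.ofReal_mul (Real.Gamma_pos_of_pos hb0).le, mul_comm]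
    congr 2
    rw [one_div, Real.inv_rpow (by positivity), ← Real.rpow_neg (by positivity), ← Real.rpow_natCast,
      ← Real.rpow_mul (norm_nonneg _)]
    congr 1; rw [hb]; push_cast; ring
  have hm : Measurable fun ξ : E d => ‖charFun μ ξ‖ₑ ^ 2 := by
    have := continuous_charFun (μ := μ)
    exact (this.measurable.enorm).pow_const 2
  rw [energy_eq, ← lintegral_const_mul' _ _ ENNReal.ofReal_ne_top]
  have h3 : ∀ᵐ ξ : E d, ENNReal.ofReal (Real.Gamma b) * (‖charFun μ ξ‖ₑ ^ 2 *
      ENNReal.ofReal (‖ξ‖ ^ (α - (d : ℝ)))) = ∫⁻ τ in Ioi (0 : ℝ), ENNReal.ofReal (τ ^ (b - 1)) *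
        (‖charFun μ ξ‖ₑ ^ 2 * ENNReal.ofReal (Real.exp (-(τ * ‖ξ‖ ^ 2)))) := by
    have : ∀ᵐ ξ : E d, ξ ≠ 0 := by
      have h0 : volume ({0} : Set (E d)) = 0 := measure_singleton 0
      exact measure_eq_zero_iff_ae_notMem.1 h0
    filter_upwards [this] with ξ hξ
    rw [mul_left_comm, hsub ξ hξ, ← lintegral_const_mul' _ _ (by simp)]
    congr 1; ext τ; ring
  rw [lintegral_congr_ae h3, lintegral_lintegral_swap]
  · refine lintegral_congr fun τ => ?_
    rw [lintegral_const_mul' _ _ ENNReal.ofReal_ne_top]; rfl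
  · refine Measurable.aemeasurable ?_
    refine Measurable.mul ?_ (Measurable.mul (hm.comp measurable_fst) ?_)
    · exact (measurable_snd.pow_const (b - 1)).ennreal_ofReal
    · exact (Continuous.measurable (by fun_prop)).ennreal_ofReal

lemma tendsto_gauss_one {d : ℕ} (ξ : E d) : Filter.Tendsto
    (fun k : ℕ => ENNReal.ofReal (Real.exp (-((1 / ((k : ℝ) + 1)) * ‖ξ‖ ^ 2)))) Filter.atTop
    (nhds 1) := by
  have h : Filter.Tendsto (fun k : ℕ => Real.exp (-((1 / ((k : ℝ) + 1)) * ‖ξ‖ ^ 2))) Filter.atTop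
      (nhds (Real.exp (-(0 * ‖ξ‖ ^ 2)))) :=
    ((Real.continuous_exp.tendsto _).comp
      ((tendsto_one_div_add_atTop_nhds_zero_nat.mul_const _).neg))
  have := (ENNReal.continuous_ofReal.tendsto _).comp h
  simpa [Function.comp_def] using this

/-- Fatou's lemma along `τ = 1/(k+1)` removes the Gaussian regularization. -/
lemma lintegral_le_of_gauss {d : ℕ} (F : E d → ℝ≥0∞) (hF : Measurable F) {B : ℝ≥0∞}
    (h : ∀ τ : ℝ, 0 < τ → ∫⁻ ξ, F ξ * ENNReal.ofReal (Real.exp (-(τ * ‖ξ‖ ^ 2))) ≤ B) :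
    ∫⁻ ξ, F ξ ≤ B := by
  have h1 : ∀ ξ, F ξ ≤ Filter.liminf (fun k : ℕ => F ξ *
      ENNReal.ofReal (Real.exp (-((1 / ((k : ℝ) + 1)) * ‖ξ‖ ^ 2)))) Filter.atTop := by
    intro ξ
    have := ENNReal.Tendsto.const_mul (a := F ξ) (tendsto_gauss_one ξ) (Or.inl one_ne_zero)
    rw [mul_one] at this
    exact this.liminf_eq.ge
  calc ∫⁻ ξ, F ξ ≤ ∫⁻ ξ, Filter.liminf (fun k : ℕ => F ξ *
      ENNReal.ofReal (Real.exp (-((1 / ((k : ℝ) + 1)) * ‖ξ‖ ^ 2)))) Filter.atTop := lintegral_mono h1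
    _ ≤ Filter.liminf (fun k : ℕ => ∫⁻ ξ, F ξ *
      ENNReal.ofReal (Real.exp (-((1 / ((k : ℝ) + 1)) * ‖ξ‖ ^ 2)))) Filter.atTop :=
        lintegral_liminf_le fun k => hF.mul (Continuous.measurable (by fun_prop)).ennreal_ofReal
    _ ≤ B := by
        refine Filter.liminf_le_of_le (by isBoundedDefault) fun b hb => ?_
        obtain ⟨k, hk⟩ := hb.exists
        exact hk.trans (h _ (by positivity))

lemma measurable_enorm_charFun_sq {d : ℕ} (μ : Measure (E d)) [IsFiniteMeasure μ] :
    Measurable fun ξ : E d => ‖charFun μ ξ‖ₑ ^ 2 :=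
  ((continuous_charFun (μ := μ)).measurable.enorm).pow_const 2

lemma energy_self_eq {d : ℕ} (μ : Measure (E d)) :
    energy (d : ℝ) μ = ∫⁻ ξ, ‖charFun μ ξ‖ₑ ^ 2 := by
  rw [energy_eq]; simp

/-- The energy of order at most the dimension is monotone in the measure. -/
lemma energy_mono {d : ℕ} (hd : 1 ≤ d) {α : ℝ} (hα : α ≤ d) {μ' μ : Measure (E d)}
    [IsFiniteMeasure μ] (h : μ' ≤ μ) : energy α μ' ≤ energy α μ := by
  have : IsFiniteMeasure μ' := isFiniteMeasure_of_le μ h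
  rcases hα.lt_or_eq with hα | rfl
  · have hG : 0 < Real.Gamma ((d - α) / 2) := Real.Gamma_pos_of_pos (by linarith)
    rw [← ENNReal.mul_le_mul_iff_right (a := ENNReal.ofReal (Real.Gamma ((d - α) / 2)))
      (by simpa using hG) ENNReal.ofReal_ne_top,
      energy_eq_subordination hd hα, energy_eq_subordination hd hα]
    refine setLIntegral_mono' measurableSet_Ioi fun τ hτ => ?_
    gcongr
    exact gaussEnergy_mono h hτ
  -- At `α = d` subordination is not available, but the energy is the plain `L²` norm of the
  -- transform and the regularization can be removed directly.
  · rw [energy_self_eq, energy_self_eq]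
    refine lintegral_le_of_gauss _ (measurable_enorm_charFun_sq μ') fun τ hτ => ?_
    refine (gaussEnergy_mono h hτ).trans (lintegral_mono fun ξ => ?_)
    refine mul_le_of_le_one_right zero_le ?_
    rw [ENNReal.ofReal_le_one, Real.exp_le_one_iff]
    have : 0 ≤ τ * ‖ξ‖ ^ 2 := by positivity
    linarith

/-- The energy of a space-time measure is controlled by that of its projection to space. -/
lemma exists_energy_le_proj {n : ℕ} (hn : 1 ≤ n) {α : ℝ} (hα : α < n) : ∃ K : ℝ≥0,
    ∀ ν : Measure (E (n + 1)), IsFiniteMeasure ν →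
      energy α ν ≤ K * energy α (ν.map spacePart) := by
  have hG1 : 0 < Real.Gamma ((n - α) / 2) := Real.Gamma_pos_of_pos (by linarith)
  have hG2 : 0 < Real.Gamma (((n + 1 : ℕ) - α) / 2) :=
    Real.Gamma_pos_of_pos (by push_cast; linarith)
  set a := ENNReal.ofReal (Real.Gamma (((n + 1 : ℕ) - α) / 2)) with ha
  have ha0 : a ≠ 0 := by simpa [ha] using hG2
  have hat : a ≠ ⊤ := ENNReal.ofReal_ne_top
  set b := ENNReal.ofReal (Real.Gamma ((n - α) / 2)) with hb
  set c := ENNReal.ofReal (Real.pi ^ (1 / 2 : ℝ)) with hc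
  refine ⟨(a⁻¹ * c * b).toNNReal, fun ν hν => ?_⟩
  rw [ENNReal.coe_toNNReal (ENNReal.mul_ne_top (ENNReal.mul_ne_top (ENNReal.inv_ne_top.2 ha0)
    ENNReal.ofReal_ne_top) ENNReal.ofReal_ne_top)]
  have key : a * energy α ν ≤ c * (b * energy α (ν.map spacePart)) := by
    rw [energy_eq_subordination (by omega) (by push_cast; linarith),
      energy_eq_subordination hn hα, ← lintegral_const_mul' _ _ ENNReal.ofReal_ne_top]
    refine setLIntegral_mono' measurableSet_Ioi fun τ hτ => ?_
    simp only [mem_Ioi] at hτ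
    calc ENNReal.ofReal (τ ^ (((n + 1 : ℕ) - α) / 2 - 1)) * gaussEnergy τ ν
        ≤ ENNReal.ofReal (τ ^ (((n + 1 : ℕ) - α) / 2 - 1)) *
          (ENNReal.ofReal ((Real.pi / τ) ^ (1 / 2 : ℝ)) * gaussEnergy τ (ν.map spacePart)) := by
          gcongr; exact gaussEnergy_le_proj ν hτ
      _ = c * (ENNReal.ofReal (τ ^ ((n - α) / 2 - 1)) * gaussEnergy τ (ν.map spacePart)) := by
          rw [← mul_assoc, ← mul_assoc, hc, ← ENNReal.ofReal_mul (by positivity),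
            ← ENNReal.ofReal_mul (by positivity)]
          -- The factor `τ^(-1/2)` lost in the comparison of heat kernels lowers the subordination
          -- exponent of dimension `n + 1` to that of dimension `n`.
          congr 2
          rw [Real.div_rpow Real.pi_pos.le hτ.le, mul_div_assoc', mul_comm, mul_div_assoc,
            ← Real.rpow_sub hτ]
          congr 2; push_cast; ring
  calc energy α ν = a⁻¹ * (a * energy α ν) := by
        rw [← mul_assoc, ENNReal.inv_mul_cancel ha0 hat, one_mul]
    _ ≤ a⁻¹ * (c * (b * energy α (ν.map spacePart))) := by gcongr
    _ = _ := by ring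

/-- Splitting of the energy into low and high frequencies. -/
lemma energy_restrict_ball_le {d : ℕ} {α : ℝ} (μ : Measure (E d)) :
    ∫⁻ ξ in Metric.ball (0 : E d) 1, ‖charFun μ ξ‖ₑ ^ 2 * ENNReal.ofReal (‖ξ‖ ^ (α - (d : ℝ))) ≤
      μ univ ^ 2 * ∫⁻ ξ in Metric.ball (0 : E d) 1, ENNReal.ofReal (‖ξ‖ ^ (α - (d : ℝ))) := by
  rw [← lintegral_const_mul _ (by fun_prop)]
  refine lintegral_mono fun ξ => ?_
  gcongr
  refine (enorm_integral_le_lintegral_enorm _).trans (le_of_eq ?_)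
  rw [← lintegral_one]
  congr 1; ext x
  rw [← ofReal_norm, Complex.norm_exp_ofReal_mul_I]; simp

/-- Normalised Lebesgue measure on a ball has finite energy of every order up to the dimension. -/
lemma energy_volume_ball_lt_top {d : ℕ} (hd : 1 ≤ d) {α : ℝ} (hα : 0 < α) (hαd : α ≤ d) (r : ℝ) :
    energy α ((volume : Measure (E d)).restrict (Metric.ball 0 r)) < ⊤ := by
  have : IsFiniteMeasure ((volume : Measure (E d)).restrict (Metric.ball 0 r)) :=
    ⟨by rw [Measure.restrict_apply_univ]; exact measure_ball_lt_top⟩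
  set μ := (volume : Measure (E d)).restrict (Metric.ball 0 r) with hμ
  -- Plancherel for the indicator of the ball, as an inequality: one of the two copies of the
  -- measure is enlarged to Lebesgue measure, against which the heat kernel has mass `(2π)^d`.
  have hL2 : ∫⁻ ξ, ‖charFun μ ξ‖ₑ ^ 2 ≤ ENNReal.ofReal ((2 * Real.pi) ^ d) * μ univ := by
    refine lintegral_le_of_gauss _ (measurable_enorm_charFun_sq μ) fun τ hτ => ?_
    rw [lintegral_charFun_sq_gauss _ hτ]
    calc ∫⁻ x, ∫⁻ y, ENNReal.ofReal (heat d τ (x - y)) ∂μ ∂μ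
        ≤ ∫⁻ x, ∫⁻ y, ENNReal.ofReal (heat d τ (x - y)) ∂volume ∂μ :=
          lintegral_mono fun x => lintegral_mono' Measure.restrict_le_self le_rfl
      _ = ∫⁻ x, ENNReal.ofReal ((2 * Real.pi) ^ d) ∂μ := by
          refine lintegral_congr fun x => ?_
          rw [← lintegral_heat hτ x]
          refine lintegral_congr fun y => ?_
          simp only [heat, norm_sub_rev x y]
      _ = _ := by rw [lintegral_const]
  rw [energy_eq, ← lintegral_add_compl _ (measurableSet_ball (x := (0 : E d)) (ε := 1))]
  refine ENNReal.add_lt_top.2 ⟨?_, ?_⟩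
  · refine (energy_restrict_ball_le μ).trans_lt (ENNReal.mul_lt_top ?_
      (lintegral_ball_norm_rpow_lt_top hd hα))
    exact ENNReal.pow_lt_top (measure_lt_top _ _)
  · refine lt_of_le_of_lt ?_ (hL2.trans_lt (ENNReal.mul_lt_top ENNReal.ofReal_lt_top
      (measure_lt_top _ _)))
    refine le_trans ?_ (setLIntegral_le_lintegral (Metric.ball (0 : E d) 1)ᶜ _)
    refine setLIntegral_mono' measurableSet_ball.compl fun ξ hξ => ?_
    refine mul_le_of_le_one_right zero_le ?_
    rw [ENNReal.ofReal_le_one]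
    exact Real.rpow_le_one_of_one_le_of_nonpos (by simpa using hξ) (by linarith)

/-! ### Duality between propagator estimates and restriction estimates to the cone -/

/-- Test estimate for the propagator with respect to `ν`: Schwartz functions with Fourier support
in `A`, measured in the `L²` norm with frequency weight `W`. -/
def TestBound {n : ℕ} (A : Set (E n)) (W : E n → ℝ) (ν : Measure (E (n + 1))) (D : ℝ≥0∞) : Prop :=
  ∀ f : SchwartzMap (E n) ℂ, tsupport (fourierHat f) ⊆ A →
    spaceTimeLHS f ν ≤ D * (∫⁻ ξ, ENNReal.ofReal (W ξ) * ‖fourierHat f ξ‖ₑ ^ 2) ^ (1 / 2 : ℝ)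

/-- Weighted `L²` estimate over the cone for all complex measures dominated by `ν`. -/
def DualBound {n : ℕ} (m : E n → ℝ≥0∞) (ν : Measure (E (n + 1))) (D : ℝ≥0∞) : Prop :=
  ∀ w : E (n + 1) → ℂ, Measurable w → (∀ z, ‖w z‖ ≤ 1) →
    ∫⁻ ξ, m ξ * ‖ft ν w (coneLift ξ)‖ₑ ^ 2 ≤ D ^ 2

lemma DualBound.mono {n : ℕ} {m m' : E n → ℝ≥0∞} {ν : Measure (E (n + 1))} {D D' : ℝ≥0∞}
    (h : DualBound m ν D) (hm : ∀ᵐ ξ, m' ξ ≤ m ξ) (hD : D ≤ D') : DualBound m' ν D' := by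
  intro w hw hw1
  calc _ ≤ ∫⁻ ξ, m ξ * ‖ft ν w (coneLift ξ)‖ₑ ^ 2 := lintegral_mono_ae (by
        filter_upwards [hm] with ξ hξ; gcongr)
    _ ≤ D ^ 2 := h w hw hw1
    _ ≤ _ := by gcongr

lemma TestBound.mono {n : ℕ} {A : Set (E n)} {W : E n → ℝ} {ν : Measure (E (n + 1))}
    {D D' : ℝ≥0∞} (h : TestBound A W ν D) (hD : D ≤ D') : TestBound A W ν D' :=
  fun f hf => (h f hf).trans (by gcongr)

lemma wave_eq {n : ℕ} (f : SchwartzMap (E n) ℂ) (z : E (n + 1)) :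
    wave f (spacePart z) (timePart z) = (((2 * Real.pi) ^ n)⁻¹ : ℝ) *
      ∫ ξ, Complex.exp ((inner ℝ z (coneLift ξ) : ℝ) * Complex.I) * hatS f ξ := by
  simp only [wave, inner_coneLift, hatS_apply]
  congr 2; ext ξ; rw [mul_comm Complex.I]

lemma continuous_wave {n : ℕ} (f : SchwartzMap (E n) ℂ) :
    Continuous fun z : E (n + 1) => wave f (spacePart z) (timePart z) := by
  simp_rw [wave_eq]
  refine continuous_const.mul ?_
  refine continuous_of_dominated (bound := fun ξ => ‖hatS f ξ‖) (fun z => ?_) (fun z => ?_)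
    (hatS f).integrable.norm (Filter.Eventually.of_forall fun ξ => by fun_prop)
  · exact ((Continuous.mul (by have := continuous_coneLift (n := n); fun_prop)
      (hatS f).continuous)).aestronglyMeasurable
  · exact Filter.Eventually.of_forall fun ξ => by
      rw [norm_mul, Complex.norm_exp_ofReal_mul_I, one_mul]

lemma norm_wave_le {n : ℕ} (f : SchwartzMap (E n) ℂ) (z : E (n + 1)) :
    ‖wave f (spacePart z) (timePart z)‖ ≤ ((2 * Real.pi) ^ n)⁻¹ * ∫ ξ, ‖hatS f ξ‖ := by
  rw [wave_eq, norm_mul, Complex.norm_real, Real.norm_of_nonneg (by positivity)]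
  gcongr
  refine (norm_integral_le_integral_norm _).trans (le_of_eq ?_)
  congr 1; ext ξ
  rw [norm_mul, Complex.norm_exp_ofReal_mul_I, one_mul]

lemma integral_wave_mul {n : ℕ} (f : SchwartzMap (E n) ℂ) (ν : Measure (E (n + 1)))
    [IsFiniteMeasure ν] {w : E (n + 1) → ℂ} (hw : Measurable w) (hw1 : ∀ z, ‖w z‖ ≤ 1) :
    ∫ z, wave f (spacePart z) (timePart z) * w z ∂ν = (((2 * Real.pi) ^ n)⁻¹ : ℝ) *
      ∫ ξ, hatS f ξ * ft ν w (coneLift ξ) := by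
  simp_rw [wave_eq, mul_assoc]
  rw [integral_const_mul]
  congr 1
  have h1 : ∀ z : E (n + 1), (∫ ξ, Complex.exp ((inner ℝ z (coneLift ξ) : ℝ) * Complex.I) *
      hatS f ξ) * w z = ∫ ξ, Complex.exp ((inner ℝ z (coneLift ξ) : ℝ) * Complex.I) *
      hatS f ξ * w z := fun z => (integral_mul_const _ _).symm
  simp_rw [h1]
  rw [integral_integral_swap]
  · congr 1; ext ξ
    rw [ft, ← integral_const_mul]
    congr 1; ext z; ring
  · have hb : Integrable (fun q : E (n + 1) × E n => 1 * ‖hatS f q.2‖) (ν.prod volume) :=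
      Integrable.mul_prod (integrable_const _) (hatS f).integrable.norm
    refine hb.mono' ?_ (Filter.Eventually.of_forall fun q => ?_)
    · refine Measurable.aestronglyMeasurable ?_
      refine Measurable.mul (Continuous.measurable ?_) (hw.comp measurable_fst)
      exact Continuous.mul (by have := continuous_coneLift (n := n); fun_prop)
        ((hatS f).continuous.comp continuous_snd)
    · simp only [Function.uncurry]
      rw [norm_mul, norm_mul, Complex.norm_exp_ofReal_mul_I, one_mul]
      exact mul_le_of_le_one_right (norm_nonneg (hatS f q.2)) (hw1 q.1)

lemma measurable_ft_coneLift {n : ℕ} (ν : Measure (E (n + 1))) [SFinite ν] {w : E (n + 1) → ℂ}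
    (hw : Measurable w) : Measurable fun ξ : E n => ft ν w (coneLift ξ) :=
  (measurable_ft ν hw).comp continuous_coneLift.measurable

lemma fourierHat_eq_zero_of_notMem {n : ℕ} {A : Set (E n)} {f : SchwartzMap (E n) ℂ}
    (hf : tsupport (fourierHat f) ⊆ A) {ξ : E n} (hξ : ξ ∉ A) : fourierHat f ξ = 0 :=
  image_eq_zero_of_notMem_tsupport fun h => hξ (hf h)

/-- The factor `(2π)^n`. -/
def twoPiPow (n : ℕ) : ℝ≥0∞ := ENNReal.ofReal ((2 * Real.pi) ^ n)

lemma twoPiPow_ne_zero (n : ℕ) : twoPiPow n ≠ 0 := by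
  simp only [twoPiPow, ne_eq, ENNReal.ofReal_eq_zero, not_le]; positivity

lemma twoPiPow_ne_top (n : ℕ) : twoPiPow n ≠ ⊤ := ENNReal.ofReal_ne_top

lemma enorm_inv_twoPi (n : ℕ) : ‖((((2 * Real.pi) ^ n)⁻¹ : ℝ) : ℂ)‖ₑ = (twoPiPow n)⁻¹ := by
  rw [← ofReal_norm, Complex.norm_real, Real.norm_of_nonneg (by positivity), twoPiPow,
    ENNReal.ofReal_inv_of_pos (by positivity)]

lemma ofReal_mul_inv_rpow_half {a : ℝ} (ha : 0 < a) :
    ENNReal.ofReal a ^ (1 / 2 : ℝ) * ENNReal.ofReal a⁻¹ ^ (1 / 2 : ℝ) = 1 := by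
  rw [← ENNReal.mul_rpow_of_nonneg _ _ (by norm_num), ← ENNReal.ofReal_mul ha.le,
    mul_inv_cancel₀ ha.ne']
  simp

lemma ennreal_sq_rpow_half (a : ℝ≥0∞) : (a ^ 2) ^ (1 / 2 : ℝ) = a := by
  rw [← ENNReal.rpow_natCast, ← ENNReal.rpow_mul]; norm_num

lemma ennreal_rpow_half_sq (a : ℝ≥0∞) : (a ^ (1 / 2 : ℝ)) ^ 2 = a := by
  rw [← ENNReal.rpow_natCast, ← ENNReal.rpow_mul]; norm_num

lemma ennreal_le_sq_of_rpow_half_le {a b : ℝ≥0∞} (h : a ^ (1 / 2 : ℝ) ≤ b) : a ≤ b ^ 2 := by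
  rw [← ennreal_rpow_half_sq a]; gcongr

/-- Weighted Cauchy-Schwarz inequality. -/
lemma lintegral_mul_le_weighted {X : Type*} [MeasurableSpace X] (μ : Measure X) {f g : X → ℝ≥0∞}
    (hf : AEMeasurable f μ) (hg : AEMeasurable g μ) :
    ∫⁻ x, f x * g x ∂μ ≤ (∫⁻ x, f x ^ 2 ∂μ) ^ (1 / 2 : ℝ) * (∫⁻ x, g x ^ 2 ∂μ) ^ (1 / 2 : ℝ) := by
  have := ENNReal.lintegral_mul_le_Lp_mul_Lq μ Real.HolderConjugate.two_two hf hg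
  simpa using this

/-- Write `∫ |u| dν = ∫ u w dν` with `w` the conjugate phase of `u`. By Fubini this is a pairing of
`f̂` with the transform of `w ν` on the cone, to which Cauchy-Schwarz with weights `W` and `W⁻¹`
applies. -/
lemma DualBound.testBound {n : ℕ} {A : Set (E n)} (hA : MeasurableSet A) {W : E n → ℝ}
    (hW : Measurable W) (hW0 : ∀ ξ, 0 < W ξ) {ν : Measure (E (n + 1))} [IsFiniteMeasure ν]
    {D : ℝ≥0∞} (h : DualBound (A.indicator fun ξ => ENNReal.ofReal (W ξ)⁻¹) ν D) :
    TestBound A W ν ((twoPiPow n)⁻¹ * D) := by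
  intro f hf
  set u : E (n + 1) → ℂ := fun z => wave f (spacePart z) (timePart z) with hu
  have huc : Continuous u := continuous_wave f
  -- At zeros of `u` the convention `x / 0 = 0` gives `w = 0`, so both `|w| ≤ 1` and `u w = |u|`
  -- hold everywhere.
  set w : E (n + 1) → ℂ := fun z => (starRingEnd ℂ) (u z) / (‖u z‖ : ℂ) with hw
  have hwm : Measurable w := by
    have h1 : Measurable fun z => (starRingEnd ℂ) (u z) :=
      (Complex.continuous_conj.comp huc).measurable
    exact h1.div (Complex.continuous_ofReal.comp huc.norm).measurable
  have hw1 : ∀ z, ‖w z‖ ≤ 1 := by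
    intro z
    simp only [hw, norm_div, RCLike.norm_conj, Complex.norm_real, norm_norm]
    exact div_self_le_one _
  have huw : ∀ z, u z * w z = (‖u z‖ : ℂ) := by
    intro z
    simp only [hw]
    rw [mul_div_assoc', Complex.mul_conj, Complex.normSq_eq_norm_sq]
    by_cases h0 : u z = 0
    · simp [h0]
    · have : (‖u z‖ : ℂ) ≠ 0 := by simpa using h0
      push_cast; field_simp
  have hui : Integrable u ν := Integrable.of_bound huc.aestronglyMeasurable
    (((2 * Real.pi) ^ n)⁻¹ * ∫ ξ, ‖hatS f ξ‖) (Filter.Eventually.of_forall (norm_wave_le f))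
  have h1 : spaceTimeLHS f ν = ‖∫ z, u z * w z ∂ν‖ₑ := by
    simp_rw [huw]
    rw [integral_complex_ofReal, ← ofReal_norm, Complex.norm_real, Real.norm_of_nonneg
      (integral_nonneg fun z => norm_nonneg _), ofReal_integral_norm_eq_lintegral_enorm hui]
    rfl
  rw [h1, hu, integral_wave_mul f ν hwm hw1, enorm_mul, enorm_inv_twoPi, mul_assoc]
  gcongr
  have hfm : Measurable fun ξ => ‖fourierHat f ξ‖ₑ := by
    rw [← coe_hatS]; exact (hatS f).continuous.measurable.enorm
  calc ‖∫ ξ, hatS f ξ * ft ν w (coneLift ξ)‖ₑ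
      ≤ ∫⁻ ξ, ‖hatS f ξ * ft ν w (coneLift ξ)‖ₑ := enorm_integral_le_lintegral_enorm _
    _ = ∫⁻ ξ, (ENNReal.ofReal (W ξ) ^ (1 / 2 : ℝ) * ‖fourierHat f ξ‖ₑ) *
          (A.indicator (fun ξ => ENNReal.ofReal (W ξ)⁻¹ ^ (1 / 2 : ℝ)) ξ *
            ‖ft ν w (coneLift ξ)‖ₑ) := by
        refine lintegral_congr fun ξ => ?_
        by_cases hξ : ξ ∈ A
        · rw [indicator_of_mem hξ, mul_mul_mul_comm, ofReal_mul_inv_rpow_half (hW0 ξ), one_mul,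
            enorm_mul, hatS_apply]
        · rw [enorm_mul, hatS_apply, fourierHat_eq_zero_of_notMem hf hξ]; simp
    _ ≤ (∫⁻ ξ, (ENNReal.ofReal (W ξ) ^ (1 / 2 : ℝ) * ‖fourierHat f ξ‖ₑ) ^ 2) ^ (1 / 2 : ℝ) *
        (∫⁻ ξ, (A.indicator (fun ξ => ENNReal.ofReal (W ξ)⁻¹ ^ (1 / 2 : ℝ)) ξ *
            ‖ft ν w (coneLift ξ)‖ₑ) ^ 2) ^ (1 / 2 : ℝ) := by
        refine lintegral_mul_le_weighted _ ?_ ?_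
        · exact ((hW.ennreal_ofReal.pow_const _).mul hfm).aemeasurable
        · exact ((((hW.inv).ennreal_ofReal.pow_const _).indicator hA).mul
            (measurable_ft_coneLift ν hwm).enorm).aemeasurable
    _ = (∫⁻ ξ, ENNReal.ofReal (W ξ) * ‖fourierHat f ξ‖ₑ ^ 2) ^ (1 / 2 : ℝ) *
        (∫⁻ ξ, A.indicator (fun ξ => ENNReal.ofReal (W ξ)⁻¹) ξ *
            ‖ft ν w (coneLift ξ)‖ₑ ^ 2) ^ (1 / 2 : ℝ) := by
        congr 2
        · refine lintegral_congr fun ξ => ?_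
          rw [mul_pow, ennreal_rpow_half_sq]
        · refine lintegral_congr fun ξ => ?_
          rw [mul_pow]
          by_cases hξ : ξ ∈ A
          · rw [indicator_of_mem hξ, indicator_of_mem hξ, ennreal_rpow_half_sq]
          · rw [indicator_of_notMem hξ, indicator_of_notMem hξ]; simp
    _ ≤ (∫⁻ ξ, ENNReal.ofReal (W ξ) * ‖fourierHat f ξ‖ₑ ^ 2) ^ (1 / 2 : ℝ) *
        (D ^ 2) ^ (1 / 2 : ℝ) := by
        gcongr
        exact h w hwm hw1
    _ = _ := by rw [ennreal_sq_rpow_half, mul_comm]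

lemma contDiff_ft {d : ℕ} (μ : Measure (E d)) [IsFiniteMeasure μ] {r : ℝ}
    (hμ : ∀ᵐ z ∂μ, ‖z‖ ≤ r) {w : E d → ℂ} (hw : Measurable w) (hw1 : ∀ z, ‖w z‖ ≤ 1) :
    ContDiff ℝ (⊤ : ℕ∞) (ft μ w) := by
  have h1 : ft μ w = fun t => VectorFourier.fourierIntegral Real.fourierChar μ (innerₗ (E d)) w
      (-(2 * Real.pi)⁻¹ • t) := by
    ext t
    simp only [ft, VectorFourier.fourierIntegral, neg_smul,
      innerₗ_apply_apply, inner_neg_right, inner_smul_right, neg_neg,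
      Real.fourierChar_apply', Circle.smul_def, Circle.coe_exp,
      smul_eq_mul]
    congr with x
    rw [← mul_assoc, mul_inv_cancel₀ (by simp [Real.pi_ne_zero]), one_mul]
  rw [h1]
  refine (VectorFourier.contDiff_fourierIntegral (L := innerSL ℝ) fun k hk => ?_).comp
    (by fun_prop)
  refine Integrable.of_bound (C := |r| ^ k) ?_ ?_
  · exact ((measurable_norm.pow_const k).mul hw.norm).aestronglyMeasurable
  · filter_upwards [hμ] with z hz
    rw [norm_mul, norm_pow, norm_norm, norm_norm]
    calc ‖z‖ ^ k * ‖w z‖ ≤ |r| ^ k * 1 := by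
          gcongr
          · exact hz.trans (le_abs_self r)
          · exact hw1 z
      _ = _ := mul_one _

lemma contDiffAt_coneLift {n : ℕ} {ξ : E n} (hξ : ξ ≠ 0) :
    ContDiffAt ℝ (⊤ : ℕ∞) (coneLift : E n → E (n + 1)) ξ := by
  rw [contDiffAt_euclidean]
  intro i
  refine Fin.lastCases ?_ (fun j => ?_) i
  · simp only [coneLift, Fin.snoc_last]
    exact contDiffAt_norm ℝ hξ
  · simp only [coneLift, Fin.snoc_castSucc]
    exact (contDiff_euclidean.1 contDiff_id j).contDiffAt

/-- A smooth cutoff equal to `1` on a compact set and compactly supported in an open set. -/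
lemma exists_smooth_cutoff {n : ℕ} {K V : Set (E n)} (hK : IsCompact K) (hV : IsOpen V)
    (hKV : K ⊆ V) : ∃ φ : E n → ℝ, ContDiff ℝ (⊤ : ℕ∞) φ ∧ HasCompactSupport φ ∧
      tsupport φ ⊆ V ∧ (∀ x, 0 ≤ φ x ∧ φ x ≤ 1) ∧ ∀ x ∈ K, φ x = 1 := by
  obtain ⟨L, hL, hKL, hLV⟩ := exists_compact_between hK hV hKV
  obtain ⟨φ, h1, h2, h3, h4⟩ := exists_contMDiff_support_eq_eq_one_iff
    (n := (⊤ : ℕ∞))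
    (modelWithCornersSelf ℝ (E n)) (isOpen_interior (s := L)) hK.isClosed hKL
  have h5 : tsupport φ ⊆ L := by
    rw [tsupport, h3]; exact closure_minimal interior_subset hL.isClosed
  exact ⟨φ, h1.contDiff, hL.of_isClosed_subset (isClosed_tsupport φ) h5, h5.trans hLV,
    fun x => h2 (mem_range_self x), fun x hx => (h4 x).1 hx⟩

/-- Converse duality. Test with `f̂ = φ W⁻¹ F̄`, where `F` is the transform of `w ν` on the cone and
`φ` is a cutoff. The pairing is `X = ∫ φ W⁻¹ |F|²`, while the weighted norm of `f̂` squared is at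
most `X` because `φ² ≤ φ`. Hence `X ≤ (2π)^n D X^(1/2)`. Composed with `DualBound.testBound`, it
loses no constant. -/
lemma TestBound.dualBound {n : ℕ} (hn : 1 ≤ n) {U : Set (E n)} (hU : IsOpen U) {W : E n → ℝ}
    (hW : ContDiff ℝ (⊤ : ℕ∞) W) (hW0 : ∀ ξ, 0 < W ξ) {ν : Measure (E (n + 1))}
    [IsFiniteMeasure ν] {r : ℝ} (hν : ∀ᵐ z ∂ν, ‖z‖ ≤ r) {D : ℝ≥0∞} (h : TestBound U W ν D) :
    DualBound (U.indicator fun ξ => ENNReal.ofReal (W ξ)⁻¹) ν (twoPiPow n * D) := by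
  have := nontrivial_E hn
  intro w hw hw1
  set F : E n → ℂ := fun ξ => ft ν w (coneLift ξ) with hF
  have hFd : ∀ ξ : E n, ξ ≠ 0 → ContDiffAt ℝ (⊤ : ℕ∞) F ξ := fun ξ hξ =>
    ContDiffAt.comp (g := ft ν w) (f := coneLift) ξ (contDiff_ft ν hν hw hw1).contDiffAt (contDiffAt_coneLift hξ)
  have hFc : Continuous F := (contDiff_ft ν hν hw hw1).continuous.comp continuous_coneLift
  have hWi : ContDiff ℝ (⊤ : ℕ∞) fun ξ => (W ξ)⁻¹ := hW.inv fun ξ => (hW0 ξ).ne'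
  -- The cone is not smooth at its vertex, so the test function must vanish near `0`; the removed
  -- point is a null set as `n ≥ 1`.
  set V : Set (E n) := U \ {0} with hV
  have hVo : IsOpen V := hU.sdiff isClosed_singleton
  -- the estimate on compact subsets
  have key : ∀ K : Set (E n), IsCompact K → K ⊆ V →
      ∫⁻ ξ in K, ENNReal.ofReal (W ξ)⁻¹ * ‖F ξ‖ₑ ^ 2 ≤ (twoPiPow n * D) ^ 2 := by
    intro K hK hKV
    obtain ⟨φ, hφd, hφc, hφV, hφ01, hφ1⟩ := exists_smooth_cutoff hK hVo hKV
    set G : E n → ℂ := fun ξ => ((φ ξ * (W ξ)⁻¹ : ℝ) : ℂ) * (starRingEnd ℂ) (F ξ) with hG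
    have hφ0 : ∀ ξ, ξ ∉ tsupport φ → φ ξ = 0 := fun ξ hξ => image_eq_zero_of_notMem_tsupport hξ
    have hGd : ContDiff ℝ (⊤ : ℕ∞) G := by
      rw [contDiff_iff_contDiffAt]
      intro ξ
      by_cases hξ : ξ ∈ tsupport φ
      · have hξ0 : ξ ≠ 0 := (hφV hξ).2
        refine ContDiffAt.mul ?_ ?_
        · exact (Complex.ofRealCLM.contDiff.comp (hφd.mul hWi)).contDiffAt
        · exact (Complex.conjCLE.contDiff.contDiffAt).comp ξ (hFd ξ hξ0)
      · have : G =ᶠ[nhds ξ] fun _ => 0 := by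
          filter_upwards [(isClosed_tsupport φ).isOpen_compl.mem_nhds hξ] with y hy
          simp [hG, hφ0 y hy]
        exact contDiffAt_const.congr_of_eventuallyEq this
    have hGsupp : tsupport G ⊆ tsupport φ := by
      refine closure_minimal (fun ξ hξ => ?_) (isClosed_tsupport φ)
      by_contra hc
      exact hξ (by simp [hG, hφ0 ξ hc])
    have hGc : HasCompactSupport G := hφc.of_isClosed_subset (isClosed_tsupport G) hGsupp
    obtain ⟨g, hg⟩ := exists_fourierHat_eq (hGc.toSchwartzMap hGd)
    have hg' : fourierHat g = G := by rw [hg]; rfl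
    have hgU : tsupport (fourierHat g) ⊆ U := by
      rw [hg']; exact hGsupp.trans (hφV.trans sdiff_subset)
    have h1 := h g hgU
    rw [hg'] at h1
    set X : ℝ≥0∞ := ∫⁻ ξ, ENNReal.ofReal (φ ξ * (W ξ)⁻¹ * ‖F ξ‖ ^ 2) with hX
    have hcont : Continuous fun ξ => φ ξ * (W ξ)⁻¹ * ‖F ξ‖ ^ 2 :=
      (hφd.continuous.mul hWi.continuous).mul (hFc.norm.pow 2)
    have hint : Integrable fun ξ => φ ξ * (W ξ)⁻¹ * ‖F ξ‖ ^ 2 :=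
      hcont.integrable_of_hasCompactSupport
        (HasCompactSupport.mul_right (HasCompactSupport.mul_right hφc))
    have hnn : ∀ ξ, 0 ≤ φ ξ * (W ξ)⁻¹ * ‖F ξ‖ ^ 2 := fun ξ =>
      mul_nonneg (mul_nonneg (hφ01 ξ).1 (inv_nonneg.2 (hW0 ξ).le)) (by positivity)
    have hXi : X = ENNReal.ofReal (∫ ξ, φ ξ * (W ξ)⁻¹ * ‖F ξ‖ ^ 2) :=
      (ofReal_integral_eq_lintegral_ofReal hint (Filter.Eventually.of_forall hnn)).symm
    have hXt : X ≠ ⊤ := by rw [hXi]; exact ENNReal.ofReal_ne_top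
    have h2 : ∫⁻ ξ, ENNReal.ofReal (W ξ) * ‖G ξ‖ₑ ^ 2 ≤ X := by
      refine lintegral_mono fun ξ => ?_
      rw [← ofReal_norm, ← ENNReal.ofReal_pow (norm_nonneg _), ← ENNReal.ofReal_mul (hW0 ξ).le]
      refine ENNReal.ofReal_le_ofReal ?_
      simp only [hG]
      rw [norm_mul, RCLike.norm_conj, Complex.norm_real, Real.norm_of_nonneg
        (mul_nonneg (hφ01 ξ).1 (inv_nonneg.2 (hW0 ξ).le))]
      have h3 : W ξ * (φ ξ * (W ξ)⁻¹ * ‖F ξ‖) ^ 2 = φ ξ * (φ ξ * (W ξ)⁻¹ * ‖F ξ‖ ^ 2) := by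
        have := (hW0 ξ).ne'
        field_simp
      rw [h3]
      exact mul_le_of_le_one_left (hnn ξ) (hφ01 ξ).2
    have h4 : (twoPiPow n)⁻¹ * X ≤ spaceTimeLHS g ν := by
      have h5 := integral_wave_mul g ν hw hw1
      have h6 : ∫ ξ, hatS g ξ * ft ν w (coneLift ξ) =
          ((∫ ξ, φ ξ * (W ξ)⁻¹ * ‖F ξ‖ ^ 2 : ℝ) : ℂ) := by
        rw [← integral_complex_ofReal]
        congr 1; ext ξ
        rw [hatS_apply, hg']
        change ((φ ξ * (W ξ)⁻¹ : ℝ) : ℂ) * (starRingEnd ℂ) (F ξ) * F ξ = _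
        rw [mul_assoc, mul_comm ((starRingEnd ℂ) (F ξ)), Complex.mul_conj,
          Complex.normSq_eq_norm_sq]
        push_cast; ring
      calc (twoPiPow n)⁻¹ * X = ‖∫ z, wave g (spacePart z) (timePart z) * w z ∂ν‖ₑ := by
            rw [h5, h6, enorm_mul, enorm_inv_twoPi, hXi, ← ofReal_norm, Complex.norm_real,
              Real.norm_of_nonneg (integral_nonneg hnn)]
        _ ≤ ∫⁻ z, ‖wave g (spacePart z) (timePart z) * w z‖ₑ ∂ν :=
            enorm_integral_le_lintegral_enorm _
        _ ≤ _ := by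
            refine lintegral_mono fun z => ?_
            rw [enorm_mul]
            refine mul_le_of_le_one_right zero_le ?_
            rw [← ofReal_norm]; exact ENNReal.ofReal_le_one.2 (hw1 z)
    have h7 : (twoPiPow n)⁻¹ * X ≤ D * X ^ (1 / 2 : ℝ) := (h4.trans h1).trans (by gcongr)
    have h8 : X ≤ (twoPiPow n * D) * X ^ (1 / 2 : ℝ) := by
      calc X = twoPiPow n * ((twoPiPow n)⁻¹ * X) := by
            rw [← mul_assoc, ENNReal.mul_inv_cancel (twoPiPow_ne_zero n) (twoPiPow_ne_top n),
              one_mul]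
        _ ≤ twoPiPow n * (D * X ^ (1 / 2 : ℝ)) := by gcongr
        _ = _ := by ring
    -- Dividing by `X^(1/2)` is legitimate because `X` is the integral of a continuous compactly
    -- supported function, hence finite; this is why the estimate is first proved on compact sets.
    have h9 : X ≤ (twoPiPow n * D) ^ 2 := by
      by_cases hX0 : X = 0
      · rw [hX0]; exact zero_le
      refine ennreal_le_sq_of_rpow_half_le ?_
      set Y := X ^ (1 / 2 : ℝ) with hY
      have hY2 : X = Y * Y := by rw [← sq, hY, ennreal_rpow_half_sq]
      have hY0 : Y ≠ 0 := fun h0 => hX0 (by rw [hY2, h0, zero_mul])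
      have hYt : Y ≠ ⊤ := ENNReal.rpow_ne_top_of_nonneg (by norm_num) hXt
      rw [hY2] at h8
      exact (ENNReal.mul_le_mul_iff_left hY0 hYt).1 h8
    refine le_trans ?_ h9
    calc ∫⁻ ξ in K, ENNReal.ofReal (W ξ)⁻¹ * ‖F ξ‖ₑ ^ 2
        ≤ ∫⁻ ξ in K, ENNReal.ofReal (φ ξ * (W ξ)⁻¹ * ‖F ξ‖ ^ 2) := by
          refine setLIntegral_mono' hK.measurableSet fun ξ hξ => ?_
          rw [hφ1 ξ hξ, one_mul, ENNReal.ofReal_mul (inv_nonneg.2 (hW0 ξ).le),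
            ENNReal.ofReal_pow (norm_nonneg _), ofReal_norm]
      _ ≤ X := setLIntegral_le_lintegral _ _
  -- exhaustion
  obtain ⟨S, hS1, hS2, hS3, hS4⟩ := hVo.exists_iUnion_isClosed
  set T : ℕ → Set (E n) := fun k => S k ∩ Metric.closedBall 0 k with hT
  have hTm : Monotone T := fun i j hij => inter_subset_inter (hS4 hij)
    (Metric.closedBall_subset_closedBall (by exact_mod_cast hij))
  have hTU : ⋃ k, T k = V := by
    refine Subset.antisymm (iUnion_subset fun k => inter_subset_left.trans (hS2 k)) fun ξ hξ => ?_
    rw [← hS3] at hξ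
    obtain ⟨i, hi⟩ := mem_iUnion.1 hξ
    obtain ⟨j, hj⟩ := exists_nat_ge ‖ξ‖
    refine mem_iUnion.2 ⟨max i j, hS4 (le_max_left i j) hi, ?_⟩
    rw [mem_closedBall_zero_iff]
    exact hj.trans (by exact_mod_cast le_max_right i j)
  have hae : ∀ᵐ ξ : E n, ξ ≠ 0 := measure_eq_zero_iff_ae_notMem.1 (measure_singleton (0 : E n))
  calc ∫⁻ ξ, U.indicator (fun ξ => ENNReal.ofReal (W ξ)⁻¹) ξ * ‖F ξ‖ₑ ^ 2
      = ∫⁻ ξ in V, ENNReal.ofReal (W ξ)⁻¹ * ‖F ξ‖ₑ ^ 2 := by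
        rw [← lintegral_indicator hVo.measurableSet]
        refine lintegral_congr_ae ?_
        filter_upwards [hae] with ξ hξ
        by_cases hξU : ξ ∈ U
        · rw [indicator_of_mem hξU, indicator_of_mem (show ξ ∈ V from ⟨hξU, hξ⟩)]
        · rw [indicator_of_notMem hξU, indicator_of_notMem (fun hc => hξU hc.1), zero_mul]
    _ = ⨆ k, ∫⁻ ξ in T k, ENNReal.ofReal (W ξ)⁻¹ * ‖F ξ‖ₑ ^ 2 := by
        rw [← hTU, setLIntegral_iUnion_of_directed _ hTm.directed_le]
    _ ≤ _ := iSup_le fun k => key (T k)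
        ((isCompact_closedBall _ _).inter_left (hS1 k)) (inter_subset_left.trans (hS2 k))

/-! ### Localization of measures -/

/-- For `α ≥ d` the weight is at least `1` outside the unit ball; inside it the transform is bounded
by the mass, which the energy controls. -/
lemma lintegral_enorm_charFun_sq_le {d : ℕ} (hd : 1 ≤ d) (α₀ : ℝ) : ∃ K : ℝ≥0, ∀ α : ℝ,
    (d : ℝ) ≤ α → α ≤ α₀ → ∀ μ : Measure (E d), IsFiniteMeasure μ → (∀ᵐ x ∂μ, ‖x‖ ≤ 1) →
      ∫⁻ ξ, ‖charFun μ ξ‖ₑ ^ 2 ≤ K * energy α μ := by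
  obtain ⟨K, hK⟩ := exists_mass_sq_le_energy d hd α₀
  set V : ℝ≥0∞ := volume (Metric.ball (0 : E d) 1) with hV
  have hVt : V ≠ ⊤ := measure_ball_lt_top.ne
  refine ⟨K * V.toNNReal + 1, fun α hα hα₀ μ hμ hμ1 => ?_⟩
  have hd' : (1 : ℝ) ≤ d := by exact_mod_cast hd
  have h1 := hK α (by linarith) hα₀ μ hμ hμ1
  rw [← lintegral_add_compl _ (measurableSet_ball (x := (0 : E d)) (ε := 1))]
  push_cast
  rw [add_mul, one_mul, ENNReal.coe_toNNReal hVt]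
  refine add_le_add ?_ ?_
  · calc ∫⁻ ξ in Metric.ball (0 : E d) 1, ‖charFun μ ξ‖ₑ ^ 2
        ≤ ∫⁻ _ in Metric.ball (0 : E d) 1, μ univ ^ 2 := by
          refine lintegral_mono fun ξ => ?_
          gcongr
          rw [← ofReal_norm, ← ofReal_measureReal]
          exact ENNReal.ofReal_le_ofReal (norm_charFun_le ξ)
      _ = μ univ ^ 2 * V := by rw [setLIntegral_const]
      _ ≤ (K * energy α μ) * V := by gcongr
      _ = _ := by ring
  · rw [energy_eq]
    refine le_trans (setLIntegral_mono' measurableSet_ball.compl fun ξ hξ => ?_)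
      (setLIntegral_le_lintegral _ _)
    have h2 : 1 ≤ ‖ξ‖ := by simpa using hξ
    have h3 : (1 : ℝ) ≤ ‖ξ‖ ^ (α - d) := Real.one_le_rpow h2 (by linarith)
    calc ‖charFun μ ξ‖ₑ ^ 2 = ‖charFun μ ξ‖ₑ ^ 2 * 1 := (mul_one _).symm
      _ ≤ _ := by
        gcongr
        rw [← ENNReal.ofReal_one]; exact ENNReal.ofReal_le_ofReal h3

lemma lintegral_schwartz_pow_lt_top {d : ℕ} (g : SchwartzMap (E d) ℂ) (N : ℕ) :
    ∫⁻ y, ‖g y‖ₑ * ENNReal.ofReal (1 + ‖y‖ ^ N) < ⊤ := by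
  have h1 := (g.integrable).norm.add (g.integrable_pow_mul volume N)
  have h2 := h1.lintegral_lt_top
  refine lt_of_le_of_lt (lintegral_mono fun y => le_of_eq ?_) h2
  rw [← ofReal_norm, ← ENNReal.ofReal_mul (norm_nonneg _)]
  congr 1
  simp; ring

lemma add_rpow_le_two {a b p : ℝ} (ha : 0 ≤ a) (hb : 0 ≤ b) (hp : 0 ≤ p) :
    (a + b) ^ p ≤ 2 ^ p * (a ^ p + b ^ p) := by
  have h1 : (a + b) ^ p ≤ (2 * max a b) ^ p :=
    Real.rpow_le_rpow (by positivity) (by linarith [le_max_left a b, le_max_right a b]) hp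
  rw [Real.mul_rpow (by norm_num) (by positivity)] at h1
  refine h1.trans ?_
  gcongr
  rcases le_total a b with h | h
  · rw [max_eq_right h]; have := Real.rpow_nonneg ha p; linarith
  · rw [max_eq_left h]; have := Real.rpow_nonneg hb p; linarith

/-- With `χ = ĝ`, the transform of `χ μ` is a convolution of `g` with the transform of `μ`.
Cauchy-Schwarz and `|ξ+y|^p ≤ 2^p (|ξ|^p + |y|^p)`, `p = α - d`, bound the energy; the `|y|^p` term
leaves the `L²` norm of the transform and a moment of `g`. The factor `2^α₀` and the moment of order
about `α₀` are what restrict this argument to bounded orders. -/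
lemma exists_energy_withDensity_le {d : ℕ} (hd : 1 ≤ d) (α₀ : ℝ) {χ : E d → ℝ}
    (hχ : ContDiff ℝ (⊤ : ℕ∞) χ) (hχc : HasCompactSupport χ) (hχ01 : ∀ x, 0 ≤ χ x ∧ χ x ≤ 1) :
    ∃ K : ℝ≥0, ∀ α : ℝ, 0 < α → α ≤ α₀ → ∀ μ : Measure (E d), IsFiniteMeasure μ →
      (∀ᵐ x ∂μ, ‖x‖ ≤ 1) →
        energy α (μ.withDensity fun x => ENNReal.ofReal (χ x)) ≤ K * energy α μ := by
  obtain ⟨K₁, hK₁⟩ := lintegral_enorm_charFun_sq_le hd α₀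
  have hχ' : ContDiff ℝ (⊤ : ℕ∞) fun x => (χ x : ℂ) := Complex.ofRealCLM.contDiff.comp hχ
  have hχc' : HasCompactSupport fun x => (χ x : ℂ) := hχc.comp_left (g := Complex.ofReal) rfl
  obtain ⟨g, hg⟩ := exists_fourierHat_eq (hχc'.toSchwartzMap hχ')
  obtain ⟨N, hN⟩ := exists_nat_ge α₀
  set G : ℝ≥0∞ := ∫⁻ y, ‖g y‖ₑ with hG
  set G' : ℝ≥0∞ := ∫⁻ y, ‖g y‖ₑ * ENNReal.ofReal (1 + ‖y‖ ^ N) with hG'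
  have hGt' : G' ≠ ⊤ := (lintegral_schwartz_pow_lt_top g N).ne
  have hGt : G ≠ ⊤ := (hasFiniteIntegral_iff_enorm.1 (g.integrable (μ := volume)).2).ne
  refine ⟨(G * (ENNReal.ofReal (2 ^ α₀) * (G + G' * K₁))).toNNReal + 1, fun α hα hα₀ μ hμ hμ1 => ?_⟩
  have hKt : G * (ENNReal.ofReal (2 ^ α₀) * (G + G' * K₁)) ≠ ⊤ := by finiteness
  push_cast
  rw [ENNReal.coe_toNNReal hKt, add_mul, one_mul]
  have hχm : Measurable χ := hχ.continuous.measurable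
  have hle : μ.withDensity (fun x => ENNReal.ofReal (χ x)) ≤ μ := by
    conv_rhs => rw [← withDensity_one (μ := μ)]
    refine withDensity_mono (Filter.Eventually.of_forall fun x => ?_)
    exact ENNReal.ofReal_le_one.2 (hχ01 x).2
  -- Up to the dimension, monotonicity of the energy gives the constant `1`; it is the `+ 1` in the
  -- chosen constant.
  rcases le_or_gt α d with hαd | hαd
  · exact (energy_mono hd hαd hle).trans le_add_self
  refine le_trans ?_ le_self_add
  set p := α - d with hp
  have hp0 : 0 ≤ p := by linarith
  have hd' : (1 : ℝ) ≤ d := by exact_mod_cast hd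
  -- the Fourier transform of the product
  have hc : ∀ ξ, charFun (μ.withDensity fun x => ENNReal.ofReal (χ x)) ξ =
      ∫ y, g y * charFun μ (ξ - y) := by
    intro ξ
    have h1 : charFun (μ.withDensity fun x => ENNReal.ofReal (χ x)) ξ =
        ∫ x, (χ x : ℂ) * Complex.exp ((inner ℝ x ξ : ℝ) * Complex.I) ∂μ := by
      rw [charFun_apply, integral_withDensity_eq_integral_toReal_smul
        hχm.ennreal_ofReal (Filter.Eventually.of_forall fun x => ENNReal.ofReal_lt_top)]
      congr 1; ext x
      rw [ENNReal.toReal_ofReal (hχ01 x).1]; rfl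
    have h2 : ∀ x, (χ x : ℂ) = ∫ y, Complex.exp (-(Complex.I * ((inner ℝ y x : ℝ) : ℂ))) * g y := by
      intro x
      have := congrFun hg x
      rw [fourierHat] at this
      exact this.symm
    rw [h1]
    simp_rw [h2, ← integral_mul_const]
    rw [integral_integral_swap]
    · congr 1; ext y
      rw [charFun_apply, ← integral_const_mul]
      congr 1; ext x
      rw [mul_right_comm, ← Complex.exp_add, mul_comm]
      congr 2
      rw [inner_sub_right, real_inner_comm]; push_cast; ring
    · have hb : Integrable (fun q : E d × E d => 1 * ‖g q.2‖) (μ.prod volume) :=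
        Integrable.mul_prod (integrable_const _) g.integrable.norm
      refine hb.mono' ?_ (Filter.Eventually.of_forall fun q => ?_)
      · refine Continuous.aestronglyMeasurable ?_
        have := g.continuous
        simp only [Function.uncurry_def]
        fun_prop
      · simp only [Function.uncurry]
        rw [norm_mul, norm_mul, Complex.norm_exp_ofReal_mul_I, mul_one,
          show -(Complex.I * ((inner ℝ q.2 q.1 : ℝ) : ℂ)) =
            ((-inner ℝ q.2 q.1 : ℝ) : ℂ) * Complex.I by push_cast; ring,
          Complex.norm_exp_ofReal_mul_I]
  have hgm : Measurable fun y => ‖g y‖ₑ := g.continuous.measurable.enorm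
  have hcm : Measurable fun ξ : E d => ‖charFun μ ξ‖ₑ := (continuous_charFun (μ := μ)).measurable.enorm
  have hc2 : ∀ ξ, ‖charFun (μ.withDensity fun x => ENNReal.ofReal (χ x)) ξ‖ₑ ^ 2 ≤
      G * ∫⁻ y, ‖g y‖ₑ * ‖charFun μ (ξ - y)‖ₑ ^ 2 := by
    intro ξ
    have h1 : ‖charFun (μ.withDensity fun x => ENNReal.ofReal (χ x)) ξ‖ₑ ≤
        ∫⁻ y, ‖g y‖ₑ ^ (1 / 2 : ℝ) * (‖g y‖ₑ ^ (1 / 2 : ℝ) * ‖charFun μ (ξ - y)‖ₑ) := by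
      rw [hc]
      refine (enorm_integral_le_lintegral_enorm _).trans (lintegral_mono fun y => le_of_eq ?_)
      rw [enorm_mul, ← mul_assoc, ← sq, ennreal_rpow_half_sq]
    have h2 := h1.trans (lintegral_mul_le_weighted volume (hgm.pow_const _).aemeasurable
      ((hgm.pow_const _).mul (hcm.comp (measurable_const.sub measurable_id))).aemeasurable)
    refine (pow_le_pow_left' h2 2).trans (le_of_eq ?_)
    rw [mul_pow, ennreal_rpow_half_sq, ennreal_rpow_half_sq]
    simp_rw [mul_pow, ennreal_rpow_half_sq]
    rfl
  have hyp : ∀ ξ y : E d, ENNReal.ofReal (‖ξ + y‖ ^ p) ≤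
      ENNReal.ofReal (2 ^ α₀) * (ENNReal.ofReal (‖ξ‖ ^ p) + ENNReal.ofReal (1 + ‖y‖ ^ N)) := by
    intro ξ y
    rw [← ENNReal.ofReal_add (by positivity) (by positivity), ← ENNReal.ofReal_mul (by positivity)]
    refine ENNReal.ofReal_le_ofReal ?_
    have h1 : ‖ξ + y‖ ^ p ≤ (‖ξ‖ + ‖y‖) ^ p :=
      Real.rpow_le_rpow (norm_nonneg _) (norm_add_le _ _) hp0
    have h2 := add_rpow_le_two (norm_nonneg ξ) (norm_nonneg y) hp0
    have h3 : (2 : ℝ) ^ p ≤ 2 ^ α₀ := Real.rpow_le_rpow_of_exponent_le (by norm_num) (by linarith)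
    have h4 : ‖y‖ ^ p ≤ 1 + ‖y‖ ^ N := by
      rcases le_total ‖y‖ 1 with hy | hy
      · have := Real.rpow_le_one (norm_nonneg y) hy hp0
        have := pow_nonneg (norm_nonneg y) N
        linarith
      · have : ‖y‖ ^ p ≤ ‖y‖ ^ (N : ℝ) := Real.rpow_le_rpow_of_exponent_le hy (by linarith)
        rw [Real.rpow_natCast] at this
        linarith
    refine h1.trans (h2.trans ?_)
    gcongr
  rw [energy_eq]
  calc ∫⁻ ξ, ‖charFun (μ.withDensity fun x => ENNReal.ofReal (χ x)) ξ‖ₑ ^ 2 *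
          ENNReal.ofReal (‖ξ‖ ^ p)
      ≤ ∫⁻ ξ, G * ∫⁻ y, ‖g y‖ₑ * ‖charFun μ (ξ - y)‖ₑ ^ 2 * ENNReal.ofReal (‖ξ‖ ^ p) := by
        refine lintegral_mono fun ξ => ?_
        rw [lintegral_mul_const' _ _ ENNReal.ofReal_ne_top, ← mul_assoc]
        gcongr
        exact hc2 ξ
    _ = G * ∫⁻ y, ∫⁻ ξ, ‖g y‖ₑ * ‖charFun μ (ξ - y)‖ₑ ^ 2 * ENNReal.ofReal (‖ξ‖ ^ p) := by
        rw [lintegral_const_mul' _ _ hGt, lintegral_lintegral_swap]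
        refine Measurable.aemeasurable ?_
        refine Measurable.mul (Measurable.mul (hgm.comp measurable_snd) ?_) (by fun_prop)
        exact (hcm.comp (measurable_fst.sub measurable_snd)).pow_const 2
    _ = G * ∫⁻ y, ‖g y‖ₑ * ∫⁻ ξ, ‖charFun μ ξ‖ₑ ^ 2 * ENNReal.ofReal (‖ξ + y‖ ^ p) := by
        congr 1
        refine lintegral_congr fun y => ?_
        simp_rw [mul_assoc]
        rw [lintegral_const_mul' _ _ enorm_ne_top]
        congr 1
        rw [← lintegral_add_right_eq_self _ y]
        simp
    _ ≤ G * ∫⁻ y, ‖g y‖ₑ * (ENNReal.ofReal (2 ^ α₀) * (energy α μ +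
          K₁ * energy α μ * ENNReal.ofReal (1 + ‖y‖ ^ N))) := by
        gcongr with y
        calc ∫⁻ ξ, ‖charFun μ ξ‖ₑ ^ 2 * ENNReal.ofReal (‖ξ + y‖ ^ p)
            ≤ ∫⁻ ξ, ENNReal.ofReal (2 ^ α₀) * (‖charFun μ ξ‖ₑ ^ 2 * ENNReal.ofReal (‖ξ‖ ^ p) +
                ‖charFun μ ξ‖ₑ ^ 2 * ENNReal.ofReal (1 + ‖y‖ ^ N)) := by
              refine lintegral_mono fun ξ => ?_
              calc _ ≤ ‖charFun μ ξ‖ₑ ^ 2 * (ENNReal.ofReal (2 ^ α₀) *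
                    (ENNReal.ofReal (‖ξ‖ ^ p) + ENNReal.ofReal (1 + ‖y‖ ^ N))) := by
                    gcongr; exact hyp ξ y
                _ = _ := by ring
          _ = ENNReal.ofReal (2 ^ α₀) * (energy α μ +
                (∫⁻ ξ, ‖charFun μ ξ‖ₑ ^ 2) * ENNReal.ofReal (1 + ‖y‖ ^ N)) := by
              rw [lintegral_const_mul' _ _ ENNReal.ofReal_ne_top,
                lintegral_add_right _ ((hcm.pow_const 2).mul_const _),
                lintegral_mul_const' _ _ ENNReal.ofReal_ne_top, energy_eq]
          _ ≤ _ := by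
              gcongr
              exact hK₁ α hαd.le hα₀ μ hμ hμ1
    _ = G * (ENNReal.ofReal (2 ^ α₀) * (G + G' * K₁)) * energy α μ := by
        have : ∀ y, ‖g y‖ₑ * (ENNReal.ofReal (2 ^ α₀) * (energy α μ +
            K₁ * energy α μ * ENNReal.ofReal (1 + ‖y‖ ^ N))) =
            ‖g y‖ₑ * (ENNReal.ofReal (2 ^ α₀) * energy α μ) +
            (‖g y‖ₑ * ENNReal.ofReal (1 + ‖y‖ ^ N)) *
              (ENNReal.ofReal (2 ^ α₀) * (K₁ * energy α μ)) := fun y => by ring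
        simp_rw [this]
        rw [lintegral_add_left (hgm.mul_const _), lintegral_mul_const _ hgm,
          lintegral_mul_const
          (f := fun y : E d => ‖g y‖ₑ * ENNReal.ofReal (1 + ‖y‖ ^ N)) _ (hgm.mul (by fun_prop))]
        change G * (G * _ + G' * _) = _
        ring

/-! ### Lorentz reflections of the light cone -/

/-- Lebesgue measure is a multiple of `n`-dimensional Hausdorff measure, for which the Lipschitz
bound is immediate. This replaces a Jacobian for `freqMap`, which is not differentiable at the
origin in general. -/
lemma volume_image_le_of_lipschitz {n : ℕ} {S : E n → E n} {L : ℝ≥0} (hS : LipschitzWith L S)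
    (A : Set (E n)) : volume (S '' A) ≤ (L : ℝ≥0∞) ^ n * volume A := by
  have h := hS.hausdorffMeasure_image_le (d := (n : ℝ)) (by positivity) A
  have hv : (volume : Measure (E n)) =
      Measure.addHaarScalarFactor (volume : Measure (E n)) (Measure.hausdorffMeasure (n : ℝ)) •
        Measure.hausdorffMeasure (n : ℝ) := Measure.isAddLeftInvariant_eq_smul _ _
  rw [hv, Measure.smul_apply, Measure.smul_apply]
  rw [ENNReal.rpow_natCast] at h
  simp only [ENNReal.smul_def, smul_eq_mul]
  calc _ ≤ _ := mul_le_mul_right h _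
    _ = _ := by ring

/-- Change of variables inequality for a map with a Lipschitz left inverse. -/
lemma lintegral_comp_le_of_lipschitz {n : ℕ} {T S : E n → E n} (hT : Measurable T) {L : ℝ≥0}
    (hS : LipschitzWith L S) (hST : ∀ x, S (T x) = x) (f : E n → ℝ≥0∞) (hf : Measurable f) :
    ∫⁻ x, f (T x) ≤ (L : ℝ≥0∞) ^ n * ∫⁻ x, f x := by
  have h : (volume : Measure (E n)).map T ≤ ((L : ℝ≥0∞) ^ n) • (volume : Measure (E n)) := by
    refine Measure.le_iff.2 fun A hA => ?_
    rw [Measure.map_apply hT hA, Measure.smul_apply, smul_eq_mul]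
    refine le_trans (measure_mono fun x hx => ?_) (volume_image_le_of_lipschitz hS A)
    exact ⟨T x, hx, hST x⟩
  rw [← lintegral_map hf hT]
  refine (lintegral_mono' h le_rfl).trans ?_
  rw [lintegral_smul_measure, smul_eq_mul]

/-- The reflection of space-time preserving the light cone with axis determined by `k`. -/
def lorentz {n : ℕ} (k : E n) (z : E (n + 1)) : E (n + 1) :=
  mkPt (-(spacePart z + (2 / (1 - ‖k‖ ^ 2) * (inner ℝ (spacePart z) k + timePart z)) • k))
    (-timePart z + 2 / (1 - ‖k‖ ^ 2) * (inner ℝ (spacePart z) k + timePart z))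

/-- The action of the reflection on frequencies. -/
def freqMap {n : ℕ} (k ξ : E n) : E n :=
  -ξ + (2 * ((‖ξ‖ - inner ℝ ξ k) / (1 - ‖k‖ ^ 2))) • k

section

variable {n : ℕ} {k : E n}

lemma one_sub_norm_sq_pos (hk : ‖k‖ ≤ 1 / 4) : 15 / 16 ≤ 1 - ‖k‖ ^ 2 := by
  nlinarith [norm_nonneg k]

lemma abs_inner_le_quarter (hk : ‖k‖ ≤ 1 / 4) (ξ : E n) : |inner ℝ ξ k| ≤ ‖ξ‖ / 4 := by
  have := abs_real_inner_le_norm ξ k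
  nlinarith [norm_nonneg ξ]

/-- The right-hand side is the time component of a linear map preserving the Minkowski form,
evaluated at `(ξ, |ξ|)`, so the two squares agree. For `|k| ≤ 1/4` it is nonnegative, which means
that the forward cone is mapped to itself. -/
lemma norm_freqMap (hk : ‖k‖ ≤ 1 / 4) (ξ : E n) :
    ‖freqMap k ξ‖ = -‖ξ‖ + 2 * ((‖ξ‖ - inner ℝ ξ k) / (1 - ‖k‖ ^ 2)) := by
  have h0 := one_sub_norm_sq_pos hk
  have h1 := abs_le.1 (abs_inner_le_quarter hk ξ)
  set β := (‖ξ‖ - inner ℝ ξ k) / (1 - ‖k‖ ^ 2) with hβ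
  have hb : β * (1 - ‖k‖ ^ 2) = ‖ξ‖ - inner ℝ ξ k := by
    rw [hβ]; field_simp
  have hβ2 : ‖ξ‖ ≤ 2 * β := by
    nlinarith [norm_nonneg ξ, norm_nonneg k, sq_nonneg ‖k‖, h1.2]
  have hsq : ‖freqMap k ξ‖ ^ 2 = (-‖ξ‖ + 2 * β) ^ 2 := by
    rw [freqMap, ← hβ, norm_add_sq_real, norm_neg, inner_neg_left, inner_smul_right, norm_smul,
      mul_pow, Real.norm_eq_abs, sq_abs]
    linear_combination (4 * β) * (-hb)
  exact (sq_eq_sq₀ (norm_nonneg _) (by linarith)).1 hsq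

lemma freqMap_freqMap (hk : ‖k‖ ≤ 1 / 4) (ξ : E n) : freqMap k (freqMap k ξ) = ξ := by
  have h0 := one_sub_norm_sq_pos hk
  have hN := norm_freqMap hk ξ
  set β := (‖ξ‖ - inner ℝ ξ k) / (1 - ‖k‖ ^ 2) with hβ
  have hb : β * (1 - ‖k‖ ^ 2) = ‖ξ‖ - inner ℝ ξ k := by
    rw [hβ]; field_simp
  have hi : inner ℝ (freqMap k ξ) k = -inner ℝ ξ k + 2 * β * ‖k‖ ^ 2 := by
    rw [freqMap, ← hβ, inner_add_left, inner_neg_left, real_inner_smul_left,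
      real_inner_self_eq_norm_sq]
  have h2 : (‖freqMap k ξ‖ - inner ℝ (freqMap k ξ) k) / (1 - ‖k‖ ^ 2) = β := by
    rw [hN, hi, div_eq_iff (by linarith)]; linear_combination hb
  rw [freqMap, h2, freqMap, ← hβ]
  simp

lemma norm_freqMap_sub_le (hk : ‖k‖ ≤ 1 / 4) (ξ η : E n) :
    ‖freqMap k ξ - freqMap k η‖ ≤ 2 * ‖ξ - η‖ := by
  have h0 := one_sub_norm_sq_pos hk
  have h1 : freqMap k ξ - freqMap k η = -(ξ - η) +
      (2 * (((‖ξ‖ - ‖η‖) - inner ℝ (ξ - η) k) / (1 - ‖k‖ ^ 2))) • k := by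
    rw [freqMap, freqMap, inner_sub_left, add_sub_add_comm, ← sub_smul]
    congr 1
    · abel
    · congr 1; ring
  have h2 := abs_inner_le_quarter hk (ξ - η)
  have h3 : |(‖ξ‖ - ‖η‖) - inner ℝ (ξ - η) k| ≤ 5 / 4 * ‖ξ - η‖ := by
    have := abs_norm_sub_norm_le ξ η
    rw [abs_le] at this h2 ⊢
    constructor <;> linarith [this.1, this.2, h2.1, h2.2]
  rw [h1]
  refine (norm_add_le _ _).trans ?_
  rw [norm_neg, norm_smul, Real.norm_eq_abs, abs_mul, abs_div, abs_of_pos (by linarith :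
    0 < 1 - ‖k‖ ^ 2), abs_two]
  have h4 : |(‖ξ‖ - ‖η‖) - inner ℝ (ξ - η) k| / (1 - ‖k‖ ^ 2) ≤ 4 / 3 * ‖ξ - η‖ := by
    rw [div_le_iff₀ (by linarith)]
    nlinarith [norm_nonneg (ξ - η)]
  have h5 : 2 * (|(‖ξ‖ - ‖η‖) - inner ℝ (ξ - η) k| / (1 - ‖k‖ ^ 2)) * ‖k‖ ≤
      2 * (4 / 3 * ‖ξ - η‖) * (1 / 4) := by gcongr
  linarith [norm_nonneg (ξ - η)]

lemma lipschitzWith_freqMap (hk : ‖k‖ ≤ 1 / 4) : LipschitzWith 2 (freqMap k) :=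
  LipschitzWith.of_dist_le_mul fun ξ η => by
    rw [dist_eq_norm, dist_eq_norm]; exact norm_freqMap_sub_le hk ξ η

lemma norm_freqMap_le (hk : ‖k‖ ≤ 1 / 4) (ξ : E n) : ‖freqMap k ξ‖ ≤ 2 * ‖ξ‖ := by
  have h := norm_freqMap_sub_le hk ξ 0
  simpa [freqMap] using h

lemma norm_le_two_mul_freqMap (hk : ‖k‖ ≤ 1 / 4) (ξ : E n) : ‖ξ‖ ≤ 2 * ‖freqMap k ξ‖ := by
  have h := norm_freqMap_le hk (freqMap k ξ)
  rwa [freqMap_freqMap hk] at h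

/-- `lorentz k` fixes the vector `(-k, 1)` and negates its Minkowski-orthogonal complement; the
functional here is the Minkowski pairing with this vector up to sign, hence invariant. The
involution property follows. -/
lemma lorentz_inner (hk : ‖k‖ ≤ 1 / 4) (z : E (n + 1)) :
    inner ℝ (spacePart (lorentz k z)) k + timePart (lorentz k z) =
      inner ℝ (spacePart z) k + timePart z := by
  have h0 := one_sub_norm_sq_pos hk
  have h1 : 2 / (1 - ‖k‖ ^ 2) * (1 - ‖k‖ ^ 2) = 2 := by field_simp
  simp only [lorentz, spacePart_mkPt, timePart_mkPt, inner_neg_left, inner_add_left,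
    real_inner_smul_left, real_inner_self_eq_norm_sq]
  linear_combination (inner ℝ (spacePart z) k + timePart z) * h1

lemma lorentz_lorentz (hk : ‖k‖ ≤ 1 / 4) (z : E (n + 1)) : lorentz k (lorentz k z) = z := by
  have h := lorentz_inner hk z
  refine ext_space_time ?_ ?_
  · rw [lorentz, spacePart_mkPt, h]
    simp [lorentz]
  · rw [lorentz, timePart_mkPt, h]
    simp [lorentz]

/-- The reflection in space-time and the map of frequencies are adjoint on the cone, so phases of
waves are preserved under the simultaneous change of variables. -/
lemma inner_lorentz_coneLift (hk : ‖k‖ ≤ 1 / 4) (z : E (n + 1)) (ξ : E n) :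
    inner ℝ (lorentz k z) (coneLift (freqMap k ξ)) = inner ℝ z (coneLift ξ) := by
  have h0 := one_sub_norm_sq_pos hk
  rw [inner_coneLift, inner_coneLift, norm_freqMap hk]
  set β := (‖ξ‖ - inner ℝ ξ k) / (1 - ‖k‖ ^ 2) with hβ
  have hb : β * (1 - ‖k‖ ^ 2) = ‖ξ‖ - inner ℝ ξ k := by
    rw [hβ]; field_simp
  have h1 : 2 / (1 - ‖k‖ ^ 2) * (1 - ‖k‖ ^ 2) = 2 := by field_simp
  simp only [lorentz, freqMap, ← hβ, spacePart_mkPt, timePart_mkPt, inner_neg_left, inner_add_left,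
    real_inner_smul_left, inner_add_right, inner_neg_right, inner_smul_right,
    real_inner_self_eq_norm_sq, real_inner_comm ξ k] at hb ⊢
  set κ := 2 / (1 - ‖k‖ ^ 2)
  set σ := inner ℝ (spacePart z) k + timePart z with hσ
  clear_value β κ σ
  linear_combination (β * σ) * h1 + κ * σ * hb + 2 * β * hσ

lemma norm_spacePart_lorentz_le (hk : ‖k‖ ≤ 1 / 4) (z : E (n + 1)) :
    ‖spacePart (lorentz k z)‖ ≤ 2 * ‖z‖ ∧ |timePart (lorentz k z)| ≤ 4 * ‖z‖ := by
  have h0 := one_sub_norm_sq_pos hk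
  have hx := norm_spacePart_le z
  have ht := abs_timePart_le z
  have h1 : |inner ℝ (spacePart z) k + timePart z| ≤ 5 / 4 * ‖z‖ := by
    have := abs_inner_le_quarter hk (spacePart z)
    exact (abs_add_le _ _).trans (by linarith)
  have h2 : |2 / (1 - ‖k‖ ^ 2) * (inner ℝ (spacePart z) k + timePart z)| ≤ 8 / 3 * ‖z‖ := by
    rw [abs_mul, abs_of_pos (by positivity), div_mul_eq_mul_div, div_le_iff₀ (by linarith)]
    nlinarith [norm_nonneg z]
  simp only [lorentz, spacePart_mkPt, timePart_mkPt]
  constructor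
  · rw [norm_neg]
    refine (norm_add_le _ _).trans ?_
    rw [norm_smul, Real.norm_eq_abs]
    nlinarith [norm_nonneg k, norm_nonneg z]
  · refine (abs_add_le _ _).trans ?_
    rw [abs_neg]; linarith [norm_nonneg z]

lemma continuous_lorentz (k : E n) : Continuous (lorentz k) := by
  unfold lorentz
  exact continuous_mkPt.comp (f := fun z : E (n + 1) =>
    (-(spacePart z + (2 / (1 - ‖k‖ ^ 2) * (inner ℝ (spacePart z) k + timePart z)) • k),
    -timePart z + 2 / (1 - ‖k‖ ^ 2) * (inner ℝ (spacePart z) k + timePart z)))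
    (by have := continuous_timePart (n := n); fun_prop)

end

/-! ### Generic projections of space-time measures -/

lemma rpow_le_two_rpow_mul {a b e M : ℝ} (ha : 0 < a) (hb : 0 < b) (hab : a ≤ 2 * b)
    (hba : b ≤ 2 * a) (he : |e| ≤ M) : a ^ e ≤ 2 ^ M * b ^ e := by
  have h2 : (2 : ℝ) ^ |e| ≤ 2 ^ M := Real.rpow_le_rpow_of_exponent_le (by norm_num) he
  rcases le_total 0 e with h | h
  · rw [abs_of_nonneg h] at h2
    calc a ^ e ≤ (2 * b) ^ e := Real.rpow_le_rpow ha.le hab h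
      _ = 2 ^ e * b ^ e := Real.mul_rpow (by norm_num) hb.le
      _ ≤ _ := by gcongr
  · rw [abs_of_nonpos h] at h2
    calc a ^ e ≤ (b / 2) ^ e := Real.rpow_le_rpow_of_nonpos (by positivity) (by linarith) h
      _ = 2 ^ (-e) * b ^ e := by
        rw [Real.div_rpow hb.le (by norm_num), Real.rpow_neg (by norm_num)]; field_simp
      _ ≤ _ := by gcongr

/-- The marginal of a ball on the line through `ω` has bounded density. Instead of rotating
coordinates, average over the translates by `s ω` with `|s| ≤ 2c`. The translated balls stay in the
ball of radius `3c`, and for fixed `v` the integral in `s` is a one-dimensional integral of `G`. The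
factor `4c` is the length of the interval of translates. -/
lemma lintegral_ball_inner_le {n : ℕ} {c : ℝ} {ω : E n} (hω : ‖ω‖ = 1)
    {G : ℝ → ℝ≥0∞} (hG : Measurable G) :
    ENNReal.ofReal (4 * c) * ∫⁻ v in Metric.ball (0 : E n) c, G (inner ℝ v ω) ≤
      volume (Metric.ball (0 : E n) (3 * c)) * ∫⁻ s in Icc (-c) c, G s := by
  set B := Metric.ball (0 : E n) c with hB
  set F : E n → ℝ≥0∞ := fun v => B.indicator (fun v => G (inner ℝ v ω)) v with hF
  have hFm : Measurable F :=
    (hG.comp (by fun_prop : Measurable fun v : E n => inner ℝ v ω)).indicator measurableSet_ball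
  have h1 : ∀ s : ℝ, ∫⁻ v in B, G (inner ℝ v ω) = ∫⁻ v, F (v + s • ω) := by
    intro s
    rw [lintegral_add_right_eq_self F, lintegral_indicator measurableSet_ball]
  have h2 : ENNReal.ofReal (4 * c) * ∫⁻ v in B, G (inner ℝ v ω) =
      ∫⁻ s in Icc (-(2 * c)) (2 * c), ∫⁻ v, F (v + s • ω) := by
    rw [← lintegral_congr fun s => h1 s, setLIntegral_const, Real.volume_Icc, mul_comm]
    congr 2; ring
  rw [h2, lintegral_lintegral_swap]
  swap
  · exact (hFm.comp (by fun_prop : Measurable fun p : ℝ × E n => p.2 + p.1 • ω)).aemeasurable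
  calc ∫⁻ v, ∫⁻ s in Icc (-(2 * c)) (2 * c), F (v + s • ω)
      ≤ ∫⁻ v, (Metric.ball (0 : E n) (3 * c)).indicator (fun _ => ∫⁻ s in Icc (-c) c, G s) v := by
        refine lintegral_mono fun v => ?_
        have h3 : ∀ s, F (v + s • ω) ≤ (Icc (-c) c).indicator G (s + inner ℝ v ω) := by
          intro s
          by_cases hs : v + s • ω ∈ B
          · have h4 : inner ℝ (v + s • ω) ω = s + inner ℝ v ω := by
              rw [inner_add_left, real_inner_smul_left, real_inner_self_eq_norm_sq, hω]; ring
            have h5 : s + inner ℝ v ω ∈ Icc (-c) c := by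
              rw [← h4, mem_Icc, ← abs_le]
              have := abs_real_inner_le_norm (v + s • ω) ω
              rw [hω, mul_one] at this
              exact this.trans (mem_ball_zero_iff.1 hs).le
            simp only [hF]
            rw [indicator_of_mem hs, indicator_of_mem h5, h4]
          · simp only [hF]
            rw [indicator_of_notMem hs]; exact zero_le
        by_cases hv : v ∈ Metric.ball (0 : E n) (3 * c)
        · rw [indicator_of_mem hv]
          calc _ ≤ ∫⁻ s, (Icc (-c) c).indicator G (s + inner ℝ v ω) :=
                (lintegral_mono h3).trans (setLIntegral_le_lintegral _ _)
            _ = _ := by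
              rw [lintegral_add_right_eq_self, lintegral_indicator measurableSet_Icc]
        · rw [indicator_of_notMem hv]
          refine le_of_eq ((setLIntegral_congr_fun measurableSet_Icc fun s hs => ?_).trans
            lintegral_zero)
          simp only [hF]
          refine indicator_of_notMem (fun hc' => hv ?_) _
          rw [mem_ball_zero_iff] at hc' ⊢
          have h6 : ‖v‖ ≤ ‖v + s • ω‖ + ‖s • ω‖ := by
            simpa using norm_sub_le (v + s • ω) (s • ω)
          rw [norm_smul, hω, mul_one, Real.norm_eq_abs] at h6
          have := abs_le.2 hs
          linarith
    _ = _ := by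
      rw [lintegral_indicator measurableSet_ball, setLIntegral_const, mul_comm]

/-- The energy of the restriction of `ν̂` to the hyperplane `τ = ⟨v, ξ⟩`. -/
def planeEnergy {n : ℕ} (α : ℝ) (ν : Measure (E (n + 1))) (v : E n) : ℝ≥0∞ :=
  ∫⁻ ξ, ‖charFun ν (mkPt ξ (inner ℝ v ξ))‖ₑ ^ 2 * ENNReal.ofReal (‖ξ‖ ^ (α - (n : ℝ)))

lemma lintegral_comp_mul_pos {a : ℝ} (ha : 0 < a) (f : ℝ → ℝ≥0∞) (hf : Measurable f) :
    ENNReal.ofReal a * ∫⁻ s, f (a * s) = ∫⁻ s, f s := by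
  rw [← lintegral_map hf (measurable_const_mul a), ← abs_of_pos ha]
  nth_rw 2 [← Real.smul_map_volume_mul_left ha.ne']
  rw [lintegral_smul_measure, abs_of_pos ha, smul_eq_mul]

lemma measurable_planeEnergy_integrand {n : ℕ} (α : ℝ) (ν : Measure (E (n + 1)))
    [IsFiniteMeasure ν] : Measurable fun p : E n × E n =>
      ‖charFun ν (mkPt p.2 (inner ℝ p.1 p.2))‖ₑ ^ 2 * ENNReal.ofReal (‖p.2‖ ^ (α - (n : ℝ))) := by
  refine Measurable.mul (f := fun p : E n × E n => ‖charFun ν (mkPt p.2 (inner ℝ p.1 p.2))‖ₑ ^ 2)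
    ?_ (by fun_prop)
  refine (measurable_enorm_charFun_sq ν).comp (g := fun z => ‖charFun ν z‖ₑ ^ 2)
    (f := fun p : E n × E n => mkPt p.2 (inner ℝ p.1 p.2)) (Continuous.measurable ?_)
  exact continuous_mkPt.comp (f := fun p : E n × E n => (p.2, inner ℝ p.1 p.2)) (by fun_prop)

/-- For fixed `ξ` the value `τ = ⟨v, ξ⟩` sweeps `|τ| ≤ |ξ|/4` with density `≲ 1/|ξ|`, and there
`|(ξ,τ)|` is comparable to `|ξ|`. So the weight `|ξ|^(α-n)` becomes `|(ξ,τ)|^(α-n-1)`, the one of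
the energy in dimension `n + 1`. -/
lemma exists_lintegral_planeEnergy_le {n : ℕ} (hn : 1 ≤ n) (α₀ : ℝ) : ∃ K : ℝ≥0, ∀ α : ℝ, 0 < α →
    α ≤ α₀ → ∀ ν : Measure (E (n + 1)), IsFiniteMeasure ν →
      ∫⁻ v in Metric.ball (0 : E n) (1 / 4), planeEnergy α ν v ≤ K * energy α ν := by
  have := nontrivial_E hn
  set V := volume (Metric.ball (0 : E n) (3 * (1 / 4))) with hV
  have hVt : V ≠ ⊤ := measure_ball_lt_top.ne
  -- The comparison of `|ξ|` and `|(ξ,τ)|` up to a factor `2` is raised to the power `α - (n+1)`,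
  -- whose modulus is at most `α₀ + n + 1`.
  set c := ENNReal.ofReal (2 ^ (α₀ + n + 1)) with hc
  refine ⟨(V * c).toNNReal, fun α hα hα₀ ν hν => ?_⟩
  rw [ENNReal.coe_toNNReal (by finiteness)]
  set H : E (n + 1) → ℝ≥0∞ := fun z => ‖charFun ν z‖ₑ ^ 2 with hH
  have hHm : Measurable H := measurable_enorm_charFun_sq ν
  have hmk : Measurable fun p : E n × ℝ => mkPt p.1 p.2 := continuous_mkPt.measurable
  unfold planeEnergy
  rw [lintegral_lintegral_swap (measurable_planeEnergy_integrand α ν).aemeasurable]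
  have key : ∀ ξ : E n, ξ ≠ 0 → ∫⁻ v in Metric.ball (0 : E n) (1 / 4),
      H (mkPt ξ (inner ℝ v ξ)) * ENNReal.ofReal (‖ξ‖ ^ (α - (n : ℝ))) ≤
      V * (c * ∫⁻ t : ℝ, H (mkPt ξ t) *
        ENNReal.ofReal (‖(mkPt ξ t : E (n + 1))‖ ^ (α - ((n + 1 : ℕ) : ℝ)))) := by
    intro ξ hξ
    have hξ0 : 0 < ‖ξ‖ := norm_pos_iff.2 hξ
    set G : ℝ → ℝ≥0∞ := fun s => H (mkPt ξ (‖ξ‖ * s)) with hG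
    have hGm : Measurable G := hHm.comp (hmk.comp (by fun_prop : Measurable fun s : ℝ => (ξ, ‖ξ‖ * s)))
    have h1 := lintegral_ball_inner_le (c := 1 / 4) (ω := ‖ξ‖⁻¹ • ξ)
      (by rw [norm_smul, norm_inv, norm_norm, inv_mul_cancel₀ hξ0.ne']) hGm
    have h2 : ∀ v : E n, G (inner ℝ v (‖ξ‖⁻¹ • ξ)) = H (mkPt ξ (inner ℝ v ξ)) := by
      intro v
      simp only [hG, inner_smul_right]
      rw [mul_inv_cancel_left₀ hξ0.ne']
    simp_rw [h2] at h1
    rw [show (4 * (1 / 4) : ℝ) = 1 by norm_num, ENNReal.ofReal_one, one_mul] at h1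
    rw [lintegral_mul_const' _ _ ENNReal.ofReal_ne_top]
    refine (mul_le_mul_left h1 _).trans ?_
    rw [mul_assoc]
    refine mul_le_mul_right ?_ _
    have hm1 : Measurable fun t : ℝ => H (mkPt ξ t) :=
      hHm.comp (hmk.comp (by fun_prop : Measurable fun s : ℝ => (ξ, s)))
    have h3 : ∫⁻ s in Icc (-(1 / 4)) (1 / 4), G s =
        ENNReal.ofReal ‖ξ‖⁻¹ * ∫⁻ t in Icc (-(‖ξ‖ / 4)) (‖ξ‖ / 4), H (mkPt ξ t) := by
      rw [← lintegral_indicator measurableSet_Icc, ← lintegral_indicator measurableSet_Icc,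
        ← lintegral_comp_mul_pos hξ0 _ (hm1.indicator measurableSet_Icc), ← mul_assoc,
        ← ENNReal.ofReal_mul (by positivity), inv_mul_cancel₀ hξ0.ne', ENNReal.ofReal_one, one_mul]
      refine lintegral_congr fun s => ?_
      have hiff : s ∈ Icc (-(1 / 4) : ℝ) (1 / 4) ↔ ‖ξ‖ * s ∈ Icc (-(‖ξ‖ / 4)) (‖ξ‖ / 4) := by
        rw [mem_Icc, mem_Icc]
        constructor
        · rintro ⟨h, h'⟩; constructor <;> nlinarith
        · rintro ⟨h, h'⟩; constructor <;> nlinarith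
      by_cases hs : s ∈ Icc (-(1 / 4) : ℝ) (1 / 4)
      · rw [indicator_of_mem hs, indicator_of_mem (hiff.1 hs)]
      · rw [indicator_of_notMem hs, indicator_of_notMem (fun h => hs (hiff.2 h))]
    rw [h3, mul_right_comm, ← ENNReal.ofReal_mul (by positivity), ← lintegral_const_mul' _ _
      ENNReal.ofReal_ne_top, ← lintegral_const_mul' _ _ ENNReal.ofReal_ne_top]
    refine (setLIntegral_mono' measurableSet_Icc fun t ht => ?_).trans
      (setLIntegral_le_lintegral _ _)
    rw [mul_comm (H _), ← mul_assoc, ← ENNReal.ofReal_mul (by positivity)]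
    refine mul_le_mul_left (ENNReal.ofReal_le_ofReal ?_) _
    have ht' : |t| ≤ ‖ξ‖ / 4 := abs_le.2 ht
    have hN := norm_sq_eq_space_time (mkPt ξ t)
    rw [spacePart_mkPt, timePart_mkPt] at hN
    have hle : ‖ξ‖ ≤ ‖(mkPt ξ t : E (n + 1))‖ := by
      have := norm_spacePart_le (mkPt ξ t); rwa [spacePart_mkPt] at this
    have hle2 : ‖(mkPt ξ t : E (n + 1))‖ ≤ 2 * ‖ξ‖ := by
      refine abs_le_of_sq_le_sq' ?_ (by positivity) |>.2
      rw [hN]; nlinarith [sq_abs t, abs_nonneg t]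
    have he : ‖ξ‖⁻¹ * ‖ξ‖ ^ (α - (n : ℝ)) = ‖ξ‖ ^ (α - ((n + 1 : ℕ) : ℝ)) := by
      rw [mul_comm, ← Real.rpow_neg_one ‖ξ‖, ← Real.rpow_add hξ0]; congr 1; push_cast; ring
    rw [he]
    refine rpow_le_two_rpow_mul hξ0 (hξ0.trans_le hle) (by linarith [norm_nonneg ξ]) hle2 ?_
    rw [abs_le]; push_cast
    constructor <;> linarith
  have hae : ∀ᵐ ξ : E n, ξ ≠ 0 := measure_eq_zero_iff_ae_notMem.1 (measure_singleton (0 : E n))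
  refine (lintegral_mono_ae (hae.mono fun ξ hξ => key ξ hξ)).trans (le_of_eq ?_)
  rw [lintegral_const_mul' _ _ hVt, lintegral_const_mul' _ _ ENNReal.ofReal_ne_top, energy_eq,
    lintegral_space_time (fun z => ‖charFun ν z‖ₑ ^ 2 * ENNReal.ofReal (‖z‖ ^ (α - ((n + 1 : ℕ) : ℝ))))
      ((measurable_enorm_charFun_sq ν).mul (by fun_prop)), mul_assoc]

/-- The transpose of the reflected projection sends `ζ` to minus a point of the hyperplane `τ = ⟨v,
ξ⟩` with `v = 2k/(1+|k|²)`, where `ξ` is the image of `ζ` under a shear in the direction `k`. -/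
lemma charFun_map_lorentz {n : ℕ} {k : E n} (hk : ‖k‖ ≤ 1 / 4) (ν : Measure (E (n + 1)))
    [IsFiniteMeasure ν] (ζ : E n) :
    charFun (ν.map fun z => spacePart (lorentz k z)) ζ =
      charFun ν (-mkPt (ζ + (2 / (1 - ‖k‖ ^ 2) * inner ℝ k ζ) • k)
        (inner ℝ ((2 / (1 + ‖k‖ ^ 2)) • k) (ζ + (2 / (1 - ‖k‖ ^ 2) * inner ℝ k ζ) • k))) := by
  have h0 := one_sub_norm_sq_pos hk
  have hm : Measurable fun z : E (n + 1) => spacePart (lorentz k z) :=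
    (continuous_spacePart.comp (continuous_lorentz k)).measurable
  rw [charFun_apply, charFun_apply, integral_map hm.aemeasurable (by fun_prop)]
  congr 1; ext z
  congr 3
  have h1 : inner ℝ ((2 / (1 + ‖k‖ ^ 2)) • k) (ζ + (2 / (1 - ‖k‖ ^ 2) * inner ℝ k ζ) • k) =
      2 / (1 - ‖k‖ ^ 2) * inner ℝ k ζ := by
    rw [real_inner_smul_left, inner_add_right, inner_smul_right, real_inner_self_eq_norm_sq]
    have : 1 - ‖k‖ ^ 2 ≠ 0 := by linarith
    field_simp; ring
  rw [h1, inner_neg_right, inner_eq_space_time]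
  simp only [lorentz, spacePart_mkPt, timePart_mkPt, inner_neg_left, inner_add_left,
    inner_add_right, inner_smul_right, real_inner_smul_left]
  ring

lemma norm_shear_le {n : ℕ} {k : E n} {κ b : ℝ} (hκ : κ * ‖k‖ ^ 2 ≤ 1) (hb : 0 ≤ b)
    (hbκ : b ≤ κ) (x : E n) : ‖(b * inner ℝ k x) • k‖ ≤ ‖x‖ := by
  rw [norm_smul, norm_mul, Real.norm_of_nonneg hb, Real.norm_eq_abs]
  have h1 := abs_real_inner_le_norm k x
  have hκ0 : 0 ≤ κ := hb.trans hbκ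
  calc b * |inner ℝ k x| * ‖k‖ ≤ κ * (‖k‖ * ‖x‖) * ‖k‖ := by gcongr
    _ = (κ * ‖k‖ ^ 2) * ‖x‖ := by ring
    _ ≤ 1 * ‖x‖ := by gcongr
    _ = ‖x‖ := one_mul _

/-- The shear is a rank-one perturbation of the identity with an explicit inverse of the same form,
of Lipschitz constant at most `2`. -/
lemma lintegral_comp_shear_le {n : ℕ} {k : E n} {κ : ℝ} (hκ0 : 0 ≤ κ) (hκ : κ * ‖k‖ ^ 2 ≤ 1)
    (F : E n → ℝ≥0∞) (hF : Measurable F) :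
    ∫⁻ ζ, F (ζ + (κ * inner ℝ k ζ) • k) ≤ 2 ^ n * ∫⁻ ζ, F ζ := by
  have hS : LipschitzWith 2 fun ζ : E n => ζ - (κ / (1 + κ * ‖k‖ ^ 2) * inner ℝ k ζ) • k :=
    LipschitzWith.of_dist_le_mul fun x y => by
    rw [dist_eq_norm, dist_eq_norm]
    have h1 : x - (κ / (1 + κ * ‖k‖ ^ 2) * inner ℝ k x) • k -
        (y - (κ / (1 + κ * ‖k‖ ^ 2) * inner ℝ k y) • k) =
        (x - y) - (κ / (1 + κ * ‖k‖ ^ 2) * inner ℝ k (x - y)) • k := by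
      simp only [inner_sub_right, mul_sub, sub_smul]; abel
    rw [h1]
    refine (norm_sub_le _ _).trans ?_
    have := norm_shear_le hκ (b := κ / (1 + κ * ‖k‖ ^ 2)) (by positivity)
      (div_le_self hκ0 (by nlinarith [sq_nonneg ‖k‖])) (x - y)
    push_cast; linarith
  refine (lintegral_comp_le_of_lipschitz (T := fun ζ : E n => ζ + (κ * inner ℝ k ζ) • k)
    (by fun_prop) hS (fun x => ?_) F hF).trans (by norm_num)
  simp only [inner_add_right, inner_smul_right, real_inner_self_eq_norm_sq]
  have : κ / (1 + κ * ‖k‖ ^ 2) * (inner ℝ k x + κ * inner ℝ k x * ‖k‖ ^ 2) = κ * inner ℝ k x := by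
    have : 1 + κ * ‖k‖ ^ 2 ≠ 0 := by positivity
    field_simp
  rw [this, add_sub_cancel_right]

lemma norm_le_norm_shear {n : ℕ} {k : E n} {κ : ℝ} (hκ0 : 0 ≤ κ) (ζ : E n) :
    ‖ζ‖ ≤ ‖ζ + (κ * inner ℝ k ζ) • k‖ := by
  refine abs_le_of_sq_le_sq' ?_ (norm_nonneg _) |>.2
  rw [norm_add_sq_real, inner_smul_right, real_inner_comm]
  have : 0 ≤ κ * (inner ℝ ζ k * inner ℝ ζ k) := mul_nonneg hκ0 (mul_self_nonneg _)
  nlinarith [sq_nonneg ‖(κ * inner ℝ ζ k) • k‖]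

lemma energy_lorentz_proj_le {n : ℕ} (hn : 1 ≤ n) {α₀ α : ℝ} (hα : 0 < α) (hα₀ : α ≤ α₀)
    (ν : Measure (E (n + 1))) [IsFiniteMeasure ν] {k v : E n} (hk : ‖k‖ ≤ 1 / 4)
    (hkv : (2 / (1 + ‖k‖ ^ 2)) • k = v) :
    energy α (ν.map fun z => spacePart (lorentz k z)) ≤
      ENNReal.ofReal (2 ^ (α₀ + n)) * (2 ^ n * planeEnergy α ν v) := by
  have := nontrivial_E hn
  have h0 := one_sub_norm_sq_pos hk
  obtain ⟨κ, hκ⟩ : ∃ κ, κ = 2 / (1 - ‖k‖ ^ 2) := ⟨_, rfl⟩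
  have hκ0 : 0 < κ := by rw [hκ]; positivity
  have hκ3 : κ ≤ 32 / 15 := by rw [hκ, div_le_iff₀ (by linarith)]; nlinarith
  have hkk : κ * ‖k‖ ^ 2 ≤ 1 := by nlinarith [norm_nonneg k, sq_nonneg ‖k‖]
  obtain ⟨F, hF⟩ : ∃ F : E n → ℝ≥0∞, F = fun ξ => ‖charFun ν (mkPt ξ (inner ℝ v ξ))‖ₑ ^ 2 *
    ENNReal.ofReal (‖ξ‖ ^ (α - (n : ℝ))) := ⟨_, rfl⟩
  have hFm : Measurable F := by
    rw [hF]
    have h1 : Continuous fun ξ : E n => mkPt ξ (inner ℝ v ξ) :=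
      continuous_mkPt.comp (f := fun ξ : E n => (ξ, inner ℝ v ξ)) (by fun_prop)
    have h2 : Measurable fun ξ : E n => ‖charFun ν (mkPt ξ (inner ℝ v ξ))‖ₑ ^ 2 :=
      (measurable_enorm_charFun_sq ν).comp (g := fun z => ‖charFun ν z‖ₑ ^ 2) h1.measurable
    exact h2.mul (by fun_prop)
  have hae : ∀ᵐ ξ : E n, ξ ≠ 0 := measure_eq_zero_iff_ae_notMem.1 (measure_singleton (0 : E n))
  have hle : ∀ ζ : E n, ζ ≠ 0 → ‖charFun (ν.map fun z => spacePart (lorentz k z)) ζ‖ₑ ^ 2 *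
      ENNReal.ofReal (‖ζ‖ ^ (α - (n : ℝ))) ≤
      ENNReal.ofReal (2 ^ (α₀ + n)) * F (ζ + (κ * inner ℝ k ζ) • k) := by
    intro ζ hζ
    rw [charFun_map_lorentz hk, hkv, charFun_neg, ← hκ, ← ofReal_norm, RCLike.norm_conj,
      ofReal_norm, hF, mul_left_comm, ← ENNReal.ofReal_mul (by positivity)]
    refine mul_le_mul_right (ENNReal.ofReal_le_ofReal ?_) _
    have hζ0 : 0 < ‖ζ‖ := norm_pos_iff.2 hζ
    have hT1 := norm_le_norm_shear (k := k) hκ0.le ζ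
    have hT2 : ‖ζ + (κ * inner ℝ k ζ) • k‖ ≤ 2 * ‖ζ‖ :=
      (norm_add_le _ _).trans (by linarith [norm_shear_le hkk hκ0.le le_rfl ζ])
    refine rpow_le_two_rpow_mul hζ0 (hζ0.trans_le hT1) (by linarith [norm_nonneg ζ]) hT2 ?_
    rw [abs_le]
    constructor <;> linarith
  have hpl : planeEnergy α ν v = ∫⁻ ξ, F ξ := by rw [hF]; rfl
  rw [energy_eq, hpl]
  refine (lintegral_mono_ae (hae.mono hle)).trans ?_
  rw [lintegral_const_mul' _ _ ENNReal.ofReal_ne_top]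
  exact mul_le_mul_right (lintegral_comp_shear_le hκ0.le hkk F hFm) _

/-- By the mean value principle some `v` in the ball has at most average plane energy. It remains to
find the reflection whose projection sees the hyperplane with slope `v`. -/
lemma exists_energy_lorentz_proj_le {n : ℕ} (hn : 1 ≤ n) (α₀ : ℝ) : ∃ K : ℝ≥0, ∀ α : ℝ, 0 < α →
    α ≤ α₀ → ∀ ν : Measure (E (n + 1)), IsFiniteMeasure ν → ∃ k : E n, ‖k‖ ≤ 1 / 4 ∧
      energy α (ν.map fun z => spacePart (lorentz k z)) ≤ K * energy α ν := by
  have := nontrivial_E hn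
  obtain ⟨K, hK⟩ := exists_lintegral_planeEnergy_le hn α₀
  set V := volume (Metric.ball (0 : E n) (1 / 4)) with hV
  have hVt : V ≠ ⊤ := measure_ball_lt_top.ne
  have hV0 : V ≠ 0 := (Metric.measure_ball_pos volume _ (by norm_num)).ne'
  set c := ENNReal.ofReal (2 ^ (α₀ + n)) with hc
  refine ⟨(c * 2 ^ n * (K / V)).toNNReal, fun α hα hα₀ ν hν => ?_⟩
  have hKV : (K : ℝ≥0∞) / V ≠ ⊤ := ENNReal.div_ne_top ENNReal.coe_ne_top hV0
  rw [ENNReal.coe_toNNReal (by finiteness)]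
  obtain ⟨v, hv, hvE⟩ := exists_le_setLAverage hV0 hVt
    (Measurable.lintegral_prod_right' (ν := (volume : Measure (E n)))
      (measurable_planeEnergy_integrand α ν)).aemeasurable
  rw [setLAverage_eq] at hvE
  change planeEnergy α ν v ≤ (∫⁻ v in Metric.ball (0 : E n) (1 / 4), planeEnergy α ν v) / V at hvE
  have hvE2 : planeEnergy α ν v ≤ K / V * energy α ν := by
    refine hvE.trans ((ENNReal.div_le_div_right (hK α hα hα₀ ν hν) V).trans (le_of_eq ?_))
    rw [ENNReal.mul_div_right_comm]
  have hv4 : ‖v‖ < 1 / 4 := mem_ball_zero_iff.1 hv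
  -- the axis of the reflection
  set q := Real.sqrt (1 - ‖v‖ ^ 2) with hq
  have hq2 : q ^ 2 = 1 - ‖v‖ ^ 2 := Real.sq_sqrt (by nlinarith [norm_nonneg v])
  have hq0 : 0 ≤ q := Real.sqrt_nonneg _
  -- A solution of `2k/(1+|k|²) = v` with `|k| ≤ |v|`; it amounts to `(1+q)² + |v|² = 2(1+q)`.
  set k : E n := (1 / (1 + q)) • v with hkdef
  have hkn : ‖k‖ = 1 / (1 + q) * ‖v‖ := by
    rw [hkdef, norm_smul, Real.norm_of_nonneg (by positivity)]
  have hk : ‖k‖ ≤ 1 / 4 := by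
    rw [hkn]
    have : 1 / (1 + q) ≤ 1 := by rw [div_le_one (by positivity)]; linarith
    nlinarith [norm_nonneg v]
  have hkv : (2 / (1 + ‖k‖ ^ 2)) • k = v := by
    rw [hkdef, smul_smul, ← hkdef, hkn]
    have : 2 / (1 + (1 / (1 + q) * ‖v‖) ^ 2) * (1 / (1 + q)) = 1 := by
      have h1 : (1 + q) ^ 2 + ‖v‖ ^ 2 = 2 * (1 + q) := by nlinarith
      have h2 : 0 < 1 + q := by positivity
      have h3 : 1 + (1 / (1 + q) * ‖v‖) ^ 2 = 2 / (1 + q) := by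
        field_simp; linarith
      rw [h3]; field_simp
    rw [this, one_smul]
  refine ⟨k, hk, ?_⟩
  calc _ ≤ _ := energy_lorentz_proj_le hn hα hα₀ ν hk hkv
    _ ≤ c * (2 ^ n * (K / V * energy α ν)) := by gcongr
    _ = _ := by ring

/-! ### From projections to general space-time measures -/

/-- Finite measures on `B(0,1) × (0,1)` whose projection to space is compactly supported. -/
def IsSlabMeasure {n : ℕ} (ν : Measure (E (n + 1))) : Prop :=
  IsFiniteMeasure ν ∧ ∃ S : Set (E n), IsCompact S ∧ S ⊆ Metric.ball 0 1 ∧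
    (∀ᵐ z ∂ν, spacePart z ∈ S) ∧ ∀ᵐ z ∂ν, timePart z ∈ Ioo (0 : ℝ) 1

lemma coneLift_smul {n : ℕ} {r : ℝ} (hr : 0 ≤ r) (ξ : E n) :
    coneLift (r • ξ) = r • coneLift ξ := by
  refine ext_space_time ?_ ?_
  · rw [spacePart_coneLift, spacePart_smul, spacePart_coneLift]
  · rw [timePart_coneLift, timePart_smul, timePart_coneLift, norm_smul, Real.norm_of_nonneg hr]

/-- A translation, a dilation by `4`, the good Lorentz reflection and a time shift move `ν` into a
slab, where the hypothesis applies with energy `≲ I_α(ν)`. Translations only multiply transforms by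
unimodular factors, so on the cone everything reduces to the change of frequencies `ξ ↦ freqMap k
(ξ/4)`. -/
lemma exists_dualBound_local {n : ℕ} (hn : 1 ≤ n) (α₀ : ℝ) : ∃ K : ℝ≥0, ∀ α : ℝ, 0 < α → α ≤ α₀ →
    ∀ m m' : E n → ℝ≥0∞, Measurable m' →
    (∀ k : E n, ‖k‖ ≤ 1 / 4 → ∀ ξ, m ξ ≤ m' (freqMap k ((1 / 4 : ℝ) • ξ))) → ∀ D : ℝ≥0∞,
    (∀ ν' : Measure (E (n + 1)), IsSlabMeasure ν' →
      DualBound m' ν' (D * energy α (ν'.map spacePart) ^ (1 / 2 : ℝ))) →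
    ∀ (ν : Measure (E (n + 1))) (c : E (n + 1)), IsFiniteMeasure ν → (∀ᵐ z ∂ν, ‖z - c‖ ≤ 1 / 64) →
      DualBound m ν (K * D * energy α ν ^ (1 / 2 : ℝ)) := by
  obtain ⟨K₁, hK₁⟩ := exists_energy_lorentz_proj_le hn α₀
  -- The inverse change of frequencies has Lipschitz constant `4 · 2 = 8`. The `+ 1` is there
  -- because the bound obtained for the square is `q`, and `q ≤ (q + 1)²`.
  refine ⟨8 ^ n * K₁ + 1, fun α hα hα₀ m m' hm' hmm D hD ν c hν hc => ?_⟩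
  -- The dilation by `4` compensates the factor `2` by which `freqMap` may enlarge frequencies, so
  -- that the combined map does not increase `|ξ|`; it also decreases the energy, by `4^(-α)`.
  set ν₂ : Measure (E (n + 1)) := (ν.map fun z => z + -c).map fun z => (4 : ℝ) • z with hν₂
  have hν₂f : IsFiniteMeasure ν₂ := inferInstance
  have hE₂ : energy α ν₂ ≤ energy α ν := by
    rw [hν₂, energy_map_smul α _ (by norm_num), energy_map_add]
    refine mul_le_of_le_one_left zero_le ?_
    rw [ENNReal.ofReal_le_one]
    exact Real.rpow_le_one_of_one_le_of_nonpos (by norm_num) (by linarith)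
  obtain ⟨k, hk, hkE⟩ := hK₁ α hα hα₀ ν₂ hν₂f
  -- Centres the times in `(0,1)`: after dilation and reflection they have modulus at most `1/4`.
  set a : E (n + 1) := mkPt 0 (1 / 2) with ha
  have hLm : Measurable (lorentz k) := (continuous_lorentz k).measurable
  have hsp : Measurable (spacePart : E (n + 1) → E n) := continuous_spacePart.measurable
  set M : E (n + 1) → E (n + 1) := fun z => lorentz k ((4 : ℝ) • (z + -c)) + a with hM
  have hMm : Measurable M := (hLm.comp (by fun_prop)).add_const a
  set ν' : Measure (E (n + 1)) := ν.map M with hν'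
  have hν'2 : ν' = ν₂.map fun y => lorentz k y + a := by
    have h4 : Measurable fun z : E (n + 1) => (4 : ℝ) • z := by fun_prop
    rw [hν₂, Measure.map_map (hLm.add_const a) h4,
      Measure.map_map ((hLm.add_const a).comp h4) (by fun_prop)]
    rfl
  have hproj : ν'.map spacePart = ν₂.map fun z => spacePart (lorentz k z) := by
    rw [hν'2, Measure.map_map hsp (hLm.add_const a)]
    congr 1; ext z : 1
    simp [spacePart_add, ha]
  have hslab : IsSlabMeasure ν' := by
    have hz : ∀ᵐ z ∂ν, ‖(4 : ℝ) • (z + -c)‖ ≤ 1 / 16 := by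
      filter_upwards [hc] with z hz
      rw [norm_smul, ← sub_eq_add_neg, Real.norm_of_nonneg (by norm_num)]; linarith
    refine ⟨inferInstance, Metric.closedBall 0 (1 / 8), isCompact_closedBall _ _,
      Metric.closedBall_subset_ball (by norm_num), ?_, ?_⟩
    · rw [hν', ae_map_iff hMm.aemeasurable (hsp measurableSet_closedBall)]
      filter_upwards [hz] with z hz
      rw [mem_closedBall_zero_iff, hM, spacePart_add, ha, spacePart_mkPt, add_zero]
      exact (norm_spacePart_lorentz_le hk _).1.trans (by linarith)
    · rw [hν', ae_map_iff hMm.aemeasurable (continuous_timePart.measurable measurableSet_Ioo)]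
      filter_upwards [hz] with z hz
      rw [hM, timePart_add, ha, timePart_mkPt]
      have := abs_le.1 ((norm_spacePart_lorentz_le hk ((4 : ℝ) • (z + -c))).2)
      constructor <;> linarith [this.1, this.2]
  intro w hw hw1
  set w' : E (n + 1) → ℂ := fun y => w (c + (1 / 4 : ℝ) • lorentz k (y - a)) with hw'
  have hw'm : Measurable w' :=
    hw.comp (((hLm.comp (measurable_id.sub_const a)).const_smul (1 / 4 : ℝ)).const_add c)
  have hw'M : ∀ z, w' (M z) = w z := by
    intro z
    simp only [hw', hM]
    rw [add_sub_cancel_right, lorentz_lorentz hk, smul_smul]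
    norm_num
  have hD' := hD ν' hslab w' hw'm (fun z => hw1 _)
  have hft : ∀ ξ, ‖ft ν w (coneLift ξ)‖ₑ =
      ‖ft ν' w' (coneLift (freqMap k ((1 / 4 : ℝ) • ξ)))‖ₑ := by
    intro ξ
    set η := freqMap k ((1 / 4 : ℝ) • ξ) with hη
    have hphase : ∀ z, inner ℝ z (coneLift ξ) =
        (inner ℝ c (coneLift ξ) - ‖η‖ / 2) + inner ℝ (M z) (coneLift η) := by
      intro z
      rw [hM, inner_add_left, hη, inner_lorentz_coneLift hk, ← hη, ha, inner_coneLift (mkPt _ _),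
        spacePart_mkPt, timePart_mkPt, inner_zero_left, coneLift_smul (by norm_num),
        inner_smul_right, real_inner_smul_left, inner_add_left, inner_neg_left]
      ring
    have h1 : ft ν' w' (coneLift η) =
        ∫ z, Complex.exp ((inner ℝ (M z) (coneLift η) : ℝ) * Complex.I) * w z ∂ν := by
      rw [ft, hν', integral_map hMm.aemeasurable]
      · simp_rw [hw'M]
      · exact ((Continuous.measurable (by fun_prop)).mul hw'm).aestronglyMeasurable
    have h2 : ft ν w (coneLift ξ) =
        Complex.exp ((inner ℝ c (coneLift ξ) - ‖η‖ / 2 : ℝ) * Complex.I) *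
          ft ν' w' (coneLift η) := by
      rw [h1, ft, ← integral_const_mul]
      congr 1; ext z
      rw [hphase z, ← mul_assoc, ← Complex.exp_add]
      congr 2; push_cast; ring
    rw [h2, enorm_mul, ← ofReal_norm, Complex.norm_exp_ofReal_mul_I, ENNReal.ofReal_one, one_mul]
  have hT : Measurable fun ξ : E n => freqMap k ((1 / 4 : ℝ) • ξ) :=
    (lipschitzWith_freqMap hk).continuous.measurable.comp (by fun_prop)
  have hS : LipschitzWith 8 fun ξ : E n => (4 : ℝ) • freqMap k ξ :=
    LipschitzWith.of_dist_le_mul fun x y => by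
      rw [dist_eq_norm, dist_eq_norm, ← smul_sub, norm_smul, Real.norm_of_nonneg (by norm_num)]
      have := norm_freqMap_sub_le hk x y
      push_cast; linarith
  calc ∫⁻ ξ, m ξ * ‖ft ν w (coneLift ξ)‖ₑ ^ 2
      ≤ ∫⁻ ξ, m' (freqMap k ((1 / 4 : ℝ) • ξ)) *
          ‖ft ν' w' (coneLift (freqMap k ((1 / 4 : ℝ) • ξ)))‖ₑ ^ 2 := by
        refine lintegral_mono fun ξ => ?_
        rw [hft]
        gcongr
        exact hmm k hk ξ
    _ ≤ (8 : ℝ≥0) ^ n * ∫⁻ η, m' η * ‖ft ν' w' (coneLift η)‖ₑ ^ 2 := by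
        refine lintegral_comp_le_of_lipschitz hT hS (fun x => ?_)
          (fun η => m' η * ‖ft ν' w' (coneLift η)‖ₑ ^ 2)
          (hm'.mul ((measurable_ft_coneLift ν' hw'm).enorm.pow_const 2))
        rw [freqMap_freqMap hk, smul_smul]; norm_num
    _ ≤ (8 : ℝ≥0) ^ n * (D * energy α (ν'.map spacePart) ^ (1 / 2 : ℝ)) ^ 2 := by gcongr
    _ = (8 : ℝ≥0) ^ n * (D ^ 2 * energy α (ν'.map spacePart)) := by
        rw [mul_pow, ennreal_rpow_half_sq]
    _ ≤ (8 : ℝ≥0) ^ n * (D ^ 2 * (K₁ * energy α ν)) := by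
        rw [hproj]
        gcongr
        exact hkE.trans (by gcongr)
    _ = ((8 ^ n * K₁ : ℝ≥0) : ℝ≥0∞) * (D ^ 2 * energy α ν) := by push_cast; ring
    _ ≤ ((8 ^ n * K₁ + 1 : ℝ≥0) : ℝ≥0∞) ^ 2 * (D ^ 2 * energy α ν) := by
        gcongr
        rw [← ENNReal.coe_pow, ENNReal.coe_le_coe]
        set q := 8 ^ n * K₁
        nlinarith [zero_le (a := q)]
    _ = _ := by rw [mul_pow, mul_pow, ennreal_rpow_half_sq, mul_assoc]

lemma enorm_sum_sq_le {ι : Type*} (t : Finset ι) (f : ι → ℂ) :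
    ‖∑ i ∈ t, f i‖ₑ ^ 2 ≤ t.card * ∑ i ∈ t, ‖f i‖ₑ ^ 2 := by
  have h1 := ENNReal.rpow_sum_le_const_mul_sum_rpow t (fun i => ‖f i‖ₑ) (p := 2) (by norm_num)
  norm_num at h1
  calc _ ≤ (∑ i ∈ t, ‖f i‖ₑ) ^ 2 := by gcongr; exact enorm_sum_le _ _
    _ ≤ _ := h1

/-- Cover the closed unit ball by finitely many small balls and decompose `ν` with bumps `χ_c`. Each
`χ_c ν` is handled by the local result, its energy is controlled by that of `ν`, and the finite sum
is squared by Cauchy-Schwarz. -/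
lemma exists_dualBound_of_slab {n : ℕ} (hn : 1 ≤ n) (α₀ : ℝ) : ∃ K : ℝ≥0, ∀ α : ℝ, 0 < α → α ≤ α₀ →
    ∀ m m' : E n → ℝ≥0∞, Measurable m → Measurable m' →
    (∀ k : E n, ‖k‖ ≤ 1 / 4 → ∀ ξ, m ξ ≤ m' (freqMap k ((1 / 4 : ℝ) • ξ))) → ∀ D : ℝ≥0∞,
    (∀ ν' : Measure (E (n + 1)), IsSlabMeasure ν' →
      DualBound m' ν' (D * energy α (ν'.map spacePart) ^ (1 / 2 : ℝ))) →
    ∀ ν : Measure (E (n + 1)), IsFiniteMeasure ν → (∀ᵐ z ∂ν, ‖z‖ ≤ 1) →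
      DualBound m ν (K * D * energy α ν ^ (1 / 2 : ℝ)) := by
  obtain ⟨K₁, hK₁⟩ := exists_dualBound_local hn α₀
  obtain ⟨t₀, -, ht₀, htc⟩ := (isCompact_closedBall (0 : E (n + 1)) 1).finite_cover_balls
    (e := 1 / 128) (by norm_num)
  set t := ht₀.toFinset with ht
  let χ : (c : E (n + 1)) → ContDiffBump c := fun c => ⟨1 / 128, 1 / 64, by norm_num, by norm_num⟩
  have hχ01 : ∀ c z, 0 ≤ χ c z ∧ χ c z ≤ 1 := fun c z => ⟨(χ c).nonneg, (χ c).le_one⟩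
  have hχm : ∀ c, Measurable (χ c) := fun c => (χ c).continuous.measurable
  choose K₂ hK₂ using fun c : E (n + 1) => exists_energy_withDensity_le (by omega) α₀
    ((χ c).contDiff) (χ c).hasCompactSupport (hχ01 c)
  refine ⟨t.card * ∑ c ∈ t, K₁ ^ 2 * K₂ c + 1, fun α hα hα₀ m m' hm hm' hmm D hD ν hν hν1 => ?_⟩
  intro w hw hw1
  set X : E (n + 1) → ℝ := fun z => ∑ c ∈ t, χ c z with hX
  have hXm : Measurable X := Finset.measurable_sum _ fun c _ => hχm c
  -- The normalization by the sum of the bumps is absorbed into the density, which need only be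
  -- measurable, so energies are needed only for the plain bumps. The maximum with `1` keeps the
  -- quotient bounded everywhere and changes nothing on the support of `ν`.
  set w₀ : E (n + 1) → ℂ := fun z => ((max 1 (X z))⁻¹ : ℝ) * w z with hw₀
  have hw₀m : Measurable w₀ :=
    (Complex.measurable_ofReal.comp (measurable_const.max hXm).inv).mul hw
  have hw₀1 : ∀ z, ‖w₀ z‖ ≤ 1 := by
    intro z
    rw [hw₀, norm_mul, Complex.norm_real, Real.norm_of_nonneg (by positivity)]
    exact mul_le_one₀ (inv_le_one_of_one_le₀ (le_max_left _ _)) (norm_nonneg _) (hw1 z)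
  have hX1 : ∀ᵐ z ∂ν, 1 ≤ X z := by
    filter_upwards [hν1] with z hz
    obtain ⟨c, hct, hcz⟩ := mem_iUnion₂.1 (htc (mem_closedBall_zero_iff.2 hz))
    have h1 : χ c z = 1 := (χ c).one_of_mem_closedBall (Metric.ball_subset_closedBall hcz)
    rw [hX, ← h1]
    exact Finset.single_le_sum (f := fun c => χ c z) (fun i _ => (hχ01 i z).1)
      (ht₀.mem_toFinset.2 hct)
  set νc : E (n + 1) → Measure (E (n + 1)) :=
    fun c => ν.withDensity fun z => ENNReal.ofReal (χ c z) with hνc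
  have hνcf : ∀ c, IsFiniteMeasure (νc c) := fun c => isFiniteMeasure_withDensity_ofReal
    (Integrable.of_bound (hχm c).aestronglyMeasurable 1 (Filter.Eventually.of_forall fun z => by
      rw [Real.norm_of_nonneg (hχ01 c z).1]; exact (hχ01 c z).2)).2
  have hνcs : ∀ c, ∀ᵐ z ∂νc c, ‖z - c‖ ≤ 1 / 64 := by
    intro c
    rw [hνc, ae_withDensity_iff (hχm c).ennreal_ofReal]
    refine Filter.Eventually.of_forall fun z hz => ?_
    by_contra hlt
    refine hz ?_
    rw [(χ c).zero_of_le_dist, ENNReal.ofReal_zero]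
    rw [dist_eq_norm]; exact (not_le.1 hlt).le
  have hft : ∀ ξ, ft ν w ξ = ∑ c ∈ t, ft (νc c) w₀ ξ := by
    intro ξ
    have h1 : ∀ c, ft (νc c) w₀ ξ = ∫ z, (χ c z : ℂ) *
        (Complex.exp ((inner ℝ z ξ : ℝ) * Complex.I) * w₀ z) ∂ν := by
      intro c
      rw [ft, hνc, integral_withDensity_eq_integral_toReal_smul (hχm c).ennreal_ofReal
        (Filter.Eventually.of_forall fun x => ENNReal.ofReal_lt_top)]
      congr 1; ext z
      rw [ENNReal.toReal_ofReal (hχ01 c z).1]; rfl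
    simp_rw [h1]
    rw [← integral_finsetSum]
    · refine integral_congr_ae ?_
      filter_upwards [hX1] with z hz
      rw [← Finset.sum_mul, ← Complex.ofReal_sum]
      change _ = ((X z : ℝ) : ℂ) * _
      rw [hw₀]
      simp only [max_eq_right hz]
      have : (X z : ℂ) ≠ 0 := by
        rw [Complex.ofReal_ne_zero]; linarith
      push_cast
      field_simp
    · intro c _
      refine Integrable.of_bound (C := 1) ?_ (Filter.Eventually.of_forall fun z => ?_)
      · exact ((Complex.measurable_ofReal.comp (hχm c)).mul
          ((Continuous.measurable (by fun_prop)).mul hw₀m)).aestronglyMeasurable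
      · rw [norm_mul, norm_mul, Complex.norm_exp_ofReal_mul_I, one_mul, Complex.norm_real,
          Real.norm_of_nonneg (hχ01 c z).1]
        exact mul_le_one₀ (hχ01 c z).2 (norm_nonneg _) (hw₀1 z)
  calc ∫⁻ ξ, m ξ * ‖ft ν w (coneLift ξ)‖ₑ ^ 2
      ≤ ∫⁻ ξ, t.card * ∑ c ∈ t, m ξ * ‖ft (νc c) w₀ (coneLift ξ)‖ₑ ^ 2 := by
        refine lintegral_mono fun ξ => ?_
        rw [hft, ← Finset.mul_sum, mul_left_comm]
        gcongr
        exact enorm_sum_sq_le t _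
    _ = t.card * ∑ c ∈ t, ∫⁻ ξ, m ξ * ‖ft (νc c) w₀ (coneLift ξ)‖ₑ ^ 2 := by
        rw [lintegral_const_mul' _ _ (by finiteness), lintegral_finsetSum]
        intro c _
        exact hm.mul ((measurable_ft_coneLift _ hw₀m).enorm.pow_const 2)
    _ ≤ t.card * ∑ c ∈ t, (K₁ ^ 2 * K₂ c : ℝ≥0) * (D ^ 2 * energy α ν) := by
        gcongr with c hc
        refine (hK₁ α hα hα₀ m m' hm' hmm D hD (νc c) c (hνcf c) (hνcs c) w₀ hw₀m hw₀1).trans ?_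
        rw [mul_pow, mul_pow, ennreal_rpow_half_sq]
        calc _ ≤ (K₁ : ℝ≥0∞) ^ 2 * D ^ 2 * (K₂ c * energy α ν) := by
              gcongr
              exact hK₂ c α hα hα₀ ν hν hν1
          _ = _ := by push_cast; ring
    _ = ((t.card * ∑ c ∈ t, K₁ ^ 2 * K₂ c : ℝ≥0) : ℝ≥0∞) * (D ^ 2 * energy α ν) := by
        rw [← Finset.sum_mul]; push_cast; ring
    _ ≤ ((t.card * ∑ c ∈ t, K₁ ^ 2 * K₂ c + 1 : ℝ≥0) : ℝ≥0∞) ^ 2 * (D ^ 2 * energy α ν) := by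
        gcongr
        rw [← ENNReal.coe_pow, ENNReal.coe_le_coe]
        set q := t.card * ∑ c ∈ t, K₁ ^ 2 * K₂ c
        nlinarith [zero_le (a := q)]
    _ = _ := by rw [mul_pow, mul_pow, ennreal_rpow_half_sq, mul_assoc]

/-! ### Maximal estimates and slab measures -/

lemma continuous_wave_left {n : ℕ} (g : SchwartzMap (E n) ℂ) (t : ℝ) :
    Continuous fun x => wave g x t := by
  have h : Continuous fun x : E n => mkPt x t :=
    continuous_mkPt.comp (f := fun x : E n => (x, t)) (by fun_prop)
  have := (continuous_wave g).comp h
  simpa [Function.comp_def] using this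

lemma measurable_iSup_wave {n : ℕ} (g : SchwartzMap (E n) ℂ) :
    Measurable fun x => ⨆ t ∈ Ioo (0 : ℝ) 1, ‖wave g x t‖ₑ :=
  (lowerSemicontinuous_biSup fun t _ =>
    (continuous_wave_left g t).enorm.lowerSemicontinuous).measurable

lemma IsSlabMeasure.compactlySupported_map {n : ℕ} {ν : Measure (E (n + 1))}
    (h : IsSlabMeasure ν) : IsCompactlySupportedIn (ν.map spacePart) (Metric.ball 0 1) := by
  obtain ⟨hf, S, hS, hSb, hνS, -⟩ := h
  refine ⟨inferInstance, S, hS, hSb, ?_⟩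
  rw [Measure.map_apply continuous_spacePart.measurable hS.measurableSet.compl]
  exact hνS

lemma IsSlabMeasure.ae_norm_le {n : ℕ} {ν : Measure (E (n + 1))} (h : IsSlabMeasure ν) :
    ∀ᵐ z ∂ν, ‖z‖ ≤ 2 := by
  obtain ⟨hf, S, hS, hSb, hνS, ht⟩ := h
  filter_upwards [hνS, ht] with z hz htz
  have h1 : ‖spacePart z‖ < 1 := mem_ball_zero_iff.1 (hSb hz)
  have h2 := norm_sq_eq_space_time z
  refine abs_le_of_sq_le_sq' ?_ (by norm_num) |>.2
  nlinarith [norm_nonneg (spacePart z), htz.1, htz.2]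

/-- The only way the maximal estimate enters: at almost every point the time is in `(0,1)` and
competes in the supremum. -/
lemma IsSlabMeasure.spaceTimeLHS_le {n : ℕ} {ν : Measure (E (n + 1))} (h : IsSlabMeasure ν)
    (g : SchwartzMap (E n) ℂ) : spaceTimeLHS g ν ≤ maxLHS g (ν.map spacePart) := by
  rw [maxLHS, lintegral_map (measurable_iSup_wave g) continuous_spacePart.measurable, spaceTimeLHS]
  obtain ⟨hf, S, hS, hSb, hνS, ht⟩ := h
  refine lintegral_mono_ae ?_
  filter_upwards [ht] with z hz
  exact le_iSup₂ (f := fun t (_ : t ∈ Ioo (0 : ℝ) 1) => ‖wave g (spacePart z) t‖ₑ) _ hz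

/-- Estimates for slab measures in terms of the energy of the projection. -/
def SlabBound {n : ℕ} (A : Set (E n)) (W : E n → ℝ) (α : ℝ) (D : ℝ≥0∞) : Prop :=
  ∀ ν : Measure (E (n + 1)), IsSlabMeasure ν →
    TestBound A W ν (D * energy α (ν.map spacePart) ^ (1 / 2 : ℝ))

/-- The change of frequencies does not increase `|ξ|`, so nothing is lost when `A` and `W` are
monotone in `|ξ|`. This covers the Sobolev weight on the whole space and the constant weight on
balls; annuli need a separate argument. -/
lemma exists_testBound_of_slabBound_of_le {n : ℕ} (hn : 1 ≤ n) (α₀ : ℝ) : ∃ K : ℝ≥0, ∀ α : ℝ,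
    0 < α → α ≤ α₀ → ∀ (A : Set (E n)) (W : E n → ℝ), IsOpen A → ContDiff ℝ (⊤ : ℕ∞) W →
    (∀ ξ, 0 < W ξ) → (∀ ξ η, ‖η‖ ≤ ‖ξ‖ → ξ ∈ A → η ∈ A ∧ W η ≤ W ξ) →
    ∀ D : ℝ≥0∞, SlabBound A W α D → ∀ ν : Measure (E (n + 1)), IsFiniteMeasure ν →
      (∀ᵐ z ∂ν, ‖z‖ ≤ 1) → TestBound A W ν (K * D * energy α ν ^ (1 / 2 : ℝ)) := by
  obtain ⟨K, hK⟩ := exists_dualBound_of_slab hn α₀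
  refine ⟨K, fun α hα hα₀ A W hA hW hW0 hAW D hD ν hν hν1 => ?_⟩
  have hmeas : Measurable (A.indicator fun ξ => ENNReal.ofReal (W ξ)⁻¹) :=
    (hW.continuous.measurable.inv.ennreal_ofReal).indicator hA.measurableSet
  have h1 := hK α hα hα₀ (A.indicator fun ξ => ENNReal.ofReal (W ξ)⁻¹)
    (A.indicator fun ξ => ENNReal.ofReal (W ξ)⁻¹) hmeas hmeas ?_ (twoPiPow n * D) ?_ ν hν hν1
  · have h2 := h1.testBound hA.measurableSet hW.continuous.measurable hW0
    refine h2.mono (le_of_eq ?_)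
    calc _ = ((twoPiPow n)⁻¹ * twoPiPow n) * (K * D * energy α ν ^ (1 / 2 : ℝ)) := by ring
      _ = _ := by rw [ENNReal.inv_mul_cancel (twoPiPow_ne_zero n) (twoPiPow_ne_top n), one_mul]
  · intro k hk ξ
    by_cases hξ : ξ ∈ A
    · have hle : ‖freqMap k ((1 / 4 : ℝ) • ξ)‖ ≤ ‖ξ‖ := by
        refine (norm_freqMap_le hk _).trans ?_
        rw [norm_smul, Real.norm_of_nonneg (by norm_num)]
        linarith [norm_nonneg ξ]
      obtain ⟨h3, h4⟩ := hAW ξ _ hle hξ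
      rw [indicator_of_mem hξ, indicator_of_mem h3]
      exact ENNReal.ofReal_le_ofReal (inv_anti₀ (hW0 _) h4)
    · rw [indicator_of_notMem hξ]; exact zero_le
  · intro ν' hν'
    have := hν'.1
    refine ((hD ν' hν').dualBound hn hA hW hW0 hν'.ae_norm_le).mono
      (Filter.Eventually.of_forall fun _ => le_rfl) (le_of_eq (by ring))

lemma ae_norm_le_one_of_compactlySupported {d : ℕ} {μ : Measure (E d)}
    (h : IsCompactlySupportedIn μ (Metric.ball 0 1)) : ∀ᵐ z ∂μ, ‖z‖ ≤ 1 := by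
  obtain ⟨-, S, -, hS, h0⟩ := h
  filter_upwards [show ∀ᵐ z ∂μ, z ∈ S from h0] with z hz
  exact (mem_ball_zero_iff.1 (hS hz)).le

lemma contDiff_sobolevWeight {n : ℕ} (s : ℝ) :
    ContDiff ℝ (⊤ : ℕ∞) fun ξ : E n => (1 + ‖ξ‖ ^ 2) ^ s :=
  (contDiff_const.add (contDiff_norm_sq ℝ)).rpow_const_of_ne fun ξ => by positivity

lemma sobolevNorm_eq {n : ℕ} (s : ℝ) (g : SchwartzMap (E n) ℂ) :
    sobolevNorm s g =
      (∫⁻ ξ, ENNReal.ofReal ((1 + ‖ξ‖ ^ 2) ^ s) * ‖fourierHat g ξ‖ₑ ^ 2) ^ (1 / 2 : ℝ) := by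
  rw [sobolevNorm]
  congr 1
  refine lintegral_congr fun ξ => ?_
  rw [ENNReal.ofReal_mul (by positivity), ENNReal.ofReal_pow (norm_nonneg _), ofReal_norm]

lemma eLpNorm_two_eq_fourier {n : ℕ} (g : SchwartzMap (E n) ℂ) :
    eLpNorm g 2 volume = (twoPiPow n)⁻¹ ^ (1 / 2 : ℝ) *
      (∫⁻ ξ, ENNReal.ofReal 1 * ‖fourierHat g ξ‖ₑ ^ 2) ^ (1 / 2 : ℝ) := by
  simp_rw [ENNReal.ofReal_one, one_mul]
  rw [lintegral_enorm_sq_fourierHat, ← ENNReal.mul_rpow_of_nonneg _ _ (by norm_num), ← mul_assoc,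
    eLpNorm_two_eq]
  change _ = ((twoPiPow n)⁻¹ * twoPiPow n * _) ^ _
  rw [ENNReal.inv_mul_cancel (twoPiPow_ne_zero n) (twoPiPow_ne_top n), one_mul]

lemma GlobalMaxEstimate.slabBound {n : ℕ} {α s : ℝ} {C : ℝ≥0} (h : GlobalMaxEstimate n α s C) :
    SlabBound (univ : Set (E n)) (fun ξ => (1 + ‖ξ‖ ^ 2) ^ s) α C := by
  intro ν hν f _
  refine (hν.spaceTimeLHS_le f).trans ((h _ hν.compactlySupported_map f).trans (le_of_eq ?_))
  rw [sobolevNorm_eq]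

lemma MaxEstimateOn.slabBound {n : ℕ} {α s lam : ℝ} {C : ℝ≥0} {A : Set (E n)}
    (h : MaxEstimateOn n α s lam C A) :
    SlabBound A (fun _ => 1) α
      (C * ENNReal.ofReal (lam ^ s) * (twoPiPow n)⁻¹ ^ (1 / 2 : ℝ)) := by
  intro ν hν f hf
  refine (hν.spaceTimeLHS_le f).trans ((h _ hν.compactlySupported_map f hf).trans (le_of_eq ?_))
  rw [eLpNorm_two_eq_fourier]; ring

/-- The transfer from slab measures to general measures, uniformly in `α`, yields the transfer from
the maximal estimates to the space-time estimates. -/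
lemma spaceTime_of_max {n : ℕ} {α : ℝ} {K : ℝ≥0}
    (hK : ∀ (A : Set (E n)) (W : E n → ℝ), IsOpen A → ContDiff ℝ (⊤ : ℕ∞) W →
      (∀ ξ, 0 < W ξ) → (∀ ξ η, ‖η‖ ≤ ‖ξ‖ → ξ ∈ A → η ∈ A ∧ W η ≤ W ξ) →
      ∀ D : ℝ≥0∞, SlabBound A W α D → ∀ ν : Measure (E (n + 1)),
        IsCompactlySupportedIn ν (Metric.ball 0 1) →
          TestBound A W ν (K * D * energy α ν ^ (1 / 2 : ℝ))) {s : ℝ} (hs : 0 ≤ s) (C : ℝ≥0) :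
    (GlobalMaxEstimate n α s C → GlobalSpaceTimeEstimate n α s (K * C)) ∧
      ∀ lam : ℝ, 1 ≤ lam → MaxEstimateOn n α s lam C (Metric.ball 0 lam) →
        SpaceTimeEstimateOn n α s lam (K * C) (Metric.ball 0 lam) := by
  constructor
  · intro h ν hν f
    have h1 := hK univ (fun ξ => (1 + ‖ξ‖ ^ 2) ^ s) isOpen_univ (contDiff_sobolevWeight s)
      (fun ξ => by positivity) (fun ξ η hle _ => ⟨mem_univ _, by gcongr⟩) C h.slabBound ν hν f
      (subset_univ _)
    rw [sobolevNorm_eq]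
    refine h1.trans (le_of_eq ?_)
    push_cast; ring
  · intro lam _ h ν hν f hf
    have h1 := hK (Metric.ball 0 lam) (fun _ => 1) Metric.isOpen_ball contDiff_const
      (fun _ => one_pos) (fun ξ η hle hξ => ⟨?_, le_rfl⟩) _ h.slabBound ν hν f hf
    · refine h1.trans (le_of_eq ?_)
      rw [eLpNorm_two_eq_fourier]
      push_cast; ring
    · rw [mem_ball_zero_iff] at hξ ⊢
      exact hle.trans_lt hξ

/-! ### Decay over annular pieces of the cone -/

/-- The estimate `∫_{R/2 ≤ |ξ| < R} |ν̂(ξ, |ξ|)|² dξ ≤ C R^{2s} I_α(ν)`, uniformly in `R ≥ 1`. -/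
def ConeDecay (n : ℕ) (α s : ℝ) : Prop :=
  ∃ C : ℝ≥0, ∀ R : ℝ, 1 ≤ R → ∀ ν : Measure (E (n + 1)),
    IsCompactlySupportedIn ν (Metric.ball 0 1) →
      ∫⁻ ξ in annulus n R, ‖charFun ν (coneLift ξ)‖ₑ ^ 2 ≤
        C * ENNReal.ofReal (R ^ (2 * s)) * energy α ν

lemma measurableSet_annulus (n : ℕ) (R : ℝ) : MeasurableSet (annulus n R) :=
  measurableSet_ball.diff measurableSet_ball

lemma mem_annulus {n : ℕ} {R : ℝ} {ξ : E n} : ξ ∈ annulus n R ↔ R / 2 ≤ ‖ξ‖ ∧ ‖ξ‖ < R := by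
  rw [annulus, mem_sdiff, mem_ball_zero_iff, mem_ball_zero_iff, not_lt, and_comm]

/-- The open annulus `R / 2 < |ξ| < R`. -/
def openAnnulus (n : ℕ) (R : ℝ) : Set (E n) := Metric.ball 0 R \ Metric.closedBall 0 (R / 2)

lemma mem_openAnnulus {n : ℕ} {R : ℝ} {ξ : E n} :
    ξ ∈ openAnnulus n R ↔ R / 2 < ‖ξ‖ ∧ ‖ξ‖ < R := by
  rw [openAnnulus, mem_sdiff, mem_ball_zero_iff, mem_closedBall_zero_iff, not_le, and_comm]

lemma isOpen_openAnnulus (n : ℕ) (R : ℝ) : IsOpen (openAnnulus n R) :=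
  Metric.isOpen_ball.sdiff Metric.isClosed_closedBall

lemma openAnnulus_subset (n : ℕ) (R : ℝ) : openAnnulus n R ⊆ annulus n R :=
  fun _ hξ => mem_annulus.2 ⟨(mem_openAnnulus.1 hξ).1.le, (mem_openAnnulus.1 hξ).2⟩

lemma ae_norm_ne {n : ℕ} (hn : 1 ≤ n) (r : ℝ) : ∀ᵐ ξ : E n, ‖ξ‖ ≠ r := by
  have := nontrivial_E hn
  have h : volume (Metric.sphere (0 : E n) r) = 0 := Measure.addHaar_sphere volume 0 r
  refine (measure_eq_zero_iff_ae_notMem.1 h).mono fun ξ hξ h' => hξ ?_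
  rw [mem_sphere_zero_iff_norm]; exact h'

/-- Reduction of the dual estimate to positive measures. -/
lemma dualBound_of_le {n : ℕ} {m : E n → ℝ≥0∞} (hm : Measurable m) {ν : Measure (E (n + 1))}
    [IsFiniteMeasure ν] {D : ℝ≥0∞}
    (h : ∀ ν' ≤ ν, ∫⁻ ξ, m ξ * ‖charFun ν' (coneLift ξ)‖ₑ ^ 2 ≤ D ^ 2) : DualBound m ν (4 * D) := by
  intro w hw hw1
  -- Positive and negative parts of the real and imaginary parts of `w`. Each part is at most `1`,
  -- so the four measures are submeasures of `ν`.
  let c : Fin 4 → ℂ := ![1, -1, Complex.I, -Complex.I]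
  let p : Fin 4 → E (n + 1) → ℝ := ![fun z => max (w z).re 0, fun z => max (-(w z).re) 0,
    fun z => max (w z).im 0, fun z => max (-(w z).im) 0]
  have hc : ∀ j, ‖c j‖ = 1 := by intro j; fin_cases j <;> simp [c]
  have hre : Measurable fun z => (w z).re := Complex.measurable_re.comp hw
  have him : Measurable fun z => (w z).im := Complex.measurable_im.comp hw
  have hpm : ∀ j, Measurable (p j) := by
    intro j
    fin_cases j
    · exact hre.max measurable_const
    · exact hre.neg.max measurable_const
    · exact him.max measurable_const
    · exact him.neg.max measurable_const
  have hp0 : ∀ j z, 0 ≤ p j z := by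
    intro j z
    fin_cases j <;> exact le_max_right _ _
  have hp1 : ∀ j z, p j z ≤ 1 := by
    intro j z
    have h1 := abs_le.1 ((Complex.abs_re_le_norm (w z)).trans (hw1 z))
    have h2 := abs_le.1 ((Complex.abs_im_le_norm (w z)).trans (hw1 z))
    fin_cases j
    · exact max_le h1.2 zero_le_one
    · exact max_le (by linarith [h1.1]) zero_le_one
    · exact max_le h2.2 zero_le_one
    · exact max_le (by linarith [h2.1]) zero_le_one
  have hdec : ∀ z, w z = ∑ j, c j * (p j z : ℂ) := by
    intro z
    have h1 : ∀ x : ℝ, max x 0 - max (-x) 0 = x := fun x => by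
      rcases le_total 0 x with hx | hx
      · rw [max_eq_left hx, max_eq_right (by linarith)]; ring
      · rw [max_eq_right hx, max_eq_left (by linarith)]; ring
    rw [Fin.sum_univ_four]
    apply Complex.ext
    · simp only [c, p]
      simp
      linarith [h1 (w z).re]
    · simp only [c, p]
      simp
      linarith [h1 (w z).im]
  set νj : Fin 4 → Measure (E (n + 1)) := fun j => ν.withDensity fun z => ENNReal.ofReal (p j z)
    with hνj
  have hle : ∀ j, νj j ≤ ν := by
    intro j
    conv_rhs => rw [← withDensity_one (μ := ν)]
    exact withDensity_mono (Filter.Eventually.of_forall fun z => ENNReal.ofReal_le_one.2 (hp1 j z))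
  have hfin : ∀ j, IsFiniteMeasure (νj j) := fun j => isFiniteMeasure_of_le ν (hle j)
  have hft : ∀ ξ, ft ν w ξ = ∑ j, c j * charFun (νj j) ξ := by
    intro ξ
    have h1 : ∀ j, charFun (νj j) ξ = ∫ z, (p j z : ℂ) *
        Complex.exp ((inner ℝ z ξ : ℝ) * Complex.I) ∂ν := by
      intro j
      rw [charFun_apply, hνj, integral_withDensity_eq_integral_toReal_smul
        (hpm j).ennreal_ofReal (Filter.Eventually.of_forall fun x => ENNReal.ofReal_lt_top)]
      congr 1; ext z
      rw [ENNReal.toReal_ofReal (hp0 j z)]; rfl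
    simp_rw [h1, ← integral_const_mul]
    rw [← integral_finsetSum]
    · rw [ft]
      congr 1; ext z
      conv_lhs => rw [hdec z]
      rw [Finset.mul_sum]
      refine Finset.sum_congr rfl fun j _ => by ring
    · intro j _
      refine Integrable.of_bound (C := 1) ?_ (Filter.Eventually.of_forall fun z => ?_)
      · exact (measurable_const.mul ((Complex.measurable_ofReal.comp (hpm j)).mul
          (Continuous.measurable (by fun_prop)))).aestronglyMeasurable
      · rw [norm_mul, norm_mul, Complex.norm_exp_ofReal_mul_I, hc, one_mul, mul_one,
          Complex.norm_real, Real.norm_of_nonneg (hp0 j z)]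
        exact hp1 j z
  calc ∫⁻ ξ, m ξ * ‖ft ν w (coneLift ξ)‖ₑ ^ 2
      ≤ ∫⁻ ξ, 4 * ∑ j, m ξ * ‖charFun (νj j) (coneLift ξ)‖ₑ ^ 2 := by
        refine lintegral_mono fun ξ => ?_
        rw [hft, ← Finset.mul_sum, mul_left_comm]
        gcongr
        refine (enorm_sum_sq_le _ _).trans (le_of_eq ?_)
        simp only [Finset.card_univ, Fintype.card_fin, Nat.cast_ofNat]
        congr 1
        refine Finset.sum_congr rfl fun j _ => ?_
        rw [enorm_mul, ← ofReal_norm (c j), hc, ENNReal.ofReal_one, one_mul]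
    _ = 4 * ∑ j, ∫⁻ ξ, m ξ * ‖charFun (νj j) (coneLift ξ)‖ₑ ^ 2 := by
        rw [lintegral_const_mul' _ _ (by norm_num), lintegral_finsetSum]
        intro j _
        exact hm.mul ((measurable_enorm_charFun_sq (νj j)).comp continuous_coneLift.measurable)
    _ ≤ 4 * ∑ _j : Fin 4, D ^ 2 := by gcongr with j _; exact h _ (hle j)
    _ = (4 * D) ^ 2 := by
        simp only [Finset.sum_const, Finset.card_univ, Fintype.card_fin, nsmul_eq_mul]
        push_cast; ring

/-! ### The space-time exponent as an exponent of decay over the cone. -/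

lemma IsCompactlySupportedIn.mono {d : ℕ} {μ μ' : Measure (E d)} {A : Set (E d)}
    (h : IsCompactlySupportedIn μ A) (hle : μ' ≤ μ) : IsCompactlySupportedIn μ' A := by
  obtain ⟨hf, S, hS, hSA, h0⟩ := h
  exact ⟨isFiniteMeasure_of_le μ hle, S, hS, hSA, le_antisymm ((hle _).trans h0.le) zero_le⟩

lemma lintegral_indicator_one_mul {X : Type*} [MeasurableSpace X] (μ : Measure X) {A : Set X}
    (hA : MeasurableSet A) (f : X → ℝ≥0∞) :
    ∫⁻ x, A.indicator (fun _ => 1) x * f x ∂μ = ∫⁻ x in A, f x ∂μ := by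
  rw [← lintegral_indicator hA]
  refine lintegral_congr fun x => ?_
  by_cases hx : x ∈ A
  · rw [indicator_of_mem hx, indicator_of_mem hx, one_mul]
  · rw [indicator_of_notMem hx, indicator_of_notMem hx, zero_mul]

lemma ofReal_rpow_two_mul {R : ℝ} (hR : 0 < R) (s : ℝ) :
    ENNReal.ofReal (R ^ (2 * s)) = ENNReal.ofReal (R ^ s) ^ 2 := by
  rw [← ENNReal.ofReal_pow (by positivity), ← Real.rpow_natCast, ← Real.rpow_mul hR.le]
  congr 2; push_cast; ring

/-- Decay of Fourier transforms over the cone yields dual estimates for complex densities. -/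
lemma ConeDecay.dualBound {n : ℕ} {α s : ℝ} (hα : α ≤ n + 1) (h : ConeDecay n α s) :
    ∃ C : ℝ≥0, ∀ R : ℝ, 1 ≤ R → ∀ ν : Measure (E (n + 1)),
      IsCompactlySupportedIn ν (Metric.ball 0 1) →
        DualBound ((annulus n R).indicator fun _ => 1) ν
          (C * ENNReal.ofReal (R ^ s) * energy α ν ^ (1 / 2 : ℝ)) := by
  obtain ⟨C, hC⟩ := h
  -- `C` bounds the square, and `C ≤ (C + 1)²` avoids a root; the `4` comes from the splitting into
  -- four submeasures. Their energies are at most that of `ν`, which is where `α ≤ n + 1` is used.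
  refine ⟨4 * (C + 1), fun R hR ν hν => ?_⟩
  have hf := hν.1
  have h1 := dualBound_of_le (m := (annulus n R).indicator fun _ => 1) (ν := ν)
    (D := (C + 1) * ENNReal.ofReal (R ^ s) * energy α ν ^ (1 / 2 : ℝ))
    (measurable_const.indicator (measurableSet_annulus n R)) ?_
  · exact h1.mono (Filter.Eventually.of_forall fun _ => le_rfl) (le_of_eq (by push_cast; ring))
  · intro ν' hν'
    rw [lintegral_indicator_one_mul _ (measurableSet_annulus n R)]
    refine (hC R hR ν' (hν.mono hν')).trans ?_
    rw [mul_pow, mul_pow, ennreal_rpow_half_sq, ofReal_rpow_two_mul (by linarith)]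
    gcongr
    · exact_mod_cast (show C ≤ (C + 1) ^ 2 by nlinarith [zero_le (a := C)])
    · exact energy_mono (by omega) (by push_cast; exact hα) hν'

lemma ConeDecay.spaceTimeEstimateOn {n : ℕ} {α s : ℝ} (hα : α ≤ n + 1) (h : ConeDecay n α s) :
    ∃ C : ℝ≥0, ∀ R : ℝ, 1 ≤ R → SpaceTimeEstimateOn n α s R C (annulus n R) := by
  obtain ⟨C, hC⟩ := h.dualBound hα
  refine ⟨((twoPiPow n)⁻¹ ^ (1 / 2 : ℝ) * C).toNNReal, fun R hR ν hν f hf => ?_⟩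
  have hν1 := hν.1
  have h1 := (hC R hR ν hν)
  have h2 : DualBound ((annulus n R).indicator fun ξ => ENNReal.ofReal ((fun _ => (1 : ℝ)) ξ)⁻¹) ν
      (C * ENNReal.ofReal (R ^ s) * energy α ν ^ (1 / 2 : ℝ)) := by simpa using h1
  have h3 := h2.testBound (measurableSet_annulus n R) measurable_const (fun _ => one_pos) f hf
  have ht : (twoPiPow n)⁻¹ ≠ ⊤ := ENNReal.inv_ne_top.2 (twoPiPow_ne_zero n)
  have h4 : (twoPiPow n)⁻¹ = (twoPiPow n)⁻¹ ^ (1 / 2 : ℝ) * (twoPiPow n)⁻¹ ^ (1 / 2 : ℝ) := by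
    rw [← sq, ennreal_rpow_half_sq]
  rw [eLpNorm_two_eq_fourier, ENNReal.coe_toNNReal (ENNReal.mul_ne_top
    (ENNReal.rpow_ne_top_of_nonneg (by norm_num) ht) ENNReal.coe_ne_top)]
  refine h3.trans (le_of_eq ?_)
  nth_rw 1 [h4]
  ring

/-- Converse duality with the density `1`. It requires an open set of frequencies, so the inner
sphere of the annulus, a null set, is discarded. -/
lemma coneDecay_of_spaceTimeEstimateOn {n : ℕ} (hn : 1 ≤ n) {α s : ℝ}
    (h : ∃ C : ℝ≥0, ∀ R : ℝ, 1 ≤ R → SpaceTimeEstimateOn n α s R C (annulus n R)) :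
    ConeDecay n α s := by
  obtain ⟨C, hC⟩ := h
  set c := twoPiPow n * (C * (twoPiPow n)⁻¹ ^ (1 / 2 : ℝ)) with hc
  have ht : (twoPiPow n)⁻¹ ≠ ⊤ := ENNReal.inv_ne_top.2 (twoPiPow_ne_zero n)
  have hct : c ≠ ⊤ := ENNReal.mul_ne_top (twoPiPow_ne_top n) (ENNReal.mul_ne_top
    ENNReal.coe_ne_top (ENNReal.rpow_ne_top_of_nonneg (by norm_num) ht))
  refine ⟨(c ^ 2).toNNReal, fun R hR ν hν => ?_⟩
  have hνf := hν.1
  have h1 : TestBound (openAnnulus n R) (fun _ => 1) ν (C * energy α ν ^ (1 / 2 : ℝ) *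
      ENNReal.ofReal (R ^ s) * (twoPiPow n)⁻¹ ^ (1 / 2 : ℝ)) := by
    intro f hf
    refine (hC R hR ν hν f (hf.trans (openAnnulus_subset n R))).trans (le_of_eq ?_)
    rw [eLpNorm_two_eq_fourier]; ring
  have h2 := (h1.dualBound hn (isOpen_openAnnulus n R) contDiff_const (fun _ => one_pos)
    (ae_norm_le_one_of_compactlySupported hν)) (fun _ => 1) measurable_const (fun _ => by simp)
  simp only [ft_one, inv_one, ENNReal.ofReal_one] at h2
  rw [lintegral_indicator_one_mul _ (isOpen_openAnnulus n R).measurableSet] at h2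
  have h3 : openAnnulus n R =ᵐ[volume] annulus n R := by
    filter_upwards [ae_norm_ne hn (R / 2)] with ξ hξ
    apply propext
    change ξ ∈ openAnnulus n R ↔ ξ ∈ annulus n R
    rw [mem_openAnnulus, mem_annulus]
    exact and_congr_left fun _ => ⟨le_of_lt, fun h => lt_of_le_of_ne h (Ne.symm hξ)⟩
  rw [← setLIntegral_congr h3]
  refine h2.trans (le_of_eq ?_)
  rw [ENNReal.coe_toNNReal (by finiteness), ofReal_rpow_two_mul (by linarith), hc]
  simp only [mul_pow, ennreal_rpow_half_sq]
  ring

lemma sWave_eq {n : ℕ} (hn : 1 ≤ n) {α : ℝ} (hα : α ≤ n + 1) :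
    sWave n α = ⨅ (s : ℝ≥0) (_ : ConeDecay n α s), (s : ℝ≥0∞) := by
  rw [sWave]
  congr 1; ext s
  exact iInf_congr_Prop ⟨coneDecay_of_spaceTimeEstimateOn hn, fun h => h.spaceTimeEstimateOn hα⟩
    fun _ => rfl

/-- The substitution `ξ ↦ R ξ` produces the factor `R^(-n)`, so a decay exponent `β` corresponds to
`2s = n - β`. At this stage `s` may be negative. -/
lemma coneDecay_iff_beta {n : ℕ} {α β : ℝ} : (∃ C : ℝ≥0, ∀ R : ℝ, 1 ≤ R →
      ∀ ν : Measure (E (n + 1)), IsCompactlySupportedIn ν (Metric.ball 0 1) →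
        ∫⁻ ξ in annulus n 1, ENNReal.ofReal (‖measureHat ν (R • coneLift ξ)‖ ^ 2) ≤
          C * energy α ν * ENNReal.ofReal (R ^ (-β))) ↔ ConeDecay n α ((n - β) / 2) := by
  have key : ∀ R : ℝ, 1 ≤ R → ∀ ν : Measure (E (n + 1)),
      ∫⁻ ξ in annulus n 1, ENNReal.ofReal (‖measureHat ν (R • coneLift ξ)‖ ^ 2) =
        ENNReal.ofReal (R ^ (-(n : ℝ))) *
          ∫⁻ ξ in annulus n R, ‖charFun ν (coneLift ξ)‖ₑ ^ 2 := by
    intro R hR ν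
    have hR0 : 0 < R := by linarith
    rw [← lintegral_indicator (measurableSet_annulus n 1),
      ← lintegral_indicator (measurableSet_annulus n R), ← lintegral_comp_smul_pos _ hR0]
    refine lintegral_congr fun ξ => ?_
    have hiff : ξ ∈ annulus n 1 ↔ R • ξ ∈ annulus n R := by
      rw [mem_annulus, mem_annulus, norm_smul, Real.norm_of_nonneg hR0.le]
      constructor
      · rintro ⟨h1, h2⟩; constructor <;> nlinarith
      · rintro ⟨h1, h2⟩; constructor <;> nlinarith
    by_cases hξ : ξ ∈ annulus n 1
    · rw [indicator_of_mem hξ, indicator_of_mem (hiff.1 hξ), coneLift_smul hR0.le,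
        norm_measureHat, ENNReal.ofReal_pow (norm_nonneg _), ofReal_norm]
    · rw [indicator_of_notMem hξ, indicator_of_notMem (fun h => hξ (hiff.2 h))]
  have hpow : ∀ R : ℝ, 1 ≤ R → ENNReal.ofReal (R ^ (-(n : ℝ))) *
      ENNReal.ofReal (R ^ (2 * ((n - β) / 2))) = ENNReal.ofReal (R ^ (-β)) := by
    intro R hR
    rw [← ENNReal.ofReal_mul (by positivity), ← Real.rpow_add (by linarith)]
    congr 2; ring
  refine exists_congr fun C => forall₂_congr fun R hR => forall₂_congr fun ν hν => ?_
  rw [key R hR ν, ← hpow R hR]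
  have h0 : ENNReal.ofReal (R ^ (-(n : ℝ))) ≠ 0 := by
    rw [ne_eq, ENNReal.ofReal_eq_zero, not_le]
    have : 0 < R := by linarith
    positivity
  rw [show (C : ℝ≥0∞) * energy α ν * (ENNReal.ofReal (R ^ (-(n : ℝ))) *
      ENNReal.ofReal (R ^ (2 * ((n - β) / 2)))) = ENNReal.ofReal (R ^ (-(n : ℝ))) *
      (C * ENNReal.ofReal (R ^ (2 * ((n - β) / 2))) * energy α ν) by ring]
  exact ENNReal.mul_le_mul_iff_right h0 ENNReal.ofReal_ne_top

/-- The trivial decay estimate. -/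
lemma coneDecay_half {n : ℕ} {α : ℝ} (hα : 0 < α) : ConeDecay n α (n / 2) := by
  obtain ⟨K, hK⟩ := exists_mass_sq_le_energy (n + 1) (by omega) α
  set V : ℝ≥0∞ := volume (Metric.ball (0 : E n) 1) with hV
  have hVt : V ≠ ⊤ := measure_ball_lt_top.ne
  refine ⟨K * V.toNNReal, fun R hR ν hν => ?_⟩
  have hf := hν.1
  calc ∫⁻ ξ in annulus n R, ‖charFun ν (coneLift ξ)‖ₑ ^ 2
      ≤ ∫⁻ _ in annulus n R, ν univ ^ 2 := by
        refine lintegral_mono fun ξ => ?_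
        gcongr
        rw [← ofReal_norm, ← ofReal_measureReal]
        exact ENNReal.ofReal_le_ofReal (norm_charFun_le _)
    _ = ν univ ^ 2 * volume (annulus n R) := by rw [setLIntegral_const]
    _ ≤ (K * energy α ν) * (ENNReal.ofReal (R ^ n) * V) := by
        gcongr
        · exact hK α hα le_rfl ν hf (ae_norm_le_one_of_compactlySupported hν)
        · refine (measure_mono sdiff_subset).trans (le_of_eq ?_)
          rw [Measure.addHaar_ball_of_pos _ _ (by linarith), finrank_euclideanSpace_fin]
    _ = _ := by
        push_cast
        rw [ENNReal.coe_toNNReal hVt, ← Real.rpow_natCast]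
        rw [show (2 * ((n : ℝ) / 2)) = n by ring]
        ring

/-- Modulating Lebesgue measure on a ball moves the peak of its transform to any point of the cone;
the integral over the annulus then stays bounded below while `R^(2s)` would tend to `0`. The dual
bound is used because the modulated measure is complex. This excludes `β > n` and matches the
restriction `s ≥ 0` in the definition of `s_n`. -/
lemma ConeDecay.nonneg {n : ℕ} (hn : 1 ≤ n) {α s : ℝ} (hα0 : 0 < α) (hα : α ≤ n + 1)
    (h : ConeDecay n α s) : 0 ≤ s := by
  obtain ⟨C, hC⟩ := h.dualBound hα
  have := nontrivial_E hn
  set ν : Measure (E (n + 1)) := volume.restrict (Metric.ball 0 (1 / 2)) with hν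
  have hνf : IsFiniteMeasure ν :=
    ⟨by rw [hν, Measure.restrict_apply_univ]; exact measure_ball_lt_top⟩
  have hνM : IsCompactlySupportedIn ν (Metric.ball 0 1) := by
    refine ⟨hνf, Metric.closedBall 0 (1 / 2), isCompact_closedBall _ _,
      Metric.closedBall_subset_ball (by norm_num), ?_⟩
    rw [hν, Measure.restrict_apply measurableSet_closedBall.compl]
    refine measure_mono_null (fun x hx => hx.1 (Metric.ball_subset_closedBall hx.2)) measure_empty
  have hE : energy α ν ≠ ⊤ :=
    (energy_volume_ball_lt_top (d := n + 1) (by omega) hα0 (by push_cast; exact hα) _).ne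
  have hM0 : ν univ ≠ 0 := by
    rw [hν, Measure.restrict_apply_univ]
    exact (Metric.measure_ball_pos volume _ (by norm_num)).ne'
  set V : ℝ≥0∞ := volume (Metric.ball (0 : E n) (1 / 4)) with hV
  have hV0 : V ≠ 0 := (Metric.measure_ball_pos volume _ (by norm_num)).ne'
  obtain ⟨e, he⟩ := exists_norm_eq (E n) zero_le_one
  -- the lower bound by modulation
  have key : ∀ R : ℝ, 1 ≤ R → ν univ ^ 2 * V ≤
      4 * ((C : ℝ≥0∞) ^ 2 * energy α ν) * ENNReal.ofReal (R ^ (2 * s)) := by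
    intro R hR
    -- The middle radius: for every `R ≥ 1` the ball of radius `1/4` about this point lies in the
    -- annulus.
    set ξ₀ : E n := (3 * R / 4) • e with hξ₀
    have hξ₀n : ‖ξ₀‖ = 3 * R / 4 := by
      rw [hξ₀, norm_smul, he, mul_one, Real.norm_of_nonneg (by positivity)]
    set w : E (n + 1) → ℂ := fun z => Complex.exp ((-inner ℝ z (coneLift ξ₀) : ℝ) * Complex.I)
      with hw
    have h1 := hC R hR ν hνM w (Continuous.measurable (by fun_prop))
      (fun z => (Complex.norm_exp_ofReal_mul_I _).le)
    rw [lintegral_indicator_one_mul _ (measurableSet_annulus n R)] at h1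
    have hft : ∀ ξ, ft ν w ξ = charFun ν (ξ - coneLift ξ₀) := by
      intro ξ
      rw [ft, charFun_apply]
      congr 1; ext z
      rw [hw, ← Complex.exp_add, inner_sub_right]
      congr 1; push_cast; ring
    have hsub : Metric.ball ξ₀ (1 / 4) ⊆ annulus n R := by
      intro ξ hξ
      rw [mem_ball_iff_norm] at hξ
      have h2 := abs_le.1 ((abs_norm_sub_norm_le ξ ξ₀).trans hξ.le)
      have h3 := lt_of_le_of_lt (abs_norm_sub_norm_le ξ ξ₀) hξ
      rw [abs_lt, hξ₀n] at h3
      rw [mem_annulus]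
      constructor <;> linarith [h3.1, h3.2]
    have hlow : ∀ ξ ∈ Metric.ball ξ₀ (1 / 4), ν univ ^ 2 ≤ 4 * ‖ft ν w (coneLift ξ)‖ₑ ^ 2 := by
      intro ξ hξ
      rw [mem_ball_iff_norm] at hξ
      have h2 : ‖coneLift ξ - coneLift ξ₀‖ ≤ 1 := by
        have h3 := norm_sq_eq_space_time (coneLift ξ - coneLift ξ₀)
        have h4 : spacePart (coneLift ξ - coneLift ξ₀) = ξ - ξ₀ := by
          rw [sub_eq_add_neg, ← neg_one_smul ℝ, spacePart_add, spacePart_smul]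
          simp [sub_eq_add_neg]
        have h5 : timePart (coneLift ξ - coneLift ξ₀) = ‖ξ‖ - ‖ξ₀‖ := by
          rw [sub_eq_add_neg, ← neg_one_smul ℝ, timePart_add, timePart_smul]
          simp [sub_eq_add_neg]
        rw [h4, h5] at h3
        have h6 := abs_le.1 ((abs_norm_sub_norm_le ξ ξ₀).trans hξ.le)
        refine abs_le_of_sq_le_sq' ?_ zero_le_one |>.2
        rw [h3]
        nlinarith [norm_nonneg (ξ - ξ₀), h6.1, h6.2]
      have h7 := half_mass_le_enorm_charFun ν (ae_norm_le_one_of_compactlySupported hνM)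
        (ξ := coneLift ξ - coneLift ξ₀) (by rw [one_mul]; exact h2)
      rw [hft]
      calc ν univ ^ 2 ≤ (2 * ‖charFun ν (coneLift ξ - coneLift ξ₀)‖ₑ) ^ 2 := by gcongr
        _ = _ := by rw [mul_pow]; norm_num
    calc ν univ ^ 2 * V = ∫⁻ _ in Metric.ball ξ₀ (1 / 4), ν univ ^ 2 := by
          rw [setLIntegral_const, hV, Measure.addHaar_ball_center volume ξ₀]
      _ ≤ ∫⁻ ξ in Metric.ball ξ₀ (1 / 4), 4 * ‖ft ν w (coneLift ξ)‖ₑ ^ 2 :=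
          setLIntegral_mono' measurableSet_ball hlow
      _ ≤ 4 * ∫⁻ ξ in annulus n R, ‖ft ν w (coneLift ξ)‖ₑ ^ 2 := by
          rw [lintegral_const_mul' _ _ (by norm_num)]
          gcongr
      _ ≤ 4 * (C * ENNReal.ofReal (R ^ s) * energy α ν ^ (1 / 2 : ℝ)) ^ 2 := by gcongr
      _ = _ := by
          rw [mul_pow, mul_pow, ennreal_rpow_half_sq, ofReal_rpow_two_mul (by linarith)]; ring
  by_contra hs
  rw [not_le] at hs
  set B : ℝ≥0∞ := 4 * ((C : ℝ≥0∞) ^ 2 * energy α ν) with hB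
  have hBt : B ≠ ⊤ := by finiteness
  have hlim : Filter.Tendsto (fun R : ℝ => B * ENNReal.ofReal (R ^ (2 * s))) Filter.atTop
      (nhds (B * ENNReal.ofReal 0)) := by
    refine ENNReal.Tendsto.const_mul (ENNReal.tendsto_ofReal ?_) (Or.inr hBt)
    have := tendsto_rpow_neg_atTop (show 0 < -(2 * s) by linarith)
    simpa using this
  rw [ENNReal.ofReal_zero, mul_zero] at hlim
  have h0 := ge_of_tendsto hlim (Filter.eventually_ge_atTop (1 : ℝ) |>.mono key)
  exact (mul_ne_zero (pow_ne_zero 2 hM0) hV0) (le_antisymm h0 zero_le)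

/-- Admissible `β` and `s` correspond by `β = n - 2s`. The trivial decay shows `2 s_n ≤ n`, so the
truncated subtraction in `[0, ∞]` is harmless; nonnegativity of decay exponents turns every
admissible `β` into an admissible `s ≥ 0`. -/
lemma betaCone_add_two_mul_sWave {n : ℕ} (hn : 1 ≤ n) {α : ℝ} (hα0 : 0 < α) (hα : α ≤ n + 1) :
    betaCone n α + 2 * sWave n α = n := by
  rw [sWave_eq hn hα]
  set s₀ : ℝ≥0∞ := ⨅ (s : ℝ≥0) (_ : ConeDecay n α s), (s : ℝ≥0∞) with hs₀
  have hhalf : 2 * s₀ ≤ n := by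
    have h1 : s₀ ≤ ((n / 2 : ℝ≥0) : ℝ≥0∞) :=
      iInf₂_le (n / 2 : ℝ≥0) (by simpa using coneDecay_half (n := n) hα0)
    calc 2 * s₀ ≤ 2 * ((n / 2 : ℝ≥0) : ℝ≥0∞) := by gcongr
      _ = ((2 * (n / 2) : ℝ≥0) : ℝ≥0∞) := by push_cast; rfl
      _ = n := by rw [mul_div_cancel₀ _ two_ne_zero]; simp
  refine le_antisymm ?_ ?_
  · have h1 : betaCone n α ≤ n - 2 * s₀ := by
      refine iSup₂_le fun β hβ => ?_
      have h2 : ConeDecay n α ((n - β) / 2) := coneDecay_iff_beta.1 hβ.2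
      have h3 := h2.nonneg hn hα0 hα
      obtain ⟨σ, hσ⟩ : ∃ σ : ℝ≥0, (σ : ℝ) = (n - β) / 2 := ⟨⟨_, h3⟩, rfl⟩
      rw [← hσ] at h2
      have h4 : s₀ ≤ (σ : ℝ≥0∞) := iInf₂_le σ h2
      refine ENNReal.le_sub_of_add_le_right (ENNReal.mul_ne_top (by norm_num)
        (ne_top_of_le_ne_top ENNReal.coe_ne_top h4)) ?_
      have h5 : β + 2 * σ = (n : ℝ≥0) := by
        rw [← NNReal.coe_inj]; push_cast; rw [hσ]; ring
      calc (β : ℝ≥0∞) + 2 * s₀ ≤ β + 2 * (σ : ℝ≥0∞) := by gcongr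
        _ = ((β + 2 * σ : ℝ≥0) : ℝ≥0∞) := by push_cast; rfl
        _ = n := by rw [h5]; simp
    calc _ ≤ (n - 2 * s₀) + 2 * s₀ := by gcongr
      _ = n := tsub_add_cancel_of_le hhalf
  · have h1 : ((n : ℝ≥0∞) - betaCone n α) / 2 ≤ s₀ := by
      refine le_iInf₂ fun s hs => ?_
      refine ENNReal.div_le_of_le_mul ?_
      rw [tsub_le_iff_right]
      -- If `2s ≥ n` the corresponding `β` is not positive and hence not admissible, but then the
      -- inequality is trivial.
      rcases le_or_gt (n : ℝ) (2 * s) with hn2 | hn2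
      · have : (n : ℝ≥0) ≤ s * 2 := by
          rw [← NNReal.coe_le_coe]; push_cast; linarith
        calc (n : ℝ≥0∞) = ((n : ℝ≥0) : ℝ≥0∞) := by simp
          _ ≤ ((s * 2 : ℝ≥0) : ℝ≥0∞) := ENNReal.coe_le_coe.2 this
          _ ≤ _ := by push_cast; exact le_self_add
      · obtain ⟨β, hβ⟩ : ∃ β : ℝ≥0, (β : ℝ) = n - 2 * s := ⟨⟨_, by linarith⟩, rfl⟩
        have h2 : (β : ℝ≥0∞) ≤ betaCone n α := by
          refine le_iSup₂ (f := fun (β : ℝ≥0) _ => (β : ℝ≥0∞)) β ⟨?_, ?_⟩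
          · rw [← NNReal.coe_pos, hβ]; linarith
          · refine coneDecay_iff_beta.2 ?_
            rwa [hβ, show ((n : ℝ) - ((n : ℝ) - 2 * s)) / 2 = s by ring]
        have h5 : s * 2 + β = (n : ℝ≥0) := by
          rw [← NNReal.coe_inj]; push_cast; rw [hβ]; ring
        calc (n : ℝ≥0∞) = ((s * 2 + β : ℝ≥0) : ℝ≥0∞) := by rw [h5]; simp
          _ = s * 2 + (β : ℝ≥0∞) := by push_cast; rfl
          _ ≤ _ := by gcongr
    calc (n : ℝ≥0∞) ≤ betaCone n α + (n - betaCone n α) := le_add_tsub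
      _ = betaCone n α + 2 * ((n - betaCone n α) / 2) := by
        rw [ENNReal.mul_div_cancel (by norm_num) (by norm_num)]
      _ ≤ _ := by gcongr

/-! ### Comparison of the critical exponents -/

lemma enorm_ft_le {d : ℕ} (μ : Measure (E d)) {w : E d → ℂ} (hw1 : ∀ z, ‖w z‖ ≤ 1) (ξ : E d) :
    ‖ft μ w ξ‖ₑ ≤ μ univ := by
  refine (enorm_integral_le_lintegral_enorm _).trans ?_
  rw [← lintegral_one]
  refine lintegral_mono fun z => ?_
  rw [enorm_mul, ← ofReal_norm, Complex.norm_exp_ofReal_mul_I, ENNReal.ofReal_one, one_mul,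
    ← ofReal_norm]
  exact ENNReal.ofReal_le_one.2 (hw1 z)

/-- The hypothesis covers radii `r ≥ 1` only, whereas the Lorentz step leads from radius `R ≥ 1`
down to `R/16`. For `r < 1` the transform is bounded by the mass, which the energy of the projection
controls. -/
lemma exists_dualBound_openAnnulus {n : ℕ} (hn : 1 ≤ n) {α s : ℝ} (hα : 0 < α) (hs : 0 ≤ s)
    {C : ℝ≥0} (hC : ∀ R : ℝ, 1 ≤ R → MaxEstimateOn n α s R C (annulus n R)) :
    ∃ C' : ℝ≥0, ∀ r R : ℝ, 0 < r → r ≤ R → 1 ≤ R → ∀ ν : Measure (E (n + 1)), IsSlabMeasure ν →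
      DualBound ((openAnnulus n r).indicator fun _ => 1) ν
        (C' * ENNReal.ofReal (R ^ s) * energy α (ν.map spacePart) ^ (1 / 2 : ℝ)) := by
  obtain ⟨K, hK⟩ := exists_mass_sq_le_energy n hn α
  set V : ℝ≥0∞ := volume (Metric.ball (0 : E n) 1) with hV
  have hVt : V ≠ ⊤ := measure_ball_lt_top.ne
  set c := twoPiPow n * (C * (twoPiPow n)⁻¹ ^ (1 / 2 : ℝ)) with hc
  have ht : (twoPiPow n)⁻¹ ≠ ⊤ := ENNReal.inv_ne_top.2 (twoPiPow_ne_zero n)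
  have hct : c ≠ ⊤ := ENNReal.mul_ne_top (twoPiPow_ne_top n) (ENNReal.mul_ne_top
    ENNReal.coe_ne_top (ENNReal.rpow_ne_top_of_nonneg (by norm_num) ht))
  refine ⟨c.toNNReal + (K * V.toNNReal + 1), fun r R hr hrR hR ν hν => ?_⟩
  have hνf := hν.1
  rcases le_or_gt 1 r with h1 | h1
  · have h2 : TestBound (openAnnulus n r) (fun _ => 1) ν
        (C * ENNReal.ofReal (r ^ s) * (twoPiPow n)⁻¹ ^ (1 / 2 : ℝ) *
          energy α (ν.map spacePart) ^ (1 / 2 : ℝ)) :=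
      fun f hf => (hC r h1).slabBound ν hν f (hf.trans (openAnnulus_subset n r))
    have h3 := h2.dualBound hn (isOpen_openAnnulus n r) contDiff_const (fun _ => one_pos)
      hν.ae_norm_le
    refine h3.mono (Filter.Eventually.of_forall fun ξ => by simp) ?_
    calc _ = c * ENNReal.ofReal (r ^ s) * energy α (ν.map spacePart) ^ (1 / 2 : ℝ) := by
          rw [hc]; ring
      _ ≤ _ := by
        push_cast
        rw [ENNReal.coe_toNNReal hct]
        gcongr
        exact le_self_add
  · intro w hw hw1
    have hmass : ν univ = (ν.map spacePart) univ := by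
      rw [Measure.map_apply continuous_spacePart.measurable MeasurableSet.univ, preimage_univ]
    have hR1 : 1 ≤ ENNReal.ofReal (R ^ s) := by
      rw [← ENNReal.ofReal_one]; exact ENNReal.ofReal_le_ofReal (Real.one_le_rpow hR hs)
    rw [lintegral_indicator_one_mul _ (isOpen_openAnnulus n r).measurableSet]
    calc ∫⁻ ξ in openAnnulus n r, ‖ft ν w (coneLift ξ)‖ₑ ^ 2
        ≤ ∫⁻ _ in openAnnulus n r, ν univ ^ 2 := by
          refine lintegral_mono fun ξ => ?_
          gcongr
          exact enorm_ft_le ν hw1 _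
      _ = ν univ ^ 2 * volume (openAnnulus n r) := by rw [setLIntegral_const]
      _ ≤ (K * energy α (ν.map spacePart)) * V := by
          gcongr
          · rw [hmass]
            exact hK α hα le_rfl _ inferInstance
              (ae_norm_le_one_of_compactlySupported hν.compactlySupported_map)
          · exact measure_mono (sdiff_subset.trans (Metric.ball_subset_ball h1.le))
      _ = ((K * V.toNNReal : ℝ≥0) : ℝ≥0∞) * 1 ^ 2 * energy α (ν.map spacePart) := by
          push_cast; rw [ENNReal.coe_toNNReal hVt]; ring
      _ ≤ ((c.toNNReal + (K * V.toNNReal + 1) : ℝ≥0) : ℝ≥0∞) ^ 2 * ENNReal.ofReal (R ^ s) ^ 2 *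
            energy α (ν.map spacePart) := by
          gcongr
          rw [← ENNReal.coe_pow, ENNReal.coe_le_coe]
          set q := K * V.toNNReal
          nlinarith [zero_le (a := q), zero_le (a := c.toNNReal),
            mul_nonneg (zero_le (a := q)) (zero_le (a := c.toNNReal))]
      _ = _ := by rw [mul_pow, mul_pow, ennreal_rpow_half_sq]

/-- The passage from slabs to general measures, with frequency set an annulus: its image under the
change of frequencies is no longer an annulus of ratio `2`, but three dyadic ones cover it up to
null sets. -/
lemma coneDecay_of_maxEstimateOn {n : ℕ} (hn : 1 ≤ n) {α s : ℝ} (hα : 0 < α) (hs : 0 ≤ s)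
    {C : ℝ≥0} (hC : ∀ R : ℝ, 1 ≤ R → MaxEstimateOn n α s R C (annulus n R)) :
    ConeDecay n α s := by
  obtain ⟨C', hC'⟩ := exists_dualBound_openAnnulus hn hα hs hC
  obtain ⟨K, hK⟩ := exists_dualBound_of_slab hn α
  refine ⟨(K * (2 * C')) ^ 2, fun R hR ν hν => ?_⟩
  have hνf := hν.1
  -- On the annulus `R/8 ≤ |ξ/4| < R/4`, and `freqMap` changes norms by at most a factor `2` either
  -- way.
  set T : Set (E n) := {η | R / 16 ≤ ‖η‖ ∧ ‖η‖ ≤ R / 2} with hT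
  have hTm : MeasurableSet T :=
    (measurableSet_le measurable_const measurable_norm).inter
      (measurableSet_le measurable_norm measurable_const)
  have h1 := hK α hα le_rfl ((annulus n R).indicator fun _ => 1) (T.indicator fun _ => 1)
    (measurable_const.indicator (measurableSet_annulus n R)) (measurable_const.indicator hTm)
    ?_ (2 * C' * ENNReal.ofReal (R ^ s)) ?_ ν hνf (ae_norm_le_one_of_compactlySupported hν)
    (fun _ => 1) measurable_const (fun _ => by simp)
  · simp only [ft_one] at h1
    rw [lintegral_indicator_one_mul _ (measurableSet_annulus n R)] at h1
    refine h1.trans (le_of_eq ?_)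
    rw [mul_pow, ennreal_rpow_half_sq, ofReal_rpow_two_mul (by linarith)]
    push_cast; ring
  · intro k hk ξ
    by_cases hξ : ξ ∈ annulus n R
    · rw [mem_annulus] at hξ
      have h2 := norm_freqMap_le hk ((1 / 4 : ℝ) • ξ)
      have h3 := norm_le_two_mul_freqMap hk ((1 / 4 : ℝ) • ξ)
      rw [norm_smul, Real.norm_of_nonneg (by norm_num)] at h2 h3
      rw [indicator_of_mem (mem_annulus.2 hξ), indicator_of_mem]
      constructor <;> linarith [hξ.1, hξ.2]
    · rw [indicator_of_notMem hξ]; exact zero_le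
  · intro ν' hν' w hw hw1
    have hν'f := hν'.1
    have hb : ∀ j : ℝ, 1 ≤ j → ∫⁻ ξ in openAnnulus n (R / j), ‖ft ν' w (coneLift ξ)‖ₑ ^ 2 ≤
        (C' * ENNReal.ofReal (R ^ s) * energy α (ν'.map spacePart) ^ (1 / 2 : ℝ)) ^ 2 := by
      intro j hj
      have h2 := hC' (R / j) R (by positivity) (div_le_self (by linarith) hj) hR ν' hν' w hw hw1
      rwa [lintegral_indicator_one_mul _ (isOpen_openAnnulus n _).measurableSet] at h2
    rw [lintegral_indicator_one_mul _ hTm]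
    have hcov : T ≤ᵐ[volume] (openAnnulus n (R / 2) ∪ (openAnnulus n (R / 4) ∪
        openAnnulus n (R / 8)) : Set (E n)) := by
      filter_upwards [ae_norm_ne hn (R / 2), ae_norm_ne hn (R / 4), ae_norm_ne hn (R / 8),
        ae_norm_ne hn (R / 16)] with ξ h2 h4 h8 h16 hξ
      change ξ ∈ (openAnnulus n (R / 2) ∪ (openAnnulus n (R / 4) ∪ openAnnulus n (R / 8)) : Set (E n))
      have ha := lt_of_le_of_ne hξ.1 (Ne.symm h16)
      have hb := lt_of_le_of_ne hξ.2 h2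
      rcases lt_or_gt_of_ne h4 with h | h
      · right
        rcases lt_or_gt_of_ne h8 with h' | h'
        · right; rw [mem_openAnnulus]; constructor <;> linarith
        · left; rw [mem_openAnnulus]; constructor <;> linarith
      · left; rw [mem_openAnnulus]; constructor <;> linarith
    calc ∫⁻ ξ in T, ‖ft ν' w (coneLift ξ)‖ₑ ^ 2
        ≤ ∫⁻ ξ in (openAnnulus n (R / 2) ∪ (openAnnulus n (R / 4) ∪ openAnnulus n (R / 8)) :
            Set (E n)), ‖ft ν' w (coneLift ξ)‖ₑ ^ 2 := lintegral_mono_set' hcov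
      _ ≤ (∫⁻ ξ in openAnnulus n (R / 2), ‖ft ν' w (coneLift ξ)‖ₑ ^ 2) +
          ((∫⁻ ξ in openAnnulus n (R / 4), ‖ft ν' w (coneLift ξ)‖ₑ ^ 2) +
          (∫⁻ ξ in openAnnulus n (R / 8), ‖ft ν' w (coneLift ξ)‖ₑ ^ 2)) :=
        (lintegral_union_le _ _ _).trans (by gcongr; exact lintegral_union_le _ _ _)
      _ ≤ (C' * ENNReal.ofReal (R ^ s) * energy α (ν'.map spacePart) ^ (1 / 2 : ℝ)) ^ 2 +
          ((C' * ENNReal.ofReal (R ^ s) * energy α (ν'.map spacePart) ^ (1 / 2 : ℝ)) ^ 2 +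
          (C' * ENNReal.ofReal (R ^ s) * energy α (ν'.map spacePart) ^ (1 / 2 : ℝ)) ^ 2) := by
        gcongr
        · exact hb 2 (by norm_num)
        · exact hb 4 (by norm_num)
        · exact hb 8 (by norm_num)
      _ = 3 * (C' * ENNReal.ofReal (R ^ s) * energy α (ν'.map spacePart) ^ (1 / 2 : ℝ)) ^ 2 := by
        ring
      _ ≤ 4 * (C' * ENNReal.ofReal (R ^ s) * energy α (ν'.map spacePart) ^ (1 / 2 : ℝ)) ^ 2 := by
        gcongr; norm_num
      _ = _ := by ring

lemma sWave_le_sMaxWave {n : ℕ} (hn : 1 ≤ n) {α : ℝ} (hα0 : 0 < α) (hα : α ≤ n + 1) :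
    sWave n α ≤ sMaxWave n α := by
  rw [sWave_eq hn hα]
  refine le_iInf₂ fun s hs => iInf₂_le s ?_
  obtain ⟨C, hC⟩ := hs
  exact coneDecay_of_maxEstimateOn hn hα0 s.2 hC

/-! ### Maximal estimates from decay over the cone -/

/-- A mollifier: a measure in the unit ball with rapidly decaying Fourier transform. -/
lemma exists_mollifier (d : ℕ) : ∃ (φ : Measure (E d)) (A : ℝ≥0), IsFiniteMeasure φ ∧
    (∀ᵐ x ∂φ, ‖x‖ ≤ 1) ∧ φ univ ≠ 0 ∧ ∀ ε : ℝ, 0 ≤ ε → ε ≤ 2 → ∀ η : E d,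
      ‖charFun φ η‖ₑ ^ 2 * ENNReal.ofReal (‖η‖ ^ ε) ≤ A := by
  let χ : ContDiffBump (0 : E d) := ⟨1 / 2, 1, by norm_num, by norm_num⟩
  have hχm : Measurable χ := χ.continuous.measurable
  set φ : Measure (E d) := volume.withDensity fun x => ENNReal.ofReal (χ x) with hφ
  have hφf : IsFiniteMeasure φ := isFiniteMeasure_withDensity_ofReal χ.integrable.2
  have hχ' : ContDiff ℝ (⊤ : ℕ∞) fun x => (χ x : ℂ) := Complex.ofRealCLM.contDiff.comp χ.contDiff
  have hχc' : HasCompactSupport fun x => (χ x : ℂ) :=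
    χ.hasCompactSupport.comp_left (g := Complex.ofReal) rfl
  set g := hχc'.toSchwartzMap hχ' with hg
  have hcf : ∀ η, ‖charFun φ η‖ = ‖hatS g η‖ := by
    intro η
    rw [hatS_apply, ← norm_measureHat]
    congr 1
    rw [measureHat, fourierHat, hφ, integral_withDensity_eq_integral_toReal_smul
      hχm.ennreal_ofReal (Filter.Eventually.of_forall fun x => ENNReal.ofReal_lt_top)]
    congr 1; ext x
    rw [ENNReal.toReal_ofReal χ.nonneg, mul_comm (Complex.exp _)]; rfl
  obtain ⟨A₀, hA₀, h0⟩ := (hatS g).decay 0 0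
  obtain ⟨A₁, hA₁, h1⟩ := (hatS g).decay 1 0
  simp only [norm_iteratedFDeriv_zero, pow_zero, one_mul, pow_one] at h0 h1
  refine ⟨φ, (A₀ ^ 2 + A₁ ^ 2).toNNReal, hφf, ?_, ?_, fun ε hε hε2 η => ?_⟩
  · rw [hφ, ae_withDensity_iff hχm.ennreal_ofReal]
    refine Filter.Eventually.of_forall fun z hz => ?_
    by_contra hlt
    refine hz ?_
    rw [χ.zero_of_le_dist, ENNReal.ofReal_zero]
    rw [dist_zero_right]; exact (not_le.1 hlt).le
  · rw [hφ, withDensity_apply _ MeasurableSet.univ, Measure.restrict_univ,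
      ← ofReal_integral_eq_lintegral_ofReal χ.integrable
        (Filter.Eventually.of_forall fun x => χ.nonneg)]
    rw [ne_eq, ENNReal.ofReal_eq_zero, not_le]
    exact χ.integral_pos
  · rw [← ofReal_norm, ← ENNReal.ofReal_pow (norm_nonneg _), ← ENNReal.ofReal_mul (by positivity),
      hcf]
    refine ENNReal.ofReal_le_ofReal ?_
    have h2 : ‖η‖ ^ ε ≤ 1 + ‖η‖ ^ 2 := by
      rcases le_total ‖η‖ 1 with hy | hy
      · have := Real.rpow_le_one (norm_nonneg η) hy hε
        nlinarith [norm_nonneg η]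
      · have : ‖η‖ ^ ε ≤ ‖η‖ ^ (2 : ℝ) := Real.rpow_le_rpow_of_exponent_le hy hε2
        rw [Real.rpow_two] at this
        linarith
    calc ‖hatS g η‖ ^ 2 * ‖η‖ ^ ε ≤ ‖hatS g η‖ ^ 2 * (1 + ‖η‖ ^ 2) := by gcongr
      _ = ‖hatS g η‖ ^ 2 + (‖η‖ * ‖hatS g η‖) ^ 2 := by ring
      _ ≤ A₀ ^ 2 + A₁ ^ 2 := by
        gcongr
        · exact h0 η
        · exact h1 η

lemma ae_conv {d : ℕ} {μ ν : Measure (E d)} [SFinite μ] [SFinite ν] {r s : ℝ}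
    (hμ : ∀ᵐ x ∂μ, ‖x‖ ≤ r) (hν : ∀ᵐ x ∂ν, ‖x‖ ≤ s) : ∀ᵐ x ∂(μ ∗ ν), ‖x‖ ≤ r + s := by
  rw [Measure.conv, ae_map_iff (by fun_prop) (measurableSet_le measurable_norm measurable_const)]
  have h1 : ∀ᵐ p ∂(μ.prod ν), ‖p.1‖ ≤ r := Measure.quasiMeasurePreserving_fst.ae hμ
  have h2 : ∀ᵐ p ∂(μ.prod ν), ‖p.2‖ ≤ s := Measure.quasiMeasurePreserving_snd.ae hν
  filter_upwards [h1, h2] with p hp1 hp2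
  exact (norm_add_le _ _).trans (by linarith)

lemma isCompactlySupportedIn_of_ae {d : ℕ} {μ : Measure (E d)} (hμ : IsFiniteMeasure μ) {r : ℝ}
    (hr : r < 1) (h : ∀ᵐ x ∂μ, ‖x‖ ≤ r) : IsCompactlySupportedIn μ (Metric.ball 0 1) := by
  refine ⟨hμ, Metric.closedBall 0 r, isCompact_closedBall _ _, Metric.closedBall_subset_ball hr, ?_⟩
  have h' : ∀ᵐ x ∂μ, x ∈ Metric.closedBall (0 : E d) r := by
    simpa [mem_closedBall_zero_iff] using h
  exact h'

lemma norm_coneLift_le {n : ℕ} (ξ : E n) : ‖coneLift ξ‖ ≤ 2 * ‖ξ‖ := by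
  have h := norm_sq_eq_space_time (coneLift ξ)
  rw [spacePart_coneLift, timePart_coneLift] at h
  refine abs_le_of_sq_le_sq' ?_ (by positivity) |>.2
  nlinarith [norm_nonneg ξ]

/-- Convolve with a mollifier at scale `1/(8R)`. On the part of the cone considered its transform is
at least half its mass, so the left side is not lost. Its decay at higher frequencies bounds the
energy of order `α` by `R^ε` times the one of order `α - ε`. -/
lemma ConeDecay.smoothed {n : ℕ} {α s ε : ℝ} (h : ConeDecay n α s) (hε : 0 < ε)
    (hε2 : ε ≤ 2) : ∃ C : ℝ≥0, ∀ R : ℝ, 1 ≤ R → ∀ σ : Measure (E (n + 1)), IsFiniteMeasure σ →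
      (∀ᵐ z ∂σ, ‖z‖ ≤ 3 / 2) → ∫⁻ ξ in annulus n R, ‖charFun σ (coneLift ξ)‖ₑ ^ 2 ≤
        C * ENNReal.ofReal (R ^ (2 * s + ε)) * energy (α - ε) σ := by
  obtain ⟨C, hC⟩ := h
  obtain ⟨φ, A, hφf, hφs, hφ0, hφA⟩ := exists_mollifier (n + 1)
  set b : ℝ≥0∞ := 4 * (C * ENNReal.ofReal (2 ^ (2 * s)) *
    (A * (ENNReal.ofReal (8 ^ ε) * ENNReal.ofReal ((1 / 2) ^ (-(α - ε)))))) with hb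
  have hbt : b ≠ ⊤ := by finiteness
  have hφt : φ univ ^ 2 ≠ ⊤ := by finiteness
  have hφ02 : φ univ ^ 2 ≠ 0 := pow_ne_zero 2 hφ0
  refine ⟨(b / φ univ ^ 2).toNNReal, fun R hR σ hσ hσs => ?_⟩
  have hR0 : 0 < R := by linarith
  rw [ENNReal.coe_toNNReal (ENNReal.div_ne_top hbt hφ02)]
  -- Small enough that `c` times the cone point above `2ξ`, `|ξ| < R`, has norm at most `1`, and
  -- that the convolution is supported in radius `3/4 + 1/8 < 1`.
  set c : ℝ := (8 * R)⁻¹ with hc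
  have hc0 : 0 < c := by positivity
  have hc8 : c ≤ 1 / 8 := by
    rw [hc, one_div]; exact inv_anti₀ (by norm_num) (by linarith)
  -- Halving brings a measure in the ball of radius `3/2`, such as a graph over the unit ball with
  -- times in `(0,1)`, into the unit ball. Frequencies double, hence the annulus of radius `2R`
  -- below.
  set σ' : Measure (E (n + 1)) := σ.map fun z => (1 / 2 : ℝ) • z with hσ'
  set φ' : Measure (E (n + 1)) := φ.map fun z => c • z with hφ'
  have hσ's : ∀ᵐ z ∂σ', ‖z‖ ≤ 3 / 4 := by
    rw [hσ', ae_map_iff (by fun_prop) (measurableSet_le measurable_norm measurable_const)]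
    filter_upwards [hσs] with z hz
    rw [norm_smul, Real.norm_of_nonneg (by norm_num)]; linarith
  have hφ's : ∀ᵐ z ∂φ', ‖z‖ ≤ 1 / 8 := by
    rw [hφ', ae_map_iff (by fun_prop) (measurableSet_le measurable_norm measurable_const)]
    filter_upwards [hφs] with z hz
    rw [norm_smul, Real.norm_of_nonneg hc0.le]
    nlinarith [norm_nonneg z]
  set τ : Measure (E (n + 1)) := σ' ∗ φ' with hτ
  have hτf : IsFiniteMeasure τ := inferInstance
  have hτM : IsCompactlySupportedIn τ (Metric.ball 0 1) :=
    isCompactlySupportedIn_of_ae hτf (by norm_num : (3 / 4 + 1 / 8 : ℝ) < 1) (ae_conv hσ's hφ's)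
  have hcf : ∀ ζ, charFun τ ζ = charFun σ' ζ * charFun φ (c • ζ) := by
    intro ζ
    rw [hτ, charFun_conv, hφ', charFun_map_smul (μ := φ)]
  -- the energy of the mollified measure
  have hE : energy α τ ≤ A * (ENNReal.ofReal (8 ^ ε) * ENNReal.ofReal ((1 / 2) ^ (-(α - ε)))) *
      ENNReal.ofReal (R ^ ε) * energy (α - ε) σ := by
    have h1 : energy (α - ε) σ' = ENNReal.ofReal ((1 / 2) ^ (-(α - ε))) * energy (α - ε) σ := by
      rw [hσ', energy_map_smul _ _ (by norm_num)]
    have h2 : energy α τ ≤ A * ENNReal.ofReal ((8 * R) ^ ε) * energy (α - ε) σ' := by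
      rw [energy_eq, energy_eq, ← lintegral_const_mul' _ _ (by finiteness)]
      have hae : ∀ᵐ ζ : E (n + 1), ζ ≠ 0 :=
        measure_eq_zero_iff_ae_notMem.1 (measure_singleton (0 : E (n + 1)))
      refine lintegral_mono_ae (hae.mono fun ζ hζ => ?_)
      have hζ0 : 0 < ‖ζ‖ := norm_pos_iff.2 hζ
      have h3 : ‖ζ‖ ^ (α - ((n + 1 : ℕ) : ℝ)) = ‖c • ζ‖ ^ ε * (8 * R) ^ ε *
          ‖ζ‖ ^ (α - ε - ((n + 1 : ℕ) : ℝ)) := by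
        rw [norm_smul, Real.norm_of_nonneg hc0.le, Real.mul_rpow hc0.le hζ0.le, hc,
          Real.inv_rpow (by positivity)]
        have : ((8 * R) ^ ε) ≠ 0 := by positivity
        field_simp
        rw [← Real.rpow_add hζ0]
        congr 1; ring
      rw [hcf, enorm_mul, mul_pow, h3, ENNReal.ofReal_mul (by positivity),
        ENNReal.ofReal_mul (by positivity)]
      calc _ = (‖charFun φ (c • ζ)‖ₑ ^ 2 * ENNReal.ofReal (‖c • ζ‖ ^ ε)) *
            ENNReal.ofReal ((8 * R) ^ ε) * (‖charFun σ' ζ‖ₑ ^ 2 *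
              ENNReal.ofReal (‖ζ‖ ^ (α - ε - ((n + 1 : ℕ) : ℝ)))) := by ring
        _ ≤ _ := by
          gcongr
          exact hφA ε hε.le hε2 _
    refine h2.trans (le_of_eq ?_)
    rw [h1, Real.mul_rpow (by norm_num) hR0.le, ENNReal.ofReal_mul (by positivity)]
    ring
  -- comparison of the Fourier transforms over the cone
  have hlow : ∀ ξ ∈ annulus n R, φ univ ^ 2 * ‖charFun σ (coneLift ξ)‖ₑ ^ 2 ≤
      4 * ‖charFun τ (coneLift ((2 : ℝ) • ξ))‖ₑ ^ 2 := by
    intro ξ hξ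
    rw [mem_annulus] at hξ
    have h1 : 1 * ‖c • coneLift ((2 : ℝ) • ξ)‖ ≤ 1 := by
      rw [one_mul, norm_smul, Real.norm_of_nonneg hc0.le]
      have h2 := norm_coneLift_le ((2 : ℝ) • ξ)
      rw [norm_smul, Real.norm_of_nonneg (by norm_num)] at h2
      calc c * ‖coneLift ((2 : ℝ) • ξ)‖ ≤ c * (8 * R) := by
            gcongr; linarith [hξ.2]
        _ = 1 := by rw [hc]; field_simp
    have h2 := half_mass_le_enorm_charFun φ hφs h1
    have h3 : charFun σ' (coneLift ((2 : ℝ) • ξ)) = charFun σ (coneLift ξ) := by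
      rw [hσ', charFun_map_smul, coneLift_smul (by norm_num), smul_smul]; norm_num
    rw [hcf, h3, enorm_mul, mul_pow]
    calc φ univ ^ 2 * ‖charFun σ (coneLift ξ)‖ₑ ^ 2
        ≤ (2 * ‖charFun φ (c • coneLift ((2 : ℝ) • ξ))‖ₑ) ^ 2 * ‖charFun σ (coneLift ξ)‖ₑ ^ 2 := by
          gcongr
      _ = _ := by ring
  have hmain : φ univ ^ 2 * ∫⁻ ξ in annulus n R, ‖charFun σ (coneLift ξ)‖ₑ ^ 2 ≤
      b * ENNReal.ofReal (R ^ (2 * s + ε)) * energy (α - ε) σ := by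
    calc φ univ ^ 2 * ∫⁻ ξ in annulus n R, ‖charFun σ (coneLift ξ)‖ₑ ^ 2
        = ∫⁻ ξ in annulus n R, φ univ ^ 2 * ‖charFun σ (coneLift ξ)‖ₑ ^ 2 :=
          (lintegral_const_mul' _ _ hφt).symm
      _ ≤ ∫⁻ ξ in annulus n R, 4 * ‖charFun τ (coneLift ((2 : ℝ) • ξ))‖ₑ ^ 2 :=
          setLIntegral_mono' (measurableSet_annulus n R) hlow
      _ = 4 * ∫⁻ ξ in annulus n R, ‖charFun τ (coneLift ((2 : ℝ) • ξ))‖ₑ ^ 2 :=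
          lintegral_const_mul' _ _ (by norm_num)
      _ ≤ 4 * ∫⁻ ξ in annulus n (2 * R), ‖charFun τ (coneLift ξ)‖ₑ ^ 2 := by
          refine mul_le_mul_right ?_ _
          rw [← lintegral_indicator (measurableSet_annulus n R),
            ← lintegral_indicator (measurableSet_annulus n (2 * R))]
          have h1 := lintegral_comp_smul_pos ((annulus n (2 * R)).indicator
            fun ξ => ‖charFun τ (coneLift ξ)‖ₑ ^ 2) (r := 2) (by norm_num)
          refine le_trans (le_of_eq ?_) (h1.le.trans (mul_le_of_le_one_left zero_le ?_))
          · refine lintegral_congr fun ξ => ?_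
            have hiff : ξ ∈ annulus n R ↔ (2 : ℝ) • ξ ∈ annulus n (2 * R) := by
              rw [mem_annulus, mem_annulus, norm_smul, Real.norm_of_nonneg (by norm_num)]
              constructor
              · rintro ⟨h1, h2⟩; constructor <;> linarith
              · rintro ⟨h1, h2⟩; constructor <;> linarith
            by_cases hξ : ξ ∈ annulus n R
            · rw [indicator_of_mem hξ, indicator_of_mem (hiff.1 hξ)]
            · rw [indicator_of_notMem hξ, indicator_of_notMem (fun h => hξ (hiff.2 h))]
          · rw [ENNReal.ofReal_le_one]
            exact Real.rpow_le_one_of_one_le_of_nonpos (by norm_num) (by simp)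
      _ ≤ 4 * (C * ENNReal.ofReal ((2 * R) ^ (2 * s)) * energy α τ) := by
          gcongr
          exact hC (2 * R) (by linarith) τ hτM
      _ ≤ 4 * (C * ENNReal.ofReal ((2 * R) ^ (2 * s)) *
          (A * (ENNReal.ofReal (8 ^ ε) * ENNReal.ofReal ((1 / 2) ^ (-(α - ε)))) *
            ENNReal.ofReal (R ^ ε) * energy (α - ε) σ)) := by gcongr
      _ = _ := by
          rw [hb, Real.mul_rpow (by norm_num) hR0.le, ENNReal.ofReal_mul (by positivity),
            Real.rpow_add hR0, ENNReal.ofReal_mul (by positivity)]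
          ring
  calc ∫⁻ ξ in annulus n R, ‖charFun σ (coneLift ξ)‖ₑ ^ 2
      = (φ univ ^ 2)⁻¹ * (φ univ ^ 2 * ∫⁻ ξ in annulus n R, ‖charFun σ (coneLift ξ)‖ₑ ^ 2) := by
        rw [← mul_assoc, ENNReal.inv_mul_cancel hφ02 hφt, one_mul]
    _ ≤ (φ univ ^ 2)⁻¹ * (b * ENNReal.ofReal (R ^ (2 * s + ε)) * energy (α - ε) σ) := by gcongr
    _ = _ := by rw [div_eq_mul_inv]; ring

/-- Energies of smaller order are dominated by energies of larger order. -/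
lemma exists_energy_sub_le {d : ℕ} (hd : 1 ≤ d) {α ε : ℝ} (hε : 0 ≤ ε) (hεα : ε < α) :
    ∃ K : ℝ≥0, ∀ μ : Measure (E d), IsFiniteMeasure μ → (∀ᵐ x ∂μ, ‖x‖ ≤ 1) →
      energy (α - ε) μ ≤ K * energy α μ := by
  obtain ⟨K, hK⟩ := exists_mass_sq_le_energy d hd α
  have hVt := (lintegral_ball_norm_rpow_lt_top hd (show 0 < α - ε by linarith)).ne
  set V : ℝ≥0∞ := ∫⁻ ξ in Metric.ball (0 : E d) 1, ENNReal.ofReal (‖ξ‖ ^ (α - ε - (d : ℝ))) with hV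
  refine ⟨K * V.toNNReal + 1, fun μ hμ hμ1 => ?_⟩
  push_cast
  rw [ENNReal.coe_toNNReal hVt, add_mul, one_mul, energy_eq,
    ← lintegral_add_compl _ (measurableSet_ball (x := (0 : E d)) (ε := 1))]
  refine add_le_add ?_ ?_
  · calc _ ≤ _ := energy_restrict_ball_le μ
      _ ≤ (K * energy α μ) * V := by
        gcongr
        exact hK α (by linarith) le_rfl μ hμ hμ1
      _ = _ := by ring
  · rw [energy_eq]
    refine le_trans (setLIntegral_mono' measurableSet_ball.compl fun ξ hξ => ?_)
      (setLIntegral_le_lintegral _ _)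
    have h2 : 1 ≤ ‖ξ‖ := by simpa using hξ
    gcongr
    linarith

/-- Measurable choice of times realizing the maximal function along a sequence. -/
def argmaxTime {X : Type*} (u : X → ℝ → ℝ) (q : ℕ → ℝ) : ℕ → X → ℝ
  | 0 => fun _ => q 0
  | N + 1 => fun x => by
    classical
    exact if u x (argmaxTime u q N x) < u x (q (N + 1)) then q (N + 1) else argmaxTime u q N x

lemma argmaxTime_mem {X : Type*} (u : X → ℝ → ℝ) (q : ℕ → ℝ) (N : ℕ) (x : X) :
    ∃ i, argmaxTime u q N x = q i := by
  induction N with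
  | zero => exact ⟨0, rfl⟩
  | succ N ih =>
    simp only [argmaxTime]
    split_ifs
    · exact ⟨N + 1, rfl⟩
    · exact ih

lemma le_argmaxTime_succ {X : Type*} (u : X → ℝ → ℝ) (q : ℕ → ℝ) (N : ℕ) (x : X) :
    u x (argmaxTime u q N x) ≤ u x (argmaxTime u q (N + 1) x) ∧
      u x (q (N + 1)) ≤ u x (argmaxTime u q (N + 1) x) := by
  simp only [argmaxTime]
  split_ifs with h
  · exact ⟨h.le, le_rfl⟩
  · exact ⟨le_rfl, not_lt.1 h⟩

lemma le_argmaxTime {X : Type*} (u : X → ℝ → ℝ) (q : ℕ → ℝ) (N : ℕ) (x : X) :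
    u x (q N) ≤ u x (argmaxTime u q N x) := by
  cases N with
  | zero => exact le_rfl
  | succ N => exact (le_argmaxTime_succ u q N x).2

lemma measurable_argmaxTime {X : Type*} [MeasurableSpace X] {u : X → ℝ → ℝ}
    (hu : Measurable fun p : X × ℝ => u p.1 p.2) (q : ℕ → ℝ) (N : ℕ) :
    Measurable (argmaxTime u q N) := by
  induction N with
  | zero => exact measurable_const
  | succ N ih =>
    have h1 : Measurable fun x => u x (argmaxTime u q N x) := hu.comp (measurable_id.prodMk ih)
    have h2 : Measurable fun x => u x (q (N + 1)) := hu.comp (measurable_id.prodMk measurable_const)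
    exact Measurable.ite (measurableSet_lt h1 h2) measurable_const ih

/-- The graph of a time function over a measure in space. -/
def graphMeasure {n : ℕ} (μ : Measure (E n)) (t : E n → ℝ) : Measure (E (n + 1)) :=
  μ.map fun x => mkPt x (t x)

lemma measurable_graph {n : ℕ} {t : E n → ℝ} (ht : Measurable t) :
    Measurable fun x => mkPt x (t x) :=
  continuous_mkPt.measurable.comp (f := fun x => (x, t x)) (measurable_id.prodMk ht)

lemma graphMeasure_map_spacePart {n : ℕ} (μ : Measure (E n)) {t : E n → ℝ} (ht : Measurable t) :
    (graphMeasure μ t).map spacePart = μ := by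
  rw [graphMeasure, Measure.map_map continuous_spacePart.measurable (measurable_graph ht)]
  have : (spacePart ∘ fun x => mkPt x (t x)) = id := by ext x : 1; simp
  rw [this, Measure.map_id]

lemma measurable_enorm_wave {n : ℕ} (g : SchwartzMap (E n) ℂ) :
    Measurable fun z : E (n + 1) => ‖wave g (spacePart z) (timePart z)‖ₑ :=
  (continuous_wave g).measurable.enorm

lemma continuous_wave_uncurry {n : ℕ} (g : SchwartzMap (E n) ℂ) :
    Continuous fun p : E n × ℝ => wave g p.1 p.2 := by
  have := (continuous_wave g).comp continuous_mkPt
  simpa [Function.comp_def] using this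

lemma continuous_wave_right {n : ℕ} (g : SchwartzMap (E n) ℂ) (x : E n) :
    Continuous fun t : ℝ => wave g x t := by
  have hp : Continuous fun t : ℝ => ((x, t) : E n × ℝ) := by fun_prop
  have := (continuous_wave_uncurry g).comp hp
  exact this

/-- Linearization of the maximal function. -/
lemma maxLHS_le_of_graph {n : ℕ} (g : SchwartzMap (E n) ℂ) (μ : Measure (E n)) {B : ℝ≥0∞}
    (h : ∀ t : E n → ℝ, Measurable t → (∀ x, t x ∈ Ioo (0 : ℝ) 1) →
      spaceTimeLHS g (graphMeasure μ t) ≤ B) : maxLHS g μ ≤ B := by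
  have : Nonempty (Ioo (0 : ℝ) 1) := ⟨⟨1 / 2, by norm_num, by norm_num⟩⟩
  set q : ℕ → ℝ := fun k => (TopologicalSpace.denseSeq (Ioo (0 : ℝ) 1) k : ℝ) with hq
  have hqm : ∀ k, q k ∈ Ioo (0 : ℝ) 1 := fun k => (TopologicalSpace.denseSeq (Ioo (0 : ℝ) 1) k).2
  set u : E n → ℝ → ℝ := fun x t => ‖wave g x t‖ with hu
  have huc := continuous_wave_uncurry g
  have hum : Measurable fun p : E n × ℝ => u p.1 p.2 := huc.norm.measurable
  set T := argmaxTime u q with hT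
  have hTm : ∀ N, Measurable (T N) := measurable_argmaxTime hum q
  have hTI : ∀ N x, T N x ∈ Ioo (0 : ℝ) 1 := by
    intro N x
    obtain ⟨i, hi⟩ := argmaxTime_mem u q N x
    rw [hT, hi]; exact hqm i
  have henorm : ∀ {a b : ℂ}, ‖a‖ ≤ ‖b‖ → ‖a‖ₑ ≤ ‖b‖ₑ := by
    intro a b hab
    rw [← ofReal_norm, ← ofReal_norm]; exact ENNReal.ofReal_le_ofReal hab
  -- The wave is continuous in time, so the supremum over a dense sequence suffices; along it the
  -- maximizing times are measurable and the values increase with `N`, which allows monotone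
  -- convergence.
  have hpt : ∀ x, (⨆ t ∈ Ioo (0 : ℝ) 1, ‖wave g x t‖ₑ) ≤ ⨆ N, ‖wave g x (T N x)‖ₑ := by
    intro x
    refine iSup₂_le fun t ht => ?_
    obtain ⟨M, hM⟩ : ∃ M, M = ⨆ N, ‖wave g x (T N x)‖ₑ := ⟨_, rfl⟩
    rw [← hM]
    have hcl : IsClosed {t : Ioo (0 : ℝ) 1 | ‖wave g x t‖ₑ ≤ M} := by
      have hc : Continuous fun t : Ioo (0 : ℝ) 1 => wave g x t :=
        (continuous_wave_right g x).comp continuous_subtype_val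
      exact isClosed_le hc.enorm continuous_const
    exact (TopologicalSpace.denseRange_denseSeq (Ioo (0 : ℝ) 1)).induction_on
      (p := fun t : Ioo (0 : ℝ) 1 => ‖wave g x t‖ₑ ≤ M) ⟨t, ht⟩ hcl
      fun N => (henorm (le_argmaxTime u q N x)).trans
        (hM ▸ le_iSup (fun N => ‖wave g x (T N x)‖ₑ) N)
  have hm : ∀ N, Measurable fun x => ‖wave g x (T N x)‖ₑ := by
    intro N
    have hp : Measurable fun x : E n => ((x, T N x) : E n × ℝ) := measurable_id.prodMk (hTm N)
    exact (huc.measurable.comp (g := fun p : E n × ℝ => wave g p.1 p.2) hp).enorm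
  calc maxLHS g μ ≤ ∫⁻ x, ⨆ N, ‖wave g x (T N x)‖ₑ ∂μ := lintegral_mono hpt
    _ = ⨆ N, ∫⁻ x, ‖wave g x (T N x)‖ₑ ∂μ := by
      refine lintegral_iSup hm (monotone_nat_of_le_succ fun N x => ?_)
      exact henorm (le_argmaxTime_succ u q N x).1
    _ ≤ B := by
      refine iSup_le fun N => ?_
      refine le_trans (le_of_eq ?_) (h (T N) (hTm N) (hTI N))
      rw [spaceTimeLHS, graphMeasure, lintegral_map (measurable_enorm_wave g)
        (measurable_graph (hTm N))]
      simp

/-- On the graph of a measurable time function the decay is applied at order `α - ε`. Being strictly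
below `n`, this order allows the energy of the graph to be compared with that of its projection `μ`,
and the energy of order `α` of `μ` dominates the one of order `α - ε`. -/
lemma ConeDecay.maxEstimateOn {n : ℕ} (hn : 1 ≤ n) {α s ε : ℝ} (hα : α ≤ n)
    (h : ConeDecay n α s) (hε : 0 < ε) (hε2 : ε ≤ 2) (hεα : ε < α) :
    ∃ C : ℝ≥0, ∀ R : ℝ, 1 ≤ R → MaxEstimateOn n α (s + ε / 2) R C (annulus n R) := by
  obtain ⟨C, hC⟩ := h.smoothed hε hε2
  obtain ⟨K₁, hK₁⟩ := exists_energy_sub_le hn hε.le hεα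
  obtain ⟨K₂, hK₂⟩ := exists_energy_le_proj hn (show α - ε < n by linarith)
  have ht : (twoPiPow n)⁻¹ ≠ ⊤ := ENNReal.inv_ne_top.2 (twoPiPow_ne_zero n)
  have ht2 : (twoPiPow n)⁻¹ ^ (1 / 2 : ℝ) ≠ ⊤ := ENNReal.rpow_ne_top_of_nonneg (by norm_num) ht
  set Q : ℝ≥0∞ := (4 * (C + 1)) * ((K₂ : ℝ≥0∞) * K₁) ^ (1 / 2 : ℝ) with hQ
  have hQt : Q ≠ ⊤ := by
    have : ((K₂ : ℝ≥0∞) * K₁) ^ (1 / 2 : ℝ) ≠ ⊤ :=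
      ENNReal.rpow_ne_top_of_nonneg (by norm_num) (by finiteness)
    finiteness
  refine ⟨((twoPiPow n)⁻¹ ^ (1 / 2 : ℝ) * Q).toNNReal, fun R hR μ hμ g hg => ?_⟩
  have hμf := hμ.1
  have hR0 : 0 < R := by linarith
  have hμ1 := ae_norm_le_one_of_compactlySupported hμ
  rw [ENNReal.coe_toNNReal (ENNReal.mul_ne_top ht2 hQt)]
  refine maxLHS_le_of_graph g μ fun t ht htI => ?_
  set ν := graphMeasure μ t with hν
  have hνf : IsFiniteMeasure ν := by rw [hν, graphMeasure]; infer_instance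
  have hνs : ∀ᵐ z ∂ν, ‖z‖ ≤ 3 / 2 := by
    rw [hν, graphMeasure, ae_map_iff (measurable_graph ht).aemeasurable
      (measurableSet_le measurable_norm measurable_const)]
    filter_upwards [hμ1] with x hx
    have h1 := norm_sq_eq_space_time (mkPt x (t x))
    rw [spacePart_mkPt, timePart_mkPt] at h1
    refine abs_le_of_sq_le_sq' ?_ (by norm_num) |>.2
    nlinarith [norm_nonneg x, (htI x).1, (htI x).2]
  have hE : energy (α - ε) ν ≤ K₂ * K₁ * energy α μ := by
    calc energy (α - ε) ν ≤ K₂ * energy (α - ε) (ν.map spacePart) := hK₂ ν hνf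
      _ = K₂ * energy (α - ε) μ := by rw [hν, graphMeasure_map_spacePart μ ht]
      _ ≤ K₂ * (K₁ * energy α μ) := by gcongr; exact hK₁ μ hμf hμ1
      _ = _ := by ring
  have hpow : ENNReal.ofReal (R ^ (2 * s + ε)) = ENNReal.ofReal (R ^ (s + ε / 2)) ^ 2 := by
    rw [← ofReal_rpow_two_mul hR0]; congr 2; ring
  have hdual := dualBound_of_le (m := (annulus n R).indicator fun _ => 1) (ν := ν)
    (D := (C + 1) * ENNReal.ofReal (R ^ (s + ε / 2)) * energy (α - ε) ν ^ (1 / 2 : ℝ))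
    (measurable_const.indicator (measurableSet_annulus n R)) (by
      intro ν' hν'
      rw [lintegral_indicator_one_mul _ (measurableSet_annulus n R)]
      refine (hC R hR ν' (isFiniteMeasure_of_le ν hν') (hνs.filter_mono
        (Measure.absolutelyContinuous_of_le hν').ae_le)).trans ?_
      rw [mul_pow, mul_pow, ennreal_rpow_half_sq, hpow]
      gcongr
      · exact_mod_cast (show C ≤ (C + 1) ^ 2 by nlinarith [zero_le (a := C)])
      · exact energy_mono (by omega) (by push_cast; linarith) hν')
  have h2 : DualBound ((annulus n R).indicator fun ξ => ENNReal.ofReal ((fun _ => (1 : ℝ)) ξ)⁻¹) ν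
      (4 * ((C + 1) * ENNReal.ofReal (R ^ (s + ε / 2)) * energy (α - ε) ν ^ (1 / 2 : ℝ))) := by
    simpa using hdual
  have h3 := h2.testBound (measurableSet_annulus n R) measurable_const (fun _ => one_pos) g hg
  have h4 : (twoPiPow n)⁻¹ = (twoPiPow n)⁻¹ ^ (1 / 2 : ℝ) * (twoPiPow n)⁻¹ ^ (1 / 2 : ℝ) := by
    rw [← sq, ennreal_rpow_half_sq]
  refine h3.trans ?_
  rw [eLpNorm_two_eq_fourier]
  nth_rw 1 [h4]
  calc _ = (twoPiPow n)⁻¹ ^ (1 / 2 : ℝ) * (4 * (C + 1)) * energy (α - ε) ν ^ (1 / 2 : ℝ) *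
        ENNReal.ofReal (R ^ (s + ε / 2)) * ((twoPiPow n)⁻¹ ^ (1 / 2 : ℝ) *
        (∫⁻ ξ, ENNReal.ofReal 1 * ‖fourierHat g ξ‖ₑ ^ 2) ^ (1 / 2 : ℝ)) := by ring
    _ ≤ (twoPiPow n)⁻¹ ^ (1 / 2 : ℝ) * (4 * (C + 1)) * (K₂ * K₁ * energy α μ) ^ (1 / 2 : ℝ) *
        ENNReal.ofReal (R ^ (s + ε / 2)) * ((twoPiPow n)⁻¹ ^ (1 / 2 : ℝ) *
        (∫⁻ ξ, ENNReal.ofReal 1 * ‖fourierHat g ξ‖ₑ ^ 2) ^ (1 / 2 : ℝ)) := by gcongr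
    _ = _ := by
      rw [hQ, ENNReal.mul_rpow_of_nonneg (_ * _) _ (by norm_num)]; ring

lemma sMaxWave_le_sWave {n : ℕ} (hn : 1 ≤ n) {α : ℝ} (hα0 : 0 < α) (hα : α ≤ n) :
    sMaxWave n α ≤ sWave n α := by
  rw [sWave_eq hn (by linarith)]
  refine le_iInf₂ fun s hs => ENNReal.le_of_forall_pos_le_add fun δ hδ _ => ?_
  -- The loss `ε/2` must not exceed `δ`; `ε ≤ 2` is the range of the mollifier and `ε < α` keeps the
  -- reduced order positive.
  set ε : ℝ := min (2 * δ) (min 2 (α / 2)) with hε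
  have hδ' : (0 : ℝ) < δ := hδ
  have hε0 : 0 < ε := by positivity
  obtain ⟨C, hC⟩ := hs.maxEstimateOn hn hα hε0 ((min_le_right _ _).trans (min_le_left _ _))
    (lt_of_le_of_lt ((min_le_right _ _).trans (min_le_right _ _)) (by linarith))
  rw [← ENNReal.coe_add]
  refine iInf₂_le (s + δ) ⟨C, fun R hR μ hμ g hg => (hC R hR μ hμ g hg).trans ?_⟩
  gcongr
  push_cast
  have : ε ≤ 2 * δ := min_le_left _ _
  linarith

/-! ### Repeated integration by parts and Gegenbauer weights -/

/-- `U k` and `V k` stand for successive derivatives. Boundary terms vanish as soon as one of the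
two factors vanishes at each end point. -/
lemma integral_mul_eq_neg_one_pow {U V : ℕ → ℝ → ℂ} (hU : ∀ k x, HasDerivAt (U k) (U (k + 1) x) x)
    (hV : ∀ k x, HasDerivAt (V k) (V (k + 1) x) x) {a b : ℝ} (N : ℕ)
    (ha : ∀ i < N, U i a * V (N - 1 - i) a = 0) (hb : ∀ i < N, U i b * V (N - 1 - i) b = 0) :
    ∫ x in a..b, U 0 x * V N x = (-1) ^ N * ∫ x in a..b, U N x * V 0 x := by
  have hUc : ∀ k, Continuous (U k) := fun k =>
    continuous_iff_continuousAt.2 fun x => (hU k x).continuousAt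
  have hVc : ∀ k, Continuous (V k) := fun k =>
    continuous_iff_continuousAt.2 fun x => (hV k x).continuousAt
  have key : ∀ j ≤ N, ∫ x in a..b, U 0 x * V N x =
      (-1) ^ j * ∫ x in a..b, U j x * V (N - j) x := by
    intro j
    induction j with
    | zero => intro _; simp
    | succ j ih =>
      intro hj
      rw [ih (by omega)]
      have h1 : N - j = (N - (j + 1)) + 1 := by omega
      have h2 := intervalIntegral.integral_mul_deriv_eq_deriv_mul (a := a) (b := b)
        (fun x _ => hU j x) (fun x _ => hV (N - (j + 1)) x)
        ((hUc (j + 1)).intervalIntegrable a b) ((hVc (N - (j + 1) + 1)).intervalIntegrable a b)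
      have h3 : N - (j + 1) = N - 1 - j := by omega
      rw [h1, h2, h3, ha j (by omega), hb j (by omega), pow_succ]
      ring
  simpa using key N le_rfl

open Polynomial in
/-- The derivatives of a real polynomial as a sequence of functions. -/
def polySeq (p : ℝ[X]) (k : ℕ) (x : ℝ) : ℂ := (((derivative^[k] p).eval x : ℝ) : ℂ)

open Polynomial in
lemma hasDerivAt_polySeq (p : ℝ[X]) (k : ℕ) (x : ℝ) :
    HasDerivAt (polySeq p k) (polySeq p (k + 1) x) x := by
  unfold polySeq
  rw [Function.iterate_succ_apply']
  exact ((derivative^[k] p).hasDerivAt x).ofReal_comp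

open Polynomial in
/-- The quadratic polynomial `(y - a)(b - y)`. -/
def chordPoly (a b : ℝ) : ℝ[X] := (X - C a) * (C b - X)

section chordPoly

open Polynomial

variable (a b : ℝ) (N : ℕ)

lemma eval_chordPoly (y : ℝ) : (chordPoly a b).eval y = (y - a) * (b - y) := by
  simp [chordPoly]

lemma eval_iterate_derivative_pow_of_root {Q : ℝ[X]} {c : ℝ} (h : Q.eval c = 0) {i N : ℕ}
    (hi : i < N) : (derivative^[i] (Q ^ N)).eval c = 0 := by
  have h1 := pow_sub_dvd_iterate_derivative_of_pow_dvd i (dvd_refl (Q ^ N))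
  have h2 : Q ∣ derivative^[i] (Q ^ N) := (dvd_pow_self Q (by omega)).trans h1
  obtain ⟨r, hr⟩ := h2
  rw [hr, eval_mul, h, zero_mul]

lemma natDegree_chordPoly_le : (chordPoly a b).natDegree ≤ 2 := by
  unfold chordPoly; compute_degree

lemma natDegree_chordPoly_pow_le : (chordPoly a b ^ N).natDegree ≤ N * 2 :=
  natDegree_pow_le_of_le N (natDegree_chordPoly_le a b)

lemma coeff_chordPoly : (chordPoly a b).coeff 2 = -1 := by
  unfold chordPoly
  have : (X - C a) * (C b - X) = -(X ^ 2) + C (a + b) * X - C (a * b) := by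
    simp only [C_add, C_mul]; ring
  rw [this]
  simp

lemma iterate_derivative_chordPoly_pow :
    derivative^[2 * N] (chordPoly a b ^ N) = C ((-1) ^ N * ((2 * N).factorial : ℝ)) := by
  have hd : (derivative^[2 * N] (chordPoly a b ^ N)).natDegree = 0 := by
    have h1 := natDegree_iterate_derivative (chordPoly a b ^ N) (2 * N)
    have h2 := natDegree_chordPoly_pow_le a b N
    omega
  rw [eq_C_of_natDegree_eq_zero hd, coeff_iterate_derivative, zero_add]
  congr 1
  rw [Nat.descFactorial_self, show 2 * N = N * 2 by ring,
    coeff_pow_of_natDegree_le (natDegree_chordPoly_le a b), coeff_chordPoly, nsmul_eq_mul]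
  ring

lemma iterate_derivative_chordPoly_pow_eq_zero {k : ℕ} (hk : 2 * N < k) :
    derivative^[k] (chordPoly a b ^ N) = 0 :=
  iterate_derivative_eq_zero (by have := natDegree_chordPoly_pow_le a b N; omega)

lemma polySeq_chordPoly_left {i : ℕ} (hi : i < N) : polySeq (chordPoly a b ^ N) i a = 0 := by
  rw [polySeq, eval_iterate_derivative_pow_of_root (by simp [eval_chordPoly]) hi, Complex.ofReal_zero]

lemma polySeq_chordPoly_right {i : ℕ} (hi : i < N) : polySeq (chordPoly a b ^ N) i b = 0 := by
  rw [polySeq, eval_iterate_derivative_pow_of_root (by simp [eval_chordPoly]) hi, Complex.ofReal_zero]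

lemma polySeq_chordPoly_zero (x : ℝ) :
    polySeq (chordPoly a b ^ N) 0 x = (((x - a) * (b - x)) ^ N : ℝ) := by
  simp [polySeq, eval_chordPoly]

lemma polySeq_chordPoly_top (x : ℝ) :
    polySeq (chordPoly a b ^ N) (2 * N) x = ((-1) ^ N * ((2 * N).factorial : ℝ) : ℝ) := by
  rw [polySeq, iterate_derivative_chordPoly_pow, eval_C]

lemma continuous_polySeq (p : ℝ[X]) (k : ℕ) : Continuous (polySeq p k) :=
  continuous_iff_continuousAt.2 fun x => (hasDerivAt_polySeq p k x).continuousAt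

end chordPoly

/-- The mass of the weight `(1 - x²)^N` on `[-1, 1]`. -/
def gegenMass (N : ℕ) : ℝ := ∫ x in (-1 : ℝ)..1, ((x + 1) * (1 - x)) ^ N

/-- By Bernoulli's inequality the weight is at least `1/2` on the interval `|x| ≤ δ`, where `δ` is
the asserted lower bound. -/
lemma le_gegenMass (N : ℕ) : (1 / 2) * (√(N + 1))⁻¹ ≤ gegenMass N := by
  set δ : ℝ := (1 / 2) * (√(N + 1))⁻¹ with hδ
  have hs : 1 ≤ √((N : ℝ) + 1) := Real.one_le_sqrt.2 (by simp)
  have hs2 : (√((N : ℝ) + 1)) ^ 2 = N + 1 := Real.sq_sqrt (by positivity)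
  have hδ0 : 0 < δ := by positivity
  have hδ1 : δ ≤ 1 / 2 := by
    have := inv_le_one_of_one_le₀ hs
    linarith
  have hδ2 : δ ^ 2 * (N + 1) = 1 / 4 := by
    rw [hδ, mul_pow, inv_pow, hs2]; field_simp; norm_num
  have h1 : ∫ x in (-δ)..δ, (1 / 2 : ℝ) ≤ ∫ x in (-δ)..δ, ((x + 1) * (1 - x)) ^ N := by
    refine intervalIntegral.integral_mono_on (by linarith) (by simp)
      (Continuous.intervalIntegrable (by fun_prop) _ _) fun x hx => ?_
    have hx2 : x ^ 2 ≤ δ ^ 2 := sq_le_sq' hx.1 hx.2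
    have h2 := one_add_mul_le_pow (a := -x ^ 2) (by nlinarith) N
    have h3 : (x + 1) * (1 - x) = 1 + -x ^ 2 := by ring
    rw [h3]
    have hN : (0 : ℝ) ≤ N := N.cast_nonneg
    nlinarith [mul_le_mul_of_nonneg_left hx2 hN, sq_nonneg δ]
  have h2 : ∫ x in (-δ)..δ, ((x + 1) * (1 - x)) ^ N ≤ gegenMass N := by
    refine intervalIntegral.integral_mono_interval (by linarith) (by linarith) (by linarith) ?_
      (Continuous.intervalIntegrable (by fun_prop) _ _)
    filter_upwards [ae_restrict_mem measurableSet_Ioc] with x hx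
    exact pow_nonneg (mul_nonneg (by linarith [hx.1]) (by linarith [hx.2])) N
  rw [intervalIntegral.integral_const, smul_eq_mul] at h1
  linarith

lemma gegenMass_pos (N : ℕ) : 0 < gegenMass N :=
  lt_of_lt_of_le (by positivity) (le_gegenMass N)

/-- The Fourier transform of the normalized weight `(1 - x²)^N` on `[-1, 1]`. -/
def gegenHat (N : ℕ) (s : ℝ) : ℂ :=
  ((gegenMass N)⁻¹ : ℝ) *
    ∫ x in (-1 : ℝ)..1, ((((x + 1) * (1 - x)) ^ N : ℝ) : ℂ) * Complex.exp (s * x * Complex.I)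

lemma norm_gegenHat_le (N : ℕ) (s : ℝ) : ‖gegenHat N s‖ ≤ 1 := by
  have h1 : ‖∫ x in (-1 : ℝ)..1, ((((x + 1) * (1 - x)) ^ N : ℝ) : ℂ) *
      Complex.exp (s * x * Complex.I)‖ ≤ gegenMass N := by
    refine (intervalIntegral.norm_integral_le_of_norm_le (g := fun x => ((x + 1) * (1 - x)) ^ N)
      (by norm_num) ?_ (Continuous.intervalIntegrable (by fun_prop) _ _))
    refine Filter.Eventually.of_forall fun x hx => ?_
    rw [norm_mul, ← Complex.ofReal_mul, Complex.norm_exp_ofReal_mul_I, mul_one, Complex.norm_real,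
      Real.norm_of_nonneg]
    exact pow_nonneg (mul_nonneg (by linarith [hx.1]) (by linarith [hx.2])) N
  rw [gegenHat, norm_mul, Complex.norm_real, Real.norm_of_nonneg (by positivity [gegenMass_pos N])]
  calc _ ≤ (gegenMass N)⁻¹ * gegenMass N := by
        have := gegenMass_pos N
        gcongr
    _ = 1 := inv_mul_cancel₀ (gegenMass_pos N).ne'

/-- As for Legendre polynomials: integrate by parts until all derivatives fall on one factor, whose
derivative of order `2N` is the constant `(-1)^N (2N)!`. -/
lemma integral_sq_iterate_derivative (N : ℕ) :
    ∫ x in (-1 : ℝ)..1, polySeq (chordPoly (-1) 1 ^ N) N x * polySeq (chordPoly (-1) 1 ^ N) N x =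
      ((2 * N).factorial * gegenMass N : ℝ) := by
  set U := polySeq (chordPoly (-1) 1 ^ N) with hU
  have h := integral_mul_eq_neg_one_pow (U := U) (V := fun k => U (N + k)) (a := -1) (b := 1)
    (hasDerivAt_polySeq _) (fun k x => hasDerivAt_polySeq _ (N + k) x) N
    (fun i hi => by rw [hU, polySeq_chordPoly_left _ _ _ hi, zero_mul])
    (fun i hi => by rw [hU, polySeq_chordPoly_right _ _ _ hi, zero_mul])
  simp only [add_zero] at h
  have h2 : (-1 : ℂ) ^ N * (-1) ^ N = 1 := by rw [← mul_pow]; simp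
  have h3 : ∫ x in (-1 : ℝ)..1, U N x * U N x =
      (-1) ^ N * ∫ x in (-1 : ℝ)..1, U 0 x * U (N + N) x := by
    rw [h, ← mul_assoc, h2, one_mul]
  rw [h3]
  have h4 : ∀ x, U 0 x * U (N + N) x =
      ((-1) ^ N * ((2 * N).factorial : ℝ) : ℝ) * ((((x + 1) * (1 - x)) ^ N : ℝ) : ℂ) := by
    intro x
    rw [← two_mul, hU, polySeq_chordPoly_top, polySeq_chordPoly_zero, sub_neg_eq_add]; ring
  simp_rw [h4]
  rw [intervalIntegral.integral_const_mul, intervalIntegral.integral_ofReal]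
  change _ * (_ * ((gegenMass N : ℝ) : ℂ)) = _
  push_cast
  rw [← mul_assoc, ← mul_assoc, h2, one_mul]

/-- Integration by parts `N` times against the exponential: multiplying the transform by `(is)^N`
amounts to differentiating the weight. -/
lemma pow_mul_gegenHat (N : ℕ) (s : ℝ) : ((s : ℂ) * Complex.I) ^ N * gegenHat N s =
    (-1) ^ N * (((gegenMass N)⁻¹ : ℝ) * ∫ x in (-1 : ℝ)..1,
      polySeq (chordPoly (-1) 1 ^ N) N x * Complex.exp (s * x * Complex.I)) := by
  have hV : ∀ (k : ℕ) (x : ℝ), HasDerivAt (fun x : ℝ => ((s : ℂ) * Complex.I) ^ k *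
      Complex.exp (s * x * Complex.I)) (((s : ℂ) * Complex.I) ^ (k + 1) *
      Complex.exp (s * x * Complex.I)) x := by
    intro k x
    have h1 : HasDerivAt (fun x : ℝ => (s : ℂ) * x * Complex.I) (s * Complex.I) x := by
      have := ((Complex.ofRealCLM.hasDerivAt (x := x)).const_mul (s : ℂ)).mul_const Complex.I
      simpa using this
    exact (h1.cexp.const_mul (((s : ℂ) * Complex.I) ^ k)).congr_deriv (by ring)
  have h := integral_mul_eq_neg_one_pow (a := -1) (b := 1)
    (hasDerivAt_polySeq (chordPoly (-1) 1 ^ N)) hV N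
    (fun i hi => by rw [polySeq_chordPoly_left _ _ _ hi, zero_mul])
    (fun i hi => by rw [polySeq_chordPoly_right _ _ _ hi, zero_mul])
  simp only [pow_zero, one_mul] at h
  rw [gegenHat, mul_left_comm, mul_left_comm _ (((gegenMass N)⁻¹ : ℝ) : ℂ), ← h]
  rw [← intervalIntegral.integral_const_mul ((s * Complex.I : ℂ) ^ N)]
  congr 1
  refine intervalIntegral.integral_congr fun x _ => ?_
  simp only [polySeq_chordPoly_zero, sub_neg_eq_add]
  ring

/-! ### A Plancherel inequality and weighted norms of the Gegenbauer transform. -/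

lemma ennreal_mul_le_sq_add_sq (a b : ℝ≥0∞) : a * b ≤ a ^ 2 + b ^ 2 := by
  rcases le_total a b with h | h
  · calc a * b ≤ b * b := by gcongr
      _ = b ^ 2 := (sq b).symm
      _ ≤ _ := le_add_self
  · calc a * b ≤ a * a := by gcongr
      _ = a ^ 2 := (sq a).symm
      _ ≤ _ := le_self_add

/-- A Schur test: after Gaussian regularization use `ab ≤ a² + b²` and the mass `(2π)^d` of the heat
kernel in either variable. The factor `2` is harmless. -/
lemma lintegral_ft_sq_le {d : ℕ} (S : Set (E d)) (hS : volume S ≠ ⊤) {w : E d → ℂ}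
    (hw : Measurable w) {C : ℝ} (hC : ∀ x, ‖w x‖ ≤ C) :
    ∫⁻ ξ, ‖ft (volume.restrict S) w ξ‖ₑ ^ 2 ≤
      ENNReal.ofReal (2 * (2 * Real.pi) ^ d) * ∫⁻ x in S, ‖w x‖ₑ ^ 2 := by
  have : IsFiniteMeasure (volume.restrict S) := ⟨by simpa using hS.lt_top⟩
  set μ := volume.restrict S with hμ
  refine lintegral_le_of_gauss _ ((measurable_ft μ hw).enorm.pow_const 2) fun τ hτ => ?_
  refine (lintegral_ft_sq_gauss_le μ hw hC hτ).trans ?_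
  have hheat : ∀ y, ∫⁻ x, ENNReal.ofReal (heat d τ (x - y)) ∂μ ≤
      ENNReal.ofReal ((2 * Real.pi) ^ d) := fun y =>
    (lintegral_mono' Measure.restrict_le_self le_rfl).trans (lintegral_heat hτ y).le
  have hsymm : ∀ x y : E d, heat d τ (x - y) = heat d τ (y - x) := fun x y => by
    rw [heat, heat, norm_sub_rev]
  have hm : Measurable fun p : E d × E d => ENNReal.ofReal (heat d τ (p.1 - p.2)) := by
    refine ENNReal.measurable_ofReal.comp ?_
    unfold heat
    exact Continuous.measurable (by fun_prop)
  have hm1 : ∀ x : E d, Measurable fun y => ENNReal.ofReal (heat d τ (x - y)) := by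
    intro x
    unfold heat
    exact ENNReal.measurable_ofReal.comp (Continuous.measurable (by fun_prop))
  have hm2 : ∀ x : E d, Measurable fun y => ENNReal.ofReal (heat d τ (y - x)) := by
    intro x
    unfold heat
    exact ENNReal.measurable_ofReal.comp (Continuous.measurable (by fun_prop))
  have hw2 : Measurable fun x => ‖w x‖ₑ ^ 2 := hw.enorm.pow_const 2
  calc _ ≤ ∫⁻ x, ∫⁻ y, (‖w x‖ₑ ^ 2 * ENNReal.ofReal (heat d τ (x - y)) +
        ‖w y‖ₑ ^ 2 * ENNReal.ofReal (heat d τ (x - y))) ∂μ ∂μ := by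
        gcongr with x y
        rw [← add_mul]
        gcongr
        exact ennreal_mul_le_sq_add_sq _ _
    _ = (∫⁻ x, ∫⁻ y, ‖w x‖ₑ ^ 2 * ENNReal.ofReal (heat d τ (x - y)) ∂μ ∂μ) +
        ∫⁻ x, ∫⁻ y, ‖w y‖ₑ ^ 2 * ENNReal.ofReal (heat d τ (x - y)) ∂μ ∂μ := by
        rw [← lintegral_add_left]
        · refine lintegral_congr fun x => ?_
          rw [lintegral_add_left]
          exact (hm1 x).const_mul _
        · exact Measurable.lintegral_prod_right' (f := fun p : E d × E d =>
            ‖w p.1‖ₑ ^ 2 * ENNReal.ofReal (heat d τ (p.1 - p.2)))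
            ((hw2.comp measurable_fst).mul hm)
    _ = (∫⁻ x, ‖w x‖ₑ ^ 2 * ∫⁻ y, ENNReal.ofReal (heat d τ (y - x)) ∂μ ∂μ) +
        ∫⁻ y, ‖w y‖ₑ ^ 2 * ∫⁻ x, ENNReal.ofReal (heat d τ (x - y)) ∂μ ∂μ := by
        congr 1
        · refine lintegral_congr fun x => ?_
          simp_rw [hsymm x]
          rw [lintegral_const_mul _ (hm2 x)]
        · rw [lintegral_lintegral_swap]
          · refine lintegral_congr fun y => ?_
            rw [lintegral_const_mul _ (hm2 y)]
          · exact ((hw2.comp measurable_snd).mul hm).aemeasurable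
    _ ≤ (∫⁻ x, ‖w x‖ₑ ^ 2 * ENNReal.ofReal ((2 * Real.pi) ^ d) ∂μ) +
        ∫⁻ y, ‖w y‖ₑ ^ 2 * ENNReal.ofReal ((2 * Real.pi) ^ d) ∂μ := by
        gcongr <;> exact hheat _
    _ = _ := by
        rw [lintegral_mul_const _ hw2, ← mul_add, ENNReal.ofReal_mul (by norm_num),
          ENNReal.ofReal_ofNat, mul_comm]
        rw [← two_mul]

/-- The identification of `ℝ` with `E 1`. -/
def lineEquiv : ℝ ≃ᵐ E 1 :=
  (MeasurableEquiv.funUnique (Fin 1) ℝ).symm.trans (MeasurableEquiv.toLp 2 (Fin 1 → ℝ))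

lemma measurePreserving_lineEquiv : MeasurePreserving lineEquiv volume volume :=
  (EuclideanSpace.volume_preserving_symm_measurableEquiv_toLp (Fin 1)).symm.comp
    (volume_preserving_funUnique (Fin 1) ℝ).symm

lemma inner_lineEquiv (x s : ℝ) : inner ℝ (lineEquiv x) (lineEquiv s) = s * x := by
  have h : ∀ x, (lineEquiv x) 0 = x := fun x => rfl
  rw [PiLp.inner_apply]
  simp [h]

lemma lintegral_exp_sq_le {g : ℝ → ℂ} (hg : Continuous g) (a b : ℝ) (hab : a ≤ b) :
    ∫⁻ s : ℝ, ‖∫ x in a..b, g x * Complex.exp (s * x * Complex.I)‖ₑ ^ 2 ≤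
      ENNReal.ofReal (4 * Real.pi) * ∫⁻ x in Ioc a b, ‖g x‖ₑ ^ 2 := by
  obtain ⟨C, hC⟩ := (isCompact_Icc (a := a) (b := b)).exists_bound_of_continuousOn hg.continuousOn
  set S : Set (E 1) := lineEquiv.symm ⁻¹' Ioc a b with hS
  set w : E 1 → ℂ := S.indicator fun y => g (lineEquiv.symm y) with hw
  have hSm : MeasurableSet S := lineEquiv.symm.measurable measurableSet_Ioc
  have hSv : volume S ≠ ⊤ := by
    rw [hS, measurePreserving_lineEquiv.symm.measure_preimage measurableSet_Ioc.nullMeasurableSet]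
    simp
  have hwm : Measurable w := (hg.measurable.comp lineEquiv.symm.measurable).indicator hSm
  have hC' : ∀ x, ‖w x‖ ≤ |C| := by
    intro x
    by_cases hx : x ∈ S
    · rw [hw, indicator_of_mem hx]
      exact (hC _ (Ioc_subset_Icc_self hx)).trans (le_abs_self C)
    · rw [hw, indicator_of_notMem hx, norm_zero]; positivity
  have hpre : lineEquiv ⁻¹' S = Ioc a b := by ext x; simp [hS]
  have h := lintegral_ft_sq_le S hSv hwm hC'
  have hft : ∀ s : ℝ, ft (volume.restrict S) w (lineEquiv s) =
      ∫ x in a..b, g x * Complex.exp (s * x * Complex.I) := by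
    intro s
    rw [ft, ← measurePreserving_lineEquiv.setIntegral_preimage_emb lineEquiv.measurableEmbedding,
      hpre, intervalIntegral.integral_of_le hab]
    refine setIntegral_congr_fun measurableSet_Ioc fun x hx => ?_
    have hx' : lineEquiv x ∈ S := by rw [← mem_preimage, hpre]; exact hx
    simp only [hw, indicator_of_mem hx', MeasurableEquiv.symm_apply_apply, inner_lineEquiv]
    push_cast; ring
  rw [← measurePreserving_lineEquiv.lintegral_comp_emb lineEquiv.measurableEmbedding,
    ← measurePreserving_lineEquiv.setLIntegral_comp_preimage_emb lineEquiv.measurableEmbedding,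
    hpre] at h
  simp_rw [hft] at h
  refine h.trans (le_of_eq ?_)
  congr 1
  · congr 1; ring
  · refine setLIntegral_congr_fun measurableSet_Ioc fun x hx => ?_
    have hx' : lineEquiv x ∈ S := by rw [← mem_preimage, hpre]; exact hx
    simp only [hw, indicator_of_mem hx', MeasurableEquiv.symm_apply_apply]

lemma norm_polySeq_sq (p : Polynomial ℝ) (k : ℕ) (x : ℝ) :
    ((‖polySeq p k x‖ ^ 2 : ℝ) : ℂ) = polySeq p k x * polySeq p k x := by
  rw [polySeq, Complex.norm_real, Real.norm_eq_abs, sq_abs]; push_cast; ring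

lemma lintegral_pow_mul_gegenHat_le (N : ℕ) :
    ∫⁻ s : ℝ, ENNReal.ofReal (|s| ^ (2 * N)) * ‖gegenHat N s‖ₑ ^ 2 ≤
      ENNReal.ofReal (4 * Real.pi * ((2 * N).factorial * (gegenMass N)⁻¹)) := by
  set U := polySeq (chordPoly (-1) 1 ^ N) with hU
  have hB := gegenMass_pos N
  have h0 : ∀ s : ℝ, ENNReal.ofReal (|s| ^ (2 * N)) * ‖gegenHat N s‖ₑ ^ 2 =
      ENNReal.ofReal ((gegenMass N)⁻¹) ^ 2 *
        ‖∫ x in (-1 : ℝ)..1, U N x * Complex.exp (s * x * Complex.I)‖ₑ ^ 2 := by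
    intro s
    have h1 := congrArg (fun z : ℂ => ‖z‖ₑ ^ 2) (pow_mul_gegenHat N s)
    simp only [enorm_mul, mul_pow, enorm_pow] at h1
    have h2 : ‖(s : ℂ)‖ₑ = ENNReal.ofReal |s| := by
      rw [← ofReal_norm, Complex.norm_real, Real.norm_eq_abs]
    have h3 : ‖Complex.I‖ₑ = 1 := by rw [← ofReal_norm]; simp
    have h4 : ‖(-1 : ℂ)‖ₑ = 1 := by rw [← ofReal_norm]; simp
    have h5 : ‖(((gegenMass N)⁻¹ : ℝ) : ℂ)‖ₑ = ENNReal.ofReal ((gegenMass N)⁻¹) := by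
      rw [← ofReal_norm, Complex.norm_real, Real.norm_of_nonneg (by positivity)]
    rw [h2, h3, h4, h5] at h1
    simp only [one_pow, mul_one, one_mul] at h1
    rw [← h1, ENNReal.ofReal_pow (abs_nonneg s), ← pow_mul, mul_comm 2 N]
  simp_rw [h0]
  rw [lintegral_const_mul' _ _ (by finiteness)]
  have h6 : ∫⁻ x in Ioc (-1 : ℝ) 1, ‖U N x‖ₑ ^ 2 =
      ENNReal.ofReal ((2 * N).factorial * gegenMass N) := by
    have h7 := integral_sq_iterate_derivative N
    simp_rw [← norm_polySeq_sq] at h7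
    rw [intervalIntegral.integral_ofReal] at h7
    have h8 := Complex.ofReal_injective h7
    rw [← h8, intervalIntegral.integral_of_le (by norm_num),
      ofReal_integral_eq_lintegral_ofReal]
    · refine lintegral_congr fun x => ?_
      rw [ENNReal.ofReal_pow (norm_nonneg _), ofReal_norm]
    · exact ((continuous_polySeq _ N).norm.pow 2).integrableOn_Ioc
    · exact Filter.Eventually.of_forall fun x => by positivity
  calc _ ≤ ENNReal.ofReal ((gegenMass N)⁻¹) ^ 2 * (ENNReal.ofReal (4 * Real.pi) *
        ENNReal.ofReal ((2 * N).factorial * gegenMass N)) := by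
        rw [← h6]
        gcongr
        exact lintegral_exp_sq_le (continuous_polySeq _ N) (-1) 1 (by norm_num)
    _ = _ := by
        rw [← ENNReal.ofReal_pow (by positivity), ← ENNReal.ofReal_mul (by positivity),
          ← ENNReal.ofReal_mul (by positivity)]
        congr 1
        field_simp

lemma lintegral_abs_rpow_le {κ c : ℝ} (hκ : 0 ≤ κ) (hc : 0 ≤ c) :
    ∫⁻ s in Icc (-c) c, ENNReal.ofReal (|s| ^ κ) ≤ ENNReal.ofReal (c ^ κ * (2 * c)) := by
  calc _ ≤ ∫⁻ s in Icc (-c) c, ENNReal.ofReal (c ^ κ) := by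
        refine setLIntegral_mono measurable_const fun s hs => ENNReal.ofReal_le_ofReal ?_
        exact Real.rpow_le_rpow (abs_nonneg s) (abs_le.2 hs) hκ
    _ = _ := by
        rw [setLIntegral_const, Real.volume_Icc, ← ENNReal.ofReal_mul (by positivity)]
        congr 2; ring

/-- Crude Stirling: `(1+1/N)^(2N) ≤ e²` and `(2N)^(2N) ≤ (2N)! e^(2N)`. There is room for `√(N+1) ≤
2^N` because `e² · (1/4) · (1/4) · 2 < 1`. -/
lemma succ_rpow_le_factorial {N : ℕ} (hN : 1 ≤ N) :
    ((N : ℝ) + 1) ^ (2 * N) * (1 / 4) ^ N * √(N + 1) ≤ 8 * (2 * N).factorial := by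
  have hN0 : (0 : ℝ) < N := by exact_mod_cast hN
  have he := Real.exp_one_lt_d9
  have he0 := Real.exp_pos 1
  -- `(1 + 1/N)^(2N) ≤ e²`
  have h1 : ((N : ℝ) + 1) ^ (2 * N) ≤ (N : ℝ) ^ (2 * N) * Real.exp 1 ^ 2 := by
    have h2 : ((N : ℝ) + 1) ≤ N * Real.exp (1 / N) := by
      have := Real.add_one_le_exp (1 / (N : ℝ))
      calc (N : ℝ) + 1 = N * (1 / N + 1) := by field_simp; ring
        _ ≤ _ := by gcongr
    calc _ ≤ (N * Real.exp (1 / N)) ^ (2 * N) := by gcongr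
      _ = (N : ℝ) ^ (2 * N) * Real.exp 1 ^ 2 := by
        rw [mul_pow, ← Real.exp_nat_mul, ← Real.exp_nat_mul]
        congr 2; push_cast; field_simp
  have h3 : ((2 * N : ℕ) : ℝ) ^ (2 * N) ≤ (2 * N).factorial * Real.exp 1 ^ (2 * N) := by
    have := Real.pow_div_factorial_le_exp ((2 * N : ℕ) : ℝ) (by positivity) (2 * N)
    rw [div_le_iff₀ (by positivity)] at this
    rw [← Real.exp_nat_mul, mul_one]; linarith
  have h4 : √((N : ℝ) + 1) ≤ 2 ^ N := by
    have h5 : ((N : ℝ) + 1) ≤ 2 ^ N := by exact_mod_cast Nat.lt_two_pow_self (n := N)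
    refine Real.sqrt_le_iff.2 ⟨by positivity, h5.trans ?_⟩
    have : (1 : ℝ) ≤ 2 ^ N := one_le_pow₀ (by norm_num)
    nlinarith
  have h6 : (Real.exp 1 ^ 2) ≤ 8 := by nlinarith
  have h7 : (Real.exp 1 ^ 2) ^ N * (1 / 4) ^ N * (1 / 4) ^ N * 2 ^ N ≤ 1 := by
    rw [← mul_pow, ← mul_pow, ← mul_pow]
    exact pow_le_one₀ (by positivity) (by nlinarith)
  have h8 : (N : ℝ) ^ (2 * N) = (1 / 4) ^ N * ((2 * N : ℕ) : ℝ) ^ (2 * N) := by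
    push_cast
    rw [mul_pow, pow_mul 2 2 N, ← mul_assoc, ← mul_pow]; norm_num
  calc _ ≤ ((N : ℝ) ^ (2 * N) * Real.exp 1 ^ 2) * (1 / 4) ^ N * 2 ^ N := by gcongr
    _ ≤ ((1 / 4) ^ N * ((2 * N).factorial * Real.exp 1 ^ (2 * N)) * Real.exp 1 ^ 2) *
        (1 / 4) ^ N * 2 ^ N := by rw [h8]; gcongr
    _ = ((Real.exp 1 ^ 2) ^ N * (1 / 4) ^ N * (1 / 4) ^ N * 2 ^ N) * Real.exp 1 ^ 2 *
        (2 * N).factorial := by rw [pow_mul (Real.exp 1) 2 N]; ring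
    _ ≤ 1 * 8 * (2 * N).factorial := by gcongr
    _ = _ := by ring

/-- For large `|s|` the power `κ` is compared with `2N`, where the norm is known from
`lintegral_pow_mul_gegenHat_le`; for small `|s|` the transform is bounded by `1` and the polynomial
growth is beaten by `(2N)!`. -/
lemma lintegral_rpow_mul_gegenHat_le {N : ℕ} (hN : 1 ≤ N) {κ : ℝ} (h1 : 2 * (N : ℝ) - 2 ≤ κ)
    (h2 : κ ≤ 2 * N) :
    ∫⁻ s : ℝ, ENNReal.ofReal (|s| ^ κ) * ‖gegenHat N s‖ₑ ^ 2 ≤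
      ENNReal.ofReal ((32 * Real.pi + 32) *
        ((2 * N).factorial * √(N + 1) * ((N : ℝ) + 1) ^ (κ - 2 * N))) := by
  set M : ℝ := N + 1 with hM
  have hN0 : (1 : ℝ) ≤ N := by exact_mod_cast hN
  have hM0 : 0 < M := by positivity
  have hB := gegenMass_pos N
  -- The threshold: small enough for `c^(2N)` to be dominated by `(2N)!`, and comparable to `N + 1`,
  -- so that `c^(κ-2N)` loses at most `4`, since `-2 ≤ κ - 2N ≤ 0`.
  set c : ℝ := M / 2 with hc
  have hc0 : 0 < c := by positivity
  have hc4 : c ^ (κ - 2 * N) ≤ 4 * M ^ (κ - 2 * N) := by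
    rw [hc, Real.div_rpow hM0.le (by norm_num), div_le_iff₀ (by positivity)]
    have h3 : (1 : ℝ) ≤ 4 * 2 ^ (κ - 2 * N) := by
      have : (4 : ℝ) = 2 ^ (2 : ℝ) := by norm_num
      rw [this, ← Real.rpow_add (by norm_num)]
      exact Real.one_le_rpow (by norm_num) (by linarith)
    have h4 : 0 < M ^ (κ - 2 * N) := by positivity
    nlinarith
  rw [← lintegral_add_compl _ (measurableSet_Icc (a := -c) (b := c))]
  have hlow : ∫⁻ s in Icc (-c) c, ENNReal.ofReal (|s| ^ κ) * ‖gegenHat N s‖ₑ ^ 2 ≤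
      ENNReal.ofReal (32 * ((2 * N).factorial * √M * M ^ (κ - 2 * N))) := by
    calc _ ≤ ∫⁻ s in Icc (-c) c, ENNReal.ofReal (|s| ^ κ) := by
          refine lintegral_mono fun s => ?_
          have : ‖gegenHat N s‖ₑ ≤ 1 := by
            rw [← ofReal_norm]; exact ENNReal.ofReal_le_one.2 (norm_gegenHat_le N s)
          calc _ ≤ ENNReal.ofReal (|s| ^ κ) * 1 ^ 2 := by gcongr
            _ = _ := by ring
      _ ≤ ENNReal.ofReal (c ^ κ * (2 * c)) := lintegral_abs_rpow_le (by linarith) hc0.le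
      _ ≤ _ := by
          refine ENNReal.ofReal_le_ofReal ?_
          have h5 := succ_rpow_le_factorial hN
          rw [← hM] at h5
          have h6 : c ^ κ = c ^ (κ - 2 * N) * (M ^ (2 * N) * (1 / 4) ^ N) := by
            have : c ^ κ = c ^ (κ - 2 * N) * c ^ ((2 * N : ℕ) : ℝ) := by
              rw [← Real.rpow_add hc0]; congr 1; push_cast; ring
            rw [this, Real.rpow_natCast, hc, div_pow, pow_mul 2 2 N]
            congr 1
            rw [div_eq_mul_inv, one_div, inv_pow]; norm_num
          have h7 : 2 * c = √M * √M := by rw [Real.mul_self_sqrt hM0.le, hc]; ring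
          rw [h6, h7]
          calc _ = c ^ (κ - 2 * N) * (M ^ (2 * N) * (1 / 4) ^ N * √M) * √M := by ring
            _ ≤ (4 * M ^ (κ - 2 * N)) * (8 * (2 * N).factorial) * √M := by gcongr
            _ = _ := by ring
  have hhigh : ∫⁻ s in (Icc (-c) c)ᶜ, ENNReal.ofReal (|s| ^ κ) * ‖gegenHat N s‖ₑ ^ 2 ≤
      ENNReal.ofReal (32 * Real.pi * ((2 * N).factorial * √M * M ^ (κ - 2 * N))) := by
    calc _ ≤ ∫⁻ s in (Icc (-c) c)ᶜ, ENNReal.ofReal (c ^ (κ - 2 * N)) *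
          (ENNReal.ofReal (|s| ^ (2 * N)) * ‖gegenHat N s‖ₑ ^ 2) := by
          refine setLIntegral_mono' measurableSet_Icc.compl fun s hs => ?_
          rw [← mul_assoc, ← ENNReal.ofReal_mul (by positivity)]
          gcongr
          have hs' : c ≤ |s| := by
            by_contra hlt
            exact hs (abs_le.1 (not_le.1 hlt).le)
          have hs0 : 0 < |s| := hc0.trans_le hs'
          calc |s| ^ κ = |s| ^ (κ - 2 * N) * |s| ^ ((2 * N : ℕ) : ℝ) := by
                rw [← Real.rpow_add hs0]; congr 1; push_cast; ring
            _ ≤ c ^ (κ - 2 * N) * |s| ^ (2 * N) := by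
                rw [Real.rpow_natCast]
                gcongr ?_ * _
                exact Real.rpow_le_rpow_of_nonpos hc0 hs' (by linarith)
      _ ≤ ENNReal.ofReal (c ^ (κ - 2 * N)) *
          ENNReal.ofReal (4 * Real.pi * ((2 * N).factorial * (gegenMass N)⁻¹)) := by
          rw [lintegral_const_mul' _ _ ENNReal.ofReal_ne_top]
          gcongr
          exact (setLIntegral_le_lintegral _ _).trans (lintegral_pow_mul_gegenHat_le N)
      _ ≤ _ := by
          rw [← ENNReal.ofReal_mul (by positivity)]
          refine ENNReal.ofReal_le_ofReal ?_
          have h8 : (gegenMass N)⁻¹ ≤ 2 * √M := by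
            have h9 := inv_anti₀ (by positivity) (le_gegenMass N)
            rw [mul_inv, inv_inv] at h9
            norm_num at h9
            exact h9
          have hpi := Real.pi_pos
          calc _ ≤ (4 * M ^ (κ - 2 * N)) * (4 * Real.pi * ((2 * N).factorial * (2 * √M))) := by
                gcongr
            _ = _ := by ring
  refine (add_le_add hlow hhigh).trans ?_
  rw [← ENNReal.ofReal_add (by positivity) (by positivity)]
  refine ENNReal.ofReal_le_ofReal (le_of_eq (by ring))

/-! ### A representation formula on a chord -/

/-- The derivatives of the difference quotient `(F y - F 0) / y`, in terms of the derivatives `F k`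
of `F`. -/
def quotSeq (F : ℕ → ℝ → ℂ) (k : ℕ) (y : ℝ) : ℂ := ∫ ρ in (0 : ℝ)..1, (ρ : ℂ) ^ k * F (k + 1) (ρ * y)

section quotSeq

variable {F : ℕ → ℝ → ℂ} (hF : ∀ k x, HasDerivAt (F k) (F (k + 1) x) x)

include hF

lemma continuous_of_hasDerivAt_seq (k : ℕ) : Continuous (F k) :=
  continuous_iff_continuousAt.2 fun x => (hF k x).continuousAt

lemma hasDerivAt_quotSeq (k : ℕ) (y : ℝ) :
    HasDerivAt (quotSeq F k) (quotSeq F (k + 1) y) y := by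
  have hc := continuous_of_hasDerivAt_seq hF
  have h1 := hc (k + 1)
  have h2 := hc (k + 2)
  obtain ⟨C, hC⟩ := (isCompact_closedBall (0 : ℝ) (|y| + 1)).exists_bound_of_continuousOn
    h2.continuousOn
  refine (intervalIntegral.hasDerivAt_integral_of_dominated_loc_of_deriv_le (μ := volume)
    (F := fun (y ρ : ℝ) => (ρ : ℂ) ^ k * F (k + 1) (ρ * y))
    (F' := fun (y ρ : ℝ) => (ρ : ℂ) ^ (k + 1) * F (k + 2) (ρ * y)) (bound := fun _ => C)
    (Metric.ball_mem_nhds y one_pos) ?_ ?_ ?_ ?_ ?_ ?_).2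
  · exact Filter.Eventually.of_forall fun z =>
      (Continuous.aestronglyMeasurable (by fun_prop))
  · exact Continuous.intervalIntegrable (by fun_prop) _ _
  · exact Continuous.aestronglyMeasurable (by fun_prop)
  · refine Filter.Eventually.of_forall fun ρ hρ z hz => ?_
    rw [uIoc_of_le zero_le_one] at hρ
    have hz' : |z| ≤ |y| + 1 := by
      have := abs_sub_abs_le_abs_sub z y
      have h3 : |z - y| < 1 := by simpa [Real.dist_eq] using hz
      linarith
    have h4 : ‖F (k + 2) (ρ * z)‖ ≤ C := by
      refine hC _ ?_
      rw [mem_closedBall_zero_iff, Real.norm_eq_abs, abs_mul, abs_of_pos hρ.1]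
      nlinarith [abs_nonneg z, hρ.2]
    rw [norm_mul, norm_pow, Complex.norm_real, Real.norm_of_nonneg hρ.1.le]
    have h5 : ρ ^ (k + 1) ≤ 1 := pow_le_one₀ hρ.1.le hρ.2
    have h6 : 0 ≤ ρ ^ (k + 1) := by have := hρ.1.le; positivity
    nlinarith [norm_nonneg (F (k + 2) (ρ * z))]
  · simp
  · refine Filter.Eventually.of_forall fun ρ _ z _ => ?_
    have h3 : HasDerivAt (fun z => F (k + 1) (ρ * z)) (ρ • F (k + 2) (ρ * z)) z := by
      have h4 : HasDerivAt (fun z : ℝ => ρ * z) ρ z := by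
        simpa using (hasDerivAt_id z).const_mul ρ
      exact HasDerivAt.scomp z (hF (k + 1) (ρ * z)) h4
    refine (h3.const_mul ((ρ : ℂ) ^ k)).congr_deriv ?_
    rw [Complex.real_smul]; ring

/-- The derivative of order `k + 1` of `y q(y) = F(y) - F(0)`, obtained by integrating a derivative
in `ρ` so that `y = 0` needs no separate treatment. -/
lemma quotSeq_relation (k : ℕ) (y : ℝ) :
    (y : ℂ) * quotSeq F (k + 1) y + (k + 1) * quotSeq F k y = F (k + 1) y := by
  have hc := continuous_of_hasDerivAt_seq hF
  have h1 := hc (k + 1)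
  have h2 := hc (k + 2)
  have hd : ∀ ρ : ℝ, HasDerivAt (fun ρ : ℝ => (ρ : ℂ) ^ (k + 1) * F (k + 1) (ρ * y))
      ((k + 1) * ((ρ : ℂ) ^ k * F (k + 1) (ρ * y)) +
        y * ((ρ : ℂ) ^ (k + 1) * F (k + 2) (ρ * y))) ρ := by
    intro ρ
    have h3 : HasDerivAt (fun ρ : ℝ => F (k + 1) (ρ * y)) (y • F (k + 2) (ρ * y)) ρ := by
      have h4 : HasDerivAt (fun ρ : ℝ => ρ * y) y ρ := by
        simpa using (hasDerivAt_id ρ).mul_const y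
      exact HasDerivAt.scomp ρ (hF (k + 1) (ρ * y)) h4
    have h5 : HasDerivAt (fun ρ : ℝ => (ρ : ℂ) ^ (k + 1)) ((k + 1 : ℕ) * (ρ : ℂ) ^ k) ρ := by
      have := (Complex.ofRealCLM.hasDerivAt (x := ρ)).fun_pow (k + 1)
      simpa using this
    refine (h5.mul h3).congr_deriv ?_
    rw [Complex.real_smul]; push_cast; ring
  have h := intervalIntegral.integral_eq_sub_of_hasDerivAt (a := 0) (b := 1) (fun ρ _ => hd ρ)
    (Continuous.intervalIntegrable (by fun_prop) _ _)
  rw [intervalIntegral.integral_add (Continuous.intervalIntegrable (by fun_prop) _ _)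
    (Continuous.intervalIntegrable (by fun_prop) _ _), intervalIntegral.integral_const_mul,
    intervalIntegral.integral_const_mul] at h
  simp only [Complex.ofReal_one, one_pow, one_mul, Complex.ofReal_zero, ne_eq, Nat.succ_ne_zero,
    not_false_eq_true, zero_pow, zero_mul, sub_zero] at h
  rw [← h]
  simp only [quotSeq]
  ring

lemma mul_quotSeq_zero (y : ℝ) : (y : ℂ) * quotSeq F 0 y = F 0 y - F 0 0 := by
  have h1 := continuous_of_hasDerivAt_seq hF 1
  have hd : ∀ ρ : ℝ, HasDerivAt (fun ρ : ℝ => F 0 (ρ * y)) (y * F 1 (ρ * y)) ρ := by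
    intro ρ
    have h4 : HasDerivAt (fun ρ : ℝ => ρ * y) y ρ := by
      simpa using (hasDerivAt_id ρ).mul_const y
    refine (HasDerivAt.scomp ρ (hF 0 (ρ * y)) h4).congr_deriv ?_
    rw [Complex.real_smul]
  have h := intervalIntegral.integral_eq_sub_of_hasDerivAt (a := 0) (b := 1) (fun ρ _ => hd ρ)
    (Continuous.intervalIntegrable (by fun_prop) _ _)
  rw [intervalIntegral.integral_const_mul] at h
  simpa [quotSeq] using h

/-- Division by `y` does not lower the order of vanishing away from the origin, provided that `F(0)
= 0`. -/
lemma quotSeq_eq_zero {y : ℝ} (hy : y ≠ 0) (h0 : F 0 0 = 0) {m : ℕ} (hm : ∀ k < m, F k y = 0) :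
    ∀ k < m, quotSeq F k y = 0 := by
  have hy' : (y : ℂ) ≠ 0 := by exact_mod_cast hy
  intro k
  induction k with
  | zero =>
    intro hk
    have := mul_quotSeq_zero hF y
    rw [hm 0 hk, h0, sub_zero] at this
    exact (mul_eq_zero.1 this).resolve_left hy'
  | succ k ih =>
    intro hk
    have := quotSeq_relation hF k y
    rw [ih (by omega), hm (k + 1) hk, mul_zero, add_zero] at this
    exact (mul_eq_zero.1 this).resolve_left hy'

end quotSeq

/-- A function which vanishes to infinite order at both end points of a chord around `0` is
determined at `0` by its derivative of order `2 (N + 1)`. -/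
lemma integral_mul_quotSeq {F : ℕ → ℝ → ℂ} (hF : ∀ k x, HasDerivAt (F k) (F (k + 1) x) x)
    {a b : ℝ} (ha : a < 0) (hb : 0 < b) (hFa : ∀ k, F k a = 0) (hFb : ∀ k, F k b = 0) (N : ℕ) :
    (∫ y in a..b, ((((y - a) * (b - y)) ^ N : ℝ) : ℂ)) * F 0 0 =
      ((a * b) ^ (N + 1) / (2 * (N + 1)).factorial * (2 * (N + 1)) : ℝ) *
        ∫ y in a..b, ((((y - a) * (b - y)) ^ N : ℝ) : ℂ) * quotSeq F (2 * N + 1) y := by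
  set U := polySeq (chordPoly a b ^ N) with hU
  set P := polySeq (chordPoly a b ^ (N + 1)) with hP
  have hUd : ∀ k x, HasDerivAt (U k) (U (k + 1) x) x := hasDerivAt_polySeq _
  have hPd : ∀ k x, HasDerivAt (P k) (P (k + 1) x) x := hasDerivAt_polySeq _
  have hU0 : ∀ y, U 0 y = ((((y - a) * (b - y)) ^ N : ℝ) : ℂ) := polySeq_chordPoly_zero a b N
  have hab : (-(a * b : ℂ)) ≠ 0 := by
    have : a * b ≠ 0 := mul_ne_zero ha.ne hb.ne'
    exact neg_ne_zero.2 (by exact_mod_cast this)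
  have hP0 : P 0 0 = (-(a * b : ℂ)) ^ (N + 1) := by
    rw [hP, polySeq_chordPoly_zero]; push_cast; ring
  -- Subtracting `c ((y-a)(b-y))^(N+1)` makes the function vanish at `0` while keeping zeros of
  -- order `N + 1` at the ends, so its quotient by `y` vanishes there to the same order. The
  -- derivative of order `2N + 2` of the subtracted polynomial is constant, which will isolate `F 0
  -- 0`.
  obtain ⟨c, hc⟩ : ∃ c, F 0 0 = c * (-(a * b : ℂ)) ^ (N + 1) :=
    ⟨F 0 0 / (-(a * b : ℂ)) ^ (N + 1), by field_simp⟩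
  set G : ℕ → ℝ → ℂ := fun k y => F k y - c * P k y with hG
  have hGd : ∀ k x, HasDerivAt (G k) (G (k + 1) x) x := fun k x =>
    (hF k x).sub ((hPd k x).const_mul c)
  have hG0 : G 0 0 = 0 := by rw [hG]; simp only; rw [hc, hP0, sub_self]
  have hGa : ∀ k < N + 1, quotSeq G k a = 0 := quotSeq_eq_zero hGd ha.ne hG0 fun k hk => by
    rw [hG]; simp only; rw [hFa, hP, polySeq_chordPoly_left _ _ _ hk, mul_zero, sub_zero]
  have hGb : ∀ k < N + 1, quotSeq G k b = 0 := quotSeq_eq_zero hGd hb.ne' hG0 fun k hk => by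
    rw [hG]; simp only; rw [hFb, hP, polySeq_chordPoly_right _ _ _ hk, mul_zero, sub_zero]
  -- All `2N + 1` derivatives are moved onto a polynomial of degree at most `2N`, so the integral is
  -- zero. In the boundary terms the polynomial factor vanishes for `i < N`; for `i ≥ N` the
  -- quotient carries `2N - i < N + 1` derivatives and vanishes.
  have hibp := integral_mul_eq_neg_one_pow hUd (hasDerivAt_quotSeq hGd) (a := a) (b := b)
    (2 * N + 1) (fun i hi => ?_) (fun i hi => ?_)
  rotate_left
  · rcases lt_or_ge i N with h | h
    · rw [hU, polySeq_chordPoly_left _ _ _ h, zero_mul]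
    · rw [hGa _ (by omega), mul_zero]
  · rcases lt_or_ge i N with h | h
    · rw [hU, polySeq_chordPoly_right _ _ _ h, zero_mul]
    · rw [hGb _ (by omega), mul_zero]
  have hUtop : ∀ x, U (2 * N + 1) x = 0 := fun x => by
    rw [hU, polySeq, iterate_derivative_chordPoly_pow_eq_zero _ _ _ (by omega)]; simp
  simp_rw [hUtop, zero_mul, intervalIntegral.integral_zero, mul_zero] at hibp
  have hFc := continuous_of_hasDerivAt_seq hF (2 * N + 2)
  have hUc := continuous_of_hasDerivAt_seq hUd 0
  have hψc : Continuous (quotSeq F (2 * N + 1)) :=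
    continuous_of_hasDerivAt_seq (hasDerivAt_quotSeq hF) _
  have hquot : ∀ y, quotSeq G (2 * N + 1) y = quotSeq F (2 * N + 1) y -
      c * ((-1) ^ (N + 1) * ((2 * (N + 1)).factorial : ℝ) / (2 * (N + 1) : ℝ) : ℝ) := by
    intro y
    have hPt : ∀ x, P (2 * N + 1 + 1) x = ((-1) ^ (N + 1) * ((2 * (N + 1)).factorial : ℝ) : ℝ) :=
      fun x => polySeq_chordPoly_top a b (N + 1) x
    have h1 : ∫ ρ in (0 : ℝ)..1, (ρ : ℂ) ^ (2 * N + 1) = 1 / (2 * (N + 1)) := by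
      have : ∫ ρ in (0 : ℝ)..1, (ρ : ℂ) ^ (2 * N + 1) = ((∫ ρ in (0 : ℝ)..1, ρ ^ (2 * N + 1) : ℝ) : ℂ) := by
        rw [← intervalIntegral.integral_ofReal]; push_cast; rfl
      rw [this, integral_pow]; push_cast
      simp only [one_pow, ne_eq, Nat.succ_ne_zero, not_false_eq_true, zero_pow, sub_zero]
      congr 1; ring
    simp only [quotSeq, hG, hPt, mul_sub]
    rw [intervalIntegral.integral_sub (Continuous.intervalIntegrable (by fun_prop) _ _)
      (Continuous.intervalIntegrable (by fun_prop) _ _), intervalIntegral.integral_mul_const, h1]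
    push_cast; ring
  simp_rw [hquot, mul_sub] at hibp
  rw [intervalIntegral.integral_sub (Continuous.intervalIntegrable (by fun_prop) _ _)
    (Continuous.intervalIntegrable (by fun_prop) _ _), intervalIntegral.integral_mul_const,
    sub_eq_zero] at hibp
  simp_rw [← hU0]
  rw [hibp, hc]
  have hf : (((2 * (N + 1)).factorial : ℝ) : ℂ) ≠ 0 := by
    exact_mod_cast Nat.factorial_ne_zero _
  have hN : ((N : ℂ) + 1) ≠ 0 := by exact_mod_cast Nat.succ_ne_zero N
  have hs : (-(a * b : ℂ)) ^ (N + 1) = (-1) ^ (N + 1) * (a * b) ^ (N + 1) := by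
    rw [← mul_pow]; ring
  rw [hs]
  push_cast at hf ⊢
  field_simp

/-! ### Averages over directions -/

/-- The integral of `(1 + |y|²)^(-q/2)` over `ℝⁿ`. -/
def bracketInt (n : ℕ) (q : ℝ) : ℝ≥0∞ := ∫⁻ y : E n, ENNReal.ofReal ((1 + ‖y‖ ^ 2) ^ (-q / 2))

lemma bracketInt_anti {n : ℕ} {p q : ℝ} (h : p ≤ q) : bracketInt n q ≤ bracketInt n p := by
  refine lintegral_mono fun y => ENNReal.ofReal_le_ofReal ?_
  exact Real.rpow_le_rpow_of_exponent_le (by nlinarith [norm_nonneg y]) (by linarith)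

/-- Bernoulli's inequality compares the integrand with a fixed integrable one, of exponent `2(n+1)`,
evaluated at `y √(q/(2(n+1)))`; scaling produces `q^(-n/2)`. -/
lemma exists_bracketInt_le (n : ℕ) : ∃ K : ℝ≥0, ∀ q : ℝ, 2 * ((n : ℝ) + 1) ≤ q →
    bracketInt n q ≤ K * ENNReal.ofReal (q ^ (-(n : ℝ) / 2)) := by
  have hfin : ∫⁻ y : E n, ENNReal.ofReal ((1 + ‖y‖ ^ 2) ^ (-(2 * ((n : ℝ) + 1)) / 2)) ≠ ⊤ := by
    have h := integrable_rpow_neg_one_add_norm_sq (E := E n) (μ := volume) (r := 2 * ((n : ℝ) + 1))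
      (by simp; linarith)
    exact (h.lintegral_lt_top).ne
  obtain ⟨J, hJ⟩ : ∃ J : ℝ≥0, ∫⁻ y : E n,
      ENNReal.ofReal ((1 + ‖y‖ ^ 2) ^ (-(2 * ((n : ℝ) + 1)) / 2)) = J :=
    ⟨_, (ENNReal.coe_toNNReal hfin).symm⟩
  set p : ℝ := (n : ℝ) + 1 with hp
  have hp0 : 0 < p := by positivity
  refine ⟨J * ((2 * p) ^ ((n : ℝ) / 2)).toNNReal, fun q hq => ?_⟩
  have hq0 : 0 < q := by linarith
  set r : ℝ := √(q / (2 * p)) with hr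
  have hr0 : 0 < r := Real.sqrt_pos.2 (by positivity)
  have hr2 : r ^ 2 = q / (2 * p) := Real.sq_sqrt (by positivity)
  have hpt : ∀ y : E n, (1 + ‖y‖ ^ 2) ^ (-q / 2) ≤ (1 + ‖r • y‖ ^ 2) ^ (-(2 * p) / 2) := by
    intro y
    have h1 : 1 ≤ q / (2 * p) := by rw [le_div_iff₀ (by positivity)]; linarith
    have h2 := one_add_mul_self_le_rpow_one_add (s := ‖y‖ ^ 2) (by nlinarith [norm_nonneg y]) h1
    have h3 : (1 + ‖y‖ ^ 2) ^ (-q / 2) = ((1 + ‖y‖ ^ 2) ^ (q / (2 * p))) ^ (-(2 * p) / 2) := by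
      rw [← Real.rpow_mul (by positivity)]; congr 1; field_simp
    rw [h3, norm_smul, mul_pow, Real.norm_of_nonneg hr0.le, hr2]
    exact Real.rpow_le_rpow_of_nonpos (by positivity) h2 (by linarith)
  calc bracketInt n q ≤ ∫⁻ y : E n, ENNReal.ofReal ((1 + ‖r • y‖ ^ 2) ^ (-(2 * p) / 2)) :=
        lintegral_mono fun y => ENNReal.ofReal_le_ofReal (hpt y)
    _ = ENNReal.ofReal (r ^ (-(n : ℝ))) * J := by
        rw [lintegral_comp_smul_pos (fun y : E n => ENNReal.ofReal ((1 + ‖y‖ ^ 2) ^ (-(2 * p) / 2)))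
          hr0, hJ]
    _ = _ := by
        have h4 : r ^ (-(n : ℝ)) = (2 * p) ^ ((n : ℝ) / 2) * q ^ (-(n : ℝ) / 2) := by
          rw [hr, Real.sqrt_eq_rpow, ← Real.rpow_mul (by positivity),
            Real.div_rpow (by positivity) (by positivity), div_eq_mul_inv,
            ← Real.rpow_neg (by positivity), mul_comm]
          congr 2 <;> ring
        rw [h4, ENNReal.ofReal_mul (by positivity)]
        push_cast
        simp only [ENNReal.ofReal]
        ring

lemma norm_mkPt_sq {n : ℕ} (x : E n) (t : ℝ) : ‖mkPt x t‖ ^ 2 = ‖x‖ ^ 2 + t ^ 2 := by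
  rw [norm_sq_eq_space_time, spacePart_mkPt, timePart_mkPt]

lemma lintegral_norm_mkPt_rpow {n : ℕ} {t : ℝ} (ht : t ≠ 0) (p : ℝ) :
    ∫⁻ x : E n, ENNReal.ofReal (‖mkPt x t‖ ^ (-p)) =
      ENNReal.ofReal (|t| ^ ((n : ℝ) - p)) * bracketInt n p := by
  have ht0 : 0 < |t| := abs_pos.2 ht
  have h := lintegral_comp_smul_pos (fun x : E n => ENNReal.ofReal (‖mkPt x t‖ ^ (-p))) ht0
  have h1 : ∀ x : E n, ‖mkPt (|t| • x) t‖ ^ (-p) = |t| ^ (-p) * (1 + ‖x‖ ^ 2) ^ (-p / 2) := by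
    intro x
    have h2 : ‖mkPt (|t| • x) t‖ ^ 2 = |t| ^ 2 * (1 + ‖x‖ ^ 2) := by
      rw [norm_mkPt_sq, norm_smul, Real.norm_eq_abs, abs_abs, ← sq_abs t]; ring
    have h3 : ‖mkPt (|t| • x) t‖ ^ (-p) = (‖mkPt (|t| • x) t‖ ^ 2) ^ (-p / 2) := by
      rw [← Real.rpow_natCast, ← Real.rpow_mul (norm_nonneg _)]; congr 1; push_cast; ring
    rw [h3, h2, Real.mul_rpow (by positivity) (by positivity)]
    congr 1
    rw [← Real.rpow_natCast, ← Real.rpow_mul ht0.le]; congr 1; push_cast; ring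
  simp_rw [h1] at h
  have h4 : ∫⁻ x : E n, ENNReal.ofReal (|t| ^ (-p) * (1 + ‖x‖ ^ 2) ^ (-p / 2)) =
      ENNReal.ofReal (|t| ^ (-p)) * bracketInt n p := by
    rw [bracketInt, ← lintegral_const_mul' _ _ ENNReal.ofReal_ne_top]
    refine lintegral_congr fun x => ?_
    rw [ENNReal.ofReal_mul (by positivity)]
  rw [h4] at h
  calc _ = ENNReal.ofReal (|t| ^ (n : ℝ)) * (ENNReal.ofReal (|t| ^ (-(n : ℝ))) *
        ∫⁻ x : E n, ENNReal.ofReal (‖mkPt x t‖ ^ (-p))) := by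
        rw [← mul_assoc, ← ENNReal.ofReal_mul (by positivity), ← Real.rpow_add ht0]; simp
    _ = _ := by
        rw [← h, ← mul_assoc, ← ENNReal.ofReal_mul (by positivity), ← Real.rpow_add ht0]; rfl

/-- Integrals of functions of `⟨v, w⟩` and `|w|` in coordinates with the last axis along `v`. -/
lemma lintegral_inner_norm {n : ℕ} (v : E (n + 1)) (f : ℝ → ℝ → ℝ≥0∞)
    (hf : Measurable (Function.uncurry f)) :
    ∫⁻ w, f (inner ℝ v w) ‖w‖ = ∫⁻ t : ℝ, ∫⁻ x : E n, f (‖v‖ * t) ‖mkPt x t‖ := by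
  set e : E (n + 1) := mkPt 0 ‖v‖ with he
  have hev : ‖v‖ = ‖e‖ := by
    have := norm_mkPt_sq (0 : E n) ‖v‖
    rw [norm_zero] at this
    rw [← abs_of_nonneg (norm_nonneg v), ← abs_of_nonneg (norm_nonneg e), ← sq_eq_sq_iff_abs_eq_abs,
      he, this]; ring
  -- The reflection interchanging `v` and the vector of equal length on the time axis.
  set R := Submodule.reflection (Submodule.span ℝ {v - e})ᗮ with hR
  have hRv : R v = e := Submodule.reflection_sub hev
  have h1 : ∫⁻ w, f (inner ℝ v w) ‖w‖ = ∫⁻ w, f (inner ℝ e w) ‖w‖ := by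
    rw [← R.measurePreserving.lintegral_comp_emb R.toHomeomorph.measurableEmbedding
      (fun w => f (inner ℝ e w) ‖w‖)]
    refine lintegral_congr fun w => ?_
    rw [← hRv, R.inner_map_map, R.norm_map]
  have hm : Measurable fun w : E (n + 1) => f (inner ℝ e w) ‖w‖ :=
    hf.comp (f := fun w : E (n + 1) => (inner ℝ e w, ‖w‖)) (by fun_prop)
  rw [h1, lintegral_space_time _ hm, lintegral_lintegral_swap]
  · refine lintegral_congr fun t => lintegral_congr fun x => ?_
    congr 1
    rw [inner_eq_space_time, he]; simp
  · exact (hm.comp continuous_mkPt.measurable).aemeasurable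

/-- Only the direction of `w` enters, so this is an average over directions. At height `t` along `ξ`
the integral over the orthogonal variable is at most `|ξ|^m |t|^n` times `bracketInt n m`, and `|t|
≤ 1`. A high power of a cosine thus gains `m^(-n/2)`. -/
lemma lintegral_ball_direction_le {n : ℕ} (ξ : E (n + 1)) (m : ℕ) :
    ∫⁻ w in Metric.ball (0 : E (n + 1)) 1, ENNReal.ofReal (|inner ℝ ξ w / ‖w‖| ^ m) ≤
      ENNReal.ofReal (‖ξ‖ ^ m) * (2 * bracketInt n m) := by
  set f : ℝ → ℝ → ℝ≥0∞ := fun u r => (Iio (1 : ℝ)).indicator 1 r * ENNReal.ofReal (|u / r| ^ m)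
    with hf
  have hfm : Measurable (Function.uncurry f) := by
    have h1 : Measurable fun p : ℝ × ℝ => (Iio (1 : ℝ)).indicator (1 : ℝ → ℝ≥0∞) p.2 :=
      (measurable_one.indicator measurableSet_Iio).comp measurable_snd
    exact h1.mul (by fun_prop)
  have h1 : ∫⁻ w in Metric.ball (0 : E (n + 1)) 1, ENNReal.ofReal (|inner ℝ ξ w / ‖w‖| ^ m) =
      ∫⁻ w, f (inner ℝ ξ w) ‖w‖ := by
    rw [← lintegral_indicator Metric.isOpen_ball.measurableSet]
    refine lintegral_congr fun w => ?_
    by_cases hw : ‖w‖ < 1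
    · rw [indicator_of_mem (mem_ball_zero_iff.2 hw), hf]
      simp only
      rw [indicator_of_mem (show ‖w‖ ∈ Iio (1 : ℝ) from hw), Pi.one_apply, one_mul]
    · rw [indicator_of_notMem (fun h => hw (mem_ball_zero_iff.1 h)), hf]
      simp only
      rw [indicator_of_notMem (show ‖w‖ ∉ Iio (1 : ℝ) from hw), zero_mul]
  rw [h1, lintegral_inner_norm ξ f hfm]
  have h2 : ∀ᵐ t : ℝ, ∫⁻ x : E n, f (‖ξ‖ * t) ‖mkPt x t‖ ≤
      (Icc (-1 : ℝ) 1).indicator (fun _ => ENNReal.ofReal (‖ξ‖ ^ m) * bracketInt n m) t := by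
    filter_upwards [compl_mem_ae_iff.2 (measure_singleton (0 : ℝ))] with t ht
    have ht0 : 0 < |t| := abs_pos.2 ht
    by_cases ht1 : t ∈ Icc (-1 : ℝ) 1
    · rw [indicator_of_mem ht1]
      have h3 : ∀ x : E n, f (‖ξ‖ * t) ‖mkPt x t‖ ≤
          ENNReal.ofReal (‖ξ‖ ^ m * |t| ^ m) * ENNReal.ofReal (‖mkPt x t‖ ^ (-(m : ℝ))) := by
        intro x
        rw [← ENNReal.ofReal_mul (by positivity), hf]
        simp only
        calc _ ≤ 1 * ENNReal.ofReal (|‖ξ‖ * t / ‖mkPt x t‖| ^ m) := by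
              gcongr
              exact indicator_le_self' (fun _ _ => zero_le) _
          _ = _ := by
              rw [one_mul]; congr 1
              rw [abs_div, abs_mul, abs_norm, abs_norm, div_pow, mul_pow, Real.rpow_neg (norm_nonneg _),
                Real.rpow_natCast, div_eq_mul_inv]
      calc _ ≤ _ := lintegral_mono h3
        _ = ENNReal.ofReal (‖ξ‖ ^ m) * (ENNReal.ofReal (|t| ^ m * |t| ^ ((n : ℝ) - m)) *
            bracketInt n m) := by
            rw [lintegral_const_mul' _ _ ENNReal.ofReal_ne_top, lintegral_norm_mkPt_rpow ht,
              ENNReal.ofReal_mul (by positivity), ENNReal.ofReal_mul (by positivity)]; ring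
        _ ≤ ENNReal.ofReal (‖ξ‖ ^ m) * (1 * bracketInt n m) := by
            gcongr
            refine ENNReal.ofReal_le_one.2 ?_
            rw [← Real.rpow_natCast, ← Real.rpow_add ht0]
            exact Real.rpow_le_one ht0.le (abs_le.2 ht1) (by simp)
        _ = _ := by rw [one_mul]
    · rw [indicator_of_notMem ht1]
      refine le_of_eq ((lintegral_congr fun x => ?_).trans lintegral_zero)
      rw [hf]; simp only
      rw [indicator_of_notMem, zero_mul]
      intro h
      have h4 : |t| ≤ ‖mkPt x t‖ := by
        have := abs_timePart_le (mkPt x t); rwa [timePart_mkPt] at this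
      exact ht1 (abs_le.1 (h4.trans (le_of_lt h)))
  refine (lintegral_mono_ae h2).trans (le_of_eq ?_)
  rw [lintegral_indicator_const measurableSet_Icc, Real.volume_Icc]
  norm_num
  ring

/-- At height `t` along `θ`, scaling the orthogonal variable by `|t|` turns its integral into
`|t|^(n-p)` times `bracketInt n p`. -/
lemma lintegral_rpow_mul_inner {n : ℕ} {θ : E (n + 1)} (hθ : ‖θ‖ = 1) (p : ℝ) {Φ : ℝ → ℝ≥0∞}
    (hΦ : Measurable Φ) :
    ∫⁻ ξ, ENNReal.ofReal (‖ξ‖ ^ (-p)) * Φ (inner ℝ θ ξ) =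
      bracketInt n p * ∫⁻ t, ENNReal.ofReal (|t| ^ ((n : ℝ) - p)) * Φ t := by
  have hm : Measurable (Function.uncurry fun u r : ℝ => ENNReal.ofReal (r ^ (-p)) * Φ u) := by
    have : Measurable fun q : ℝ × ℝ => Φ q.1 := hΦ.comp measurable_fst
    exact Measurable.mul (by fun_prop) this
  have h := lintegral_inner_norm θ (fun u r => ENNReal.ofReal (r ^ (-p)) * Φ u) hm
  rw [h, ← lintegral_const_mul _ (by fun_prop)]
  refine lintegral_congr_ae ?_
  filter_upwards [compl_mem_ae_iff.2 (measure_singleton (0 : ℝ))] with t ht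
  rw [hθ, one_mul, lintegral_mul_const, lintegral_norm_mkPt_rpow ht]
  · ring
  · have : Measurable fun x : E n => ‖mkPt x t‖ := by
      have hp : Continuous fun x : E n => ((x, t) : E n × ℝ) := by fun_prop
      exact (continuous_mkPt.comp hp).norm.measurable
    fun_prop

/-! ### Pointwise bounds for functions supported in the unit ball -/

lemma fourierHat_inversion {d : ℕ} (h : SchwartzMap (E d) ℂ) (z : E d) :
    ((2 * Real.pi) ^ d : ℝ) * h z =
      ∫ ξ, hatS h ξ * Complex.exp ((inner ℝ ξ z : ℝ) * Complex.I) := by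
  have h1 := Measure.integral_comp_inv_smul_of_nonneg (volume : Measure (E d))
    (fun v => FourierTransform.fourier h v * Complex.exp ((2 * Real.pi * inner ℝ v z : ℝ) * Complex.I))
    (R := 2 * Real.pi) (by positivity)
  have h2 : ∀ ξ : E d, FourierTransform.fourier h ((2 * Real.pi)⁻¹ • ξ) *
      Complex.exp ((2 * Real.pi * inner ℝ ((2 * Real.pi)⁻¹ • ξ) z : ℝ) * Complex.I) =
      hatS h ξ * Complex.exp ((inner ℝ ξ z : ℝ) * Complex.I) := by
    intro ξ
    rw [hatS_apply, fourierHat_eq_fourier, inner_smul_left, SchwartzMap.fourier_coe]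
    congr 4
    rw [← mul_assoc]
    simp only [conj_trivial]
    rw [mul_inv_cancel₀ (by positivity), one_mul]
  simp_rw [h2] at h1
  rw [h1, finrank_euclideanSpace_fin, Complex.real_smul]
  congr 1
  have h3 : (FourierTransformInv.fourierInv (FourierTransform.fourier h : SchwartzMap (E d) ℂ) :
      SchwartzMap (E d) ℂ) = h := FourierTransform.fourierInv_fourier_eq h
  conv_lhs => rw [← h3]
  rw [SchwartzMap.fourierInv_coe, Real.fourierInv_eq']
  refine integral_congr_ae (Filter.Eventually.of_forall fun v => ?_)
  simp only [smul_eq_mul, mul_comm]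

/-- The derivatives along a line of a function with Fourier transform `Φ`. -/
def lineSeq {d : ℕ} (Φ : SchwartzMap (E d) ℂ) (z θ : E d) (k : ℕ) (y : ℝ) : ℂ :=
  ∫ ξ, Φ ξ * ((inner ℝ ξ θ : ℝ) * Complex.I) ^ k *
    Complex.exp ((inner ℝ ξ z + y * inner ℝ ξ θ : ℝ) * Complex.I)

section lineSeq

variable {d : ℕ} (Φ : SchwartzMap (E d) ℂ) (z : E d) {θ : E d}

lemma norm_lineSeq_integrand_le (hθ : ‖θ‖ = 1) (k : ℕ) (y : ℝ) (ξ : E d) :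
    ‖Φ ξ * ((inner ℝ ξ θ : ℝ) * Complex.I) ^ k *
      Complex.exp ((inner ℝ ξ z + y * inner ℝ ξ θ : ℝ) * Complex.I)‖ ≤ ‖ξ‖ ^ k * ‖Φ ξ‖ := by
  rw [norm_mul, Complex.norm_exp_ofReal_mul_I, mul_one, norm_mul, norm_pow, norm_mul,
    Complex.norm_I, mul_one, Complex.norm_real, mul_comm]
  have := norm_inner_le_norm (𝕜 := ℝ) ξ θ
  rw [hθ, mul_one] at this
  gcongr

lemma integrable_lineSeq_integrand (hθ : ‖θ‖ = 1) (k : ℕ) (y : ℝ) :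
    Integrable fun ξ => Φ ξ * ((inner ℝ ξ θ : ℝ) * Complex.I) ^ k *
      Complex.exp ((inner ℝ ξ z + y * inner ℝ ξ θ : ℝ) * Complex.I) := by
  refine (Φ.integrable_pow_mul volume k).mono' ?_ (Filter.Eventually.of_forall fun ξ =>
    norm_lineSeq_integrand_le Φ z hθ k y ξ)
  have := Φ.continuous
  exact Continuous.aestronglyMeasurable (by fun_prop)

lemma hasDerivAt_lineSeq (hθ : ‖θ‖ = 1) (k : ℕ) (y : ℝ) :
    HasDerivAt (lineSeq Φ z θ k) (lineSeq Φ z θ (k + 1) y) y := by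
  have hc := Φ.continuous
  refine (hasDerivAt_integral_of_dominated_loc_of_deriv_le (μ := volume)
    (F := fun (y : ℝ) (ξ : E d) => Φ ξ * ((inner ℝ ξ θ : ℝ) * Complex.I) ^ k *
      Complex.exp ((inner ℝ ξ z + y * inner ℝ ξ θ : ℝ) * Complex.I))
    (F' := fun (y : ℝ) (ξ : E d) => Φ ξ * ((inner ℝ ξ θ : ℝ) * Complex.I) ^ (k + 1) *
      Complex.exp ((inner ℝ ξ z + y * inner ℝ ξ θ : ℝ) * Complex.I))
    (bound := fun ξ => ‖ξ‖ ^ (k + 1) * ‖Φ ξ‖) (Filter.univ_mem) ?_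
    (integrable_lineSeq_integrand Φ z hθ k y) ?_ ?_ (Φ.integrable_pow_mul volume (k + 1)) ?_).2
  · exact Filter.Eventually.of_forall fun y => (integrable_lineSeq_integrand Φ z hθ k y).1
  · exact (integrable_lineSeq_integrand Φ z hθ (k + 1) y).1
  · exact Filter.Eventually.of_forall fun ξ y _ => norm_lineSeq_integrand_le Φ z hθ (k + 1) y ξ
  · refine Filter.Eventually.of_forall fun ξ y _ => ?_
    have h1 : HasDerivAt (fun y : ℝ => ((inner ℝ ξ z + y * inner ℝ ξ θ : ℝ) : ℂ) * Complex.I)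
        (((inner ℝ ξ θ : ℝ) : ℂ) * Complex.I) y := by
      have h2 : HasDerivAt (fun y : ℝ => inner ℝ ξ z + y * inner ℝ ξ θ) (inner ℝ ξ θ) y := by
        simpa using ((hasDerivAt_id y).mul_const (inner ℝ ξ θ)).const_add (inner ℝ ξ z)
      exact h2.ofReal_comp.mul_const Complex.I
    refine (h1.cexp.const_mul (Φ ξ * ((inner ℝ ξ θ : ℝ) * Complex.I) ^ k)).congr_deriv ?_
    ring

/-- All derivatives vanish on the open half-line, hence at its end point by continuity. This
supplies the boundary conditions at the ends of a chord. -/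
lemma seq_eq_zero_left {F : ℕ → ℝ → ℂ} (hF : ∀ k x, HasDerivAt (F k) (F (k + 1) x) x) {a : ℝ}
    (h : ∀ y < a, F 0 y = 0) (k : ℕ) : F k a = 0 := by
  have h1 : ∀ k, ∀ y < a, F k y = 0 := by
    intro k
    induction k with
    | zero => exact h
    | succ k ih =>
      intro y hy
      have h2 : F k =ᶠ[nhds y] fun _ => 0 := by
        filter_upwards [Iio_mem_nhds hy] with x hx using ih x hx
      exact (hF k y).unique (h2.hasDerivAt_iff.2 (hasDerivAt_const y 0))
  have hc := continuous_of_hasDerivAt_seq hF k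
  have h3 : closure (Iio a) ⊆ {y | F k y = 0} :=
    (isClosed_eq hc continuous_const).closure_subset_iff.2 fun y hy => h1 k y hy
  exact h3 (by rw [closure_Iio]; exact mem_Iic.2 le_rfl)

lemma seq_eq_zero_right {F : ℕ → ℝ → ℂ} (hF : ∀ k x, HasDerivAt (F k) (F (k + 1) x) x) {a : ℝ}
    (h : ∀ y > a, F 0 y = 0) (k : ℕ) : F k a = 0 := by
  have h1 : ∀ k, ∀ y > a, F k y = 0 := by
    intro k
    induction k with
    | zero => exact h
    | succ k ih =>
      intro y hy
      have h2 : F k =ᶠ[nhds y] fun _ => 0 := by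
        filter_upwards [Ioi_mem_nhds hy] with x hx using ih x hx
      exact (hF k y).unique (h2.hasDerivAt_iff.2 (hasDerivAt_const y 0))
  have hc := continuous_of_hasDerivAt_seq hF k
  have h3 : closure (Ioi a) ⊆ {y | F k y = 0} :=
    (isClosed_eq hc continuous_const).closure_subset_iff.2 fun y hy => h1 k y hy
  exact h3 (by rw [closure_Ioi]; exact mem_Ici.2 le_rfl)

/-- Insert the Fourier representation and integrate first along the chord: the weight `(1-x²)^N`
then acts on each frequency through its own transform. -/
lemma enorm_integral_lineSeq_le (hθ : ‖θ‖ = 1) (N k : ℕ) (ρ c l : ℝ) :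
    ‖∫ x in (-1 : ℝ)..1, ((((x + 1) * (1 - x)) ^ N : ℝ) : ℂ) *
      lineSeq Φ z θ k (ρ * (c + l * x))‖ₑ ≤ ENNReal.ofReal (gegenMass N) *
        ∫⁻ ξ, ‖Φ ξ‖ₑ * ENNReal.ofReal (|inner ℝ ξ θ| ^ k) *
          ‖gegenHat N (ρ * l * inner ℝ ξ θ)‖ₑ := by
  have hc := Φ.continuous
  have h1 : ∫ x in (-1 : ℝ)..1, ((((x + 1) * (1 - x)) ^ N : ℝ) : ℂ) *
      lineSeq Φ z θ k (ρ * (c + l * x)) = ∫ ξ, ∫ x in (-1 : ℝ)..1,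
        ((((x + 1) * (1 - x)) ^ N : ℝ) : ℂ) * (Φ ξ * ((inner ℝ ξ θ : ℝ) * Complex.I) ^ k *
          Complex.exp ((inner ℝ ξ z + ρ * (c + l * x) * inner ℝ ξ θ : ℝ) * Complex.I)) := by
    simp_rw [intervalIntegral.integral_of_le (show (-1 : ℝ) ≤ 1 by norm_num), lineSeq,
      ← integral_const_mul]
    rw [integral_integral_swap]
    refine Integrable.mono' (g := fun p : ℝ × E d => 4 ^ N * (‖p.2‖ ^ k * ‖Φ p.2‖))
      (Integrable.mul_prod (integrable_const _) (Φ.integrable_pow_mul volume k)) ?_ ?_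
    · exact Continuous.aestronglyMeasurable (by unfold Function.uncurry; fun_prop)
    · have : ∀ᵐ p ∂((volume.restrict (Ioc (-1 : ℝ) 1)).prod (volume : Measure (E d))),
          p.1 ∈ Ioc (-1 : ℝ) 1 :=
        Measure.quasiMeasurePreserving_fst.ae (ae_restrict_mem measurableSet_Ioc)
      filter_upwards [this] with p hp
      rw [Function.uncurry, norm_mul]
      have h2 := norm_lineSeq_integrand_le Φ z hθ k (ρ * (c + l * p.1)) p.2
      have h3 : ‖((((p.1 + 1) * (1 - p.1)) ^ N : ℝ) : ℂ)‖ ≤ 4 ^ N := by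
        rw [Complex.norm_real, norm_pow, Real.norm_of_nonneg
          (mul_nonneg (by linarith [hp.1]) (by linarith [hp.2]))]
        exact pow_le_pow_left₀ (mul_nonneg (by linarith [hp.1]) (by linarith [hp.2]))
          (by nlinarith [hp.1, hp.2]) N
      exact mul_le_mul h3 h2 (norm_nonneg _) (by positivity)
  rw [h1]
  have hB := gegenMass_pos N
  have h4 : ∀ ξ, ∫ x in (-1 : ℝ)..1, ((((x + 1) * (1 - x)) ^ N : ℝ) : ℂ) *
      (Φ ξ * ((inner ℝ ξ θ : ℝ) * Complex.I) ^ k *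
        Complex.exp ((inner ℝ ξ z + ρ * (c + l * x) * inner ℝ ξ θ : ℝ) * Complex.I)) =
      Φ ξ * ((inner ℝ ξ θ : ℝ) * Complex.I) ^ k *
        Complex.exp ((inner ℝ ξ z + ρ * c * inner ℝ ξ θ : ℝ) * Complex.I) *
        ((gegenMass N : ℂ) * gegenHat N (ρ * l * inner ℝ ξ θ)) := by
    intro ξ
    have h5 : (gegenMass N : ℂ) * gegenHat N (ρ * l * inner ℝ ξ θ) =
        ∫ x in (-1 : ℝ)..1, ((((x + 1) * (1 - x)) ^ N : ℝ) : ℂ) *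
          Complex.exp ((ρ * l * inner ℝ ξ θ : ℝ) * x * Complex.I) := by
      rw [gegenHat, ← mul_assoc, ← Complex.ofReal_mul, mul_inv_cancel₀ hB.ne', Complex.ofReal_one,
        one_mul]
    rw [h5, ← intervalIntegral.integral_const_mul]
    refine intervalIntegral.integral_congr fun x _ => ?_
    have h6 : Complex.exp ((inner ℝ ξ z + ρ * (c + l * x) * inner ℝ ξ θ : ℝ) * Complex.I) =
        Complex.exp ((inner ℝ ξ z + ρ * c * inner ℝ ξ θ : ℝ) * Complex.I) *
        Complex.exp ((ρ * l * inner ℝ ξ θ : ℝ) * x * Complex.I) := by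
      rw [← Complex.exp_add]; congr 1; push_cast; ring
    simp only [h6]
    ring
  simp_rw [h4]
  refine (enorm_integral_le_lintegral_enorm _).trans (le_of_eq ?_)
  rw [← lintegral_const_mul' _ _ ENNReal.ofReal_ne_top]
  refine lintegral_congr fun ξ => ?_
  have h7 : ‖Complex.exp ((inner ℝ ξ z + ρ * c * inner ℝ ξ θ : ℝ) * Complex.I)‖ₑ = 1 := by
    rw [← ofReal_norm, Complex.norm_exp_ofReal_mul_I, ENNReal.ofReal_one]
  have h8 : ‖(((inner ℝ ξ θ : ℝ) : ℂ) * Complex.I) ^ k‖ₑ = ENNReal.ofReal (|inner ℝ ξ θ| ^ k) := by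
    rw [← ofReal_norm, norm_pow, norm_mul, Complex.norm_I, mul_one, Complex.norm_real,
      Real.norm_eq_abs]
  have h9 : ‖(gegenMass N : ℂ)‖ₑ = ENNReal.ofReal (gegenMass N) := by
    rw [← ofReal_norm, Complex.norm_real, Real.norm_of_nonneg hB.le]
  rw [enorm_mul, enorm_mul, enorm_mul, enorm_mul, h7, h8, h9]
  ring

end lineSeq

/-- The averages over dilations that occur in the representation formula on a chord. -/
def dilAvg (N : ℕ) (l s : ℝ) : ℝ≥0∞ :=
  ∫⁻ ρ in Ioc (0 : ℝ) 1, ENNReal.ofReal (ρ ^ (2 * N + 1)) * ‖gegenHat N (ρ * l * s)‖ₑ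

lemma continuous_gegenHat (N : ℕ) : Continuous (gegenHat N) := by
  unfold gegenHat
  refine continuous_const.mul ?_
  exact intervalIntegral.continuous_parametric_intervalIntegral_of_continuous' (by
    unfold Function.uncurry; fun_prop) _ _

lemma integral_chord_eq (φ : ℝ → ℂ) (c l : ℝ) (N : ℕ) :
    ∫ y in (c - l)..(c + l), ((((y - (c - l)) * (c + l - y)) ^ N : ℝ) : ℂ) * φ y =
      (l ^ (2 * N + 1) : ℝ) * ∫ x in (-1 : ℝ)..1, ((((x + 1) * (1 - x)) ^ N : ℝ) : ℂ) *
        φ (c + l * x) := by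
  have h := intervalIntegral.smul_integral_comp_add_mul (a := -1) (b := 1)
    (fun y => ((((y - (c - l)) * (c + l - y)) ^ N : ℝ) : ℂ) * φ y) l c
  have h1 : c + l * -1 = c - l := by ring
  rw [h1, mul_one] at h
  rw [← h, Complex.real_smul]
  have h2 : ∀ x : ℝ, ((((c + l * x - (c - l)) * (c + l - (c + l * x))) ^ N : ℝ) : ℂ) * φ (c + l * x) =
      (l ^ (2 * N) : ℝ) * (((((x + 1) * (1 - x)) ^ N : ℝ) : ℂ) * φ (c + l * x)) := by
    intro x
    rw [← mul_assoc, ← Complex.ofReal_mul]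
    congr 2
    rw [pow_mul, ← mul_pow]; congr 1; ring
  simp_rw [h2]
  rw [intervalIntegral.integral_const_mul, ← mul_assoc]
  push_cast; ring

/-- The chord formula for `y ↦ h(z + yθ)`, which vanishes outside the chord cut from the unit ball.
By the power of a point, the signed end points have product `-(1-|z|²)` whatever `θ` is; this
produces the factor `(1-|z|²)^(N+1)`. -/
lemma enorm_le_dilAvg {d : ℕ} (h : SchwartzMap (E d) ℂ) (hh : ∀ z, 1 < ‖z‖ → h z = 0) {z θ : E d}
    (hz : ‖z‖ < 1) (hθ : ‖θ‖ = 1) (N : ℕ) :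
    ENNReal.ofReal ((2 * Real.pi) ^ d) * ‖h z‖ₑ ≤
      ENNReal.ofReal ((1 - ‖z‖ ^ 2) ^ (N + 1) / (2 * (N + 1)).factorial * (2 * (N + 1))) *
      ∫⁻ ξ, ‖hatS h ξ‖ₑ * ENNReal.ofReal (|inner ℝ ξ θ| ^ (2 * N + 2)) *
        dilAvg N (√((inner ℝ z θ) ^ 2 + (1 - ‖z‖ ^ 2))) (inner ℝ ξ θ) := by
  set F := lineSeq (hatS h) z θ with hF
  have hFd : ∀ k x, HasDerivAt (F k) (F (k + 1) x) x := hasDerivAt_lineSeq _ z hθ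
  have hz1 : 0 < 1 - ‖z‖ ^ 2 := by nlinarith [norm_nonneg z]
  -- Midpoint and half-length of the chord through `z` in the direction `θ`, as parameters on the
  -- line.
  set c : ℝ := -inner ℝ z θ with hc
  set l : ℝ := √((inner ℝ z θ) ^ 2 + (1 - ‖z‖ ^ 2)) with hl
  have hl2 : l ^ 2 = c ^ 2 + (1 - ‖z‖ ^ 2) := by
    rw [hl, Real.sq_sqrt (by positivity), hc]; ring
  have hl0 : 0 < l := Real.sqrt_pos.2 (by positivity)
  have hcl : |c| < l := abs_lt_of_sq_lt_sq (by linarith) hl0.le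
  have ha : c - l < 0 := by linarith [le_abs_self c]
  have hb : 0 < c + l := by linarith [neg_abs_le c]
  have hF0 : ∀ y, F 0 y = ((2 * Real.pi) ^ d : ℝ) * h (z + y • θ) := by
    intro y
    rw [fourierHat_inversion, hF, lineSeq]
    simp only [pow_zero, mul_one, inner_add_right, inner_smul_right]
  have hout : ∀ y, 0 < (y - (c - l)) * (y - (c + l)) → F 0 y = 0 := by
    intro y hy
    rw [hF0, hh, mul_zero]
    have h1 : ‖z + y • θ‖ ^ 2 = ‖z‖ ^ 2 + 2 * (y * inner ℝ z θ) + y ^ 2 := by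
      rw [norm_add_sq_real, inner_smul_right, norm_smul, hθ, mul_one, Real.norm_eq_abs, sq_abs]
    have h2 : 1 < ‖z + y • θ‖ ^ 2 := by
      rw [h1, show inner ℝ z θ = -c by rw [hc, neg_neg]]; nlinarith
    nlinarith [norm_nonneg (z + y • θ)]
  have hFa : ∀ k, F k (c - l) = 0 := seq_eq_zero_left hFd fun y hy => hout y (by nlinarith)
  have hFb : ∀ k, F k (c + l) = 0 := seq_eq_zero_right hFd fun y hy => hout y (by nlinarith)
  have key := integral_mul_quotSeq hFd ha hb hFa hFb N
  have h3 : ∫ y in (c - l)..(c + l), ((((y - (c - l)) * (c + l - y)) ^ N : ℝ) : ℂ) =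
      (l ^ (2 * N + 1) : ℝ) * (gegenMass N : ℂ) := by
    have := integral_chord_eq (fun _ => 1) c l N
    simp only [mul_one] at this
    rw [this, intervalIntegral.integral_ofReal, gegenMass]
  rw [h3, integral_chord_eq _ c l N] at key
  have hlN : ((l ^ (2 * N + 1) : ℝ) : ℂ) ≠ 0 := by
    exact_mod_cast (pow_pos hl0 _).ne'
  have key2 : (gegenMass N : ℂ) * F 0 0 = (((c - l) * (c + l)) ^ (N + 1) /
      (2 * (N + 1)).factorial * (2 * (N + 1)) : ℝ) * ∫ x in (-1 : ℝ)..1,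
        ((((x + 1) * (1 - x)) ^ N : ℝ) : ℂ) * quotSeq F (2 * N + 1) (c + l * x) := by
    apply mul_left_cancel₀ hlN
    linear_combination key
  have hFc := continuous_of_hasDerivAt_seq hFd (2 * N + 1 + 1)
  have hswap : ∫ x in (-1 : ℝ)..1, ((((x + 1) * (1 - x)) ^ N : ℝ) : ℂ) *
      quotSeq F (2 * N + 1) (c + l * x) = ∫ ρ in (0 : ℝ)..1, (ρ : ℂ) ^ (2 * N + 1) *
        ∫ x in (-1 : ℝ)..1, ((((x + 1) * (1 - x)) ^ N : ℝ) : ℂ) *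
          F (2 * N + 1 + 1) (ρ * (c + l * x)) := by
    simp only [quotSeq, ← intervalIntegral.integral_const_mul]
    simp_rw [intervalIntegral.integral_of_le (show (-1 : ℝ) ≤ 1 by norm_num),
      intervalIntegral.integral_of_le (zero_le_one' ℝ)]
    rw [integral_integral_swap]
    · refine integral_congr_ae (Filter.Eventually.of_forall fun ρ =>
        integral_congr_ae (Filter.Eventually.of_forall fun x => ?_))
      simp only; ring
    · rw [Measure.prod_restrict]
      have hcont : Continuous (Function.uncurry fun x ρ : ℝ => ((((x + 1) * (1 - x)) ^ N : ℝ) : ℂ) *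
          ((ρ : ℂ) ^ (2 * N + 1) * F (2 * N + 1 + 1) (ρ * (c + l * x)))) := by
        unfold Function.uncurry; fun_prop
      exact (hcont.continuousOn.integrableOn_compact
        ((isCompact_Icc (a := (-1 : ℝ)) (b := 1)).prod (isCompact_Icc (a := (0 : ℝ)) (b := 1)))).mono_set
        (prod_mono Ioc_subset_Icc_self Ioc_subset_Icc_self)
  rw [hswap] at key2
  have hB := gegenMass_pos N
  have h4 : ‖(gegenMass N : ℂ)‖ₑ = ENNReal.ofReal (gegenMass N) := by
    rw [← ofReal_norm, Complex.norm_real, Real.norm_of_nonneg hB.le]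
  have h5 : ‖((((c - l) * (c + l)) ^ (N + 1) / (2 * (N + 1)).factorial * (2 * (N + 1)) : ℝ) : ℂ)‖ₑ =
      ENNReal.ofReal ((1 - ‖z‖ ^ 2) ^ (N + 1) / (2 * (N + 1)).factorial * (2 * (N + 1))) := by
    rw [← ofReal_norm, Complex.norm_real, norm_mul, norm_div, norm_pow, Real.norm_natCast,
      Real.norm_of_nonneg (show (0 : ℝ) ≤ 2 * (N + 1) by positivity), Real.norm_eq_abs]
    have : (c - l) * (c + l) = -(1 - ‖z‖ ^ 2) := by linear_combination -hl2
    rw [this, abs_neg, abs_of_pos hz1]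
  have h6 : ‖∫ ρ in (0 : ℝ)..1, (ρ : ℂ) ^ (2 * N + 1) * ∫ x in (-1 : ℝ)..1,
      ((((x + 1) * (1 - x)) ^ N : ℝ) : ℂ) * F (2 * N + 1 + 1) (ρ * (c + l * x))‖ₑ ≤
      ENNReal.ofReal (gegenMass N) * ∫⁻ ξ, ‖hatS h ξ‖ₑ *
        ENNReal.ofReal (|inner ℝ ξ θ| ^ (2 * N + 2)) * dilAvg N l (inner ℝ ξ θ) := by
    have hgm := (continuous_gegenHat N)
    have hhc := (hatS h).continuous
    rw [intervalIntegral.integral_of_le zero_le_one]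
    refine (enorm_integral_le_lintegral_enorm _).trans ?_
    calc _ ≤ ∫⁻ ρ in Ioc (0 : ℝ) 1, ENNReal.ofReal (ρ ^ (2 * N + 1)) *
          (ENNReal.ofReal (gegenMass N) * ∫⁻ ξ, ‖hatS h ξ‖ₑ *
            ENNReal.ofReal (|inner ℝ ξ θ| ^ (2 * N + 2)) * ‖gegenHat N (ρ * l * inner ℝ ξ θ)‖ₑ) := by
          refine setLIntegral_mono' measurableSet_Ioc fun ρ hρ => ?_
          rw [enorm_mul, enorm_pow]
          have h7 : ‖(ρ : ℂ)‖ₑ = ENNReal.ofReal ρ := by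
            rw [← ofReal_norm, Complex.norm_real, Real.norm_of_nonneg hρ.1.le]
          rw [h7, ← ENNReal.ofReal_pow hρ.1.le]
          gcongr
          exact enorm_integral_lineSeq_le (hatS h) z hθ N (2 * N + 2) ρ c l
      _ = ENNReal.ofReal (gegenMass N) * ∫⁻ ρ in Ioc (0 : ℝ) 1, ∫⁻ ξ, ‖hatS h ξ‖ₑ *
            ENNReal.ofReal (|inner ℝ ξ θ| ^ (2 * N + 2)) *
            (ENNReal.ofReal (ρ ^ (2 * N + 1)) * ‖gegenHat N (ρ * l * inner ℝ ξ θ)‖ₑ) := by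
          rw [← lintegral_const_mul' _ _ ENNReal.ofReal_ne_top]
          refine lintegral_congr fun ρ => ?_
          rw [mul_left_comm, ← lintegral_const_mul' _ _ ENNReal.ofReal_ne_top]
          congr 1
          refine lintegral_congr fun ξ => ?_
          ring
      _ = _ := by
          congr 1
          rw [lintegral_lintegral_swap]
          · refine lintegral_congr fun ξ => ?_
            have h12 : Measurable fun ρ : ℝ => ‖gegenHat N (ρ * l * inner ℝ ξ θ)‖ₑ :=
              (hgm.comp (by fun_prop)).measurable.enorm
            rw [lintegral_const_mul _ (by fun_prop), dilAvg]
          · have h12 : Measurable fun p : ℝ × E d => ‖gegenHat N (p.1 * l * inner ℝ p.2 θ)‖ₑ :=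
              (hgm.comp (by fun_prop)).measurable.enorm
            have h13 : Measurable fun p : ℝ × E d => ‖hatS h p.2‖ₑ :=
              (hhc.comp continuous_snd).measurable.enorm
            have h14 : Measurable fun p : ℝ × E d => ‖hatS h p.2‖ₑ *
                ENNReal.ofReal (|inner ℝ p.2 θ| ^ (2 * N + 2)) *
                (ENNReal.ofReal (p.1 ^ (2 * N + 1)) * ‖gegenHat N (p.1 * l * inner ℝ p.2 θ)‖ₑ) := by
              fun_prop
            exact h14.aemeasurable
  have h8 := congrArg (fun z : ℂ => ‖z‖ₑ) key2
  rw [enorm_mul, h4, enorm_mul, h5] at h8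
  have h9 : ENNReal.ofReal (gegenMass N) ≠ 0 := by simpa using hB
  rw [← ENNReal.mul_le_mul_iff_right h9 ENNReal.ofReal_ne_top]
  have h10 : ‖F 0 0‖ₑ = ENNReal.ofReal ((2 * Real.pi) ^ d) * ‖h z‖ₑ := by
    rw [hF0, zero_smul, add_zero, enorm_mul]
    congr 1
    rw [← ofReal_norm, Complex.norm_real, Real.norm_of_nonneg (by positivity)]
  rw [← h10, h8]
  calc _ ≤ ENNReal.ofReal ((1 - ‖z‖ ^ 2) ^ (N + 1) / (2 * (N + 1)).factorial * (2 * (N + 1))) *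
        (ENNReal.ofReal (gegenMass N) * ∫⁻ ξ, ‖hatS h ξ‖ₑ *
        ENNReal.ofReal (|inner ℝ ξ θ| ^ (2 * N + 2)) * dilAvg N l (inner ℝ ξ θ)) := by
        gcongr
    _ = _ := by ring

/-! ### Weighted bounds for the dilation averages and the average over chords. -/

lemma measurable_dilAvg (N : ℕ) (l : ℝ) : Measurable (dilAvg N l) := by
  have h1 : Measurable fun p : ℝ × ℝ => ‖gegenHat N (p.2 * l * p.1)‖ₑ :=
    ((continuous_gegenHat N).comp (by fun_prop)).measurable.enorm
  have h2 : Measurable fun p : ℝ × ℝ =>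
      ENNReal.ofReal (p.2 ^ (2 * N + 1)) * ‖gegenHat N (p.2 * l * p.1)‖ₑ := by fun_prop
  exact h2.lintegral_prod_right'

lemma lintegral_pow_Ioc (N : ℕ) :
    ∫⁻ ρ in Ioc (0 : ℝ) 1, ENNReal.ofReal (ρ ^ N) = ENNReal.ofReal (1 / (N + 1)) := by
  rw [← ofReal_integral_eq_lintegral_ofReal, ← intervalIntegral.integral_of_le zero_le_one,
    integral_pow]
  · simp
  · exact (continuous_pow N).integrableOn_Ioc
  · filter_upwards [ae_restrict_mem measurableSet_Ioc] with ρ hρ using pow_nonneg hρ.1.le N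

lemma lintegral_rpow_mul_comp_mul {f : ℝ → ℝ≥0∞} (hf : Measurable f) (κ : ℝ) {a : ℝ} (ha : 0 < a) :
    ∫⁻ s, ENNReal.ofReal (|s| ^ κ) * f (a * s) =
      ENNReal.ofReal (a ^ (-κ - 1)) * ∫⁻ s, ENNReal.ofReal (|s| ^ κ) * f s := by
  have h := lintegral_comp_mul_pos ha (fun s => ENNReal.ofReal (|s| ^ κ) * f s) (by fun_prop)
  have h1 : ∀ s : ℝ, ENNReal.ofReal (|a * s| ^ κ) * f (a * s) =
      ENNReal.ofReal (a ^ κ) * (ENNReal.ofReal (|s| ^ κ) * f (a * s)) := by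
    intro s
    rw [abs_mul, abs_of_pos ha, Real.mul_rpow ha.le (abs_nonneg s),
      ENNReal.ofReal_mul (by positivity), mul_assoc]
  simp_rw [h1] at h
  rw [← h, lintegral_const_mul' _ _ ENNReal.ofReal_ne_top, ← mul_assoc, ← mul_assoc,
    ← ENNReal.ofReal_mul (by positivity), ← ENNReal.ofReal_mul (by positivity)]
  have h2 : a ^ (-κ - 1) * a * a ^ κ = 1 := by
    nth_rw 2 [← Real.rpow_one a]
    rw [← Real.rpow_add ha, ← Real.rpow_add ha]; ring_nf; exact Real.rpow_zero a
  rw [h2, ENNReal.ofReal_one, one_mul]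

/-- Cauchy-Schwarz with `ρ^(2N+1) = ρ^(N/2) ρ^((3N+2)/2)`: the first factor yields `1/(N+1)`, and
the second keeps enough powers of `ρ` to absorb the loss from rescaling `s`. -/
lemma dilAvg_sq_le (N : ℕ) (l s : ℝ) : dilAvg N l s ^ 2 ≤ ENNReal.ofReal (1 / (N + 1)) *
    ∫⁻ ρ in Ioc (0 : ℝ) 1, ENNReal.ofReal (ρ ^ (3 * N + 2)) * ‖gegenHat N (ρ * l * s)‖ₑ ^ 2 := by
  have h1 : Measurable fun ρ : ℝ => ‖gegenHat N (ρ * l * s)‖ₑ :=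
    ((continuous_gegenHat N).comp (by fun_prop)).measurable.enorm
  have h2 := lintegral_mul_le_weighted (volume.restrict (Ioc (0 : ℝ) 1))
    (f := fun ρ => ENNReal.ofReal (√(ρ ^ N)))
    (g := fun ρ => ENNReal.ofReal (√(ρ ^ (3 * N + 2))) * ‖gegenHat N (ρ * l * s)‖ₑ)
    (by fun_prop) (by fun_prop)
  have h3 : dilAvg N l s = ∫⁻ ρ in Ioc (0 : ℝ) 1, ENNReal.ofReal (√(ρ ^ N)) *
      (ENNReal.ofReal (√(ρ ^ (3 * N + 2))) * ‖gegenHat N (ρ * l * s)‖ₑ) := by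
    refine setLIntegral_congr_fun measurableSet_Ioc fun ρ hρ => ?_
    have hρ0 := hρ.1.le
    rw [← mul_assoc, ← ENNReal.ofReal_mul (by positivity), ← Real.sqrt_mul (by positivity),
      ← pow_add, show N + (3 * N + 2) = (2 * N + 1) * 2 by ring, pow_mul,
      Real.sqrt_sq (by positivity)]
  have h4 : ∀ k : ℕ, ∀ ρ ∈ Ioc (0 : ℝ) 1, ENNReal.ofReal (√(ρ ^ k)) ^ 2 = ENNReal.ofReal (ρ ^ k) := by
    intro k ρ hρ
    have hρ0 := hρ.1.le
    rw [← ENNReal.ofReal_pow (by positivity), Real.sq_sqrt (by positivity)]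
  have h5 : ∫⁻ ρ in Ioc (0 : ℝ) 1, ENNReal.ofReal (√(ρ ^ N)) ^ 2 = ENNReal.ofReal (1 / (N + 1)) := by
    rw [← lintegral_pow_Ioc]
    exact setLIntegral_congr_fun measurableSet_Ioc (h4 N)
  have h6 : ∫⁻ ρ in Ioc (0 : ℝ) 1,
      (ENNReal.ofReal (√(ρ ^ (3 * N + 2))) * ‖gegenHat N (ρ * l * s)‖ₑ) ^ 2 =
      ∫⁻ ρ in Ioc (0 : ℝ) 1, ENNReal.ofReal (ρ ^ (3 * N + 2)) * ‖gegenHat N (ρ * l * s)‖ₑ ^ 2 := by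
    refine setLIntegral_congr_fun measurableSet_Ioc fun ρ hρ => ?_
    rw [mul_pow, h4 _ ρ hρ]
  rw [← h3, h5, h6] at h2
  calc dilAvg N l s ^ 2 ≤ _ := pow_le_pow_left₀ zero_le h2 2
    _ = _ := by rw [mul_pow, ennreal_rpow_half_sq, ennreal_rpow_half_sq]

/-- Rescaling `s` by `ρ l` gives `(ρ l)^(-κ-1)`. With `κ ≤ 2N` there remains at least a power `ρ^N`,
whose integral is a second factor `1/(N+1)`. -/
lemma lintegral_rpow_mul_dilAvg_sq_le (N : ℕ) {κ l : ℝ} (hl : 0 < l) (hκ : κ ≤ 2 * N) :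
    ∫⁻ s : ℝ, ENNReal.ofReal (|s| ^ κ) * dilAvg N l s ^ 2 ≤
      ENNReal.ofReal (((N : ℝ) + 1) ^ (-2 : ℝ) * l ^ (-κ - 1)) *
        ∫⁻ s : ℝ, ENNReal.ofReal (|s| ^ κ) * ‖gegenHat N s‖ₑ ^ 2 := by
  have hgm : Measurable fun s => ‖gegenHat N s‖ₑ ^ 2 :=
    (continuous_gegenHat N).measurable.enorm.pow_const 2
  set EE := ∫⁻ s : ℝ, ENNReal.ofReal (|s| ^ κ) * ‖gegenHat N s‖ₑ ^ 2 with hEE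
  have hN : (0 : ℝ) < N + 1 := by positivity
  have hm : Measurable fun p : ℝ × ℝ => ENNReal.ofReal (|p.1| ^ κ) *
      (ENNReal.ofReal (p.2 ^ (3 * N + 2)) * ‖gegenHat N (p.2 * l * p.1)‖ₑ ^ 2) := by
    have h1 : Measurable fun p : ℝ × ℝ => ‖gegenHat N (p.2 * l * p.1)‖ₑ :=
      ((continuous_gegenHat N).comp (by fun_prop)).measurable.enorm
    fun_prop
  calc _ ≤ ∫⁻ s : ℝ, ENNReal.ofReal (1 / (N + 1)) * ∫⁻ ρ in Ioc (0 : ℝ) 1, ENNReal.ofReal (|s| ^ κ) *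
        (ENNReal.ofReal (ρ ^ (3 * N + 2)) * ‖gegenHat N (ρ * l * s)‖ₑ ^ 2) := by
        refine lintegral_mono fun s => ?_
        rw [lintegral_const_mul' _ _ ENNReal.ofReal_ne_top, mul_left_comm]
        exact mul_le_mul_right (dilAvg_sq_le N l s) _
    _ = ENNReal.ofReal (1 / (N + 1)) * ∫⁻ ρ in Ioc (0 : ℝ) 1, ∫⁻ s : ℝ, ENNReal.ofReal (|s| ^ κ) *
        (ENNReal.ofReal (ρ ^ (3 * N + 2)) * ‖gegenHat N (ρ * l * s)‖ₑ ^ 2) := by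
        rw [lintegral_const_mul' _ _ ENNReal.ofReal_ne_top, lintegral_lintegral_swap hm.aemeasurable]
    _ ≤ ENNReal.ofReal (1 / (N + 1)) * ∫⁻ ρ in Ioc (0 : ℝ) 1,
        ENNReal.ofReal (ρ ^ N) * (ENNReal.ofReal (l ^ (-κ - 1)) * EE) := by
        refine mul_le_mul_right (setLIntegral_mono' measurableSet_Ioc fun ρ hρ => ?_) _
        have hρ0 := hρ.1
        have h2 := lintegral_rpow_mul_comp_mul hgm κ (mul_pos hρ0 hl)
        simp_rw [mul_left_comm (ENNReal.ofReal (|_| ^ κ))]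
        rw [lintegral_const_mul' _ _ ENNReal.ofReal_ne_top, h2, ← mul_assoc,
          ← ENNReal.ofReal_mul (by positivity), ← mul_assoc, ← ENNReal.ofReal_mul (by positivity)]
        refine mul_le_mul_left (ENNReal.ofReal_le_ofReal ?_) _
        rw [Real.mul_rpow hρ0.le hl.le, ← mul_assoc]
        refine mul_le_mul_of_nonneg_right ?_ (by positivity)
        rw [← Real.rpow_natCast, ← Real.rpow_natCast, ← Real.rpow_add hρ0]
        exact Real.rpow_le_rpow_of_exponent_ge hρ0 hρ.2 (by push_cast; linarith)
    _ = _ := by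
        rw [lintegral_mul_const _ (by fun_prop), lintegral_pow_Ioc, ← mul_assoc, ← mul_assoc,
          ← ENNReal.ofReal_mul (by positivity), ← ENNReal.ofReal_mul (by positivity)]
        congr 3
        rw [Real.rpow_neg hN.le]
        norm_num
        field_simp

/-- Cauchy-Schwarz in `ξ`, with `|⟨ξ,θ⟩|^(4N+4)` shared between two factors. One is the energy
density times a high power of the cosine of the angle to `θ`, to be averaged over `θ`. The other
depends on `⟨ξ,θ⟩` and a negative power of `|ξ|` only, so its orthogonal variables integrate out.
Each factor gains about `N^(-n/2)`. -/
lemma enorm_sq_le_direction {n : ℕ} (h : SchwartzMap (E (n + 1)) ℂ) (hh : ∀ z, 1 < ‖z‖ → h z = 0)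
    {z θ : E (n + 1)} (hz : ‖z‖ < 1) (hθ : ‖θ‖ = 1) {N : ℕ} (hN : 1 ≤ N) {η : ℝ} (hη : 0 ≤ η)
    (hη2 : η ≤ 2) :
    ENNReal.ofReal ((2 * Real.pi) ^ (n + 1)) ^ 2 * ‖h z‖ₑ ^ 2 ≤
      ENNReal.ofReal ((1 - ‖z‖ ^ 2) ^ (N + 1) / (2 * (N + 1)).factorial * (2 * (N + 1))) ^ 2 *
      ((∫⁻ ξ, ‖hatS h ξ‖ₑ ^ 2 * ENNReal.ofReal (‖ξ‖ ^ (2 * (N : ℝ) + n + 4 + η)) *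
        ENNReal.ofReal (|inner ℝ ξ θ / ‖ξ‖| ^ (N + 1))) *
      (bracketInt n (N + n + 3 + η) * (ENNReal.ofReal (((N : ℝ) + 1) ^ (-2 : ℝ) *
        (1 - ‖z‖ ^ 2) ^ (-(2 * N - η + 1) / 2)) *
        ∫⁻ s : ℝ, ENNReal.ofReal (|s| ^ (2 * N - η)) * ‖gegenHat N s‖ₑ ^ 2))) := by
  have hz1 : 0 < 1 - ‖z‖ ^ 2 := by nlinarith [norm_nonneg z]
  set l : ℝ := √((inner ℝ z θ) ^ 2 + (1 - ‖z‖ ^ 2)) with hl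
  have hl0 : 0 < l := Real.sqrt_pos.2 (by positivity)
  have hhm : Measurable fun ξ => ‖hatS h ξ‖ₑ := (hatS h).continuous.measurable.enorm
  have hdm := measurable_dilAvg N l
  set Φ : ℝ → ℝ≥0∞ := fun t => ENNReal.ofReal (|t| ^ (3 * N + 3)) * dilAvg N l t ^ 2 with hΦ
  have hΦm : Measurable Φ := by fun_prop
  set A : E (n + 1) → ℝ≥0∞ := fun ξ => ‖hatS h ξ‖ₑ ^ 2 *
    ENNReal.ofReal (‖ξ‖ ^ (2 * (N : ℝ) + n + 4 + η)) *
    ENNReal.ofReal (|inner ℝ ξ θ / ‖ξ‖| ^ (N + 1)) with hA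
  set B : E (n + 1) → ℝ≥0∞ := fun ξ =>
    ENNReal.ofReal (‖ξ‖ ^ (-((N : ℝ) + n + 3 + η))) * Φ (inner ℝ θ ξ) with hB
  have hAm : Measurable A := by fun_prop
  have hBm : Measurable B := by
    have : Measurable fun ξ : E (n + 1) => Φ (inner ℝ θ ξ) := hΦm.comp (by fun_prop)
    fun_prop
  have h1 : ∫⁻ ξ, ‖hatS h ξ‖ₑ * ENNReal.ofReal (|inner ℝ ξ θ| ^ (2 * N + 2)) *
      dilAvg N l (inner ℝ ξ θ) ≤ (∫⁻ ξ, A ξ) ^ (1 / 2 : ℝ) * (∫⁻ ξ, B ξ) ^ (1 / 2 : ℝ) := by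
    have h2 := lintegral_mul_le_weighted volume (f := fun ξ => A ξ ^ (1 / 2 : ℝ))
      (g := fun ξ => B ξ ^ (1 / 2 : ℝ)) (by fun_prop) (by fun_prop)
    simp_rw [ennreal_rpow_half_sq] at h2
    refine le_trans (le_of_eq (lintegral_congr_ae ?_)) h2
    have hne : ∀ᵐ ξ : E (n + 1), ξ ≠ 0 := by
      have := nontrivial_E (d := n + 1) (by omega)
      exact compl_mem_ae_iff.2 (measure_singleton 0)
    filter_upwards [hne] with ξ hξ
    have hξ0 : 0 < ‖ξ‖ := norm_pos_iff.2 hξ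
    rw [← ENNReal.mul_rpow_of_nonneg _ _ (by norm_num : (0 : ℝ) ≤ 1 / 2)]
    rw [← ennreal_sq_rpow_half (‖hatS h ξ‖ₑ * _ * _)]
    congr 1
    simp only [hA, hB, hΦ, real_inner_comm ξ θ]
    have h3 : ENNReal.ofReal (|inner ℝ ξ θ| ^ (2 * N + 2)) ^ 2 =
        ENNReal.ofReal (‖ξ‖ ^ (2 * (N : ℝ) + n + 4 + η)) *
        ENNReal.ofReal (|inner ℝ ξ θ / ‖ξ‖| ^ (N + 1)) *
        (ENNReal.ofReal (‖ξ‖ ^ (-((N : ℝ) + n + 3 + η))) *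
        ENNReal.ofReal (|inner ℝ ξ θ| ^ (3 * N + 3))) := by
      rw [← ENNReal.ofReal_pow (by positivity), ← ENNReal.ofReal_mul (by positivity),
        ← ENNReal.ofReal_mul (by positivity), ← ENNReal.ofReal_mul (by positivity)]
      congr 1
      rw [abs_div, abs_norm, div_pow]
      have h4 : ‖ξ‖ ^ (2 * (N : ℝ) + n + 4 + η) * ‖ξ‖ ^ (-((N : ℝ) + n + 3 + η)) = ‖ξ‖ ^ (N + 1) := by
        rw [← Real.rpow_natCast, ← Real.rpow_add hξ0]; congr 1; push_cast; ring
      have h5 : ‖ξ‖ ^ (N + 1) ≠ 0 := by positivity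
      calc _ = |inner ℝ ξ θ| ^ (N + 1) * |inner ℝ ξ θ| ^ (3 * N + 3) := by
            rw [← pow_mul, ← pow_add]; congr 1; ring
        _ = (‖ξ‖ ^ (2 * (N : ℝ) + n + 4 + η) * ‖ξ‖ ^ (-((N : ℝ) + n + 3 + η))) / ‖ξ‖ ^ (N + 1) *
            (|inner ℝ ξ θ| ^ (N + 1) * |inner ℝ ξ θ| ^ (3 * N + 3)) := by
            rw [h4, div_self h5, one_mul]
        _ = _ := by ring
    rw [mul_pow, mul_pow, h3]; ring
  have h6 : ∫⁻ ξ, B ξ ≤ bracketInt n (N + n + 3 + η) * (ENNReal.ofReal (((N : ℝ) + 1) ^ (-2 : ℝ) *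
        (1 - ‖z‖ ^ 2) ^ (-(2 * N - η + 1) / 2)) *
        ∫⁻ s : ℝ, ENNReal.ofReal (|s| ^ (2 * N - η)) * ‖gegenHat N s‖ₑ ^ 2) := by
    rw [hB, lintegral_rpow_mul_inner hθ _ hΦm]
    refine mul_le_mul_right ?_ _
    have h7 : ∫⁻ t : ℝ, ENNReal.ofReal (|t| ^ ((n : ℝ) - (N + n + 3 + η))) * Φ t =
        ∫⁻ t : ℝ, ENNReal.ofReal (|t| ^ (2 * N - η)) * dilAvg N l t ^ 2 := by
      refine lintegral_congr_ae ?_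
      filter_upwards [compl_mem_ae_iff.2 (measure_singleton (0 : ℝ))] with t ht
      have ht0 : 0 < |t| := abs_pos.2 ht
      simp only [hΦ]
      rw [← mul_assoc, ← ENNReal.ofReal_mul (by positivity), ← Real.rpow_natCast,
        ← Real.rpow_add ht0]
      rw [show (n : ℝ) - (N + n + 3 + η) + ((3 * N + 3 : ℕ) : ℝ) = 2 * N - η by push_cast; ring]
    rw [h7]
    refine (lintegral_rpow_mul_dilAvg_sq_le N hl0 (by linarith)).trans ?_
    refine mul_le_mul_left (ENNReal.ofReal_le_ofReal ?_) _
    refine mul_le_mul_of_nonneg_left ?_ (by positivity)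
    have hN' : (1 : ℝ) ≤ N := by exact_mod_cast hN
    have hl2 : l ^ 2 = (inner ℝ z θ) ^ 2 + (1 - ‖z‖ ^ 2) := Real.sq_sqrt (by positivity)
    have h9 : l ^ (-(2 * (N : ℝ) - η) - 1) = (l ^ 2) ^ (-(2 * N - η + 1) / 2) := by
      rw [← Real.rpow_natCast, ← Real.rpow_mul hl0.le]; congr 1; push_cast; ring
    rw [h9]
    exact Real.rpow_le_rpow_of_nonpos hz1 (by rw [hl2]; nlinarith [sq_nonneg (inner ℝ z θ)])
      (by linarith)
  have h8 := enorm_le_dilAvg h hh hz hθ N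
  rw [← mul_pow]
  calc _ ≤ (ENNReal.ofReal ((1 - ‖z‖ ^ 2) ^ (N + 1) / (2 * (N + 1)).factorial * (2 * (N + 1))) *
        ((∫⁻ ξ, A ξ) ^ (1 / 2 : ℝ) * (∫⁻ ξ, B ξ) ^ (1 / 2 : ℝ))) ^ 2 :=
        pow_le_pow_left₀ zero_le (h8.trans (mul_le_mul_right h1 _)) 2
    _ = ENNReal.ofReal ((1 - ‖z‖ ^ 2) ^ (N + 1) / (2 * (N + 1)).factorial * (2 * (N + 1))) ^ 2 *
        ((∫⁻ ξ, A ξ) * ∫⁻ ξ, B ξ) := by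
        rw [mul_pow, mul_pow, ennreal_rpow_half_sq, ennreal_rpow_half_sq]
    _ ≤ _ := mul_le_mul_right (mul_le_mul_right h6 _) _

lemma measurable_direction {d : ℕ} {g : E d → ℝ≥0∞} (hg : Measurable g) (m : ℕ) :
    Measurable fun p : E d × E d => g p.2 *
      ENNReal.ofReal (|inner ℝ p.2 ((‖p.1‖)⁻¹ • p.1) / ‖p.2‖| ^ m) := by
  have : Measurable fun p : E d × E d => g p.2 := hg.comp measurable_snd
  have h2 : Measurable fun p : E d × E d => (inner ℝ p.2 ((‖p.1‖)⁻¹ • p.1) : ℝ) :=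
    measurable_snd.inner (by fun_prop)
  fun_prop

/-- The cosine is symmetric in the two directions, so after Fubini the average over `w` for fixed
`ξ` is the one already computed. -/
lemma lintegral_direction_le {n : ℕ} {g : E (n + 1) → ℝ≥0∞} (hg : Measurable g) (m : ℕ) :
    ∫⁻ w in Metric.ball (0 : E (n + 1)) 1, ∫⁻ ξ, g ξ *
      ENNReal.ofReal (|inner ℝ ξ ((‖w‖)⁻¹ • w) / ‖ξ‖| ^ m) ≤
      2 * bracketInt n m * ∫⁻ ξ, g ξ := by
  rw [lintegral_lintegral_swap (measurable_direction hg m).aemeasurable, ← lintegral_const_mul _ hg]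
  refine lintegral_mono fun ξ => ?_
  have h1 : ∀ w : E (n + 1), g ξ * ENNReal.ofReal (|inner ℝ ξ ((‖w‖)⁻¹ • w) / ‖ξ‖| ^ m) =
      (g ξ * ENNReal.ofReal ((‖ξ‖ ^ m)⁻¹)) * ENNReal.ofReal (|inner ℝ ξ w / ‖w‖| ^ m) := by
    intro w
    rw [mul_assoc, ← ENNReal.ofReal_mul (by positivity)]
    congr 2
    rw [inner_smul_right, abs_div, abs_norm, div_pow, div_eq_inv_mul, div_eq_inv_mul]
  simp_rw [h1]
  rw [lintegral_const_mul _ (by fun_prop)]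
  calc _ ≤ (g ξ * ENNReal.ofReal ((‖ξ‖ ^ m)⁻¹)) * (ENNReal.ofReal (‖ξ‖ ^ m) * (2 * bracketInt n m)) :=
        mul_le_mul_right (lintegral_ball_direction_le ξ m) _
    _ = ENNReal.ofReal ((‖ξ‖ ^ m)⁻¹ * ‖ξ‖ ^ m) * (2 * bracketInt n m * g ξ) := by
        rw [ENNReal.ofReal_mul (by positivity)]; ring
    _ ≤ 1 * (2 * bracketInt n m * g ξ) := by
        refine mul_le_mul_left (ENNReal.ofReal_le_one.2 ?_) _
        exact inv_mul_le_one
    _ = _ := one_mul _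

/-- The pointwise bound for functions supported in the unit ball in terms of their energy of large
order. -/
lemma exists_enorm_sq_le_energy (n : ℕ) : ∃ K : ℝ≥0, ∀ (N : ℕ) (η : ℝ), 2 * n + 1 ≤ N → 0 ≤ η →
    η ≤ 2 → ∀ h : SchwartzMap (E (n + 1)) ℂ, (∀ z, 1 < ‖z‖ → h z = 0) → ∀ z, ‖z‖ < 1 →
    ‖h z‖ₑ ^ 2 ≤ K * ENNReal.ofReal ((1 - ‖z‖ ^ 2) ^ (N + 1) *
      (((N : ℝ) + 1) ^ (-(n : ℝ) - η) * √(N + 1) * (2 * N).factorial /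
        ((2 * (N + 1)).factorial : ℝ) ^ 2)) *
      ∫⁻ ξ, ‖hatS h ξ‖ₑ ^ 2 * ENNReal.ofReal (‖ξ‖ ^ (2 * (N : ℝ) + n + 4 + η)) := by
  obtain ⟨KJ, hKJ⟩ := exists_bracketInt_le n
  set v : ℝ≥0∞ := volume (Metric.ball (0 : E (n + 1)) 1) * ENNReal.ofReal ((2 * Real.pi) ^ (n + 1)) ^ 2
    with hv
  have hv0 : v ≠ 0 := mul_ne_zero (Metric.measure_ball_pos _ _ one_pos).ne'
    (pow_ne_zero _ (by simp; positivity))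
  have hvt : v ≠ ⊤ := ENNReal.mul_ne_top measure_ball_lt_top.ne (by finiteness)
  refine ⟨v.toNNReal⁻¹ * (8 * KJ ^ 2 * (32 * Real.pi + 32).toNNReal), fun N η hN hη hη2 h hh z hz => ?_⟩
  have hz1 : 0 < 1 - ‖z‖ ^ 2 := by nlinarith [norm_nonneg z]
  have hz2 : 1 - ‖z‖ ^ 2 ≤ 1 := by nlinarith [norm_nonneg z]
  have hN' : 2 * (n : ℝ) + 1 ≤ N := by exact_mod_cast hN
  have hM : (0 : ℝ) < N + 1 := by positivity
  set g : E (n + 1) → ℝ≥0∞ := fun ξ => ‖hatS h ξ‖ₑ ^ 2 *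
    ENNReal.ofReal (‖ξ‖ ^ (2 * (N : ℝ) + n + 4 + η)) with hg
  have hgm : Measurable g := by
    have : Measurable fun ξ => ‖hatS h ξ‖ₑ := (hatS h).continuous.measurable.enorm
    fun_prop
  set I := ∫⁻ ξ, g ξ with hI
  set Q : ℝ≥0∞ := ENNReal.ofReal ((1 - ‖z‖ ^ 2) ^ (N + 1) / (2 * (N + 1)).factorial * (2 * (N + 1))) ^ 2 *
    (bracketInt n (N + n + 3 + η) * (ENNReal.ofReal (((N : ℝ) + 1) ^ (-2 : ℝ) *
        (1 - ‖z‖ ^ 2) ^ (-(2 * N - η + 1) / 2)) *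
        ∫⁻ s : ℝ, ENNReal.ofReal (|s| ^ (2 * N - η)) * ‖gegenHat N s‖ₑ ^ 2)) with hQ
  have h1 : v * ‖h z‖ₑ ^ 2 ≤ Q * (2 * bracketInt n (N + 1 : ℕ) * I) := by
    -- The left side does not depend on the direction, so the chord bound may be averaged over it.
    calc v * ‖h z‖ₑ ^ 2 = ∫⁻ w in Metric.ball (0 : E (n + 1)) 1,
          ENNReal.ofReal ((2 * Real.pi) ^ (n + 1)) ^ 2 * ‖h z‖ₑ ^ 2 := by
          rw [setLIntegral_const, hv]; ring
      _ ≤ ∫⁻ w in Metric.ball (0 : E (n + 1)) 1, Q * ∫⁻ ξ, g ξ *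
          ENNReal.ofReal (|inner ℝ ξ ((‖w‖)⁻¹ • w) / ‖ξ‖| ^ (N + 1)) := by
          refine lintegral_mono_ae ?_
          have hne : ∀ᵐ w : E (n + 1) ∂(volume.restrict (Metric.ball 0 1)), w ≠ 0 := by
            have := nontrivial_E (d := n + 1) (by omega)
            exact ae_restrict_of_ae (compl_mem_ae_iff.2 (measure_singleton 0))
          filter_upwards [hne] with w hw
          have hθ : ‖(‖w‖)⁻¹ • w‖ = 1 := by
            rw [norm_smul, norm_inv, norm_norm, inv_mul_cancel₀ (norm_ne_zero_iff.2 hw)]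
          refine (enorm_sq_le_direction h hh hz hθ (show 1 ≤ N by omega) hη hη2).trans (le_of_eq ?_)
          exact (mul_left_comm _ _ _).trans (mul_comm _ _)
      _ = Q * ∫⁻ w in Metric.ball (0 : E (n + 1)) 1, ∫⁻ ξ, g ξ *
          ENNReal.ofReal (|inner ℝ ξ ((‖w‖)⁻¹ • w) / ‖ξ‖| ^ (N + 1)) := by
          rw [lintegral_const_mul]
          exact (measurable_direction hgm (N + 1)).lintegral_prod_right'
      _ ≤ _ := mul_le_mul_right (lintegral_direction_le hgm (N + 1)) _
  have hJ1 : bracketInt n (N + 1 : ℕ) ≤ KJ * ENNReal.ofReal (((N : ℝ) + 1) ^ (-(n : ℝ) / 2)) := by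
    have := hKJ (N + 1 : ℕ) (by push_cast; linarith)
    push_cast at this ⊢; exact this
  have hJ2 : bracketInt n (N + n + 3 + η) ≤ KJ * ENNReal.ofReal (((N : ℝ) + 1) ^ (-(n : ℝ) / 2)) :=
    (bracketInt_anti (by push_cast; linarith [(n.cast_nonneg : (0 : ℝ) ≤ n)])).trans hJ1
  have hE := lintegral_rpow_mul_gegenHat_le (N := N) (by omega) (κ := 2 * N - η) (by linarith)
    (by linarith)
  have hreal : ((1 - ‖z‖ ^ 2) ^ (N + 1) / (2 * (N + 1)).factorial * (2 * (N + 1))) ^ 2 *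
      ((((N : ℝ) + 1) ^ (-(n : ℝ) / 2)) * ((((N : ℝ) + 1) ^ (-2 : ℝ) *
        (1 - ‖z‖ ^ 2) ^ (-(2 * N - η + 1) / 2)) * (((2 * N).factorial * √(N + 1) *
          ((N : ℝ) + 1) ^ (2 * N - η - 2 * N))))) * ((N : ℝ) + 1) ^ (-(n : ℝ) / 2) ≤
      4 * ((1 - ‖z‖ ^ 2) ^ (N + 1) * (((N : ℝ) + 1) ^ (-(n : ℝ) - η) * √(N + 1) * (2 * N).factorial /
        ((2 * (N + 1)).factorial : ℝ) ^ 2)) := by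
    have e1 : ((N : ℝ) + 1) ^ (-(n : ℝ) / 2) * ((N : ℝ) + 1) ^ (-(n : ℝ) / 2) *
        ((N : ℝ) + 1) ^ (2 * N - η - 2 * N) = ((N : ℝ) + 1) ^ (-(n : ℝ) - η) := by
      rw [← Real.rpow_add hM, ← Real.rpow_add hM]; congr 1; ring
    have e2 : ((N : ℝ) + 1) ^ (-2 : ℝ) * (N + 1) ^ 2 = 1 := by
      rw [Real.rpow_neg hM.le, Real.rpow_two, inv_mul_cancel₀ (by positivity)]
    -- One of the two factors `(1-|z|²)^(N+1)` is spent against the negative power coming from the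
    -- chord length; the remaining exponent `(1+η)/2` is nonnegative.
    have e3 : (1 - ‖z‖ ^ 2) ^ (N + 1) * (1 - ‖z‖ ^ 2) ^ (-(2 * N - η + 1) / 2) ≤ 1 := by
      rw [← Real.rpow_natCast, ← Real.rpow_add hz1]
      exact Real.rpow_le_one hz1.le hz2 (by push_cast; linarith)
    calc _ = 4 * ((1 - ‖z‖ ^ 2) ^ (N + 1) * ((((N : ℝ) + 1) ^ (-(n : ℝ) / 2) *
          ((N : ℝ) + 1) ^ (-(n : ℝ) / 2) * ((N : ℝ) + 1) ^ (2 * N - η - 2 * N)) * √(N + 1) *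
          (2 * N).factorial / ((2 * (N + 1)).factorial : ℝ) ^ 2)) *
          (((N : ℝ) + 1) ^ (-2 : ℝ) * (N + 1) ^ 2) *
          ((1 - ‖z‖ ^ 2) ^ (N + 1) * (1 - ‖z‖ ^ 2) ^ (-(2 * N - η + 1) / 2)) := by ring
      _ ≤ 4 * ((1 - ‖z‖ ^ 2) ^ (N + 1) * ((((N : ℝ) + 1) ^ (-(n : ℝ) / 2) *
          ((N : ℝ) + 1) ^ (-(n : ℝ) / 2) * ((N : ℝ) + 1) ^ (2 * N - η - 2 * N)) * √(N + 1) *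
          (2 * N).factorial / ((2 * (N + 1)).factorial : ℝ) ^ 2)) * 1 * 1 := by
          rw [e2]; gcongr
      _ = _ := by rw [e1]; ring
  have h2 : Q * (2 * bracketInt n (N + 1 : ℕ) * I) ≤ 8 * KJ ^ 2 * ENNReal.ofReal (32 * Real.pi + 32) *
      ENNReal.ofReal ((1 - ‖z‖ ^ 2) ^ (N + 1) *
      (((N : ℝ) + 1) ^ (-(n : ℝ) - η) * √(N + 1) * (2 * N).factorial /
        ((2 * (N + 1)).factorial : ℝ) ^ 2)) * I := by
    have hpi := Real.pi_pos
    set EJ := ENNReal.ofReal (((N : ℝ) + 1) ^ (-(n : ℝ) / 2)) with hEJ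
    calc _ ≤ (ENNReal.ofReal ((1 - ‖z‖ ^ 2) ^ (N + 1) / (2 * (N + 1)).factorial * (2 * (N + 1))) ^ 2 *
          (KJ * EJ * (ENNReal.ofReal (((N : ℝ) + 1) ^ (-2 : ℝ) *
          (1 - ‖z‖ ^ 2) ^ (-(2 * N - η + 1) / 2)) * ENNReal.ofReal ((32 * Real.pi + 32) *
          ((2 * N).factorial * √(N + 1) * ((N : ℝ) + 1) ^ (2 * N - η - 2 * N)))))) *
          (2 * (KJ * EJ) * I) := by
          rw [hQ]
          exact mul_le_mul' (mul_le_mul_right (mul_le_mul' hJ2 (mul_le_mul_right hE _)) _)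
            (mul_le_mul_left (mul_le_mul_right hJ1 _) _)
      _ = 2 * KJ ^ 2 * ENNReal.ofReal (32 * Real.pi + 32) * (ENNReal.ofReal ((1 - ‖z‖ ^ 2) ^ (N + 1) /
          (2 * (N + 1)).factorial * (2 * (N + 1))) ^ 2 * (EJ * (ENNReal.ofReal
          (((N : ℝ) + 1) ^ (-2 : ℝ) * (1 - ‖z‖ ^ 2) ^ (-(2 * N - η + 1) / 2)) * ENNReal.ofReal
          ((2 * N).factorial * √(N + 1) * ((N : ℝ) + 1) ^ (2 * N - η - 2 * N)))) * EJ) * I := by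
          rw [ENNReal.ofReal_mul (p := 32 * Real.pi + 32) (by positivity)]; ring
      _ ≤ 2 * KJ ^ 2 * ENNReal.ofReal (32 * Real.pi + 32) * ENNReal.ofReal (4 *
          ((1 - ‖z‖ ^ 2) ^ (N + 1) * (((N : ℝ) + 1) ^ (-(n : ℝ) - η) * √(N + 1) * (2 * N).factorial /
            ((2 * (N + 1)).factorial : ℝ) ^ 2))) * I := by
          rw [hEJ, ← ENNReal.ofReal_pow (by positivity), ← ENNReal.ofReal_mul (by positivity),
            ← ENNReal.ofReal_mul (by positivity), ← ENNReal.ofReal_mul (by positivity),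
            ← ENNReal.ofReal_mul (by positivity)]
          exact mul_le_mul_left (mul_le_mul_right (ENNReal.ofReal_le_ofReal hreal) _) _
      _ = _ := by
          rw [ENNReal.ofReal_mul (p := 4) (by norm_num), ENNReal.ofReal_ofNat]; ring
  have hvv : ((v.toNNReal⁻¹ : ℝ≥0) : ℝ≥0∞) = v⁻¹ := by
    rw [ENNReal.coe_inv (by simpa [ENNReal.toNNReal_eq_zero_iff] using ⟨hv0, hvt⟩),
      ENNReal.coe_toNNReal hvt]
  calc ‖h z‖ₑ ^ 2 = v⁻¹ * (v * ‖h z‖ₑ ^ 2) := by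
        rw [← mul_assoc, ENNReal.inv_mul_cancel hv0 hvt, one_mul]
    _ ≤ v⁻¹ * _ := mul_le_mul_right (h1.trans h2) _
    _ = _ := by
        rw [← hvv]
        push_cast
        change _ = _ * (8 * (KJ : ℝ≥0∞) ^ 2 * ENNReal.ofReal (32 * Real.pi + 32)) * _ * _
        ring

/-! ### Radial test measures -/

/-- The density `(1 - r²)₊^e`. -/
def capDensity (e r : ℝ) : ℝ≥0∞ := ENNReal.ofReal ((max 0 (1 - r ^ 2)) ^ e)

/-- The radial measure with density `(1 - |y|²)₊^e`. -/
def capMeasure (d : ℕ) (e : ℝ) : Measure (E d) := volume.withDensity fun y => capDensity e ‖y‖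

@[fun_prop]
lemma measurable_capDensity (e : ℝ) : Measurable (capDensity e) := by
  unfold capDensity; fun_prop

lemma capMeasure_univ (d : ℕ) (e : ℝ) : capMeasure d e univ = ∫⁻ y : E d, capDensity e ‖y‖ := by
  rw [capMeasure, withDensity_apply _ MeasurableSet.univ, Measure.restrict_univ]

lemma capDensity_le_exp {e : ℝ} (he : 0 ≤ e) (r : ℝ) :
    capDensity e r ≤ ENNReal.ofReal (Real.exp (-(e * r ^ 2))) := by
  refine ENNReal.ofReal_le_ofReal ?_
  have h1 : max 0 (1 - r ^ 2) ≤ Real.exp (-r ^ 2) :=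
    max_le (Real.exp_pos _).le (by linarith [Real.add_one_le_exp (-r ^ 2)])
  calc _ ≤ Real.exp (-r ^ 2) ^ e := Real.rpow_le_rpow (le_max_left _ _) h1 he
    _ = _ := by rw [← Real.exp_mul]; congr 1; ring

lemma lintegral_exp_neg_mul_sq (d : ℕ) {b : ℝ} (hb : 0 < b) :
    ∫⁻ y : E d, ENNReal.ofReal (Real.exp (-(b * ‖y‖ ^ 2))) =
      ENNReal.ofReal ((Real.pi / b) ^ ((d : ℝ) / 2)) := by
  rw [← ofReal_integral_eq_lintegral_ofReal (integrable_gauss hb)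
    (Filter.Eventually.of_forall fun _ => (Real.exp_pos _).le)]
  have := GaussianFourier.integral_rexp_neg_mul_sq_norm (V := E d) hb
  rw [finrank_euclideanSpace_fin] at this
  rw [← this]
  congr 2; ext y; rw [neg_mul]

lemma capMeasure_univ_le (d : ℕ) {e : ℝ} (he : 0 < e) :
    capMeasure d e univ ≤ ENNReal.ofReal ((Real.pi / e) ^ ((d : ℝ) / 2)) := by
  rw [capMeasure_univ, ← lintegral_exp_neg_mul_sq d he]
  exact lintegral_mono fun y => capDensity_le_exp he.le _

lemma isFiniteMeasure_capMeasure (d : ℕ) {e : ℝ} (he : 0 < e) : IsFiniteMeasure (capMeasure d e) :=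
  ⟨(capMeasure_univ_le d he).trans_lt ENNReal.ofReal_lt_top⟩

lemma ae_norm_le_capMeasure (d : ℕ) {e : ℝ} (he : 0 < e) : ∀ᵐ y ∂(capMeasure d e), ‖y‖ ≤ 1 := by
  rw [capMeasure, ae_withDensity_iff (by fun_prop)]
  refine Filter.Eventually.of_forall fun y hy => ?_
  by_contra hlt
  refine hy ?_
  rw [capDensity, max_eq_left (by nlinarith), Real.zero_rpow he.ne', ENNReal.ofReal_zero]

/-- A slice at height `t` is a ball of radius `√(1-t²)`; rescaling it raises the exponent by `k/2`.
-/
lemma lintegral_capDensity_mkPt {k : ℕ} {e : ℝ} (he : 0 < e) (t : ℝ) :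
    ∫⁻ x : E k, capDensity e ‖mkPt x t‖ =
      capDensity (e + k / 2) t * capMeasure k e univ := by
  have hk : (0 : ℝ) ≤ k := k.cast_nonneg
  rcases le_or_gt (1 - t ^ 2) 0 with ht | ht
  · have h1 : ∀ x : E k, capDensity e ‖mkPt x t‖ = 0 := fun x => by
      rw [capDensity, norm_mkPt_sq, max_eq_left (by nlinarith [sq_nonneg ‖x‖]),
        Real.zero_rpow he.ne', ENNReal.ofReal_zero]
    simp_rw [h1]
    rw [capDensity, max_eq_left ht, Real.zero_rpow (by positivity)]
    simp
  · set a : ℝ := √(1 - t ^ 2) with ha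
    have ha0 : 0 < a := Real.sqrt_pos.2 ht
    have ha2 : a ^ 2 = 1 - t ^ 2 := Real.sq_sqrt ht.le
    have h := lintegral_comp_smul_pos (fun x : E k => capDensity e ‖mkPt x t‖) ha0
    have h1 : ∀ x : E k, capDensity e ‖mkPt (a • x) t‖ =
        ENNReal.ofReal ((a ^ 2) ^ e) * capDensity e ‖x‖ := by
      intro x
      rw [capDensity, capDensity, norm_mkPt_sq, norm_smul, Real.norm_of_nonneg ha0.le,
        ← ENNReal.ofReal_mul (by positivity), ← Real.mul_rpow (by positivity) (le_max_left _ _),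
        mul_max_of_nonneg _ _ (by positivity), mul_zero]
      congr 3
      nlinarith
    simp_rw [h1] at h
    rw [lintegral_const_mul' _ _ ENNReal.ofReal_ne_top, ← capMeasure_univ] at h
    calc _ = ENNReal.ofReal (a ^ (k : ℝ)) * (ENNReal.ofReal (a ^ (-(k : ℝ))) *
          ∫⁻ x : E k, capDensity e ‖mkPt x t‖) := by
          rw [← mul_assoc, ← ENNReal.ofReal_mul (by positivity), ← Real.rpow_add ha0]; simp
      _ = _ := by
          rw [← h, ← mul_assoc, ← ENNReal.ofReal_mul (by positivity), capDensity,
            max_eq_right ht.le, ← ha2]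
          congr 2
          rw [Real.rpow_add (by positivity), mul_comm]
          congr 1
          rw [← Real.rpow_natCast, ← Real.rpow_mul ha0.le]; congr 1; push_cast; ring

lemma lintegral_inner_capMeasure {k : ℕ} {e : ℝ} (he : 0 < e) (ξ : E (k + 1)) {f : ℝ → ℝ≥0∞}
    (hf : Measurable f) : ∫⁻ y, f (inner ℝ ξ y) ∂(capMeasure (k + 1) e) =
      capMeasure k e univ * ∫⁻ t, capDensity (e + k / 2) t * f (‖ξ‖ * t) := by
  have hfm : Measurable fun y : E (k + 1) => f (inner ℝ ξ y) := hf.comp (by fun_prop)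
  rw [capMeasure, lintegral_withDensity_eq_lintegral_mul _ (by fun_prop) hfm]
  have h := lintegral_inner_norm ξ (fun u r => capDensity e r * f u) (by
    have h1 : Measurable fun p : ℝ × ℝ => capDensity e p.2 := by fun_prop
    have h2 : Measurable fun p : ℝ × ℝ => f p.1 := hf.comp measurable_fst
    exact h1.mul h2)
  simp only [Pi.mul_apply]
  rw [h, ← lintegral_const_mul _ (by
    have h2 : Measurable fun t : ℝ => f (‖ξ‖ * t) := hf.comp (by fun_prop)
    fun_prop)]
  refine lintegral_congr fun t => ?_
  rw [lintegral_mul_const, lintegral_capDensity_mkPt he]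
  · ring
  · have hp : Continuous fun x : E k => ((x, t) : E k × ℝ) := by fun_prop
    have := (continuous_mkPt.comp hp).norm.measurable
    exact (measurable_capDensity e).comp this

lemma capDensity_natCast (N : ℕ) (t : ℝ) :
    capDensity N t = ENNReal.ofReal ((max 0 (1 - t ^ 2)) ^ N) := by
  rw [capDensity, Real.rpow_natCast]

lemma integral_max_pow_mul {N : ℕ} (hN : N ≠ 0) (f : ℝ → ℂ) :
    ∫ t, (((max 0 (1 - t ^ 2)) ^ N : ℝ) : ℂ) * f t =
      ∫ t in (-1 : ℝ)..1, ((((t + 1) * (1 - t)) ^ N : ℝ) : ℂ) * f t := by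
  rw [intervalIntegral.integral_of_le (by norm_num),
    ← setIntegral_eq_integral_of_forall_compl_eq_zero (s := Ioc (-1 : ℝ) 1)]
  · refine setIntegral_congr_fun measurableSet_Ioc fun t ht => ?_
    have h1 : 1 - t ^ 2 = (t + 1) * (1 - t) := by ring
    have h2 : 0 ≤ (t + 1) * (1 - t) := mul_nonneg (by linarith [ht.1]) (by linarith [ht.2])
    simp only [h1, max_eq_right h2]
  · intro t ht
    have h1 : 1 - t ^ 2 ≤ 0 := by
      by_contra h
      have : t ^ 2 < 1 := by linarith
      exact ht ⟨by nlinarith, by nlinarith⟩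
    rw [max_eq_left h1, zero_pow hN]; simp

/-- The projection of the measure to a line has density proportional to `(1-t²)₊^N`, so its
transform is the Gegenbauer transform at `|ξ|`. -/
lemma enorm_charFun_capMeasure {k N : ℕ} (hN : N ≠ 0) {e : ℝ} (he : 0 < e)
    (heN : e + k / 2 = N) (ξ : E (k + 1)) :
    ‖charFun (capMeasure (k + 1) e) ξ‖ₑ = capMeasure (k + 1) e univ * ‖gegenHat N ‖ξ‖‖ₑ := by
  have hfin := isFiniteMeasure_capMeasure k he
  have hct : capMeasure k e univ ≠ ⊤ := measure_ne_top _ _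
  set c : ℝ≥0∞ := capMeasure k e univ with hc
  set w : ℝ → ℝ≥0∞ := capDensity N with hw
  have hwm : Measurable w := measurable_capDensity _
  have hwt : ∀ t, (w t).toReal = (max 0 (1 - t ^ 2)) ^ N := fun t => by
    rw [hw, capDensity_natCast, ENNReal.toReal_ofReal (by positivity)]
  have hmap : (capMeasure (k + 1) e).map (fun y => inner ℝ ξ y) =
      c • (volume.withDensity w).map (fun t => ‖ξ‖ * t) := by
    refine Measure.ext fun s hs => ?_
    have hind : Measurable (s.indicator (1 : ℝ → ℝ≥0∞)) := measurable_one.indicator hs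
    have h := lintegral_inner_capMeasure he ξ hind
    have hindm : Measurable fun t : ℝ => s.indicator (1 : ℝ → ℝ≥0∞) (‖ξ‖ * t) :=
      hind.comp (by fun_prop)
    rw [heN] at h
    rw [← lintegral_indicator_one hs, ← lintegral_indicator_one hs, lintegral_map hind (by fun_prop),
      lintegral_smul_measure, lintegral_map hind (by fun_prop),
      lintegral_withDensity_eq_lintegral_mul _ hwm hindm, h]
    rfl
  have hB := gegenMass_pos N
  have hmass : capMeasure (k + 1) e univ = c * ENNReal.ofReal (gegenMass N) := by
    have h := lintegral_inner_capMeasure he (0 : E (k + 1)) (f := fun _ => 1) measurable_const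
    rw [heN, lintegral_one] at h
    simp only [mul_one] at h
    rw [h]
    congr 1
    have h2 := integral_max_pow_mul hN (fun _ => 1)
    simp only [mul_one] at h2
    have h3 : ∫ t, (max 0 (1 - t ^ 2)) ^ N = gegenMass N :=
      Complex.ofReal_injective (integral_complex_ofReal.symm.trans
        (h2.trans intervalIntegral.integral_ofReal))
    rw [← h3, ofReal_integral_eq_lintegral_ofReal]
    · exact lintegral_congr fun t => capDensity_natCast N t
    · by_contra hni
      rw [integral_undef hni] at h3
      exact hB.ne h3
    · exact Filter.Eventually.of_forall fun t => by positivity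
  have h1 : charFun (capMeasure (k + 1) e) ξ =
      (c.toReal : ℂ) * ((gegenMass N : ℂ) * gegenHat N ‖ξ‖) := by
    have h2 : charFun (capMeasure (k + 1) e) ξ =
        ∫ u, Complex.exp ((u : ℂ) * Complex.I) ∂((capMeasure (k + 1) e).map fun y => inner ℝ ξ y) := by
      rw [integral_map (by fun_prop) (Continuous.aestronglyMeasurable (by fun_prop)), charFun_apply]
      simp_rw [real_inner_comm ξ]
    rw [h2, hmap, integral_smul_measure, integral_map (by fun_prop)
      (Continuous.aestronglyMeasurable (by fun_prop)),
      integral_withDensity_eq_integral_toReal_smul hwm (Filter.Eventually.of_forall fun t =>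
        ENNReal.ofReal_lt_top), Complex.real_smul]
    congr 1
    rw [gegenHat, ← mul_assoc, ← Complex.ofReal_mul, mul_inv_cancel₀ hB.ne', Complex.ofReal_one,
      one_mul, ← integral_max_pow_mul hN]
    refine integral_congr_ae (Filter.Eventually.of_forall fun t => ?_)
    simp only [hwt, Complex.real_smul]
    push_cast; ring
  rw [h1, enorm_mul, enorm_mul, hmass]
  have h4 : ‖(c.toReal : ℂ)‖ₑ = c := by
    rw [← ofReal_norm, Complex.norm_real, Real.norm_of_nonneg ENNReal.toReal_nonneg,
      ENNReal.ofReal_toReal hct]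
  have h5 : ‖(gegenMass N : ℂ)‖ₑ = ENNReal.ofReal (gegenMass N) := by
    rw [← ofReal_norm, Complex.norm_real, Real.norm_of_nonneg hB.le]
  rw [h4, h5, mul_assoc]

/-- In polar coordinates the weight becomes `r^(d-1) r^(α-d) = r^(α-1)`, independent of the
dimension. -/
lemma energy_capMeasure_le {k N : ℕ} (hN : N ≠ 0) {e : ℝ} (he : 0 < e)
    (heN : e + k / 2 = N) (α : ℝ) :
    energy α (capMeasure (k + 1) e) ≤ capMeasure (k + 1) e univ ^ 2 *
      (((k + 1 : ℕ) * volume (Metric.ball (0 : E (k + 1)) 1)) *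
        ∫⁻ s : ℝ, ENNReal.ofReal (|s| ^ (α - 1)) * ‖gegenHat N s‖ₑ ^ 2) := by
  have hgm : Measurable fun s : ℝ => ‖gegenHat N s‖ₑ := (continuous_gegenHat N).measurable.enorm
  have hfin := isFiniteMeasure_capMeasure (k + 1) he
  rw [energy_eq]
  simp_rw [enorm_charFun_capMeasure hN he heN, mul_pow, mul_assoc]
  rw [lintegral_const_mul' _ _ (by finiteness), lintegral_radial (by omega)
    (fun r => ‖gegenHat N r‖ₑ ^ 2 * ENNReal.ofReal (r ^ (α - ((k + 1 : ℕ) : ℝ)))) (by fun_prop)]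
  rw [← mul_assoc ((k + 1 : ℕ) : ℝ≥0∞)]
  refine mul_le_mul_right (mul_le_mul_right ?_ _) _
  refine le_trans (le_of_eq ?_) (setLIntegral_le_lintegral (Ioi (0 : ℝ)) _)
  refine setLIntegral_congr_fun measurableSet_Ioi fun r hr => ?_
  have hr0 : 0 < r := hr
  rw [mul_left_comm, ← ENNReal.ofReal_mul (by positivity), mul_comm, abs_of_pos hr0,
    ← Real.rpow_natCast, ← Real.rpow_add hr0]
  congr 3
  push_cast
  ring

/-! ### Energy of the radial test measures -/

/-- The crucial cancellation between the constant of the pointwise bound and the energy of the test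
measure. After comparing all factorials with `(2N)!`, the powers of `N + 1` add up to exactly one
and `η` disappears. -/
lemma factorial_const_le (n N : ℕ) {η : ℝ} (hη : η ≤ 2) :
    ((N : ℝ) + 1) ^ (-(n : ℝ) - η) * √(N + 1) * (2 * N).factorial /
        ((2 * (N + 1)).factorial : ℝ) ^ 2 *
      ((Real.pi / (N + 1)) ^ n * ((2 * (N + n + 3)).factorial * √((N + n + 3 : ℕ) + 1) *
        (((N + n + 3 : ℕ) : ℝ) + 1) ^ (η - 2))) ≤
      Real.pi ^ n * (2 * n + 8) ^ (2 * n + 6) * (n + 4) * (N + 1) := by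
  set m : ℝ := (N : ℝ) + 1 with hm
  have hm0 : 0 < m := by positivity
  have hm1 : 1 ≤ m := by rw [hm]; linarith [(N.cast_nonneg : (0 : ℝ) ≤ N)]
  have hn0 : (0 : ℝ) ≤ n := n.cast_nonneg
  set F : ℝ := ((2 * N).factorial : ℝ) with hF
  have hF0 : 0 < F := by rw [hF]; exact_mod_cast (2 * N).factorial_pos
  have h1 : F * m ^ 2 ≤ (2 * (N + 1)).factorial := by
    rw [hF, hm, show 2 * (N + 1) = 2 * N + 1 + 1 by ring, Nat.factorial_succ, Nat.factorial_succ]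
    push_cast
    have : (0 : ℝ) ≤ (2 * N).factorial := hF0.le
    have hN : (0 : ℝ) ≤ N := N.cast_nonneg
    nlinarith [mul_nonneg this hN, mul_nonneg (mul_nonneg this hN) hN]
  have h2 : ((2 * (N + n + 3)).factorial : ℝ) ≤ F * ((2 * n + 8) ^ (2 * n + 6) * m ^ (2 * n + 6)) := by
    have h := Nat.mul_le_mul_left (2 * N).factorial (Nat.ascFactorial_le_pow_add (2 * N) (2 * n + 6))
    rw [Nat.factorial_mul_ascFactorial] at h
    rw [show 2 * (N + n + 3) = 2 * N + (2 * n + 6) by ring, ← mul_pow]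
    calc _ ≤ (((2 * N).factorial * (2 * N + (2 * n + 6)) ^ (2 * n + 6) : ℕ) : ℝ) := by exact_mod_cast h
      _ ≤ _ := by
        push_cast
        gcongr
        nlinarith
  have h3 : √((N + n + 3 : ℕ) + 1 : ℝ) ≤ (n + 4) * √m := by
    rw [← Real.sqrt_sq (show (0 : ℝ) ≤ n + 4 by positivity), ← Real.sqrt_mul (by positivity)]
    refine Real.sqrt_le_sqrt ?_
    push_cast
    have hN : (0 : ℝ) ≤ N := N.cast_nonneg
    rw [hm]
    nlinarith [mul_nonneg hn0 hN, mul_nonneg (mul_nonneg hn0 hn0) hN]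
  have h4 : (((N + n + 3 : ℕ) : ℝ) + 1) ^ (η - 2) ≤ m ^ η / m ^ 2 := by
    refine (Real.rpow_le_rpow_of_nonpos hm0 ?_ (by linarith)).trans (le_of_eq ?_)
    · push_cast; rw [hm]; linarith
    · rw [Real.rpow_sub hm0, Real.rpow_two]
  have h5 : m ^ (-(n : ℝ) - η) = (m ^ n * m ^ η)⁻¹ := by
    rw [← neg_add', Real.rpow_neg hm0.le, Real.rpow_add hm0, Real.rpow_natCast]
  have hη0 : 0 < m ^ η := by positivity
  have hs : √m * √m = m := Real.mul_self_sqrt hm0.le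
  rw [h5]
  calc _ ≤ (m ^ n * m ^ η)⁻¹ * √m * F / (F * m ^ 2) ^ 2 *
        ((Real.pi / m) ^ n * (F * ((2 * n + 8) ^ (2 * n + 6) * m ^ (2 * n + 6)) * ((n + 4) * √m) *
          (m ^ η / m ^ 2))) := by gcongr
    _ = (√m * √m) * (Real.pi ^ n * (2 * n + 8) ^ (2 * n + 6) * (n + 4)) := by
        rw [div_pow]
        field_simp
        ring
    _ = _ := by rw [hs]; ring

/-- The pointwise bound of a mollified measure, combined with the energy of the test measure. -/
lemma exists_energy_capMeasure_mul_le {n : ℕ} (hn : 1 ≤ n) : ∃ K : ℝ≥0, ∀ (N : ℕ) (η : ℝ), 0 ≤ η →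
    η ≤ 2 → ∃ e : ℝ, (N : ℝ) + 1 ≤ e ∧ e ≤ (n + 4) * (N + 1) ∧
      ENNReal.ofReal (((N : ℝ) + 1) ^ (-(n : ℝ) - η) * √(N + 1) * (2 * N).factorial /
        ((2 * (N + 1)).factorial : ℝ) ^ 2) *
        energy (2 * (N : ℝ) + 2 * n + 5 + η) (capMeasure n e) ≤ K * ENNReal.ofReal (N + 1) := by
  obtain ⟨k, rfl⟩ : ∃ k, n = k + 1 := ⟨n - 1, by omega⟩
  set n := k + 1 with hnk
  set v : ℝ≥0∞ := (k + 1 : ℕ) * volume (Metric.ball (0 : E (k + 1)) 1) with hv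
  have hvt : v ≠ ⊤ := ENNReal.mul_ne_top (ENNReal.natCast_ne_top _) measure_ball_lt_top.ne
  set c : ℝ := (32 * Real.pi + 32) * (Real.pi ^ n * (2 * n + 8) ^ (2 * n + 6) * (n + 4)) with hc
  refine ⟨(v * ENNReal.ofReal c).toNNReal, fun N η hη0 hη => ?_⟩
  rw [ENNReal.coe_toNNReal (ENNReal.mul_ne_top hvt ENNReal.ofReal_ne_top)]
  have hk0 : (0 : ℝ) ≤ k := k.cast_nonneg
  have hN0 : (0 : ℝ) ≤ N := N.cast_nonneg
  -- Makes the projected weight have the integer exponent `N + n + 3`. The energy then involves the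
  -- power `2N + 2n + 4 + η`, which is within the admissible distance `2` below `2(N+n+3)`.
  set e : ℝ := ((N + n + 3 : ℕ) : ℝ) - k / 2 with he
  have hn' : (n : ℝ) = k + 1 := by rw [hnk]; push_cast; ring
  have he1 : (N : ℝ) + 1 ≤ e := by rw [he]; push_cast; rw [hn']; linarith
  have he0 : 0 < e := by linarith
  refine ⟨e, he1, ?_, ?_⟩
  · rw [he]; push_cast; rw [hn']; nlinarith
  have h1 := energy_capMeasure_le (k := k) (N := N + n + 3) (by omega) he0 (by rw [he]; ring)
    (2 * (N : ℝ) + 2 * n + 5 + η)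
  have h2 := lintegral_rpow_mul_gegenHat_le (N := N + n + 3) (by omega)
    (κ := 2 * (N : ℝ) + 2 * n + 5 + η - 1) (by push_cast; linarith) (by push_cast; linarith)
  have h3 : capMeasure n e univ ^ 2 ≤ ENNReal.ofReal ((Real.pi / (N + 1)) ^ n) := by
    refine (pow_le_pow_left' (capMeasure_univ_le n he0) 2).trans ?_
    rw [← ENNReal.ofReal_pow (by positivity), ← Real.rpow_natCast (_ ^ _), ← Real.rpow_mul
      (by positivity), show (n : ℝ) / 2 * ((2 : ℕ) : ℝ) = n by push_cast; ring, Real.rpow_natCast]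
    gcongr
  have hexp : 2 * (N : ℝ) + 2 * n + 5 + η - 1 - 2 * ((N + n + 3 : ℕ) : ℝ) = η - 2 := by
    push_cast; ring
  rw [hexp] at h2
  set G : ℝ := ((N : ℝ) + 1) ^ (-(n : ℝ) - η) * √(N + 1) * (2 * N).factorial /
        ((2 * (N + 1)).factorial : ℝ) ^ 2 with hG
  have hG0 : 0 ≤ G := by positivity
  set Q : ℝ := (2 * (N + n + 3)).factorial * √((N + n + 3 : ℕ) + 1) *
        (((N + n + 3 : ℕ) : ℝ) + 1) ^ (η - 2) with hQ
  have hQ0 : 0 ≤ Q := by positivity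
  calc _ ≤ ENNReal.ofReal G * (ENNReal.ofReal ((Real.pi / (N + 1)) ^ n) *
        (v * ENNReal.ofReal ((32 * Real.pi + 32) * Q))) := by
        gcongr
        refine h1.trans ?_
        gcongr
    _ = v * ENNReal.ofReal ((32 * Real.pi + 32) * (G * ((Real.pi / (N + 1)) ^ n * Q))) := by
        rw [mul_left_comm (ENNReal.ofReal _) v, mul_left_comm _ v, ← ENNReal.ofReal_mul (by positivity),
          ← ENNReal.ofReal_mul hG0]
        congr 2; ring
    _ ≤ v * ENNReal.ofReal (c * (N + 1)) := by
        refine mul_le_mul_right (ENNReal.ofReal_le_ofReal ?_) _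
        rw [hc, mul_assoc]
        refine mul_le_mul_of_nonneg_left (factorial_const_le n N hη) (by positivity)
    _ = _ := by rw [ENNReal.ofReal_mul (by positivity), ← mul_assoc]

/-! ### Translations -/

lemma DualBound.map_add {n : ℕ} {m : E n → ℝ≥0∞} {ν : Measure (E (n + 1))} {D : ℝ≥0∞}
    (h : DualBound m ν D) (c : E (n + 1)) : DualBound m (ν.map fun z => z + c) D := by
  intro w hw hw1
  refine (le_of_eq (lintegral_congr fun ξ => ?_)).trans
    (h (fun z => w (z + c)) (hw.comp (by fun_prop)) fun z => hw1 _)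
  congr 2
  have h2 : ft (ν.map fun z => z + c) w (coneLift ξ) =
      Complex.exp ((inner ℝ c (coneLift ξ) : ℝ) * Complex.I) *
        ft ν (fun z => w (z + c)) (coneLift ξ) := by
    rw [ft, ft, integral_map (by fun_prop), ← integral_const_mul]
    · congr 1; ext z
      rw [inner_add_left, ← mul_assoc, ← Complex.exp_add]
      congr 2; push_cast; ring
    · exact ((Continuous.measurable (by fun_prop)).mul hw).aestronglyMeasurable
  rw [h2, enorm_mul, ← ofReal_norm (Complex.exp _), Complex.norm_exp_ofReal_mul_I,
    ENNReal.ofReal_one, one_mul]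

/-- Translation multiplies transforms by unimodular factors, so it is harmless on the dual side, and
passing there and back is lossless. Slab bounds thereby extend to translates that leave the slab. -/
lemma TestBound.map_add {n : ℕ} (hn : 1 ≤ n) {A : Set (E n)} (hA : IsOpen A) {W : E n → ℝ}
    (hW : ContDiff ℝ (⊤ : ℕ∞) W) (hW0 : ∀ ξ, 0 < W ξ) {ν : Measure (E (n + 1))}
    [IsFiniteMeasure ν] {r : ℝ} (hν : ∀ᵐ z ∂ν, ‖z‖ ≤ r) {D : ℝ≥0∞} (h : TestBound A W ν D)
    (c : E (n + 1)) : TestBound A W (ν.map fun z => z + c) D := by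
  have h1 := ((h.dualBound hn hA hW hW0 hν).map_add c).testBound hA.measurableSet
    hW.continuous.measurable hW0
  rwa [← mul_assoc, ENNReal.inv_mul_cancel (twoPiPow_ne_zero n) (twoPiPow_ne_top n), one_mul] at h1

/-- A slab bound controls all space-time translates of a dilated measure in a time slice. -/
lemma SlabBound.lintegral_translate_le {n : ℕ} (hn : 1 ≤ n) {A : Set (E n)} (hA : IsOpen A)
    {W : E n → ℝ} (hW : ContDiff ℝ (⊤ : ℕ∞) W) (hW0 : ∀ ξ, 0 < W ξ) {α : ℝ} {D : ℝ≥0∞}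
    (h : SlabBound A W α D) {P : Measure (E n)} [IsFiniteMeasure P] (hP : ∀ᵐ y ∂P, ‖y‖ ≤ 1)
    {r : ℝ} (hr0 : 0 < r) (hr1 : r < 1) {f : SchwartzMap (E n) ℂ} (hf : tsupport (fourierHat f) ⊆ A)
    (a : E n) (t : ℝ) :
    ∫⁻ y, ‖wave f (r • y + a) t‖ₑ ∂P ≤ D * (ENNReal.ofReal (r ^ (-α)) * energy α P) ^ (1 / 2 : ℝ) *
      (∫⁻ ξ, ENNReal.ofReal (W ξ) * ‖fourierHat f ξ‖ₑ ^ 2) ^ (1 / 2 : ℝ) := by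
  set μ : Measure (E n) := P.map fun y => r • y with hμ
  have hg : Measurable fun x : E n => mkPt x (1 / 2) := measurable_graph (t := fun _ => 1 / 2)
    measurable_const
  set ν := graphMeasure μ fun _ => 1 / 2 with hν
  have hνf : IsFiniteMeasure ν := by rw [hν, graphMeasure]; infer_instance
  have hslab : IsSlabMeasure ν := by
    refine ⟨hνf, Metric.closedBall 0 r, isCompact_closedBall _ _,
      Metric.closedBall_subset_ball hr1, ?_, ?_⟩
    · rw [hν, graphMeasure, ae_map_iff hg.aemeasurable
        (continuous_spacePart.measurable measurableSet_closedBall), hμ,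
        ae_map_iff (by fun_prop) (by
          simp only [spacePart_mkPt]; exact measurableSet_closedBall)]
      filter_upwards [hP] with y hy
      rw [spacePart_mkPt, mem_closedBall_zero_iff, norm_smul, Real.norm_of_nonneg hr0.le]
      nlinarith
    · rw [hν, graphMeasure, ae_map_iff hg.aemeasurable
        (continuous_timePart.measurable measurableSet_Ioo)]
      exact Filter.Eventually.of_forall fun y => by rw [timePart_mkPt]; norm_num
  have h1 := (h ν hslab).map_add hn hA hW hW0 hslab.ae_norm_le (mkPt a (t - 1 / 2)) f hf
  rw [hν, graphMeasure_map_spacePart μ measurable_const, hμ, energy_map_smul α P hr0] at h1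
  refine le_trans (le_of_eq ?_) h1
  have hm := measurable_enorm_wave f
  have hcm : Measurable fun z : E (n + 1) => z + mkPt a (t - 1 / 2) := measurable_add_const _
  rw [graphMeasure, Measure.map_map hcm hg, Measure.map_map (hcm.comp hg) (by fun_prop),
    spaceTimeLHS, lintegral_map hm ((hcm.comp hg).comp (by fun_prop))]
  refine lintegral_congr fun y => ?_
  simp only [Function.comp_apply, spacePart_add, timePart_add, spacePart_mkPt, timePart_mkPt]
  congr 2; ring

/-! ### Covering by translates -/

/-- Integrate the hypothesis over translates `a` with a Gaussian weight. For `|y| < δ` the density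
is at least `1/2`, and shifting the Gaussian by `r y` costs a further factor `2`; the remaining
integral over `y` is the volume of the small ball. -/
lemma lintegral_comp_add_smul_capMeasure {n : ℕ} {e b δ r : ℝ} (he : 1 ≤ e) (hb : 0 < b)
    (hδe : e * δ ^ 2 ≤ 1 / 2) (hδb : b * δ ^ 2 ≤ 1) (hr0 : 0 ≤ r) (hr1 : r ≤ 1)
    {v : E n → ℝ≥0∞} (hv : Measurable v) {S : ℝ≥0∞}
    (hS : ∀ a, ∫⁻ y, v (r • y + a) ∂(capMeasure n e) ≤ S) :
    volume (Metric.ball (0 : E n) δ) * ∫⁻ x, v x * ENNReal.ofReal (Real.exp (-(b / 2 * ‖x‖ ^ 2))) ≤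
      4 * ENNReal.ofReal ((4 * Real.pi / b) ^ ((n : ℝ) / 2)) * S := by
  set I := ∫⁻ x, v x * ENNReal.ofReal (Real.exp (-(b / 2 * ‖x‖ ^ 2))) with hI
  set q : E n → ℝ≥0∞ := fun a => ENNReal.ofReal (Real.exp (-(b / 4 * ‖a‖ ^ 2))) with hq
  have hqm : Measurable q := by rw [hq]; fun_prop
  have hvm : Measurable fun p : E n × E n => v (r • p.2 + p.1) := hv.comp (by fun_prop)
  have hvm1 : ∀ a, Measurable fun y : E n => v (r • y + a) := fun a => hv.comp (by fun_prop)
  have hvm2 : ∀ y, Measurable fun a : E n => v (r • y + a) := fun a => hv.comp (by fun_prop)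
  have hwm : Measurable fun y : E n => capDensity e ‖y‖ := by fun_prop
  have hfin := isFiniteMeasure_capMeasure n (lt_of_lt_of_le one_pos he)
  have h1 : ∫⁻ a, q a * ∫⁻ y, v (r • y + a) ∂(capMeasure n e) ≤
      ENNReal.ofReal ((4 * Real.pi / b) ^ ((n : ℝ) / 2)) * S := by
    calc _ ≤ ∫⁻ a, q a * S := lintegral_mono fun a => mul_le_mul_right (hS a) _
      _ = _ := by
        rw [lintegral_mul_const _ hqm, hq, lintegral_exp_neg_mul_sq n (by positivity)]
        congr 3; field_simp
  have h2 : ∫⁻ a, q a * ∫⁻ y, v (r • y + a) ∂(capMeasure n e) =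
      ∫⁻ y, capDensity e ‖y‖ * ∫⁻ x, q (x - r • y) * v x := by
    have h3 : ∀ a, q a * ∫⁻ y, v (r • y + a) ∂(capMeasure n e) =
        ∫⁻ y, q a * v (r • y + a) ∂(capMeasure n e) := fun a =>
      (lintegral_const_mul _ (hvm1 a)).symm
    simp_rw [h3]
    have hqv : Measurable fun p : E n × E n => q p.1 * v (r • p.2 + p.1) :=
      (hqm.comp measurable_fst).mul hvm
    have hqv' : Measurable fun y => ∫⁻ a, q a * v (r • y + a) := hqv.lintegral_prod_left'
    rw [lintegral_lintegral_swap hqv.aemeasurable, capMeasure,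
      lintegral_withDensity_eq_lintegral_mul _ hwm hqv']
    refine lintegral_congr fun y => ?_
    rw [Pi.mul_apply]
    congr 1
    rw [← lintegral_add_right_eq_self (fun x => q (x - r • y) * v x) (r • y)]
    refine lintegral_congr fun a => ?_
    rw [add_sub_cancel_right, add_comm]
  have h4 : ∀ y ∈ Metric.ball (0 : E n) δ, 4⁻¹ * I ≤
      capDensity e ‖y‖ * ∫⁻ x, q (x - r • y) * v x := by
    intro y hy
    have hy' : ‖y‖ < δ := mem_ball_zero_iff.1 hy
    have hy2 : ‖y‖ ^ 2 ≤ δ ^ 2 := pow_le_pow_left₀ (norm_nonneg _) hy'.le 2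
    have h5 : 2⁻¹ ≤ capDensity e ‖y‖ := by
      have h6 : 1 + e * (-‖y‖ ^ 2) ≤ (1 + -‖y‖ ^ 2) ^ e :=
        one_add_mul_self_le_rpow_one_add (by nlinarith) he
      rw [capDensity, show (2⁻¹ : ℝ≥0∞) = ENNReal.ofReal (1 / 2) by
        rw [one_div, ENNReal.ofReal_inv_of_pos two_pos]; simp]
      refine ENNReal.ofReal_le_ofReal ?_
      rw [max_eq_right (by nlinarith), sub_eq_add_neg]
      nlinarith
    have h7 : 2⁻¹ * I ≤ ∫⁻ x, q (x - r • y) * v x := by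
      rw [hI, ← lintegral_const_mul _ (by fun_prop)]
      refine lintegral_mono fun x => ?_
      rw [show (2⁻¹ : ℝ≥0∞) = ENNReal.ofReal (1 / 2) by
        rw [one_div, ENNReal.ofReal_inv_of_pos two_pos]; simp, mul_left_comm, mul_comm,
        ← ENNReal.ofReal_mul (by norm_num)]
      refine mul_le_mul_left (ENNReal.ofReal_le_ofReal ?_) _
      have h8 : ‖x - r • y‖ ^ 2 ≤ 2 * ‖x‖ ^ 2 + 2 * δ ^ 2 := by
        have h9 : ‖r • y‖ ≤ δ := by
          rw [norm_smul, Real.norm_of_nonneg hr0]; nlinarith [norm_nonneg y]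
        have h10 := norm_sub_le x (r • y)
        have h11 := norm_nonneg (x - r • y)
        nlinarith [sq_nonneg (‖x‖ - δ), norm_nonneg x, norm_nonneg (r • y)]
      have h12 : 1 / 2 ≤ Real.exp (-(b / 2 * δ ^ 2)) := by
        linarith [Real.add_one_le_exp (-(b / 2 * δ ^ 2))]
      calc _ ≤ Real.exp (-(b / 2 * δ ^ 2)) * Real.exp (-(b / 2 * ‖x‖ ^ 2)) := by gcongr
        _ ≤ _ := by
          rw [← Real.exp_add]
          refine Real.exp_le_exp.2 ?_
          nlinarith
    calc _ = 2⁻¹ * (2⁻¹ * I) := by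
          rw [← mul_assoc, ← ENNReal.mul_inv (by simp) (by simp)]; norm_num
      _ ≤ _ := by gcongr
  have h13 : volume (Metric.ball (0 : E n) δ) * (4⁻¹ * I) ≤
      ENNReal.ofReal ((4 * Real.pi / b) ^ ((n : ℝ) / 2)) * S := by
    calc _ = ∫⁻ _ in Metric.ball (0 : E n) δ, 4⁻¹ * I := by
          rw [setLIntegral_const, mul_comm]
      _ ≤ ∫⁻ y in Metric.ball (0 : E n) δ, capDensity e ‖y‖ * ∫⁻ x, q (x - r • y) * v x :=
          setLIntegral_mono' measurableSet_ball h4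
      _ ≤ _ := (setLIntegral_le_lintegral _ _).trans (h2.symm.le.trans h1)
  calc _ = 4 * (volume (Metric.ball (0 : E n) δ) * (4⁻¹ * I)) := by
        rw [mul_left_comm 4, ← mul_assoc 4, ENNReal.mul_inv_cancel (by simp) (by simp), one_mul]
    _ ≤ _ := by rw [mul_assoc]; gcongr

/-- Apply the spatial covering on every time slice and integrate the Gaussian in time, which
supplies the additional factor of order `b^(-1/2)`. -/
lemma lintegral_mul_exp_le {n : ℕ} {e b δ r : ℝ} (he : 1 ≤ e) (hb : 0 < b)
    (hδe : e * δ ^ 2 ≤ 1 / 2) (hδb : b * δ ^ 2 ≤ 1) (hr0 : 0 ≤ r) (hr1 : r ≤ 1)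
    {u : E (n + 1) → ℝ≥0∞} (hu : Measurable u) {S : ℝ≥0∞}
    (hS : ∀ a t, ∫⁻ y, u (mkPt (r • y + a) t) ∂(capMeasure n e) ≤ S) :
    volume (Metric.ball (0 : E n) δ) *
        ∫⁻ z, u z * ENNReal.ofReal (Real.exp (-(b / 2 * ‖z‖ ^ 2))) ≤
      4 * ENNReal.ofReal ((4 * Real.pi / b) ^ ((n : ℝ) / 2)) * S *
        ENNReal.ofReal √(2 * Real.pi / b) := by
  have hum : Measurable fun p : E n × ℝ => u (mkPt p.1 p.2) := hu.comp continuous_mkPt.measurable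
  have humt : ∀ t : ℝ, Measurable fun x : E n => u (mkPt x t) := fun t =>
    hum.comp (measurable_id.prodMk measurable_const)
  have h1 : ∫⁻ z, u z * ENNReal.ofReal (Real.exp (-(b / 2 * ‖z‖ ^ 2))) =
      ∫⁻ t : ℝ, ENNReal.ofReal (Real.exp (-(b / 2 * t ^ 2))) *
        ∫⁻ x : E n, u (mkPt x t) * ENNReal.ofReal (Real.exp (-(b / 2 * ‖x‖ ^ 2))) := by
    have hF : Measurable fun z : E (n + 1) => u z * ENNReal.ofReal (Real.exp (-(b / 2 * ‖z‖ ^ 2))) :=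
      hu.mul (by fun_prop)
    rw [lintegral_space_time _ hF, lintegral_lintegral_swap
      (f := fun x t => u (mkPt x t) * ENNReal.ofReal (Real.exp (-(b / 2 * ‖mkPt x t‖ ^ 2))))
      (hF.comp continuous_mkPt.measurable).aemeasurable]
    refine lintegral_congr fun t => ?_
    rw [← lintegral_const_mul' _ _ ENNReal.ofReal_ne_top]
    refine lintegral_congr fun x => ?_
    rw [mul_left_comm, ← ENNReal.ofReal_mul (by positivity), ← Real.exp_add, norm_mkPt_sq]
    congr 3; ring
  have h2 : ∫⁻ t : ℝ, ENNReal.ofReal (Real.exp (-(b / 2 * t ^ 2))) =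
      ENNReal.ofReal √(2 * Real.pi / b) := by
    have h := integral_gaussian (b / 2)
    simp_rw [neg_mul] at h
    have hi := integrable_exp_neg_mul_sq (b := b / 2) (by positivity)
    simp_rw [neg_mul] at hi
    rw [← ofReal_integral_eq_lintegral_ofReal hi
      (Filter.Eventually.of_forall fun _ => (Real.exp_pos _).le), h]
    congr 2; field_simp
  have hvol : volume (Metric.ball (0 : E n) δ) ≠ ⊤ := measure_ball_lt_top.ne
  rw [h1, ← lintegral_const_mul' _ _ hvol]
  calc _ ≤ ∫⁻ t : ℝ, (4 * ENNReal.ofReal ((4 * Real.pi / b) ^ ((n : ℝ) / 2)) * S) *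
        ENNReal.ofReal (Real.exp (-(b / 2 * t ^ 2))) := by
        refine lintegral_mono fun t => ?_
        rw [mul_left_comm, mul_comm]
        exact mul_le_mul_left (lintegral_comp_add_smul_capMeasure he hb hδe hδb hr0 hr1 (humt t)
          fun a => hS a t) _
    _ = _ := by rw [lintegral_const_mul _ (by fun_prop), h2]

/-- With `δ` of order `m^(-1/2)`, `m = N + 1`, the volume `δ^n` cancels the spatial Gaussian mass
and only the gain `m^(-1/2)` from the time direction survives. -/
lemma exists_lintegral_mul_exp_le (n : ℕ) : ∃ K : ℝ≥0, ∀ (N : ℕ) (e r : ℝ), (N : ℝ) + 1 ≤ e →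
    e ≤ (n + 4) * (N + 1) → 0 ≤ r → r ≤ 1 → ∀ u : E (n + 1) → ℝ≥0∞, Measurable u →
    ∀ S : ℝ≥0∞, (∀ a t, ∫⁻ y, u (mkPt (r • y + a) t) ∂(capMeasure n e) ≤ S) →
      ∫⁻ z, u z * ENNReal.ofReal (Real.exp (-(((N : ℝ) + 1) / 2 * ‖z‖ ^ 2))) ≤
        K * ENNReal.ofReal (√((N : ℝ) + 1))⁻¹ * S := by
  set V := volume (Metric.ball (0 : E n) 1) with hV
  have hV0 : V ≠ 0 := (Metric.measure_ball_pos volume 0 one_pos).ne'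
  have hVt : V ≠ ⊤ := measure_ball_lt_top.ne
  set c : ℝ := √(8 * Real.pi * (n + 4)) with hc
  refine ⟨(V⁻¹ * ENNReal.ofReal (4 * c ^ n * √(2 * Real.pi))).toNNReal,
    fun N e r he1 he2 hr0 hr1 u hu S hS => ?_⟩
  rw [ENNReal.coe_toNNReal (ENNReal.mul_ne_top (ENNReal.inv_ne_top.2 hV0) ENNReal.ofReal_ne_top)]
  have hN0 : (0 : ℝ) ≤ N := N.cast_nonneg
  have hn0 : (0 : ℝ) ≤ n := n.cast_nonneg
  set m : ℝ := (N : ℝ) + 1 with hm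
  have hm0 : 0 < m := by positivity
  -- Chosen so that `e δ² ≤ 1/2` for all `e ≤ (n+4) m`, and a fortiori `m δ² ≤ 1`.
  set δ : ℝ := √(1 / (2 * (n + 4) * m)) with hδ
  have hδ0 : 0 < δ := Real.sqrt_pos.2 (by positivity)
  have hδ2 : δ ^ 2 = 1 / (2 * (n + 4) * m) := Real.sq_sqrt (by positivity)
  have h := lintegral_mul_exp_le (n := n) (δ := δ) (by linarith) hm0 (by
      rw [hδ2, mul_one_div, div_le_iff₀ (by positivity)]; linarith) (by
      rw [hδ2, mul_one_div, div_le_iff₀ (by positivity)]; nlinarith) hr0 hr1 hu hS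
  rw [Measure.addHaar_ball_of_pos _ _ hδ0, finrank_euclideanSpace_fin] at h
  have h1 : (4 * Real.pi / m) ^ ((n : ℝ) / 2) = δ ^ n * c ^ n := by
    rw [← mul_pow, hδ, hc, ← Real.sqrt_mul (by positivity), Real.sqrt_eq_rpow,
      ← Real.rpow_natCast (_ ^ _), ← Real.rpow_mul (by positivity)]
    congr 1
    · field_simp; norm_num
    · ring
  have h2 : √(2 * Real.pi / m) = √(2 * Real.pi) * (√m)⁻¹ := by
    rw [Real.sqrt_div (by positivity), div_eq_mul_inv]
  set X := ∫⁻ z, u z * ENNReal.ofReal (Real.exp (-(m / 2 * ‖z‖ ^ 2))) with hX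
  have hδn : ENNReal.ofReal (δ ^ n) ≠ 0 := by
    rw [ne_eq, ENNReal.ofReal_eq_zero, not_le]; positivity
  rw [h1, h2, ENNReal.ofReal_mul (by positivity), ENNReal.ofReal_mul (by positivity)] at h
  have h3 : V * X ≤ 4 * ENNReal.ofReal (c ^ n) * S *
      (ENNReal.ofReal √(2 * Real.pi) * ENNReal.ofReal (√m)⁻¹) := by
    refine (ENNReal.mul_le_mul_iff_right hδn ENNReal.ofReal_ne_top).1 ?_
    rw [← hV] at h
    exact (mul_assoc _ _ _).symm.le.trans (h.trans (le_of_eq (by ring)))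
  calc X = V⁻¹ * (V * X) := by rw [← mul_assoc, ENNReal.inv_mul_cancel hV0 hVt, one_mul]
    _ ≤ V⁻¹ * (4 * ENNReal.ofReal (c ^ n) * S *
      (ENNReal.ofReal √(2 * Real.pi) * ENNReal.ofReal (√m)⁻¹)) := by gcongr
    _ = _ := by
      rw [ENNReal.ofReal_mul (by positivity), ENNReal.ofReal_mul (by norm_num),
        show ENNReal.ofReal 4 = 4 by simp]
      ring

/-! ### Mollification -/

/-- Each value `u y` is replaced by its average over the support of the mollifier around `y`, at the
cost of the oscillation `δ`; Fubini then moves the mollifier onto `ν`. -/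
lemma lintegral_le_lintegral_mollified {d : ℕ} {ν : Measure (E d)} [IsFiniteMeasure ν]
    {u φ : E d → ℝ≥0∞} (hu : Measurable u) (hφ : Measurable φ) (hφ1 : ∫⁻ x, φ x = 1) {δ : ℝ≥0∞}
    (hδ : ∀ᵐ y ∂ν, ∀ z, φ (z - y) ≠ 0 → u y ≤ u z + δ) :
    ∫⁻ y, u y ∂ν ≤ (∫⁻ z, u z * ∫⁻ y, φ (z - y) ∂ν) + δ * ν univ := by
  have hφm : Measurable fun p : E d × E d => φ (p.1 - p.2) := hφ.comp (by fun_prop)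
  have hm2 : Measurable fun p : E d × E d => u p.1 * φ (p.1 - p.2) :=
    (hu.comp measurable_fst).mul hφm
  have h1 : ∫⁻ z, u z * ∫⁻ y, φ (z - y) ∂ν = ∫⁻ y, ∫⁻ z, u z * φ (z - y) ∂volume ∂ν := by
    calc _ = ∫⁻ z, ∫⁻ y, u z * φ (z - y) ∂ν := by
          refine lintegral_congr fun z => ?_
          have : Measurable fun y => φ (z - y) :=
            hφm.comp (measurable_const.prodMk measurable_id)
          rw [lintegral_const_mul _ this]
      _ = _ := lintegral_lintegral_swap hm2.aemeasurable
  rw [h1, ← lintegral_const, ← lintegral_add_right _ measurable_const]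
  refine lintegral_mono_ae ?_
  filter_upwards [hδ] with y hy
  have hφy : Measurable fun z => φ (z - y) := hφm.comp (measurable_id.prodMk measurable_const)
  have h2 : ∫⁻ z, φ (z - y) = 1 := by rw [lintegral_sub_right_eq_self φ, hφ1]
  calc u y = ∫⁻ z, u y * φ (z - y) := by rw [lintegral_const_mul _ hφy, h2, mul_one]
    _ ≤ ∫⁻ z, (u z * φ (z - y) + δ * φ (z - y)) := by
        refine lintegral_mono fun z => ?_
        rw [← add_mul]
        by_cases hz : φ (z - y) = 0
        · simp [hz]
        · exact mul_le_mul_left (hy z hz) _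
    _ = _ := by
        rw [lintegral_add_right _ (hφy.const_mul _), lintegral_const_mul _ hφy, h2, mul_one]

lemma norm_exp_neg_I_mul (t : ℝ) : ‖Complex.exp (-(Complex.I * (t : ℂ)))‖ = 1 := by
  rw [show -(Complex.I * (t : ℂ)) = ((-t : ℝ) : ℂ) * Complex.I by push_cast; ring,
    Complex.norm_exp_ofReal_mul_I]

/-- Convolution becomes a product, and the transform of a probability density is bounded by `1`.
Hence mollification increases no energy, of whatever order. -/
lemma norm_fourierHat_mollified_le {d : ℕ} (ν : Measure (E d)) [IsFiniteMeasure ν] {φ : E d → ℝ}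
    (hφ : Continuous φ) (hφ0 : ∀ x, 0 ≤ φ x) (hφi : Integrable φ) (hφ1 : ∫ x, φ x = 1) (ξ : E d) :
    ‖fourierHat (fun z => ((∫ y, φ (z - y) ∂ν : ℝ) : ℂ)) ξ‖ ≤ ‖measureHat ν ξ‖ := by
  have hφl : ∫⁻ x, ENNReal.ofReal (φ x) = 1 := by
    rw [← ofReal_integral_eq_lintegral_ofReal hφi (Filter.Eventually.of_forall hφ0), hφ1,
      ENNReal.ofReal_one]
  have hφm : Measurable fun p : E d × E d => ENNReal.ofReal (φ (p.1 - p.2)) :=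
    (hφ.comp (by fun_prop)).measurable.ennreal_ofReal
  have h1 : fourierHat (fun z => ((∫ y, φ (z - y) ∂ν : ℝ) : ℂ)) ξ =
      measureHat ν ξ * fourierHat (fun x => (φ x : ℂ)) ξ := by
    rw [fourierHat, measureHat]
    have h2 : ∀ x, Complex.exp (-(Complex.I * ((inner ℝ x ξ : ℝ) : ℂ))) *
        ((∫ y, φ (x - y) ∂ν : ℝ) : ℂ) =
        ∫ y, Complex.exp (-(Complex.I * ((inner ℝ x ξ : ℝ) : ℂ))) * (φ (x - y) : ℂ) ∂ν := by
      intro x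
      rw [integral_const_mul, integral_complex_ofReal]
    simp_rw [h2]
    have hprod : Integrable (Function.uncurry fun x y : E d =>
        Complex.exp (-(Complex.I * ((inner ℝ x ξ : ℝ) : ℂ))) * (φ (x - y) : ℂ))
        (volume.prod ν) := by
      refine ⟨Continuous.aestronglyMeasurable (by
        simp only [Function.uncurry_def]
        fun_prop), ?_⟩
      rw [HasFiniteIntegral]
      calc _ = ∫⁻ p : E d × E d, ENNReal.ofReal (φ (p.1 - p.2)) ∂(volume.prod ν) := by
            refine lintegral_congr fun p => ?_
            rw [Function.uncurry_def, ← ofReal_norm, norm_mul, norm_exp_neg_I_mul, one_mul,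
              Complex.norm_real, Real.norm_of_nonneg (hφ0 _)]
        _ = ∫⁻ y, ∫⁻ x, ENNReal.ofReal (φ (x - y)) ∂volume ∂ν :=
            lintegral_prod_symm' _ hφm
        _ = ν univ := by
            simp_rw [lintegral_sub_right_eq_self (fun x => ENNReal.ofReal (φ x)), hφl]
            simp
        _ < ⊤ := measure_lt_top _ _
    rw [integral_integral_swap hprod, ← integral_mul_const]
    congr 1; ext y
    rw [fourierHat, ← integral_add_right_eq_self _ y, ← integral_const_mul]
    congr 1; ext x
    rw [add_sub_cancel_right, inner_add_left, ← mul_assoc, ← Complex.exp_add]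
    congr 2; push_cast; ring
  have h3 : ‖fourierHat (fun x => (φ x : ℂ)) ξ‖ ≤ 1 := by
    rw [fourierHat, ← hφ1]
    refine (norm_integral_le_integral_norm _).trans (le_of_eq ?_)
    congr 1; ext x
    rw [norm_mul, Complex.norm_real, Real.norm_of_nonneg (hφ0 x), norm_exp_neg_I_mul, one_mul]
  rw [h1, norm_mul]
  exact mul_le_of_le_one_right (norm_nonneg _) h3

/-- The support of `ν` has positive distance from the unit sphere, so mollification at a small scale
stays in the unit ball; uniform continuity of `u` controls the error. -/
lemma exists_schwartz_mollification {d : ℕ} {ν : Measure (E d)}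
    (hν : IsCompactlySupportedIn ν (Metric.ball 0 1)) {u : E d → ℂ} (hu : Continuous u) {δ : ℝ}
    (hδ : 0 < δ) : ∃ h : SchwartzMap (E d) ℂ, (∀ z, 1 < ‖z‖ → h z = 0) ∧
      (∀ ξ, ‖hatS h ξ‖ₑ ≤ ‖charFun ν ξ‖ₑ) ∧
      ∫⁻ z, ‖u z‖ₑ ∂ν ≤ (∫⁻ z, ‖u z‖ₑ * ‖h z‖ₑ) + ENNReal.ofReal δ * ν univ := by
  obtain ⟨hνf, S, hS, hSb, hνS⟩ := hν
  obtain ⟨ε₁, hε₁, hε₁S⟩ : ∃ ε > 0, ∀ y ∈ S, ‖y‖ + ε ≤ 1 := by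
    rcases S.eq_empty_or_nonempty with rfl | hne
    · exact ⟨1, one_pos, by simp⟩
    · obtain ⟨y₀, hy₀, hmax⟩ := hS.exists_isMaxOn hne continuous_norm.continuousOn
      have h1 : ‖y₀‖ < 1 := mem_ball_zero_iff.1 (hSb hy₀)
      exact ⟨1 - ‖y₀‖, by linarith, fun y hy => by
        have : ‖y‖ ≤ ‖y₀‖ := hmax hy
        linarith⟩
  obtain ⟨ε₂, hε₂, hε₂u⟩ := Metric.uniformContinuousOn_iff.1
    ((isCompact_closedBall (0 : E d) 1).uniformContinuousOn_of_continuous hu.continuousOn) δ hδ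
  set ε := min ε₁ ε₂ with hε
  have hε0 : 0 < ε := lt_min hε₁ hε₂
  let χ : ContDiffBump (0 : E d) := ⟨ε / 2, ε, by positivity, by linarith⟩
  set φ : E d → ℝ := χ.normed volume with hφ
  have hφ0 : ∀ x, 0 ≤ φ x := χ.nonneg_normed
  have hφs : ContDiff ℝ (⊤ : ℕ∞) φ := χ.contDiff_normed
  have hφc : HasCompactSupport φ := χ.hasCompactSupport_normed
  have hφi : Integrable φ := hφs.continuous.integrable_of_hasCompactSupport hφc
  have hφz : ∀ x, ε ≤ ‖x‖ → φ x = 0 := fun x hx => by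
    by_contra hne
    have h1 : x ∈ Function.support φ := hne
    rw [hφ, χ.support_normed_eq, mem_ball_zero_iff] at h1
    exact absurd h1 (not_lt.2 hx)
  have hφ1 : ∫ x, φ x = 1 := χ.integral_normed
  have hφl : ∫⁻ x, ENNReal.ofReal (φ x) = 1 := by
    rw [← ofReal_integral_eq_lintegral_ofReal hφi (Filter.Eventually.of_forall hφ0), hφ1,
      ENNReal.ofReal_one]
  have hae : ∀ᵐ y ∂ν, y ∈ S := hνS
  obtain ⟨B, hB⟩ := hφc.exists_bound_of_continuous hφs.continuous
  set h₀ : E d → ℝ := fun z => ∫ y, φ (z - y) ∂ν with hh₀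
  have hh₀s : ContDiff ℝ (⊤ : ℕ∞) h₀ := by
    have := hφc.contDiff_convolution_right (μ := ν) (f := fun _ => (1 : ℝ))
      (ContinuousLinearMap.mul ℝ ℝ) (integrable_const (1 : ℝ)).locallyIntegrable hφs
    convert this using 1
    ext z
    simp [hh₀, convolution]
  have hh₀z : ∀ z, 1 ≤ ‖z‖ → h₀ z = 0 := by
    intro z hz
    rw [hh₀]
    refine integral_eq_zero_of_ae ?_
    filter_upwards [hae] with y hy
    refine hφz _ ?_
    have h1 := norm_sub_norm_le z y
    have h2 := hε₁S y hy
    have h3 : ε ≤ ε₁ := min_le_left _ _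
    linarith
  have hφint : ∀ z, Integrable (fun y => φ (z - y)) ν := fun z =>
    Integrable.of_bound (hφs.continuous.comp (by fun_prop)).aestronglyMeasurable B
      (Filter.Eventually.of_forall fun y => hB _)
  have hh₀c : HasCompactSupport fun z => (h₀ z : ℂ) :=
    HasCompactSupport.of_support_subset_isCompact (isCompact_closedBall (0 : E d) 1) fun z hz => by
      rw [mem_closedBall_zero_iff]
      by_contra hlt
      exact hz (by simp [hh₀z z (not_le.1 hlt).le])
  have hh₀s' : ContDiff ℝ (⊤ : ℕ∞) fun z => (h₀ z : ℂ) := Complex.ofRealCLM.contDiff.comp hh₀s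
  set h := hh₀c.toSchwartzMap hh₀s' with hh
  have hhv : ∀ z, h z = (h₀ z : ℂ) := fun z => rfl
  have hhe : ∀ z, ‖h z‖ₑ = ∫⁻ y, ENNReal.ofReal (φ (z - y)) ∂ν := by
    intro z
    rw [hhv, ← ofReal_norm, Complex.norm_real,
      Real.norm_of_nonneg (integral_nonneg fun y => hφ0 _),
      ofReal_integral_eq_lintegral_ofReal (hφint z) (Filter.Eventually.of_forall fun y => hφ0 _)]
  refine ⟨h, fun z hz => by rw [hhv, hh₀z z hz.le]; rfl, fun ξ => ?_, ?_⟩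
  · rw [← ofReal_norm, ← ofReal_norm, ← norm_measureHat, hatS_apply]
    exact ENNReal.ofReal_le_ofReal
      (norm_fourierHat_mollified_le ν hφs.continuous hφ0 hφi hφ1 ξ)
  · simp_rw [hhe]
    refine lintegral_le_lintegral_mollified hu.measurable.enorm
      hφs.continuous.measurable.ennreal_ofReal hφl ?_
    filter_upwards [hae] with y hy
    intro z hz
    have h7 : ‖z - y‖ < ε := by
      by_contra hlt
      exact hz (by rw [hφz _ (not_lt.1 hlt), ENNReal.ofReal_zero])
    have h3 := hε₁S y hy
    have h4 : ε ≤ ε₁ := min_le_left _ _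
    have h5 : ‖z‖ ≤ 1 := by
      have := norm_le_norm_add_norm_sub' z y
      linarith
    have h6 : dist (u z) (u y) < δ := hε₂u z (mem_closedBall_zero_iff.2 h5) y
      (mem_closedBall_zero_iff.2 (by linarith)) (by
        rw [dist_eq_norm]; exact h7.trans_le (min_le_right _ _))
    rw [dist_eq_norm, norm_sub_rev] at h6
    rw [← ofReal_norm, ← ofReal_norm, ← ENNReal.ofReal_add (norm_nonneg _) hδ.le]
    refine ENNReal.ofReal_le_ofReal ?_
    have := norm_le_norm_add_norm_sub' (u y) (u z)
    linarith

/-- Combines three bounds: `|h|` is at most `(K₁ G I_α(ν))^(1/2)` times a Gaussian, the slab bound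
controls the wave against all translates of the test measure of energy `P`, and the Gaussian is
covered by these translates with gain `m^(-1/2)`. Since `G P ≤ K₂ m`, the factors `m^(1/2)` and
`m^(-1/2)` cancel and no dependence on `α` is left. -/
lemma SlabBound.testBound_of_const {n N : ℕ} (hn : 1 ≤ n) {A : Set (E n)} (hA : IsOpen A)
    {W : E n → ℝ} (hW : ContDiff ℝ (⊤ : ℕ∞) W) (hW0 : ∀ ξ, 0 < W ξ) {α e m G : ℝ} {D : ℝ≥0∞}
    (hD : SlabBound A W α D) (hα : 0 < α) (hm : m = (N : ℝ) + 1) (he : m ≤ e) {K₁ K₂ K₃ : ℝ≥0}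
    (hG : 0 ≤ G) (h₁ : ∀ h : SchwartzMap (E (n + 1)) ℂ, (∀ z, 1 < ‖z‖ → h z = 0) → ∀ z, ‖z‖ < 1 →
      ‖h z‖ₑ ^ 2 ≤ K₁ * ENNReal.ofReal ((1 - ‖z‖ ^ 2) ^ (N + 1) * G) *
        ∫⁻ ξ, ‖hatS h ξ‖ₑ ^ 2 * ENNReal.ofReal (‖ξ‖ ^ (α - ((n + 1 : ℕ) : ℝ))))
    (h₂ : ENNReal.ofReal G * energy α (capMeasure n e) ≤ K₂ * ENNReal.ofReal m)
    (h₃ : ∀ r : ℝ, 0 ≤ r → r ≤ 1 → ∀ u : E (n + 1) → ℝ≥0∞, Measurable u → ∀ S : ℝ≥0∞,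
      (∀ a t, ∫⁻ y, u (mkPt (r • y + a) t) ∂(capMeasure n e) ≤ S) →
      ∫⁻ z, u z * ENNReal.ofReal (Real.exp (-(m / 2 * ‖z‖ ^ 2))) ≤
        K₃ * ENNReal.ofReal (√m)⁻¹ * S)
    {ν : Measure (E (n + 1))} (hν : IsCompactlySupportedIn ν (Metric.ball 0 1)) :
    TestBound A W ν (((2 * K₁ * K₂ : ℝ≥0) : ℝ≥0∞) ^ (1 / 2 : ℝ) * K₃ * D *
      energy α ν ^ (1 / 2 : ℝ)) := by
  intro f hf
  have hνf := hν.1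
  have hm0 : 0 < m := by rw [hm]; positivity
  have he0 : 0 < e := hm0.trans_le he
  have hfin := isFiniteMeasure_capMeasure n he0
  set u : E (n + 1) → ℂ := fun z => wave f (spacePart z) (timePart z) with hu
  have huc : Continuous u := continuous_wave f
  set M : ℝ≥0∞ := (∫⁻ ξ, ENNReal.ofReal (W ξ) * ‖fourierHat f ξ‖ₑ ^ 2) ^ (1 / 2 : ℝ) with hM
  -- The test measure reaches the unit sphere and has to be shrunk to be compactly supported in the
  -- open ball. This choice costs the factor `r^(-α) = 2` in energy for every `α`.
  set r : ℝ := 2 ^ (-(1 / α)) with hr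
  have hr0 : 0 < r := by positivity
  have hr1 : r < 1 := Real.rpow_lt_one_of_one_lt_of_neg one_lt_two (by
    rw [neg_lt_zero]; positivity)
  have hrα : ENNReal.ofReal (r ^ (-α)) = 2 := by
    rw [hr, ← Real.rpow_mul (by norm_num), show -(1 / α) * -α = 1 by field_simp, Real.rpow_one]
    simp
  set P := energy α (capMeasure n e) with hP
  set X := ∫⁻ z, ‖u z‖ₑ * ENNReal.ofReal (Real.exp (-(m / 2 * ‖z‖ ^ 2))) with hX
  have hXle : X ≤ K₃ * ENNReal.ofReal (√m)⁻¹ * (D * (2 * P) ^ (1 / 2 : ℝ) * M) := by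
    refine h₃ r hr0.le hr1.le _ huc.measurable.enorm _ fun a t => ?_
    have h := hD.lintegral_translate_le hn hA hW hW0 (ae_norm_le_capMeasure n he0) hr0 hr1 hf a t
    rw [hrα] at h
    simp only [hu, spacePart_mkPt, timePart_mkPt]
    exact h
  set I := energy α ν with hI
  have hhle : ∀ h : SchwartzMap (E (n + 1)) ℂ, (∀ z, 1 < ‖z‖ → h z = 0) →
      (∀ ξ, ‖hatS h ξ‖ₑ ≤ ‖charFun ν ξ‖ₑ) → ∀ᵐ z, ‖h z‖ₑ ≤
        (K₁ * ENNReal.ofReal G * I) ^ (1 / 2 : ℝ) *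
          ENNReal.ofReal (Real.exp (-(m / 2 * ‖z‖ ^ 2))) := by
    intro h hz hh
    have hsph : ∀ᵐ z : E (n + 1), z ∉ Metric.sphere (0 : E (n + 1)) 1 :=
      measure_eq_zero_iff_ae_notMem.1 (Measure.addHaar_sphere_of_ne_zero _ _ one_ne_zero)
    filter_upwards [hsph] with z hzs
    rw [mem_sphere_zero_iff_norm] at hzs
    rcases lt_or_gt_of_ne hzs with hlt | hgt
    · have h4 : ‖h z‖ₑ ^ 2 ≤ K₁ * ENNReal.ofReal G * I *
          ENNReal.ofReal (Real.exp (-(m / 2 * ‖z‖ ^ 2))) ^ 2 := by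
        -- From `1 - x ≤ exp(-x)`: the cap is replaced by a Gaussian, which is the form required by
        -- the covering.
        have h5 : (1 - ‖z‖ ^ 2) ^ (N + 1) ≤ Real.exp (-(m / 2 * ‖z‖ ^ 2)) ^ 2 := by
          have h6 : 0 ≤ 1 - ‖z‖ ^ 2 := by nlinarith [norm_nonneg z]
          calc _ ≤ Real.exp (-‖z‖ ^ 2) ^ (N + 1) :=
                pow_le_pow_left₀ h6 (by linarith [Real.add_one_le_exp (-‖z‖ ^ 2)]) _
            _ = _ := by
              rw [← Real.exp_nat_mul, ← Real.exp_nat_mul, hm]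
              congr 1; push_cast; ring
        calc _ ≤ K₁ * ENNReal.ofReal ((1 - ‖z‖ ^ 2) ^ (N + 1) * G) *
              ∫⁻ ξ, ‖hatS h ξ‖ₑ ^ 2 * ENNReal.ofReal (‖ξ‖ ^ (α - ((n + 1 : ℕ) : ℝ))) :=
              h₁ h hz z hlt
          _ ≤ K₁ * ENNReal.ofReal (Real.exp (-(m / 2 * ‖z‖ ^ 2)) ^ 2 * G) * I := by
              rw [hI, energy_eq]
              gcongr with ξ
              exact hh ξ
          _ = _ := by
              rw [ENNReal.ofReal_mul (by positivity), ENNReal.ofReal_pow (Real.exp_pos _).le]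
              ring
      have h7 := ENNReal.rpow_le_rpow h4 (show (0 : ℝ) ≤ 1 / 2 by norm_num)
      rw [ENNReal.mul_rpow_of_nonneg _ _ (by norm_num)] at h7
      have hsq : ∀ x : ℝ≥0∞, (x ^ 2) ^ (1 / 2 : ℝ) = x := fun x => by
        rw [← ENNReal.rpow_natCast, ← ENNReal.rpow_mul]; norm_num
      rwa [hsq, hsq] at h7
    · rw [hz z hgt]; simp
  have hmain : (K₁ * ENNReal.ofReal G * I) ^ (1 / 2 : ℝ) * X ≤
      ((2 * K₁ * K₂ : ℝ≥0) : ℝ≥0∞) ^ (1 / 2 : ℝ) * K₃ * D * I ^ (1 / 2 : ℝ) * M := by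
    have h8 : (K₁ * ENNReal.ofReal G * I) ^ (1 / 2 : ℝ) * (2 * P) ^ (1 / 2 : ℝ) ≤
        ((2 * K₁ * K₂ : ℝ≥0) : ℝ≥0∞) ^ (1 / 2 : ℝ) * I ^ (1 / 2 : ℝ) * ENNReal.ofReal √m := by
      rw [Real.sqrt_eq_rpow, ← ENNReal.ofReal_rpow_of_nonneg hm0.le (by norm_num),
        ← ENNReal.mul_rpow_of_nonneg _ _ (by norm_num),
        ← ENNReal.mul_rpow_of_nonneg _ _ (by norm_num),
        ← ENNReal.mul_rpow_of_nonneg _ _ (by norm_num)]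
      refine ENNReal.rpow_le_rpow ?_ (by norm_num)
      push_cast
      calc _ = 2 * K₁ * I * (ENNReal.ofReal G * P) := by ring
        _ ≤ 2 * K₁ * I * (K₂ * ENNReal.ofReal m) := by gcongr
        _ = _ := by ring
    have h9 : ENNReal.ofReal √m * ENNReal.ofReal (√m)⁻¹ = 1 := by
      rw [← ENNReal.ofReal_mul (by positivity), mul_inv_cancel₀ (Real.sqrt_pos.2 hm0).ne',
        ENNReal.ofReal_one]
    calc _ ≤ (K₁ * ENNReal.ofReal G * I) ^ (1 / 2 : ℝ) *
          (K₃ * ENNReal.ofReal (√m)⁻¹ * (D * (2 * P) ^ (1 / 2 : ℝ) * M)) := by gcongr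
      _ = ((K₁ * ENNReal.ofReal G * I) ^ (1 / 2 : ℝ) * (2 * P) ^ (1 / 2 : ℝ)) *
          (K₃ * ENNReal.ofReal (√m)⁻¹ * D * M) := by ring
      _ ≤ (((2 * K₁ * K₂ : ℝ≥0) : ℝ≥0∞) ^ (1 / 2 : ℝ) * I ^ (1 / 2 : ℝ) * ENNReal.ofReal √m) *
          (K₃ * ENNReal.ofReal (√m)⁻¹ * D * M) := by gcongr
      _ = ((2 * K₁ * K₂ : ℝ≥0) : ℝ≥0∞) ^ (1 / 2 : ℝ) * K₃ * D * I ^ (1 / 2 : ℝ) * M *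
          (ENNReal.ofReal √m * ENNReal.ofReal (√m)⁻¹) := by ring
      _ = _ := by rw [h9, mul_one]
  refine ENNReal.le_of_forall_pos_le_add fun ε hε _ => ?_
  have hν0 : 0 ≤ ν.real univ := measureReal_nonneg
  have hε' : (0 : ℝ) < ε := hε
  obtain ⟨h, hz, hh, hle⟩ := exists_schwartz_mollification hν huc
    (δ := ε / (ν.real univ + 1)) (by positivity)
  refine hle.trans (add_le_add ?_ ?_)
  · refine le_trans ?_ hmain
    rw [hX, ← lintegral_const_mul _ (by have := huc.measurable; fun_prop)]
    refine lintegral_mono_ae ?_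
    filter_upwards [hhle h hz hh] with z hz'
    rw [mul_left_comm]
    exact mul_le_mul_right hz' _
  · rw [← ofReal_measureReal, ← ENNReal.ofReal_mul (by positivity)]
    refine ENNReal.ofReal_le_of_le_toReal ?_
    rw [ENNReal.coe_toReal, div_mul_eq_mul_div, div_le_iff₀ (by positivity)]
    nlinarith

/-- The constant no longer depends on `α`, and no Lorentz map occurs, so no monotonicity of `A` or
`W` is needed. -/
lemma exists_testBound_of_slabBound_of_ge {n : ℕ} (hn : 1 ≤ n) : ∃ (α₀ : ℝ) (K : ℝ≥0), ∀ α : ℝ,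
    α₀ ≤ α → ∀ (A : Set (E n)) (W : E n → ℝ), IsOpen A → ContDiff ℝ (⊤ : ℕ∞) W →
      (∀ ξ, 0 < W ξ) → ∀ D : ℝ≥0∞, SlabBound A W α D →
      ∀ ν : Measure (E (n + 1)), IsCompactlySupportedIn ν (Metric.ball 0 1) →
        TestBound A W ν (K * D * energy α ν ^ (1 / 2 : ℝ)) := by
  obtain ⟨K₁, hK₁⟩ := exists_enorm_sq_le_energy n
  obtain ⟨K₂, hK₂⟩ := exists_energy_capMeasure_mul_le hn
  obtain ⟨K₃, hK₃⟩ := exists_lintegral_mul_exp_le n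
  refine ⟨6 * n + 7, (2 * K₁ * K₂) ^ (1 / 2 : ℝ) * K₃, fun α hα A W hA hW hW0 D hD ν hν => ?_⟩
  have hn0 : (0 : ℝ) ≤ n := n.cast_nonneg
  -- Writes `α = 2N + 2n + 5 + η` with `0 ≤ η ≤ 2`. The threshold `6n + 7` ensures `N ≥ 2n + 1`, as
  -- the pointwise bound requires.
  set N : ℕ := ⌊(α - 2 * n - 5) / 2⌋₊ with hN
  set η : ℝ := α - 2 * N - 2 * n - 5 with hη
  have h1 : (N : ℝ) ≤ (α - 2 * n - 5) / 2 := Nat.floor_le (by linarith)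
  have h2 : (α - 2 * n - 5) / 2 < N + 1 := Nat.lt_floor_add_one _
  have hη0 : 0 ≤ η := by rw [hη]; linarith
  have hη2 : η ≤ 2 := by rw [hη]; linarith
  have hNn : 2 * n + 1 ≤ N := Nat.le_floor (by push_cast; linarith)
  have hαη : 2 * (N : ℝ) + 2 * n + 5 + η = α := by rw [hη]; ring
  have hexp : 2 * (N : ℝ) + n + 4 + η = α - ((n + 1 : ℕ) : ℝ) := by rw [hη]; push_cast; ring
  obtain ⟨e, he1, he2, hE⟩ := hK₂ N η hη0 hη2
  rw [hαη] at hE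
  have hK := hK₁ N η hNn hη0 hη2
  rw [hexp] at hK
  have h := hD.testBound_of_const hn hA hW hW0 (by linarith) rfl he1 (by positivity) hK hE
    (fun r hr0 hr1 u hu S hS => hK₃ N e r he1 he2 hr0 hr1 u hu S hS) hν
  rwa [ENNReal.coe_mul, ENNReal.coe_rpow_of_nonneg _ (by norm_num)]

/-! ### Uniformity over all orders. -/

lemma exists_spaceTime_of_max {n : ℕ} (hn : 1 ≤ n) : ∃ K : ℝ≥0, ∀ s : ℝ, 0 ≤ s → ∀ α : ℝ, 0 < α →
    ∀ C : ℝ≥0, (GlobalMaxEstimate n α s C → GlobalSpaceTimeEstimate n α s (K * C)) ∧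
      ∀ lam : ℝ, 1 ≤ lam → MaxEstimateOn n α s lam C (Metric.ball 0 lam) →
        SpaceTimeEstimateOn n α s lam (K * C) (Metric.ball 0 lam) := by
  -- The threshold `α₀` is fixed by the large-order regime and depends on `n` only; the constant of
  -- the bounded regime is then taken for this `α₀`.
  obtain ⟨α₀, K₁, hK₁⟩ := exists_testBound_of_slabBound_of_ge hn
  obtain ⟨K₂, hK₂⟩ := exists_testBound_of_slabBound_of_le hn α₀
  refine ⟨K₁ + K₂, fun s hs α hα C => spaceTime_of_max (fun A W hA hW hW0 hAW D hD ν hν => ?_) hs C⟩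
  push_cast
  rcases le_total α₀ α with h | h
  · refine (hK₁ α h A W hA hW hW0 D hD ν hν).mono ?_
    gcongr
    exact le_self_add
  · refine (hK₂ α hα h A W hA hW hW0 hAW D hD ν hν.1 (ae_norm_le_one_of_compactlySupported hν)).mono
      ?_
    gcongr
    exact le_add_self

end WaveMax

end

theorem theorem2 (n : ℕ) (hn : 1 ≤ n) :
    -- (i) and (ii): the constant `K` depends only on `n` and `s`
    (∀ s : ℝ, 0 ≤ s → ∃ K : ℝ≥0, ∀ α : ℝ, 0 < α → ∀ C : ℝ≥0,
      (WaveMax.GlobalMaxEstimate n α s C → WaveMax.GlobalSpaceTimeEstimate n α s (K * C)) ∧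
      (∀ lam : ℝ, 1 ≤ lam →
        WaveMax.MaxEstimateOn n α s lam C (Metric.ball 0 lam) →
          WaveMax.SpaceTimeEstimateOn n α s lam (K * C) (Metric.ball 0 lam))) ∧
    -- (iii): the critical exponents
    (∀ α : ℝ, 0 < α → α ≤ n → WaveMax.sWave n α = WaveMax.sMaxWave n α) ∧
    (∀ α : ℝ, n < α → α ≤ n + 1 → WaveMax.sWave n α ≤ WaveMax.sMaxWave n α) ∧
    -- `s_n(α)` is the exponent of `L²` decay over the cone: `β(α, Γⁿ) = n - 2 s_n(α)`
    (∀ α : ℝ, 0 < α → α ≤ n + 1 → WaveMax.betaCone n α + 2 * WaveMax.sWave n α = n) := by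
  obtain ⟨K, hK⟩ := WaveMax.exists_spaceTime_of_max hn
  have hn0 : (0 : ℝ) ≤ n := n.cast_nonneg
  exact ⟨fun s hs => ⟨K, hK s hs⟩,
    fun α hα hαn => le_antisymm (WaveMax.sWave_le_sMaxWave hn hα (by linarith))
      (WaveMax.sMaxWave_le_sWave hn hα hαn),
    fun α hα hαn => WaveMax.sWave_le_sMaxWave hn (by linarith) hαn,
    fun α hα hαn => WaveMax.betaCone_add_two_mul_sWave hn hα hαn⟩
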